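/- **Conventions.** $S_\infty$ is the group of permutations of $\{1,2,\dots\}$ fixing all but finitely many integers, $t_{ab}$ is the transposition of $a,b$, $s_i=t_{i,i+1}$, and $l(w)$ is the length of a shortest word in the $s_i$ representing $w$. Fix $r\ge 1$. $w$ is an $r$-semi-shuffle if $w(i)<w(i+1)$ for all $i>r$; $v$ is an $r$-shuffle if $v(i)<v(i+1)$ for all $i\ne r$, and then $v=v(\lambda,r)$ with $\lambda_j=v(r+1-j)-r-1+j$ for $1\le j\le r$ and $\lambda_j=0$ for $j>r$. $\lambda$ is a hook if $\lambda_j\le1$ for $j\ge2$. *Graphs.* A graph $R$ is a finite set of places $(i,j)$ ($i,j\ge1$, row and column), called crossings. Its word lists the letters $i+j-1$ of its crossings, rows from top to bottom and each row from right to left; $w(R)$ is the product of the corresponding $s_{i+j-1}$. $R$ is an rc-graph of $w(R)$ if this word is reduced, and $\mathcal{RC}(w)$ is the set of rc-graphs of $w$. Strand $i$ starts at the left end of row $i$ and moves right and up; at a crossing the strand coming from the left goes on to the right and the one coming from below goes on up, at a non-crossing the strand coming from the left turns up and the one coming from below turns right. It ends in column $w(R)(i)$. We say that a place has strands $(x,y)$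 if $x$ enters it from the left and $y$ from below. $R_{\ge\ell}$ and $R_\ell$ are the parts of $R$ in rows $\ge\ell$ and in row $\ell$. *Tableaux.* The boxes of a Young diagram are numbered $1,2,\dots$ from the bottom row up and from left to right in each row. A tableau of transpositions $T$ of $v(\lambda,r)$ is a filling of the diagram of $\lambda$ by pairs $(a_ib_i)$ (box $i$) with $1\le a_i\le r<b_i$; partial fillings of boxes $1,\dots,j$ are also used. Put $w_i(T)=t_{a_1b_1}\cdots t_{a_ib_i}$, and $w(T)=w_i(T)$ for the last filled box $i$. $T$ is an $r$-Bruhat chain of $w$ if $l(ww_i(T))=l(w)+i$ for every filled box $i$; $(w,R,T)$ is an $r$-Bruhat package if moreover $R$ is an rc-graph and $ww(T)=w(R)$. $E(w,T)$ is the tableau with $ww_i(T)(b_i)$ in box $i$; it is row and column strict if its entries strictly increase from left to right in rows and strictly increase from top to bottom in columns. For an $r$-Bruhat package $P=(w,R,T)$ with $m$ filled boxes put $S_m(P)=R$ and let $S_{j}(P)$ arise from $S_{j+1}(P)$ by removing the one crossing for which $w(S_j(P))=ww_j(T)$. *Words.* For $Y\in\mathcal{RC}(v(\lambda,r))$ and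 $s\le r$ let $word(Y,s)$ be the weakly decreasing list of the rows of the crossings on strand $s$, and $word(Y)=word(Y,1)\cdots word(Y,r)$; the letters of $word(Y,s)$ correspond to the boxes of row $r+1-s$ of the diagram of $\lambda$. The same is used for the graphs $Y_{\ge\ell}$, whose shape $sh(Y_{\geq\ell})$ is a subdiagram. **Insertion** of $Y\in\mathcal{RC}(v(\lambda,r))$ into $R\in\mathcal{RC}(w)$. For $\ell=r,r-1,\dots,1$ let $word(Y_{\ge\ell})=k_1\cdots k_{m_\ell}$ and construct $R(\ell,i)$ and a tableau $T(\ell,i)$ of shape $sh(Y_{\ge\ell})$ filled up to $i$, for $0\le i\le m_\ell$; write $R(\ell)=R(\ell,m_\ell)$, $T(\ell)=T(\ell,m_\ell)$ and $P(\ell)=(w(R_{\ge\ell}),R(\ell),T(\ell))$. Start with $R(r,0)=R_{\ge r}$, and with $R(\ell,0)=S_0(P(\ell+1))\cup R_\ell$ for $\ell<r$; $T(\ell,0)$ is empty. Step $(\ell,i)$, $i\ge1$: - *$k_i=\ell$ (insertion).* Take the rightmost non-crossing $(\ell,j)$ with strands $(c,d)$, $c\le r<d$, in $R(\ell,i-1)$.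 Add a crossing there and put $(cd)$ in box $i$. - *$k_i>\ell$ (rectification).* Let $i_+$ be the number of letters $>\ell$ among $k_1,\dots,k_i$ and $(ab)$ the entry of box $i_+$ of $T(\ell+1)$. Let $R'$ be $R(\ell,i-1)$ with the crossing of $S_{i_+}(P(\ell+1))$ that is not in $S_{i_+-1}(P(\ell+1))$ added, and $T'$ be $T(\ell,i-1)$ with $(ab)$ put in box $i$. If $(w(R_{\ge\ell}),R',T')$ is an $r$-Bruhat package and $E(w(R_{\ge\ell}),T')$ is row and column strict, then $R(\ell,i)=R'$, $T(\ell,i)=T'$. Otherwise, if row $\ell$ of $R'$ has a crossing with strands $(b,a)$, remove it and empty box $i$; if not, then with $(af)$ the entry of box $i-1$ (which must have the same $a$) remove the crossing with strands $(b,f)$ in row $\ell$, empty box $i$ and put $(ab)$ in box $i-1$. This gives $R'',T''$; let $(\ell,j_0)$ be the place of the removed crossing and $(eg)$ the entry of box $i-1$ of $T''$ (if $i>1$). Take the rightmost non-crossing $(\ell,j)$ of $R''$ with $j<j_0$ whose strands are $(c,d)$ with $c\le r<d$, or $(g,d)$ with $r<d$. Add a crossing there; in the first case put $(cd)$ in box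 $i$, in the second put $(ed)$ in box $i-1$ and $(eg)$ in box $i$. The result is $R\leftarrow Y=R(1)$ and $T(R,Y)=T(1)$. **Inverse insertion** for $(U,T)$. Start with $m_1=|T|$ (the number of boxes), $R(1,m_1)=U$, $T(1,m_1)=T$. For $\ell=1,\dots,r$ perform steps $(\ell,i)$, $i=m_\ell,\dots,1$. Let $(cd)$ be the entry of box $i$ of $T(\ell,i)$ and $(\ell_0,j_0)$ the place where strands $c,d$ intersect in $R(\ell,i)$. - *$\ell_0=\ell$.* Remove this crossing and empty box $i$ to get $R'',T''$. If no non-crossing $(\ell,j)$ of $R''$ with $j>j_0$ has strands $(b,a)$ with $a\le r<b$, this is an inverse insertion: $R(\ell,i-1)=R''$, $T(\ell,i-1)=T''$. Otherwise continue with (*). - *$\ell_0\ne\ell$.* If $i>1$, box $i-1$ contains $(cf)$ and row $\ell$ has a crossing with strands $(d,f)$, then remove that crossing, call its place $(\ell,j_0)$ from now on, empty box $i$, put $(cd)$ in box $i-1$, call the result $R'',T''$, and continue with (*). If not, remove the crossing of $c,d$ and empty box $i$ to get $R(\ell,i-1),T(\ell,i-1)$. - (*) Let $(eg)$ be the entry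 of box $i-1$ of $T''$ (if $i>1$). Take the leftmost non-crossing $(\ell,j)$ of $R''$ with $j>j_0$ whose strands are $(b,a)$ with $a\le r<b$, or $(g,d')$ for some $d'$. Add a crossing there; in the first case put $(ab)$ in box $i$, otherwise put $(ed')$ in box $i-1$ and $(eg)$ in box $i$. Then remove the crossing below row $\ell$ of the two strands in the entry of box $i$ and empty box $i$ to get $R(\ell,i-1),T(\ell,i-1)$. All steps other than inverse insertions are inverse rectifications. If $i_1<\dots<i_{m_{\ell+1}}$ are the inverse rectifications of row $\ell$, put $R(\ell+1,m_{\ell+1})=R(\ell,m_\ell)_{\ge\ell+1}$ and let $T(\ell+1,m_{\ell+1})$ have the boxes $i_1,i_2,\dots$, the $k$-th with the entry $(a_kb_k)$, $a_k\le r<b_k$, determined by $w(R(\ell,i_k)_{\ge\ell+1})=w(R(\ell,i_k-1)_{\ge\ell+1})\,t_{a_kb_k}$. After row $r$ no box may be left ($m_{r+1}=0$). Let $word_{r+1}$ be empty, and let $word_\ell$ have the letters of $word_{\ell+1}$, in order, at positions $i_1,\dots,i_{m_{\ell+1}}$ and the letter $\ell$ at the other positions of $1,\dots,m_\ell$. The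 result is $U\to T=R(r,0)\cup\bigcup_{\ell<r}R(\ell,0)_\ell$ and $Y(U,T)$, the rc-graph of $v(\lambda,r)$ with word $word_1$. **Theorem.** Let $r\ge1$, $w\in S_\infty$, and let $v=v(\lambda,r)\in S_\infty$ be an $r$-shuffle such that $w$ is an $r$-semi-shuffle or $\lambda$ is a hook. 1. Let $U$ be an rc-graph and $T$ a tableau of transpositions of $v(\lambda,r)$ such that $(w,U,T)$ is an $r$-Bruhat package and $E(w,T)$ is row and column strict. Then every step of the inverse insertion for $(U,T)$ can be performed, $R=U\to T\in\mathcal{RC}(w)$ and $Y=Y(U,T)\in\mathcal{RC}(v(\lambda,r))$ exist, the insertion of $Y$ into $R$ can be performed, $U=R\leftarrow Y$ and $T=T(R,Y)$. 2. The insertion can be performed for all $(R,Y)\in\mathcal{RC}(w)\times\mathcal{RC}(v(\lambda,r))$, and $(R,Y)\mapsto(R\leftarrow Y,T(R,Y))$ is a bijection from $\mathcal{RC}(w)\times\mathcal{RC}(v(\lambda,r))$ onto the set of pairs $(U,T)$ as in 1. -/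

import Mathlib

/-!
Rc-graphs, tableaux of transpositions, the insertion algorithm `R ← Y` and the inverse insertion
algorithm.

Conventions.  Permutations of the positive integers that fix all but finitely many integers are
permutations of `ℕ` that fix `0` and have finite support.  Rows, columns and strands are numbered
from `1`.  The two algorithms are partial: they return `none` if a step cannot be performed as
described.
-/

namespace RCInsertion

noncomputable section

/-! ### Permutations -/

/-- `w` belongs to `S_∞`. -/
def InSInf (w : Equiv.Perm ℕ) : Prop := w 0 = 0 ∧ {i | w i ≠ i}.Finite

/-- The permutation `s_{i₁} ⋯ s_{iₗ}` of a word `i₁ … iₗ`, where `s_i` exchanges `i`, `i + 1`. -/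
def wordPerm (L : List ℕ) : Equiv.Perm ℕ := (L.map fun i => Equiv.swap i (i + 1)).prod

/-- The length of `w ∈ S_∞`: the least length of a word in the letters `1, 2, …` that
represents `w`. -/
def permLength (w : Equiv.Perm ℕ) : ℕ :=
  sInf {n | ∃ L : List ℕ, (∀ i ∈ L, 1 ≤ i) ∧ wordPerm L = w ∧ L.length = n}

/-- `w` is an `r`-shuffle. -/
def IsShuffle (r : ℕ) (w : Equiv.Perm ℕ) : Prop := ∀ i, 1 ≤ i → i ≠ r → w i < w (i + 1)

/-- `w` is an `r`-semi-shuffle. -/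
def IsSemiShuffle (r : ℕ) (w : Equiv.Perm ℕ) : Prop := ∀ i, r < i → w i < w (i + 1)

/-- The `j`-th part `λ_j = v (r + 1 - j) - r - 1 + j` (`1 ≤ j ≤ r`) of the partition of an
`r`-shuffle `v`; the parts with `j > r` are zero. -/
def shufflePart (r : ℕ) (v : Equiv.Perm ℕ) (j : ℕ) : ℕ :=
  if j ≤ r then v (r + 1 - j) + j - (r + 1) else 0

/-- The partition `lam 1 ≥ lam 2 ≥ …` is a hook: all parts but the first are at most `1`. -/
def IsHook (lam : ℕ → ℕ) : Prop := ∀ j, 2 ≤ j → lam j ≤ 1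

/-! ### Graphs -/

/-- A graph is given by the finite set of its crossings; `(i, j)` is the place in row `i` and
column `j`. -/
abbrev Graph := Finset (ℕ × ℕ)

/-- All crossings are at genuine places (rows and columns are numbered from `1`). -/
def IsGraph (R : Graph) : Prop := ∀ p ∈ R, 1 ≤ p.1 ∧ 1 ≤ p.2

/-- The places `(i, j)` with `i + j ≤ n` in the order of the word
`W₀ⁿ = (n-1 … 1)(n-1 … 2) ⋯ (n-1)`: rows from top to bottom, every row from right to left. -/
def places (n : ℕ) : List (ℕ × ℕ) :=
  (List.range' 1 (n - 1)).flatMap fun i => (List.range' 1 (n - i)).reverse.map fun j => (i, j)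

/-- The subword of `W₀ⁿ` (for `n` large enough) formed by the crossings of `R`; the crossing in
row `i` and column `j` carries the letter `i + j - 1`. -/
def graphWord (R : Graph) : List ℕ :=
  ((places (R.sup fun p => p.1 + p.2)).filter (· ∈ R)).map fun p => p.1 + p.2 - 1

/-- The permutation `w(R)` of a graph. -/
def graphPerm (R : Graph) : Equiv.Perm ℕ := wordPerm (graphWord R)

/-- `R` is an rc-graph (of its permutation): its word is reduced. -/
def IsRCGraph (R : Graph) : Prop := IsGraph R ∧ (graphWord R).length = permLength (graphPerm R)

/-- The set of rc-graphs of `w`. -/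
def RC (w : Equiv.Perm ℕ) : Set Graph := {R | IsRCGraph R ∧ graphPerm R = w}

/-- `R_{≥ l}`. -/
def rowsGE (R : Graph) (l : ℕ) : Graph := R.filter fun p => l ≤ p.1

/-- `R_l`. -/
def rowOnly (R : Graph) (l : ℕ) : Graph := R.filter fun p => p.1 = l

/-- The two strands that pass the place `(i, j)` of `R`: first the one that enters the place
from the left, then the one that enters it from below.  (A strand is named by the row where it
starts.  The crossings a strand can meet before it reaches the place are those in lower rows and
those further left in row `i`; the lines that enter `(i, j)` from the left and from below are in
positions `i + j - 1` and `i + j` after these crossings.)  At a crossing the first strand is the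
horizontal one.  At a non-crossing the first strand turns up and the second one turns right. -/
def strands (R : Graph) (i j : ℕ) : ℕ × ℕ :=
  let u := graphPerm (R.filter fun p => i < p.1 ∨ (p.1 = i ∧ p.2 < j))
  (u.symm (i + j - 1), u.symm (i + j))

/-- Strands `a` and `b` intersect at the place `p` of `R`. -/
def CrossAt (R : Graph) (a b : ℕ) (p : ℕ × ℕ) : Prop :=
  p ∈ R ∧ (strands R p.1 p.2 = (a, b) ∨ strands R p.1 p.2 = (b, a))

/-- `word(Y, s)`: the rows of the crossings of strand `s` in weakly decreasing order. -/
def strandWord (Y : Graph) (s : ℕ) : List ℕ :=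
  ((Y.filter fun p => (strands Y p.1 p.2).1 = s ∨ (strands Y p.1 p.2).2 = s).val.map
    Prod.fst).sort (· ≥ ·)

/-- `word(Y) = word(Y, 1) ⋯ word(Y, r)`. -/
def fullWord (r : ℕ) (Y : Graph) : List ℕ := (List.range' 1 r).flatMap (strandWord Y)

/-- The shape of `Y` as the list of row lengths of a diagram from the bottom row to the top row:
strand `s` corresponds to row `r + 1 - s`. -/
def graphShape (r : ℕ) (Y : Graph) : List ℕ := (List.range' 1 r).map fun s => (strandWord Y s).length

/-! ### Tableaux -/

/-- A (possibly partially filled) tableau.  `shape` lists the row lengths of the diagram from the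
bottom row to the top row (empty rows are allowed at the bottom), `word` lists the entries of the
boxes `1, 2, …`, which are numbered from the bottom row up and from left to right in each row.  So
the tableau is filled up to `word.length`. -/
@[ext] structure Tableau (α : Type) where
  shape : List ℕ
  word : List α

/-- The entry of the box in column `q` of row `p`, both counted from `0` and the rows counted from
the bottom; `none` if there is no such box or if it is empty. -/
def Tableau.box {α : Type} (T : Tableau α) (p q : ℕ) : Option α :=
  if q < T.shape.getD p 0 then T.word[(T.shape.take p).sum + q]? else none

/-- Entries increase from left to right and do not decrease from top to bottom. -/
def Tableau.RowStrict (T : Tableau ℕ) : Prop :=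
  (∀ p q q' x y, q < q' → T.box p q = some x → T.box p q' = some y → x < y) ∧
  (∀ p p' q x y, p < p' → T.box p q = some x → T.box p' q = some y → y ≤ x)

/-- Entries do not decrease from left to right and increase from top to bottom. -/
def Tableau.ColumnStrict (T : Tableau ℕ) : Prop :=
  (∀ p q q' x y, q < q' → T.box p q = some x → T.box p q' = some y → x ≤ y) ∧
  (∀ p p' q x y, p < p' → T.box p q = some x → T.box p' q = some y → y < x)

/-- The diagram of the partition of the `r`-shuffle `v`, from the bottom row `r` to the top
row `1`. -/
def shuffleShape (r : ℕ) (v : Equiv.Perm ℕ) : List ℕ :=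
  (List.range' 1 r).map fun s => shufflePart r v (r + 1 - s)

/-- `T` is a (completely filled) tableau of transpositions of the `r`-shuffle `v`. -/
def IsTranspositionTableau (r : ℕ) (v : Equiv.Perm ℕ) (T : Tableau (ℕ × ℕ)) : Prop :=
  T.shape = shuffleShape r v ∧ T.word.length = T.shape.sum ∧
    ∀ t ∈ T.word, 1 ≤ t.1 ∧ t.1 ≤ r ∧ r < t.2

/-- `w_i(T)`, the product of the first `i` transpositions of `T`. -/
def Tableau.perm (T : Tableau (ℕ × ℕ)) (i : ℕ) : Equiv.Perm ℕ :=
  ((T.word.take i).map fun t => Equiv.swap t.1 t.2).prod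

/-- `T`, filled up to `T.word.length`, is an `r`-Bruhat chain of `w`. -/
def IsBruhatChain (r : ℕ) (w : Equiv.Perm ℕ) (T : Tableau (ℕ × ℕ)) : Prop :=
  (∀ t ∈ T.word, 1 ≤ t.1 ∧ t.1 ≤ r ∧ r < t.2) ∧
    ∀ i, 1 ≤ i → i ≤ T.word.length → permLength (w * T.perm i) = permLength w + i

/-- `(w, R, T)` is an `r`-Bruhat package. -/
def IsBruhatPackage (r : ℕ) (w : Equiv.Perm ℕ) (R : Graph) (T : Tableau (ℕ × ℕ)) : Prop :=
  IsRCGraph R ∧ w * T.perm T.word.length = graphPerm R ∧ IsBruhatChain r w T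

/-- `E(w, T)`: box `i` (here `i = k + 1`) contains `w w_i(T) (b_i)`. -/
def evalTableau (w : Equiv.Perm ℕ) (T : Tableau (ℕ × ℕ)) : Tableau ℕ where
  shape := T.shape
  word := T.word.mapIdx fun k t => (w * T.perm (k + 1)) t.2

/-- `E(w, T)` is row and column strict. -/
def EvalStrict (w : Equiv.Perm ℕ) (T : Tableau (ℕ × ℕ)) : Prop :=
  (evalTableau w T).RowStrict ∧ (evalTableau w T).ColumnStrict

/-! ### Selection -/

open Classical in
/-- The unique object with property `P`, if there is exactly one. -/
def theUnique {α : Type} (P : α → Prop) : Option α :=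
  if h : ∃! x, P x then some h.choose else none

/-- The largest number with property `P`, if there is one. -/
def rightmost (P : ℕ → Prop) : Option ℕ := theUnique fun j => IsGreatest {k | P k} j

/-- The smallest number with property `P`, if there is one. -/
def leftmost (P : ℕ → Prop) : Option ℕ := theUnique fun j => IsLeast {k | P k} j

/-! ### The graphs `S_j` of a package -/

/-- `S_{m-k}(w, R, T)` with `m = |T|`: it has the permutation `w w_{m-k}(T)` and arises from
`S_{m-k+1}` by removing one crossing. -/
def peel (w : Equiv.Perm ℕ) (R : Graph) (T : Tableau (ℕ × ℕ)) : ℕ → Option Graph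
  | 0 => some R
  | k + 1 => do
    let S ← peel w R T k
    let p ← theUnique fun p => p ∈ S ∧ graphPerm (S.erase p) = w * T.perm (T.word.length - (k + 1))
    return S.erase p

/-- `S_j(w, R, T)` for `0 ≤ j ≤ |T|`. -/
def sGraph (w : Equiv.Perm ℕ) (R : Graph) (T : Tableau (ℕ × ℕ)) (j : ℕ) : Option Graph :=
  peel w R T (T.word.length - j)

/-! ### The insertion algorithm

The state `(R(l, i), word of T(l, i))` of the algorithm is a pair; the shape of `T(l, i)` is the
shape of `Y_{≥ l}` throughout row `l`. -/

/-- The data carried by the algorithm: a graph and the word of a partially filled tableau. -/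
abbrev State := Graph × List (ℕ × ℕ)

/-- Place `(l, j)` is a non-crossing whose left strand `c` and lower strand `d` satisfy
`c ≤ r < d`. -/
def Allowed (r : ℕ) (R : Graph) (l j : ℕ) : Prop :=
  1 ≤ j ∧ (l, j) ∉ R ∧ (strands R l j).1 ≤ r ∧ r < (strands R l j).2

/-- Place `(l, j)` is a non-crossing whose left strand is `g` and whose lower strand `d` satisfies
`r < d`, where `(e g)` is the last entry of the word `T`. -/
def AllowedNext (r : ℕ) (R : Graph) (T : List (ℕ × ℕ)) (l j : ℕ) : Prop :=
  1 ≤ j ∧ (l, j) ∉ R ∧ (∃ e, T.getLast? = some (e, (strands R l j).1)) ∧ r < (strands R l j).2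

/-- An insertion step in row `l`. -/
def insertStep (r l : ℕ) (s : State) : Option State := do
  let j ← rightmost (Allowed r s.1 l)
  return (insert (l, j) s.1, s.2 ++ [strands s.1 l j])

/-- The crossing that has to be removed from row `l` of `R'` during a rectification (its column
is returned) together with `T''`.  Here `T` is the word of the tableau `T'` without its last entry
`(a b)`. -/
def removalPlace (l : ℕ) (R' : Graph) (T : List (ℕ × ℕ)) (a b : ℕ) :
    Option (ℕ × List (ℕ × ℕ)) :=
  match theUnique fun j => (l, j) ∈ R' ∧ strands R' l j = (b, a) with
  | some j => some (j, T)
  | none => do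
    let ef ← T.getLast?
    let j ← theUnique fun j => (l, j) ∈ R' ∧ ef.1 = a ∧ strands R' l j = (b, ef.2)
    return (j, T.dropLast ++ [(a, b)])

/-- The second half of a rectification: a crossing was removed from place `(l, j₀)`; insert one in
the rightmost allowed place to the left of it. -/
def reinsert (r l j₀ : ℕ) (R'' : Graph) (T'' : List (ℕ × ℕ)) : Option State := do
  let j ← rightmost fun j => j < j₀ ∧ (Allowed r R'' l j ∨ AllowedNext r R'' T'' l j)
  let cd := strands R'' l j
  if cd.1 ≤ r then
    return (insert (l, j) R'', T'' ++ [cd])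
  else do
    let eg ← T''.getLast?
    return (insert (l, j) R'', T''.dropLast ++ [(eg.1, cd.2), eg])

open Classical in
/-- A rectification step in row `l`.  Here `u = w(R_{≥ l})`, `sh` is the shape of `Y_{≥ l}`,
`S₀` and `S₁` are the graphs `S_{i₊ - 1}` and `S_{i₊}` of the package of row `l + 1`, and `t` is
entry `i₊` of its tableau. -/
def rectifyStep (r l : ℕ) (u : Equiv.Perm ℕ) (sh : List ℕ) (S₀ S₁ : Graph) (t : ℕ × ℕ)
    (s : State) : Option State :=
  let R' := s.1 ∪ (S₁ \ S₀)
  let T' : Tableau (ℕ × ℕ) := ⟨sh, s.2 ++ [t]⟩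
  if EvalStrict u T' ∧ IsBruhatPackage r u R' T' then some (R', T'.word)
  else do
    let q ← removalPlace l R' s.2 t.1 t.2
    reinsert r l q.1 (R'.erase (l, q.1)) q.2

/-- The state `(R(l, i), T(l, i))` after step `(l, i)`; `prev` is the pair `(R(l+1), T(l+1))`
that row `l + 1` has produced. -/
def rowState (r : ℕ) (R Y : Graph) (l : ℕ) (prev : State) : ℕ → Option State
  | 0 => do
    let S ← sGraph (graphPerm (rowsGE R (l + 1))) prev.1 ⟨graphShape r (rowsGE Y (l + 1)), prev.2⟩ 0
    return (S ∪ rowOnly R l, [])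
  | i + 1 => do
    let s ← rowState r R Y l prev i
    let ks := fullWord r (rowsGE Y l)
    let k ← ks[i]?
    if k = l then insertStep r l s
    else do
      let iPlus := ((ks.take (i + 1)).filter fun k => l < k).length
      let u := graphPerm (rowsGE R (l + 1))
      let T : Tableau (ℕ × ℕ) := ⟨graphShape r (rowsGE Y (l + 1)), prev.2⟩
      let S₀ ← sGraph u prev.1 T (iPlus - 1)
      let S₁ ← sGraph u prev.1 T iPlus
      let t ← prev.2[iPlus - 1]?
      rectifyStep r l (graphPerm (rowsGE R l)) (graphShape r (rowsGE Y l)) S₀ S₁ t s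

/-- `(R(l), T(l))` for `l = r + 1 - k`.  The start value `(R_{≥ r+1}, ∅)` makes the row-to-row step
of row `r` yield `R(r, 0) = R_{≥ r}` with an empty tableau. -/
def afterRows (r : ℕ) (R Y : Graph) : ℕ → Option State
  | 0 => some (rowsGE R (r + 1), [])
  | k + 1 => do
    let prev ← afterRows r R Y k
    rowState r R Y (r - k) prev (rowsGE Y (r - k)).card

/-- The insertion algorithm: the pair `(R ← Y, T(R, Y))`. -/
def insertion (r : ℕ) (R Y : Graph) : Option (Graph × Tableau (ℕ × ℕ)) := do
  let s ← afterRows r R Y r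
  return (s.1, ⟨graphShape r Y, s.2⟩)

/-! ### The inverse insertion algorithm -/

/-- Place `(l, j)` is a non-crossing whose left strand `b` and lower strand `a` satisfy
`a ≤ r < b`. -/
def InvAllowed (r : ℕ) (R : Graph) (l j : ℕ) : Prop :=
  1 ≤ j ∧ (l, j) ∉ R ∧ (strands R l j).2 ≤ r ∧ r < (strands R l j).1

/-- Place `(l, j)` is a non-crossing whose left strand is `g`, where `(e g)` is the last entry of
the word `T`. -/
def InvAllowedNext (R : Graph) (T : List (ℕ × ℕ)) (l j : ℕ) : Prop :=
  1 ≤ j ∧ (l, j) ∉ R ∧ ∃ e, T.getLast? = some (e, (strands R l j).1)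

/-- The result of an inverse step `(l, i)`: whether it is an inverse rectification, the graph
`R(l, i-1)` and the word of `T(l, i-1)`. -/
abbrev InvResult := Bool × Graph × List (ℕ × ℕ)

/-- The second half of an inverse rectification: a crossing was removed from place `(l, j₀)`;
insert one in the leftmost allowed place to the right of it, which yields `R'` and `T'`, then
remove the crossing below row `l` of the two strands `a`, `b` in the last entry of `T'`, and empty
the last box of `T'`. -/
def invReinsert (r l j₀ : ℕ) (R'' : Graph) (T'' : List (ℕ × ℕ)) : Option InvResult := do
  let j ← leftmost fun j => j₀ < j ∧ (InvAllowed r R'' l j ∨ InvAllowedNext R'' T'' l j)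
  let x := strands R'' l j
  let R' := insert (l, j) R''
  if x.2 ≤ r then do
    let q ← theUnique fun q => l < q.1 ∧ CrossAt R' x.2 x.1 q
    return (true, R'.erase q, T'')
  else do
    let eg ← T''.getLast?
    let q ← theUnique fun q => l < q.1 ∧ CrossAt R' eg.1 eg.2 q
    return (true, R'.erase q, T''.dropLast ++ [(eg.1, x.2)])

open Classical in
/-- The inverse step for the last filled box of the word `T` in row `l`. -/
def invStep (r l : ℕ) (R : Graph) (T : List (ℕ × ℕ)) : Option InvResult := do
  let cd ← T.getLast?
  let p ← theUnique (CrossAt R cd.1 cd.2)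
  if p.1 = l then
    if ∃ j, p.2 < j ∧ InvAllowed r (R.erase p) l j then
      invReinsert r l p.2 (R.erase p) T.dropLast
    else return (false, R.erase p, T.dropLast)
  else
    match (do
      let ef ← T.dropLast.getLast?
      theUnique fun j => ef.1 = cd.1 ∧ (l, j) ∈ R ∧ strands R l j = (cd.2, ef.2)) with
    | some j₀ => invReinsert r l j₀ (R.erase (l, j₀)) (T.dropLast.dropLast ++ [cd])
    | none => return (true, R.erase p, T.dropLast)

/-- The data of the inverse algorithm within a row: the current graph, the word of the current
tableau, for each box emptied so far (in the order of the boxes) whether it was emptied by an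
inverse rectification, and the entries of the boxes of the tableau of row `l + 1` that belong to
these inverse rectifications. -/
structure InvState where
  graph : Graph
  word : List (ℕ × ℕ)
  flags : List Bool
  entries : List (ℕ × ℕ)

/-- The state after `k` inverse steps in row `l`, started from `(R(l, m_l), T(l, m_l)) = (U, T)`.
The entry `(a b)` that an inverse rectification `(l, i)` hands over to row `l + 1` is determined by
`w(R(l, i)_{≥ l+1}) = w(R(l, i-1)_{≥ l+1}) t_{ab}`; inverse insertions do not change the
rows below `l`. -/
def invRowState (r l : ℕ) (U : Graph) (T : List (ℕ × ℕ)) : ℕ → Option InvState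
  | 0 => some ⟨U, T, [], []⟩
  | k + 1 => do
    let s ← invRowState r l U T k
    let x ← invStep r l s.graph s.word
    if x.1 then do
      let t ← theUnique fun t : ℕ × ℕ => t.1 ≤ r ∧ r < t.2 ∧
        graphPerm (rowsGE s.graph (l + 1)) =
          graphPerm (rowsGE x.2.1 (l + 1)) * Equiv.swap t.1 t.2
      return ⟨x.2.1, x.2.2, true :: s.flags, t :: s.entries⟩
    else return ⟨x.2.1, x.2.2, false :: s.flags, s.entries⟩

/-- `word_l` from `word_{l+1}`: the boxes of inverse rectifications receive the letters of
`word_{l+1}` in order, all other boxes receive the letter `l`. -/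
def mergeWord (l : ℕ) : List Bool → List ℕ → List ℕ
  | [], _ => []
  | true :: fs, k :: ks => k :: mergeWord l fs ks
  | true :: _, [] => []
  | false :: fs, ks => l :: mergeWord l fs ks

/-- The inverse algorithm on the `n` rows `l, l + 1, …, l + n - 1 = r`, started from
`(R(l, m_l), T(l, m_l)) = (U, T)`.  It returns the graph that consists of row `k` of `R(k, 0)` for
`l ≤ k ≤ r` and of the rows of `U` below row `r`, together with `word_l`.  After row `r` no box may
be left. -/
def invRows (r : ℕ) : ℕ → ℕ → Graph → List (ℕ × ℕ) → Option (Graph × List ℕ)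
  | 0, _, U, T => if T = [] then some (U, []) else none
  | n + 1, l, U, T => do
    let s ← invRowState r l U T T.length
    let x ← invRows r n (l + 1) (rowsGE U (l + 1)) s.entries
    return (rowOnly s.graph l ∪ x.1, mergeWord l s.flags x.2)

/-- The inverse insertion algorithm for the `r`-shuffle `v`: the pair `(U → T, Y(U, T))`, where
`Y(U, T)` is the rc-graph of `v` with the word that the algorithm produces. -/
def inverseInsertion (r : ℕ) (v : Equiv.Perm ℕ) (U : Graph) (T : Tableau (ℕ × ℕ)) :
    Option (Graph × Graph) := do
  let x ← invRows r r 1 U T.word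
  let Y ← theUnique fun Y => Y ∈ RC v ∧ fullWord r Y = x.2
  return (x.1, Y)

/-- The pairs `(U, T)` of an rc-graph `U` and a tableau of transpositions `T` of the `r`-shuffle `v`
such that `(w, U, T)` is an `r`-Bruhat package and `E(w, T)` is row and column strict. -/
def admissiblePairs (r : ℕ) (w v : Equiv.Perm ℕ) : Set (Graph × Tableau (ℕ × ℕ)) :=
  {x | IsTranspositionTableau r v x.2 ∧ IsBruhatPackage r w x.1 x.2 ∧ EvalStrict w x.2}

end

end RCInsertion

open RCInsertion

/-!
The algorithm treats one row at a time, and everything that happens in row `l` can be read off from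
three data: the graph below the row, the set of columns of the crossings in the row, and the word
of the tableau (`Config`). The graph below the row enters only through the strands `below L l j`
that come into the row from below, and the strand `carry` that runs along the row is then determined
by the columns. The product of the transpositions of the word, applied to `w`, is the permutation
of the whole graph; together with reducedness of the graph and of the chain this is
`Config.Valid`, the condition of an `r`-Bruhat package. By `isRCGraph_rowUnion` reducedness of the
graph amounts to reducedness below the row and to `carry < below` at each crossing of the row.

An insertion or a rectification is a relation `Step` between configurations, which does not mention
the shape of the tableau. Steps preserve validity (`Step.valid`) and can be performed
(`exists_step_insertion`, `exists_step_rectification`): a suitable non-crossing exists because the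
strand that runs along the row changes from small to large or conversely, or because far to the
right all strands are large. Conversely every valid configuration with a nonempty word arises by a
step (`exists_step_to`), and the inverse algorithm recovers the configuration before the step and
its kind (`Step.invStep_eq`). So within a row the two algorithms are inverse to each other as long
as the shape is ignored.

The shape comes in through the strictness of `E(w, T)`. The entry of `E` in the box of a step is
the position where the large strand of its transposition leaves the row. An insertion is to the
right of the step before it (`Step.lt_of_insertion`), a rectification after an insertion is to the
left of it (`Step.gt_of_rect_after_insertion`), and two consecutive rectifications are ordered as
the entries of the lower tableau (`Step.rect_rect`). These are the rules of `Alternation`; they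
settle strictness in the rows of the tableau, and for a hook also in the column. If `w` is a
semi-shuffle, every step moves one large number to the left (`Run.largeMoves`), and ballot arguments (`Moves.ballot_forward`, `Moves.ballot_backward`) compare
two consecutive rows of boxes. In both cases strictness of the lower tableau on a subdiagram
containing all but the lowest box of each column implies strictness of the upper one
(`Alternation.strict_upper`); conversely strictness of the upper tableau implies that the
rectifications form such a subdiagram and that the lower tableau is strict
(`Alternation.strict_lower`). Strictness is also what the rectification of the algorithm tests:
taking over the transposition of the lower tableau while the row has one of the two special
crossings would destroy either the package or strictness, and otherwise it preserves both, so that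
the algorithm performs exactly the relation `Step` (`Step.rectifyStep_eq`).

The rc-graphs of an `r`-shuffle are determined by the words of their strands `1, …, r`
(`IsShuffle.eq_of_strandWord`). The families of words that occur are those in which row `l` adds
letters `l` to the words in such a way that the old diagram contains all but the lowest box of each
column of the new one (`WordFamily`, `WordFamily.exists_graph`), which is the condition found for
the rectifications. The steps of all rows are put together in the relation `Rows` between the pairs
`(R, Y)` and `(U, T)`. It is total on either side (`WordFamily.exists_rows`, `exists_rows_to`),
the insertion computes it in one direction (`Rows.afterRows_eq`) and the inverse insertion in the
other (`Rows.invRows_eq`). This gives both parts of the theorem.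
-/

namespace RCInsertion

/-! ### Length and inversions -/

/-- The number of inversions of `w` among the integers below `N`. -/
def inversionNumber (N : ℕ) (w : Equiv.Perm ℕ) : ℕ :=
  ∑ i ∈ Finset.range N, ∑ j ∈ Finset.range N, if i < j ∧ w j < w i then 1 else 0

theorem InSInf.exists_bound {w : Equiv.Perm ℕ} (hw : InSInf w) : ∃ N, ∀ i, N ≤ i → w i = i := by
  obtain ⟨N, hN⟩ := hw.2.bddAbove
  refine ⟨N + 1, fun i hi => ?_⟩
  by_contra h
  have := hN h
  omega

theorem inSInf_of_bound {w : Equiv.Perm ℕ} (h0 : w 0 = 0) {N : ℕ} (h : ∀ i, N ≤ i → w i = i) :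
    InSInf w := by
  refine ⟨h0, (Set.finite_Iio N).subset fun i hi => ?_⟩
  by_contra h'
  exact hi (h i (not_lt.mp h'))

theorem InSInf.mul {w u : Equiv.Perm ℕ} (hw : InSInf w) (hu : InSInf u) : InSInf (w * u) := by
  obtain ⟨N, hN⟩ := hw.exists_bound
  obtain ⟨M, hM⟩ := hu.exists_bound
  refine inSInf_of_bound (N := N + M) (by simp [hu.1, hw.1]) fun i hi => ?_
  rw [Equiv.Perm.mul_apply, hM i (by omega), hN i (by omega)]

theorem inSInf_one : InSInf 1 := inSInf_of_bound (N := 0) rfl fun _ _ => rfl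

theorem inSInf_swap {a b : ℕ} (ha : 1 ≤ a) (hb : 1 ≤ b) : InSInf (Equiv.swap a b) :=
  inSInf_of_bound (N := a + b + 1) (Equiv.swap_apply_of_ne_of_ne (by omega) (by omega))
    fun i hi => Equiv.swap_apply_of_ne_of_ne (by omega) (by omega)

theorem apply_lt_of_bound {w : Equiv.Perm ℕ} {N : ℕ} (h : ∀ i, N ≤ i → w i = i) {i : ℕ}
    (hi : i < N) : w i < N := by
  by_contra h'
  have := w.injective (h (w i) (not_lt.mp h'))
  omega

theorem inversionNumber_succ {w : Equiv.Perm ℕ} {N : ℕ} (h : ∀ i, N ≤ i → w i = i) :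
    inversionNumber (N + 1) w = inversionNumber N w := by
  unfold inversionNumber
  have key : ∀ i ∈ Finset.range (N + 1), (∑ j ∈ Finset.range (N + 1),
      if i < j ∧ w j < w i then 1 else 0) =
      ∑ j ∈ Finset.range N, if i < j ∧ w j < w i then 1 else 0 := by
    intro i hi
    rw [Finset.sum_range_succ, if_neg, add_zero]
    rintro ⟨h1, h2⟩
    rw [h N le_rfl] at h2
    have := apply_lt_of_bound h h1
    omega
  rw [Finset.sum_congr rfl key, Finset.sum_range_succ]
  have : (∑ j ∈ Finset.range N, if N < j ∧ w j < w N then 1 else 0) = 0 := by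
    refine Finset.sum_eq_zero fun j hj => if_neg ?_
    have := Finset.mem_range.mp hj
    omega
  omega

theorem inversionNumber_eq {w : Equiv.Perm ℕ} {N M : ℕ} (hN : ∀ i, N ≤ i → w i = i)
    (hM : ∀ i, M ≤ i → w i = i) : inversionNumber N w = inversionNumber M w := by
  have key : ∀ N k, (∀ i, N ≤ i → w i = i) → inversionNumber (N + k) w = inversionNumber N w := by
    intro N k h
    induction k with
    | zero => rfl
    | succ k ih => rw [← add_assoc, inversionNumber_succ (fun i hi => h i (by omega)), ih]
  rcases le_total N M with h | h
  · obtain ⟨k, rfl⟩ := Nat.exists_eq_add_of_le h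
    exact (key _ _ hN).symm
  · obtain ⟨k, rfl⟩ := Nat.exists_eq_add_of_le h
    exact key _ _ hM

/-- No value strictly between `a` and `b` is mapped strictly between `w a` and `w b`. -/
def NoBetween (w : Equiv.Perm ℕ) (a b : ℕ) : Prop := ∀ c, a < c → c < b → ¬ (w a < w c ∧ w c < w b)

/-- Multiplying by the transposition of `a < b` with `w a < w b` creates the inversion `(a, b)` and
two further inversions for each `c` between `a` and `b` with `w a < w c < w b`. -/
theorem inversionNumber_mul_swap {w : Equiv.Perm ℕ} {N a b : ℕ} (hab : a < b) (hb : b < N)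
    (h : w a < w b) :
    ∃ k, inversionNumber N (w * Equiv.swap a b) = inversionNumber N w + 1 + 2 * k ∧
      (k = 0 ↔ NoBetween w a b) := by
  classical
  set S := ((Finset.range N).erase a).erase b with hS
  have hr : Finset.range N = insert a (insert b S) := by
    ext i
    simp only [hS, Finset.mem_insert, Finset.mem_erase, Finset.mem_range]
    omega
  have haS : a ∉ insert b S := by simp [hS, hab.ne]
  have hbS : b ∉ S := by simp [hS]
  have hne : ∀ c ∈ S, c ≠ a ∧ c ≠ b := by
    intro c hc
    simp only [hS, Finset.mem_erase] at hc
    exact ⟨hc.2.1, hc.1⟩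
  have expand : ∀ f : ℕ → ℕ → ℕ, (∑ i ∈ Finset.range N, ∑ j ∈ Finset.range N, f i j) =
      (∑ i ∈ S, ∑ j ∈ S, f i j) + (∑ c ∈ S, (f a c + f b c + f c a + f c b)) +
        (f a a + f a b + f b a + f b b) := by
    intro f
    rw [hr, Finset.sum_insert haS, Finset.sum_insert hbS]
    simp only [Finset.sum_insert haS, Finset.sum_insert hbS, Finset.sum_add_distrib]
    ring
  refine ⟨∑ c ∈ S, if a < c ∧ c < b ∧ w a < w c ∧ w c < w b then 1 else 0, ?_, ?_⟩
  · unfold inversionNumber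
    rw [expand, expand]
    have e1 : (∑ i ∈ S, ∑ j ∈ S, if i < j ∧ (w * Equiv.swap a b) j < (w * Equiv.swap a b) i
        then 1 else 0) = ∑ i ∈ S, ∑ j ∈ S, if i < j ∧ w j < w i then 1 else 0 := by
      refine Finset.sum_congr rfl fun i hi => Finset.sum_congr rfl fun j hj => ?_
      simp only [Equiv.Perm.mul_apply,
        Equiv.swap_apply_of_ne_of_ne (hne i hi).1 (hne i hi).2,
        Equiv.swap_apply_of_ne_of_ne (hne j hj).1 (hne j hj).2]
    have e2 : (∑ c ∈ S,
        ((if a < c ∧ (w * Equiv.swap a b) c < (w * Equiv.swap a b) a then 1 else 0) +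
        (if b < c ∧ (w * Equiv.swap a b) c < (w * Equiv.swap a b) b then 1 else 0) +
        (if c < a ∧ (w * Equiv.swap a b) a < (w * Equiv.swap a b) c then 1 else 0) +
        (if c < b ∧ (w * Equiv.swap a b) b < (w * Equiv.swap a b) c then 1 else 0))) =
        (∑ c ∈ S, ((if a < c ∧ w c < w a then 1 else 0) + (if b < c ∧ w c < w b then 1 else 0) +
        (if c < a ∧ w a < w c then 1 else 0) + (if c < b ∧ w b < w c then 1 else 0))) +
        2 * ∑ c ∈ S, if a < c ∧ c < b ∧ w a < w c ∧ w c < w b then 1 else 0 := by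
      rw [Finset.mul_sum, ← Finset.sum_add_distrib]
      refine Finset.sum_congr rfl fun c hc => ?_
      obtain ⟨h1, h2⟩ := hne c hc
      have h3 : w c ≠ w a := w.injective.ne h1
      have h4 : w c ≠ w b := w.injective.ne h2
      simp only [Equiv.Perm.mul_apply, Equiv.swap_apply_of_ne_of_ne h1 h2, Equiv.swap_apply_left,
        Equiv.swap_apply_right]
      split_ifs <;> omega
    rw [e1, e2]
    simp only [Equiv.Perm.mul_apply, Equiv.swap_apply_left, Equiv.swap_apply_right]
    have : ¬ (w b < w a) := by omega
    have hba : ¬ (b < a) := by omega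
    simp only [lt_irrefl, false_and, if_false, hab, h, this, hba, true_and, if_true]
    ring
  · rw [Finset.sum_eq_zero_iff]
    constructor
    · intro hk c h1 h2 h3
      have := hk c (by simp only [hS, Finset.mem_erase, Finset.mem_range]; omega)
      simp [h1, h2, h3] at this
    · intro hk c _
      refine if_neg ?_
      rintro ⟨h1, h2, h3⟩
      exact hk c h1 h2 h3

theorem swap_mul_eq_mul_swap (w : Equiv.Perm ℕ) (i j : ℕ) :
    Equiv.swap i j * w = w * Equiv.swap (w.symm i) (w.symm j) := by
  have := Equiv.swap_mul_eq_mul_swap w i j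
  simpa using this

theorem inversionNumber_swap_mul {w : Equiv.Perm ℕ} {N k : ℕ} (hN : ∀ i, N ≤ i → w i = i)
    (hk : k + 1 < N) (h : w.symm k < w.symm (k + 1)) :
    inversionNumber N (Equiv.swap k (k + 1) * w) = inversionNumber N w + 1 := by
  have hb : w.symm (k + 1) < N := by
    refine apply_lt_of_bound (fun i hi => ?_) hk
    rw [Equiv.symm_apply_eq, hN i hi]
  obtain ⟨m, hm, hm'⟩ := inversionNumber_mul_swap (w := w) h hb (by simp)
  rw [swap_mul_eq_mul_swap, hm, hm'.mpr]
  intro c _ _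
  simp only [Equiv.apply_symm_apply]
  omega

theorem wordPerm_cons (i : ℕ) (L : List ℕ) :
    wordPerm (i :: L) = Equiv.swap i (i + 1) * wordPerm L := by simp [wordPerm]

theorem inversionNumber_swap_mul_le {w : Equiv.Perm ℕ} {N k : ℕ} (hN : ∀ i, N ≤ i → w i = i)
    (hk : k + 1 < N) :
    inversionNumber N (Equiv.swap k (k + 1) * w) ≤ inversionNumber N w + 1 := by
  rcases lt_trichotomy (w.symm k) (w.symm (k + 1)) with h | h | h
  · exact (inversionNumber_swap_mul hN hk h).le
  · have := w.symm.injective h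
    omega
  · have e : Equiv.swap k (k + 1) * (Equiv.swap k (k + 1) * w) = w := by
      rw [← mul_assoc, Equiv.swap_mul_self, one_mul]
    have := inversionNumber_swap_mul (w := Equiv.swap k (k + 1) * w) (N := N) (k := k)
      (fun i hi => by
        rw [Equiv.Perm.mul_apply, hN i hi]
        exact Equiv.swap_apply_of_ne_of_ne (by omega) (by omega)) hk
      (by
        have e' : ∀ x, (Equiv.swap k (k + 1) * w).symm x = w.symm (Equiv.swap k (k + 1) x) :=
          fun x => by
            rw [Equiv.symm_apply_eq]
            simp
        rw [e', e', Equiv.swap_apply_left, Equiv.swap_apply_right]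
        exact h)
    rw [e] at this
    omega

theorem inversionNumber_one (N : ℕ) : inversionNumber N 1 = 0 := by
  refine Finset.sum_eq_zero fun i _ => Finset.sum_eq_zero fun j _ => if_neg ?_
  simp only [Equiv.Perm.coe_one, id]
  omega

theorem inversionNumber_wordPerm_le {L : List ℕ} {N : ℕ} (hL : ∀ i ∈ L, i + 1 < N) :
    (∀ i, N ≤ i → wordPerm L i = i) ∧ inversionNumber N (wordPerm L) ≤ L.length := by
  induction L with
  | nil => exact ⟨fun _ _ => rfl, by simpa [wordPerm] using (inversionNumber_one N).le⟩
  | cons i L ih =>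
    simp only [List.mem_cons, forall_eq_or_imp] at hL
    obtain ⟨h1, h2⟩ := ih hL.2
    rw [wordPerm_cons]
    refine ⟨fun j hj => ?_, (inversionNumber_swap_mul_le h1 hL.1).trans (by simpa using h2)⟩
    rw [Equiv.Perm.mul_apply, h1 j hj]
    exact Equiv.swap_apply_of_ne_of_ne (by omega) (by omega)

/-- Every permutation is represented by a word whose length is the number of its inversions. -/
theorem exists_word {w : Equiv.Perm ℕ} {N : ℕ} (h0 : w 0 = 0) (hN : ∀ i, N ≤ i → w i = i) :
    ∃ L : List ℕ, (∀ i ∈ L, 1 ≤ i) ∧ wordPerm L = w ∧ L.length = inversionNumber N w := by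
  generalize hn : inversionNumber N w = n
  induction n using Nat.strong_induction_on generalizing w with
  | _ n ih =>
    -- a descent of `w⁻¹` is split off as the first letter; without descents `w` is the identity
    by_cases hd : ∃ k, w.symm (k + 1) < w.symm k
    · obtain ⟨k, hk⟩ := hd
      have hs0 : w.symm 0 = 0 := by rw [Equiv.symm_apply_eq, h0]
      have hsN : ∀ i, N ≤ i → w.symm i = i := fun i hi => by rw [Equiv.symm_apply_eq, hN i hi]
      have hk1 : 1 ≤ k := by
        rcases Nat.eq_zero_or_pos k with rfl | h
        · omega
        · exact h
      have hkN : k + 1 < N := by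
        by_contra hc
        by_cases hc' : N ≤ k
        · rw [hsN k hc', hsN (k + 1) (by omega)] at hk
          omega
        · rw [hsN (k + 1) (by omega)] at hk
          have := apply_lt_of_bound hsN (not_le.mp hc')
          omega
      set u := Equiv.swap k (k + 1) * w with hu
      have e : Equiv.swap k (k + 1) * u = w := by
        rw [hu, ← mul_assoc, Equiv.swap_mul_self, one_mul]
      have huN : ∀ i, N ≤ i → u i = i := fun i hi => by
        rw [hu, Equiv.Perm.mul_apply, hN i hi]
        exact Equiv.swap_apply_of_ne_of_ne (by omega) (by omega)
      have hlen := inversionNumber_swap_mul (w := u) huN hkN (by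
        have e' : ∀ x, u.symm x = w.symm (Equiv.swap k (k + 1) x) := fun x => by
          rw [Equiv.symm_apply_eq, hu]
          simp
        rw [e', e', Equiv.swap_apply_left, Equiv.swap_apply_right]
        exact hk)
      rw [e, hn] at hlen
      obtain ⟨L, h1, h2, h3⟩ := ih (inversionNumber N u) (by omega) (w := u) (by
        rw [hu, Equiv.Perm.mul_apply, h0]
        exact Equiv.swap_apply_of_ne_of_ne (by omega) (by omega)) huN rfl
      refine ⟨k :: L, ?_, ?_, ?_⟩
      · simpa using ⟨hk1, h1⟩
      · rw [wordPerm_cons, h2, e]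
      · simp [h3, hlen]
    · push Not at hd
      have hmono : StrictMono w.symm := strictMono_nat_of_lt_succ fun k =>
        lt_of_le_of_ne (hd k) (fun h => by have := w.symm.injective h; omega)
      have hid : ∀ i, w.symm i = i := by
        have hmono' : StrictMono w := fun i j hij => by
          by_contra h
          have := hmono.monotone (not_lt.mp h)
          rw [Equiv.symm_apply_apply, Equiv.symm_apply_apply] at this
          omega
        intro i
        have h1 := hmono'.id_le (w.symm i)
        rw [Equiv.apply_symm_apply] at h1
        exact le_antisymm h1 (hmono.id_le i)
      have hw : w = 1 := by
        ext i
        have := hid (w i)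
        rw [Equiv.symm_apply_apply] at this
        exact this.symm
      subst hw
      rw [inversionNumber_one] at hn
      exact ⟨[], by simp, by simp [wordPerm], by simp [hn]⟩

/-- The length of a permutation is the number of its inversions. -/
theorem permLength_eq_inversionNumber {w : Equiv.Perm ℕ} {N : ℕ} (h0 : w 0 = 0)
    (hN : ∀ i, N ≤ i → w i = i) : permLength w = inversionNumber N w := by
  apply le_antisymm
  · exact Nat.sInf_le (exists_word h0 hN)
  · refine le_csInf ⟨_, exists_word h0 hN⟩ ?_
    rintro n ⟨L, -, h2, rfl⟩
    obtain ⟨h3, h4⟩ := inversionNumber_wordPerm_le (L := L) (N := L.sum + 2) (fun i hi => by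
      have := List.le_sum_of_mem hi
      omega)
    rw [h2] at h3 h4
    rwa [inversionNumber_eq hN h3]

theorem permLength_mul_swap {w : Equiv.Perm ℕ} (hw : InSInf w) {a b : ℕ} (ha : 1 ≤ a)
    (hab : a < b) (h : w a < w b) :
    ∃ k, permLength (w * Equiv.swap a b) = permLength w + 1 + 2 * k ∧
      (k = 0 ↔ NoBetween w a b) := by
  obtain ⟨N, hN⟩ := hw.exists_bound
  have hN' : ∀ i, N + b + 1 ≤ i → w i = i := fun i hi => hN i (by omega)
  obtain ⟨k, hk, hk'⟩ := inversionNumber_mul_swap (w := w) (N := N + b + 1) hab (by omega) h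
  refine ⟨k, ?_, hk'⟩
  rw [permLength_eq_inversionNumber hw.1 hN',
    permLength_eq_inversionNumber (N := N + b + 1) _ _, hk]
  · rw [Equiv.Perm.mul_apply, Equiv.swap_apply_of_ne_of_ne (by omega) (by omega), hw.1]
  · intro i hi
    rw [Equiv.Perm.mul_apply, Equiv.swap_apply_of_ne_of_ne (by omega) (by omega), hN' i hi]

theorem permLength_mul_swap_lt {w : Equiv.Perm ℕ} (hw : InSInf w) {a b : ℕ} (ha : 1 ≤ a)
    (hab : a < b) (h : w b < w a) : permLength (w * Equiv.swap a b) < permLength w := by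
  obtain ⟨k, hk, -⟩ := permLength_mul_swap (hw.mul (inSInf_swap ha (ha.trans hab.le))) ha hab
    (by simpa using h)
  rw [mul_assoc, Equiv.swap_mul_self, mul_one] at hk
  omega

/-- Covering relations of the Bruhat order. -/
theorem permLength_mul_swap_eq_succ {w : Equiv.Perm ℕ} (hw : InSInf w) {a b : ℕ} (ha : 1 ≤ a)
    (hab : a < b) :
    permLength (w * Equiv.swap a b) = permLength w + 1 ↔ w a < w b ∧ NoBetween w a b := by
  constructor
  · intro h
    have h1 : w a < w b := by
      rcases lt_trichotomy (w a) (w b) with h1 | h1 | h1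
      · exact h1
      · have := w.injective h1
        omega
      · have := permLength_mul_swap_lt hw ha hab h1
        omega
    obtain ⟨k, hk, hk'⟩ := permLength_mul_swap hw ha hab h1
    exact ⟨h1, hk'.mp (by omega)⟩
  · rintro ⟨h1, h2⟩
    obtain ⟨k, hk, hk'⟩ := permLength_mul_swap hw ha hab h1
    rw [hk, hk'.mpr h2]

theorem permLength_swap_mul {w : Equiv.Perm ℕ} (hw : InSInf w) {k : ℕ} (hk : 1 ≤ k)
    (h : w.symm k < w.symm (k + 1)) :
    permLength (Equiv.swap k (k + 1) * w) = permLength w + 1 := by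
  have h1 : 1 ≤ w.symm k := by
    rcases Nat.eq_zero_or_pos (w.symm k) with h0 | h0
    · rw [Equiv.symm_apply_eq, hw.1] at h0
      omega
    · exact h0
  rw [swap_mul_eq_mul_swap, permLength_mul_swap_eq_succ hw h1 h]
  refine ⟨by simp, fun c _ _ => ?_⟩
  simp only [Equiv.apply_symm_apply]
  omega

theorem permLength_swap_mul_of_gt {w : Equiv.Perm ℕ} (hw : InSInf w) {k : ℕ} (hk : 1 ≤ k)
    (h : w.symm (k + 1) < w.symm k) :
    permLength (Equiv.swap k (k + 1) * w) + 1 = permLength w := by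
  have hs : InSInf (Equiv.swap k (k + 1) * w) := (inSInf_swap hk (by omega)).mul hw
  have e' : ∀ x, (Equiv.swap k (k + 1) * w).symm x = w.symm (Equiv.swap k (k + 1) x) :=
    fun x => by
      rw [Equiv.symm_apply_eq]
      simp
  have := permLength_swap_mul hs hk (by
    rw [e', e', Equiv.swap_apply_left, Equiv.swap_apply_right]
    exact h)
  rw [← mul_assoc, Equiv.swap_mul_self, one_mul] at this
  exact this.symm

theorem permLength_one : permLength 1 = 0 := by
  rw [permLength_eq_inversionNumber (N := 0) rfl (fun _ _ => rfl), inversionNumber_one]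

/-! ### Words and permutations of graphs -/

/-- The crossing `p` comes before `q` in the reading order: rows from top to bottom, every row from
right to left. -/
def ReadsBefore (p q : ℕ × ℕ) : Prop := p.1 < q.1 ∨ (q.1 = p.1 ∧ q.2 < p.2)

theorem mem_places {n : ℕ} {p : ℕ × ℕ} : p ∈ places n ↔ 1 ≤ p.1 ∧ 1 ≤ p.2 ∧ p.1 + p.2 ≤ n := by
  obtain ⟨i, j⟩ := p
  simp only [places, List.mem_flatMap, List.mem_map, List.mem_reverse, List.mem_range'_1,
    Prod.mk.injEq]
  constructor
  · rintro ⟨a, ha, b, hb, rfl, rfl⟩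
    omega
  · rintro ⟨h1, h2, h3⟩
    exact ⟨i, by omega, j, by omega, rfl, rfl⟩

theorem pairwise_places (n : ℕ) : (places n).Pairwise ReadsBefore := by
  unfold places
  rw [List.pairwise_flatMap]
  constructor
  · intro i _
    rw [List.pairwise_map, List.pairwise_reverse]
    refine List.Pairwise.imp ?_ (List.pairwise_lt_range' (s := 1) (n := n - i))
    intro a b hab
    exact Or.inr ⟨rfl, hab⟩
  · refine List.Pairwise.imp ?_ (List.pairwise_lt_range' (s := 1) (n := n - 1))
    intro a b hab p hp q hq
    simp only [List.mem_map] at hp hq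
    obtain ⟨x, -, rfl⟩ := hp
    obtain ⟨y, -, rfl⟩ := hq
    exact Or.inl hab

theorem eq_of_pairwise_readsBefore {l m : List (ℕ × ℕ)} (hl : l.Pairwise ReadsBefore)
    (hm : m.Pairwise ReadsBefore) (h : ∀ p, p ∈ l ↔ p ∈ m) : l = m := by
  have nd : ∀ {l : List (ℕ × ℕ)}, l.Pairwise ReadsBefore → l.Nodup := fun h =>
    List.Pairwise.imp (fun {a b} hab e => by subst e; unfold ReadsBefore at hab; omega) h
  refine List.Perm.eq_of_pairwise (le := ReadsBefore) ?_ hl hm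
    ((List.perm_ext_iff_of_nodup (nd hl) (nd hm)).mpr h)
  intro a b _ _ h1 h2
  unfold ReadsBefore at h1 h2
  omega

theorem graphWord_eq {R : Graph} (hR : IsGraph R) {l : List (ℕ × ℕ)}
    (hl : l.Pairwise ReadsBefore) (h : ∀ p, p ∈ l ↔ p ∈ R) :
    graphWord R = l.map fun p => p.1 + p.2 - 1 := by
  unfold graphWord
  congr 1
  refine eq_of_pairwise_readsBefore ((pairwise_places _).filter _) hl fun p => ?_
  rw [h, List.mem_filter, mem_places]
  constructor
  · rintro ⟨-, h2⟩
    simpa using h2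
  · intro hp
    exact ⟨⟨(hR p hp).1, (hR p hp).2, Finset.le_sup (f := fun p : ℕ × ℕ => p.1 + p.2) hp⟩,
      by simpa using hp⟩

theorem exists_readingList {R : Graph} (hR : IsGraph R) :
    ∃ l : List (ℕ × ℕ), l.Pairwise ReadsBefore ∧ (∀ p, p ∈ l ↔ p ∈ R) ∧ l.length = R.card := by
  refine ⟨(places (R.sup fun p => p.1 + p.2)).filter (· ∈ R), (pairwise_places _).filter _, ?_, ?_⟩
  · intro p
    rw [List.mem_filter, mem_places]
    constructor
    · rintro ⟨-, h2⟩
      simpa using h2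
    · intro hp
      exact ⟨⟨(hR p hp).1, (hR p hp).2, Finset.le_sup (f := fun p : ℕ × ℕ => p.1 + p.2) hp⟩,
        by simpa using hp⟩
  · have nd : ((places (R.sup fun p => p.1 + p.2)).filter (· ∈ R)).Nodup :=
      List.Pairwise.imp (fun {a b} hab e => by subst e; unfold ReadsBefore at hab; omega)
        ((pairwise_places _).filter _)
    rw [← List.toFinset_card_of_nodup nd]
    congr 1
    ext p
    rw [List.mem_toFinset, List.mem_filter, mem_places]
    constructor
    · rintro ⟨-, h2⟩
      simpa using h2
    · intro hp
      exact ⟨⟨(hR p hp).1, (hR p hp).2, Finset.le_sup (f := fun p : ℕ × ℕ => p.1 + p.2) hp⟩,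
        by simpa using hp⟩

theorem length_graphWord {R : Graph} (hR : IsGraph R) : (graphWord R).length = R.card := by
  obtain ⟨l, h1, h2, h3⟩ := exists_readingList hR
  rw [graphWord_eq hR h1 h2, List.length_map, h3]

theorem graphPerm_empty : graphPerm ∅ = 1 := by
  have : graphWord ∅ = [] := by
    have := graphWord_eq (R := ∅) (fun p hp => by simp at hp) (l := []) List.Pairwise.nil (by simp)
    simpa using this
  simp [graphPerm, this, wordPerm]

theorem IsGraph.mono {R S : Graph} (hS : IsGraph S) (h : R ⊆ S) : IsGraph R :=
  fun p hp => hS p (h hp)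

/-- Adding a crossing that is read before all other crossings multiplies by its letter. -/
theorem graphPerm_insert_first {R : Graph} {p : ℕ × ℕ} (hR : IsGraph (insert p R))
    (h : ∀ q ∈ R, ReadsBefore p q) :
    graphPerm (insert p R) =
      Equiv.swap (p.1 + p.2 - 1) (p.1 + p.2) * graphPerm R := by
  have hR' : IsGraph R := hR.mono (Finset.subset_insert _ _)
  have hp := hR p (Finset.mem_insert_self _ _)
  obtain ⟨l, h1, h2, -⟩ := exists_readingList hR'
  have h3 := graphWord_eq hR (l := p :: l)
    (List.pairwise_cons.mpr ⟨fun q hq => h q ((h2 q).mp hq), h1⟩) (by simp [h2])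
  unfold graphPerm
  rw [h3, graphWord_eq hR' h1 h2, List.map_cons, wordPerm_cons,
    show p.1 + p.2 - 1 + 1 = p.1 + p.2 by omega]

/-- Induction on the number of crossings, removing the first crossing in the reading order. -/
theorem graph_induction {P : Graph → Prop} (h0 : P ∅)
    (h1 : ∀ (R : Graph) (p : ℕ × ℕ), IsGraph (insert p R) → (∀ q ∈ R, ReadsBefore p q) → P R →
      P (insert p R)) {R : Graph} (hR : IsGraph R) : P R := by
  obtain ⟨l, hl, hm, -⟩ := exists_readingList hR
  induction l generalizing R with
  | nil =>
    have : R = ∅ := Finset.eq_empty_of_forall_notMem fun p hp => by simpa using (hm p).mpr hp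
    exact this ▸ h0
  | cons p l ih =>
    rw [List.pairwise_cons] at hl
    have hpl : p ∉ l := fun h => by
      have := hl.1 p h
      unfold ReadsBefore at this
      omega
    have hpR : p ∈ R := (hm p).mp (by simp)
    have hmem : ∀ q, q ∈ l ↔ q ∈ R.erase p := by
      intro q
      rw [Finset.mem_erase, ← hm q, List.mem_cons]
      constructor
      · intro h
        exact ⟨fun e => hpl (e ▸ h), Or.inr h⟩
      · rintro ⟨h1, h2 | h2⟩
        · exact absurd h2 h1
        · exact h2
    rw [← Finset.insert_erase hpR]
    refine h1 _ _ (by rwa [Finset.insert_erase hpR]) (fun q hq => hl.1 q ((hmem q).mpr hq))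
      (ih (hR.mono (Finset.erase_subset _ _)) hl.2 hmem)

theorem inSInf_graphPerm {R : Graph} (hR : IsGraph R) : InSInf (graphPerm R) := by
  refine graph_induction (P := fun R => InSInf (graphPerm R)) ?_ ?_ hR
  · rw [graphPerm_empty]
    exact inSInf_one
  · intro R p hR h ih
    have hp := hR p (Finset.mem_insert_self _ _)
    rw [graphPerm_insert_first hR h]
    exact (inSInf_swap (by omega) (by omega)).mul ih

/-- The crossings that the strands through the place `p` can have met before. -/
def earlier (R : Graph) (p : ℕ × ℕ) : Graph := R.filter fun q => p.1 < q.1 ∨ (q.1 = p.1 ∧ q.2 < p.2)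

theorem strands_eq (R : Graph) (p : ℕ × ℕ) :
    strands R p.1 p.2 = ((graphPerm (earlier R p)).symm (p.1 + p.2 - 1),
      (graphPerm (earlier R p)).symm (p.1 + p.2)) := rfl

theorem strands_congr {R S : Graph} {i j : ℕ} (h : earlier R (i, j) = earlier S (i, j)) :
    strands R i j = strands S i j := by
  have h1 := strands_eq R (i, j)
  have h2 := strands_eq S (i, j)
  rw [h] at h1
  exact h1.trans h2.symm

theorem earlier_insert_self {R : Graph} {p : ℕ × ℕ} (h : ∀ q ∈ R, ReadsBefore p q) :
    earlier (insert p R) p = R := by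
  ext q
  simp only [earlier, Finset.mem_filter, Finset.mem_insert]
  constructor
  · rintro ⟨rfl | h1, h2⟩
    · omega
    · exact h1
  · intro hq
    exact ⟨Or.inr hq, h q hq⟩

theorem earlier_insert_of_mem {R : Graph} {p q : ℕ × ℕ} (h : ∀ q ∈ R, ReadsBefore p q)
    (hq : q ∈ R) : earlier (insert p R) q = earlier R q := by
  ext x
  simp only [earlier, Finset.mem_filter, Finset.mem_insert]
  constructor
  · rintro ⟨rfl | h1, h2⟩
    · have := h q hq
      unfold ReadsBefore at this
      omega
    · exact ⟨h1, h2⟩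
  · rintro ⟨h1, h2⟩
    exact ⟨Or.inr h1, h2⟩

theorem strands_insert_first {R : Graph} {p q : ℕ × ℕ} (h : ∀ q ∈ R, ReadsBefore p q)
    (hq : q ∈ R) : strands (insert p R) q.1 q.2 = strands R q.1 q.2 :=
  strands_congr (earlier_insert_of_mem h hq)

theorem not_mem_of_readsBefore {R : Graph} {p : ℕ × ℕ} (h : ∀ q ∈ R, ReadsBefore p q) : p ∉ R := by
  intro hp
  have := h p hp
  unfold ReadsBefore at this
  omega

/-- Removing a crossing multiplies the permutation on the right by the transposition of the two
strands that intersect there. -/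
theorem graphPerm_erase {R : Graph} (hR : IsGraph R) {p : ℕ × ℕ} (hp : p ∈ R) :
    graphPerm (R.erase p) =
      graphPerm R * Equiv.swap (strands R p.1 p.2).1 (strands R p.1 p.2).2 := by
  revert hp
  refine graph_induction (P := fun R => p ∈ R → graphPerm (R.erase p) =
    graphPerm R * Equiv.swap (strands R p.1 p.2).1 (strands R p.1 p.2).2) (by simp) ?_ hR
  intro R q hR h ih hp
  have hqR := not_mem_of_readsBefore h
  rw [graphPerm_insert_first hR h]
  rcases Finset.mem_insert.mp hp with rfl | hpR
  · rw [Finset.erase_insert hqR, strands_eq, earlier_insert_self h, swap_mul_eq_mul_swap,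
      mul_assoc, Equiv.swap_mul_self, mul_one]
  · have hne : q ≠ p := fun e => hqR (e ▸ hpR)
    rw [strands_insert_first h hpR, mul_assoc, ← ih hpR, Finset.erase_insert_of_ne hne,
      graphPerm_insert_first]
    · intro x hx
      exact hR x (by
        rcases Finset.mem_insert.mp hx with rfl | hx
        · exact Finset.mem_insert_self _ _
        · exact Finset.mem_insert_of_mem (Finset.mem_of_mem_erase hx))
    · intro x hx
      exact h x (Finset.mem_of_mem_erase hx)

theorem strands_ne {R : Graph} {i j : ℕ} (h : 1 ≤ i + j) :
    (strands R i j).1 ≠ (strands R i j).2 := by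
  intro e
  have h1 := strands_eq R (i, j)
  rw [h1] at e
  have := (graphPerm (earlier R (i, j))).symm.injective e
  simp only at this
  omega

theorem isRCGraph_iff_card {R : Graph} (hR : IsGraph R) :
    IsRCGraph R ↔ permLength (graphPerm R) = R.card := by
  unfold IsRCGraph
  rw [length_graphWord hR]
  exact ⟨fun h => h.2.symm, fun h => ⟨hR, h.symm⟩⟩

theorem permLength_graphPerm_le {R : Graph} (hR : IsGraph R) :
    permLength (graphPerm R) ≤ R.card := by
  rw [← length_graphWord hR]
  refine Nat.sInf_le ⟨graphWord R, ?_, rfl, rfl⟩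
  intro i hi
  obtain ⟨l, h1, h2, -⟩ := exists_readingList hR
  rw [graphWord_eq hR h1 h2, List.mem_map] at hi
  obtain ⟨p, hp, rfl⟩ := hi
  have := hR p ((h2 p).mp hp)
  omega

/-- A graph is an rc-graph iff at each crossing the strand coming from the left has the smaller
number. -/
theorem isRCGraph_iff {R : Graph} (hR : IsGraph R) :
    IsRCGraph R ↔ ∀ p ∈ R, (strands R p.1 p.2).1 < (strands R p.1 p.2).2 := by
  rw [isRCGraph_iff_card hR]
  refine graph_induction (P := fun R => permLength (graphPerm R) = R.card ↔
    ∀ p ∈ R, (strands R p.1 p.2).1 < (strands R p.1 p.2).2) ?_ ?_ hR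
  · simp [graphPerm_empty, permLength_one]
  · intro R p hR h ih
    have hR' : IsGraph R := hR.mono (Finset.subset_insert _ _)
    have hp := hR p (Finset.mem_insert_self _ _)
    have hw := inSInf_graphPerm hR'
    have hle := permLength_graphPerm_le hR'
    have hk : p.1 + p.2 = p.1 + p.2 - 1 + 1 := by omega
    rw [Finset.card_insert_of_notMem (not_mem_of_readsBefore h), Finset.forall_mem_insert,
      graphPerm_insert_first hR h, strands_eq, earlier_insert_self h]
    have hiff : (∀ q ∈ R, (strands (insert p R) q.1 q.2).1 < (strands (insert p R) q.1 q.2).2) ↔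
        permLength (graphPerm R) = R.card := by
      rw [ih]
      exact forall₂_congr fun q hq => by rw [strands_insert_first h hq]
    rw [hiff]
    rcases lt_trichotomy ((graphPerm R).symm (p.1 + p.2 - 1)) ((graphPerm R).symm (p.1 + p.2))
      with h1 | h1 | h1
    · have := permLength_swap_mul hw (k := p.1 + p.2 - 1) (by omega) (by rwa [← hk])
      rw [← hk] at this
      simp only [h1, true_and]
      omega
    · have := (graphPerm R).symm.injective h1
      omega
    · have := permLength_swap_mul_of_gt hw (k := p.1 + p.2 - 1) (by omega) (by rwa [← hk])
      rw [← hk] at this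
      constructor
      · intro h2
        omega
      · rintro ⟨h2, -⟩
        exact absurd h2 (not_lt.mpr h1.le)

/-- In an rc-graph the strands `a < b` cross at exactly one place if `w a > w b`, and nowhere
otherwise. -/
theorem strands_crossing {R : Graph} (hR : IsRCGraph R) {a b : ℕ} (hab : a < b) :
    (graphPerm R b < graphPerm R a → ∃! p, p ∈ R ∧ strands R p.1 p.2 = (a, b)) ∧
    (graphPerm R a < graphPerm R b → ∀ p ∈ R, strands R p.1 p.2 ≠ (a, b)) := by
  have hR0 := (isRCGraph_iff hR.1).mp hR
  revert hR0
  refine graph_induction (P := fun R =>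
    (∀ p ∈ R, (strands R p.1 p.2).1 < (strands R p.1 p.2).2) →
    (graphPerm R b < graphPerm R a → ∃! p, p ∈ R ∧ strands R p.1 p.2 = (a, b)) ∧
    (graphPerm R a < graphPerm R b → ∀ p ∈ R, strands R p.1 p.2 ≠ (a, b))) ?_ ?_ hR.1
  · intro _
    simp only [graphPerm_empty, Equiv.Perm.coe_one, id]
    exact ⟨fun h => by omega, fun _ p hp => by simp at hp⟩
  · intro R p hR h ih hred
    have hp := hR p (Finset.mem_insert_self _ _)
    have hk : p.1 + p.2 = p.1 + p.2 - 1 + 1 := by omega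
    have hred' : ∀ q ∈ R, (strands R q.1 q.2).1 < (strands R q.1 q.2).2 := fun q hq => by
      have := hred q (Finset.mem_insert_of_mem hq)
      rwa [strands_insert_first h hq] at this
    obtain ⟨ih1, ih2⟩ := ih hred'
    set u := graphPerm R with hu
    rw [graphPerm_insert_first hR h, ← hu]
    have hpR := not_mem_of_readsBefore h
    have hsp : strands (insert p R) p.1 p.2 = (u.symm (p.1 + p.2 - 1), u.symm (p.1 + p.2)) := by
      rw [strands_eq, earlier_insert_self h]
    -- `a`, `b` are the strands of the first crossing `p`, or `p` does not affect their order
    by_cases hc : u a = p.1 + p.2 - 1 ∧ u b = p.1 + p.2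
    · obtain ⟨ha, hb⟩ := hc
      simp only [Equiv.Perm.mul_apply, ha, hb, Equiv.swap_apply_left, Equiv.swap_apply_right]
      refine ⟨fun _ => ⟨p, ⟨Finset.mem_insert_self _ _, ?_⟩, ?_⟩, fun h' => by omega⟩
      · rw [hsp, ← ha, ← hb]
        simp
      · rintro q ⟨hq, hqs⟩
        rcases Finset.mem_insert.mp hq with rfl | hq
        · rfl
        · rw [strands_insert_first h hq] at hqs
          exact absurd hqs (ih2 (by omega) q hq)
    · have hne : strands (insert p R) p.1 p.2 ≠ (a, b) := by
        rw [hsp]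
        intro e
        simp only [Prod.mk.injEq, Equiv.symm_apply_eq] at e
        exact hc ⟨e.1.symm, e.2.symm⟩
      have hne' : ¬ (u a = p.1 + p.2 ∧ u b = p.1 + p.2 - 1) := by
        rintro ⟨ha, hb⟩
        have := hred p (Finset.mem_insert_self _ _)
        rw [hsp, ← hb, ← ha] at this
        simp only [Equiv.symm_apply_apply] at this
        omega
      have hord : ∀ x y, ¬ (u x = p.1 + p.2 - 1 ∧ u y = p.1 + p.2) →
          ¬ (u x = p.1 + p.2 ∧ u y = p.1 + p.2 - 1) → u x < u y →
          Equiv.swap (p.1 + p.2 - 1) (p.1 + p.2) (u x) <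
            Equiv.swap (p.1 + p.2 - 1) (p.1 + p.2) (u y) := by
        intro x y h1 h2 h3
        simp only [Equiv.swap_apply_def]
        split_ifs <;> omega
      have hmem : ∀ q, (q ∈ insert p R ∧ strands (insert p R) q.1 q.2 = (a, b)) ↔
          (q ∈ R ∧ strands R q.1 q.2 = (a, b)) := by
        intro q
        constructor
        · rintro ⟨hq, hqs⟩
          rcases Finset.mem_insert.mp hq with rfl | hq
          · exact absurd hqs hne
          · rw [strands_insert_first h hq] at hqs
            exact ⟨hq, hqs⟩
        · rintro ⟨hq, hqs⟩
          rw [← strands_insert_first h hq] at hqs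
          exact ⟨Finset.mem_insert_of_mem hq, hqs⟩
      have hab' : u a ≠ u b := fun e => by have := u.injective e; omega
      simp only [hmem, Equiv.Perm.mul_apply]
      constructor
      · intro h'
        refine ih1 ?_
        by_contra h''
        have := hord a b hc hne' (by omega)
        omega
      · intro h' q hq hqs
        have hlt : u a < u b := by
          by_contra h''
          have := hord b a (fun e => hne' ⟨e.2, e.1⟩) (fun e => hc ⟨e.2, e.1⟩) (by omega)
          omega
        rcases Finset.mem_insert.mp hq with rfl | hq
        · exact hne hqs
        · rw [strands_insert_first h hq] at hqs
          exact ih2 hlt q hq hqs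

/-- The unique crossing of two strands of an rc-graph that have changed their order. -/
theorem existsUnique_crossAt {R : Graph} (hR : IsRCGraph R) {a b : ℕ} (hab : a < b)
    (h : graphPerm R b < graphPerm R a) : ∃! p, CrossAt R a b p := by
  obtain ⟨p, ⟨hp, hps⟩, huniq⟩ := (strands_crossing hR hab).1 h
  refine ⟨p, ⟨hp, Or.inl hps⟩, ?_⟩
  rintro q ⟨hq, hqs | hqs⟩
  · exact huniq q ⟨hq, hqs⟩
  · have := (isRCGraph_iff hR.1).mp hR q hq
    rw [hqs] at this
    simp only at this
    omega

theorem crossAt_iff {R : Graph} (hR : IsRCGraph R) {a b : ℕ} (hab : a < b) {p : ℕ × ℕ} :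
    CrossAt R a b p ↔ p ∈ R ∧ strands R p.1 p.2 = (a, b) := by
  constructor
  · rintro ⟨hq, hqs | hqs⟩
    · exact ⟨hq, hqs⟩
    · have := (isRCGraph_iff hR.1).mp hR p hq
      rw [hqs] at this
      simp only at this
      omega
  · rintro ⟨hq, hqs⟩
    exact ⟨hq, Or.inl hqs⟩

theorem swap_eq_swap_iff {a b c d : ℕ} (hcd : c ≠ d) :
    Equiv.swap c d = Equiv.swap a b ↔ (c, d) = (a, b) ∨ (c, d) = (b, a) := by
  constructor
  · intro h
    have h1 : Equiv.swap a b c = d := by rw [← h, Equiv.swap_apply_left]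
    rw [Equiv.swap_apply_def] at h1
    simp only [Prod.mk.injEq]
    split_ifs at h1 <;> omega
  · rintro (h | h) <;> simp only [Prod.mk.injEq] at h <;> obtain ⟨rfl, rfl⟩ := h
    · rfl
    · exact Equiv.swap_comm _ _

theorem crossAt_iff_graphPerm_erase {R : Graph} (hR : IsGraph R) {a b : ℕ} {p : ℕ × ℕ}
    (hp : p ∈ R) :
    CrossAt R a b p ↔ graphPerm (R.erase p) = graphPerm R * Equiv.swap a b := by
  have := hR p hp
  rw [RCInsertion.graphPerm_erase hR hp, mul_right_inj, swap_eq_swap_iff (strands_ne (by omega))]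
  simp [CrossAt, hp]

theorem IsRCGraph.erase_of_permLength {R : Graph} (hR : IsRCGraph R) {p : ℕ × ℕ} (hp : p ∈ R)
    (h : permLength (graphPerm (R.erase p)) + 1 = permLength (graphPerm R)) :
    IsRCGraph (R.erase p) := by
  have h1 : IsGraph (R.erase p) := hR.1.mono (Finset.erase_subset _ _)
  rw [isRCGraph_iff_card h1, Finset.card_erase_of_mem hp, ← (isRCGraph_iff_card hR.1).mp hR]
  omega

/-! ### The strands that pass a row -/

/-- The strand that enters column `j` of a row from the left, if `z j` enters it from below and `A`
is the set of columns with a crossing.  Column `0` stands for the start of the row, `z 0` is the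
strand that starts there. -/
def carry (z : ℕ → ℕ) (A : Finset ℕ) : ℕ → ℕ
  | 0 => z 0
  | j + 1 => if j ∈ A then carry z A j else z j

/-- The strand that leaves the row in column `j`. -/
def exitStrand (z : ℕ → ℕ) (A : Finset ℕ) (j : ℕ) : ℕ := if j ∈ A then z j else carry z A j

section carry

variable {z : ℕ → ℕ} {A : Finset ℕ}

theorem carry_succ_of_mem {j : ℕ} (h : j ∈ A) : carry z A (j + 1) = carry z A j := by
  simp [carry, h]

theorem carry_succ_of_notMem {j : ℕ} (h : j ∉ A) : carry z A (j + 1) = z j := by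
  simp [carry, h]

theorem carry_run {i j : ℕ} (hij : i ≤ j) (h : ∀ k, i ≤ k → k < j → k ∈ A) :
    carry z A j = carry z A i := by
  induction j, hij using Nat.le_induction with
  | base => rfl
  | succ j hj ih =>
    rw [carry_succ_of_mem (h j hj (by omega)), ih fun k h1 h2 => h k h1 (by omega)]

theorem carry_eq_of_run {i j : ℕ} (hij : i < j) (hi : i ∉ A) (h : ∀ k, i < k → k < j → k ∈ A) :
    carry z A j = z i := by
  rw [carry_run (i := i + 1) hij (fun k h1 h2 => h k (by omega) h2), carry_succ_of_notMem hi]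

theorem exists_carry_eq (h0 : 0 ∉ A) {j : ℕ} (hj : 1 ≤ j) :
    ∃ i < j, i ∉ A ∧ carry z A j = z i ∧ ∀ k, i < k → k < j → k ∈ A := by
  induction j, hj using Nat.le_induction with
  | base => exact ⟨0, by omega, h0, carry_succ_of_notMem h0, fun k h1 h2 => by omega⟩
  | succ j hj ih =>
    by_cases h : j ∈ A
    · obtain ⟨i, h1, h2, h3, h4⟩ := ih
      refine ⟨i, by omega, h2, by rw [carry_succ_of_mem h, h3], fun k h5 h6 => ?_⟩
      rcases Nat.lt_succ_iff_lt_or_eq.mp h6 with h7 | rfl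
      · exact h4 k h5 h7
      · exact h
    · exact ⟨j, by omega, h, carry_succ_of_notMem h, fun k h1 h2 => by omega⟩

theorem carry_eq_iff (hz : z.Injective) (h0 : 0 ∉ A) {i j : ℕ} (hj : 1 ≤ j) :
    carry z A j = z i ↔ i < j ∧ i ∉ A ∧ ∀ k, i < k → k < j → k ∈ A := by
  constructor
  · intro h
    obtain ⟨i', h1, h2, h3, h4⟩ := exists_carry_eq (z := z) h0 hj
    rw [h3] at h
    obtain rfl := hz h
    exact ⟨h1, h2, h4⟩
  · rintro ⟨h1, h2, h3⟩
    exact carry_eq_of_run h1 h2 h3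

theorem carry_ne (hz : z.Injective) (h0 : 0 ∉ A) {i j : ℕ} (hj : 1 ≤ j) (hij : j ≤ i) :
    carry z A j ≠ z i := by
  intro h
  have := ((carry_eq_iff hz h0 hj).mp h).1
  omega

theorem carry_congr {z' : ℕ → ℕ} {A' : Finset ℕ} {j : ℕ} (hj : 1 ≤ j)
    (h : ∀ i < j, z i = z' i ∧ (i ∈ A ↔ i ∈ A')) : carry z A j = carry z' A' j := by
  induction j, hj using Nat.le_induction with
  | base =>
    have := h 0 (by omega)
    simp [carry, this.1]
  | succ j hj ih =>
    have h1 := h j (by omega)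
    have h2 := ih fun i hi => h i (by omega)
    simp [carry, h1.1, h1.2, h2]

theorem carry_comp (f : ℕ → ℕ) (j : ℕ) : carry (f ∘ z) A j = f (carry z A j) := by
  induction j with
  | zero => rfl
  | succ j ih =>
    simp only [carry, ih]
    split_ifs <;> rfl

theorem carry_insert_of_le {j k : ℕ} (hk : k ≤ j) :
    carry z (insert j A) k = carry z A k := by
  rcases Nat.eq_zero_or_pos k with rfl | h
  · rfl
  · refine carry_congr h fun i hi => ⟨rfl, ?_⟩
    have : i ≠ j := by omega
    simp [this]

theorem carry_insert_of_lt (hz : z.Injective) (h0 : 0 ∉ A) {j k : ℕ} (hj : 1 ≤ j) (hjA : j ∉ A)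
    (hk : j < k) :
    carry z (insert j A) k = Equiv.swap (carry z A j) (z j) (carry z A k) := by
  induction k, hk using Nat.le_induction with
  | base =>
    rw [carry_succ_of_mem (Finset.mem_insert_self _ _), carry_succ_of_notMem hjA,
      Equiv.swap_apply_right, carry_insert_of_le le_rfl]
  | succ k hk ih =>
    have hkj : k ≠ j := by omega
    by_cases h : k ∈ A
    · rw [carry_succ_of_mem (Finset.mem_insert_of_mem h), ih, carry_succ_of_mem h]
    · rw [carry_succ_of_notMem (by simp [h, hkj]), carry_succ_of_notMem h,
        Equiv.swap_apply_of_ne_of_ne (carry_ne hz h0 hj (by omega)).symm (hz.ne hkj)]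

theorem carry_erase_of_le {j k : ℕ} (hk : k ≤ j) : carry z (A.erase j) k = carry z A k := by
  rcases Nat.eq_zero_or_pos k with rfl | h
  · rfl
  · refine carry_congr h fun i hi => ⟨rfl, ?_⟩
    have : i ≠ j := by omega
    simp [this]

theorem carry_erase_of_lt (hz : z.Injective) (h0 : 0 ∉ A) {j k : ℕ} (hj : 1 ≤ j) (hjA : j ∈ A)
    (hk : j < k) :
    carry z (A.erase j) k = Equiv.swap (carry z A j) (z j) (carry z A k) := by
  have := carry_insert_of_lt (z := z) (A := A.erase j) hz (fun h => h0 (Finset.mem_of_mem_erase h))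
    hj (Finset.notMem_erase j A) hk
  rw [Finset.insert_erase hjA, carry_erase_of_le le_rfl] at this
  rw [this, Equiv.swap_apply_self]

/-- A carried strand with `p` is followed by one without `p` only after a non-crossing where the
former turns up and a strand without `p` turns right. -/
theorem exists_transition (p : ℕ → Prop) {i j : ℕ} (hij : i ≤ j) (hi : p (carry z A i))
    (hj : ¬ p (carry z A j)) : ∃ k, i ≤ k ∧ k < j ∧ k ∉ A ∧ p (carry z A k) ∧ ¬ p (z k) := by
  induction j, hij using Nat.le_induction with
  | base => exact absurd hi hj
  | succ j hij ih =>
    by_cases h : p (carry z A j)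
    · by_cases hjA : j ∈ A
      · rw [carry_succ_of_mem hjA] at hj
        exact absurd h hj
      · rw [carry_succ_of_notMem hjA] at hj
        exact ⟨j, hij, by omega, hjA, h, hj⟩
    · obtain ⟨k, h1, h2, h3⟩ := ih h
      exact ⟨k, h1, by omega, h3⟩

/-- The next non-crossing after column `i`. -/
theorem exists_next_notMem (A : Finset ℕ) (i : ℕ) :
    ∃ m, i < m ∧ m ∉ A ∧ ∀ k, i < k → k < m → k ∈ A := by
  have hex : ∃ m, i < m ∧ m ∉ A := by
    refine ⟨i + A.sup id + 1, by omega, fun h => ?_⟩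
    have := Finset.le_sup (f := id) h
    simp only [id] at this
    omega
  classical
  refine ⟨Nat.find hex, (Nat.find_spec hex).1, (Nat.find_spec hex).2, fun k h1 h2 => ?_⟩
  have := Nat.find_min hex h2
  tauto

end carry

/-! ### Graphs with a distinguished top row -/

/-- The graph with crossings in the columns `A` of row `l`. -/
def rowGraph (l : ℕ) (A : Finset ℕ) : Graph := A.image fun j => (l, j)

/-- The columns of the crossings in row `l`. -/
def rowCols (G : Graph) (l : ℕ) : Finset ℕ := (rowOnly G l).image Prod.snd

theorem mem_rowGraph {l : ℕ} {A : Finset ℕ} {p : ℕ × ℕ} : p ∈ rowGraph l A ↔ p.1 = l ∧ p.2 ∈ A := by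
  obtain ⟨i, j⟩ := p
  simp only [rowGraph, Finset.mem_image, Prod.mk.injEq]
  constructor
  · rintro ⟨x, hx, rfl, rfl⟩
    exact ⟨rfl, hx⟩
  · rintro ⟨rfl, h⟩
    exact ⟨j, h, rfl, rfl⟩

theorem mem_rowCols {l : ℕ} {G : Graph} {j : ℕ} : j ∈ rowCols G l ↔ (l, j) ∈ G := by
  simp only [rowCols, rowOnly, Finset.mem_image, Finset.mem_filter, Prod.exists]
  constructor
  · rintro ⟨a, b, ⟨h1, rfl⟩, rfl⟩
    exact h1
  · intro h
    exact ⟨l, j, ⟨h, rfl⟩, rfl⟩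

/-- The strands in the columns of row `l` below this row, when `L` consists of the lower rows. -/
def below (L : Graph) (l : ℕ) (j : ℕ) : ℕ := (graphPerm L).symm (l + j)

theorem below_injective (L : Graph) (l : ℕ) : (below L l).Injective := fun i j h => by
  have := (graphPerm L).symm.injective h
  omega

theorem isGraph_rowUnion {L : Graph} {l : ℕ} {A : Finset ℕ} (hl : 1 ≤ l) (hL : IsGraph L)
    (hA : 0 ∉ A) : IsGraph (L ∪ rowGraph l A) := by
  intro p hp
  rcases Finset.mem_union.mp hp with hp | hp
  · exact hL p hp
  · rw [mem_rowGraph] at hp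
    refine ⟨by omega, Nat.one_le_iff_ne_zero.mpr fun h => hA (h ▸ hp.2)⟩

section row

variable {L : Graph} {l : ℕ} {A : Finset ℕ}

theorem notMem_lower (hrows : ∀ p ∈ L, l < p.1) (j : ℕ) : (l, j) ∉ L := fun h => by
  have := hrows _ h
  simp at this

theorem mem_rowUnion (hrows : ∀ p ∈ L, l < p.1) {j : ℕ} : (l, j) ∈ L ∪ rowGraph l A ↔ j ∈ A := by
  simp [mem_rowGraph, notMem_lower hrows]

theorem graphPerm_fix (hl : IsGraph L) (hrows : ∀ p ∈ L, l < p.1) {m : ℕ} (hm : m ≤ l) :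
    graphPerm L m = m := by
  revert hrows
  refine graph_induction (P := fun L => (∀ p ∈ L, l < p.1) → graphPerm L m = m) ?_ ?_ hl
  · simp [graphPerm_empty]
  · intro R p hR h ih hrows
    have h1 := hrows p (Finset.mem_insert_self _ _)
    have h2 := hR p (Finset.mem_insert_self _ _)
    rw [graphPerm_insert_first hR h, Equiv.Perm.mul_apply,
      ih fun q hq => hrows q (Finset.mem_insert_of_mem hq),
      Equiv.swap_apply_of_ne_of_ne (by omega) (by omega)]

theorem below_zero (hl : IsGraph L) (hrows : ∀ p ∈ L, l < p.1) : below L l 0 = l := by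
  rw [below, Equiv.symm_apply_eq, add_zero, graphPerm_fix hl hrows le_rfl]

theorem below_gt (hl : IsGraph L) (hrows : ∀ p ∈ L, l < p.1) {j : ℕ} (hj : 1 ≤ j) :
    l < below L l j := by
  by_contra h
  have h1 := graphPerm_fix hl hrows (not_lt.mp h)
  rw [below, Equiv.apply_symm_apply] at h1
  unfold below at h
  omega

theorem exists_below_bound (hl : IsGraph L) (l : ℕ) : ∃ N, ∀ j, N ≤ j → below L l j = l + j := by
  obtain ⟨N, hN⟩ := (inSInf_graphPerm hl).exists_bound
  refine ⟨N, fun j hj => ?_⟩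
  rw [below, Equiv.symm_apply_eq, hN _ (by omega)]

theorem symm_swap_mul (u : Equiv.Perm ℕ) (i j m : ℕ) :
    (Equiv.swap i j * u).symm m = u.symm (Equiv.swap i j m) := by
  rw [Equiv.symm_apply_eq]
  simp

theorem rowGraph_filter_succ (j : ℕ) : rowGraph l (A.filter (· < j + 1)) =
    if j ∈ A then insert (l, j) (rowGraph l (A.filter (· < j))) else
      rowGraph l (A.filter (· < j)) := by
  ext ⟨a, b⟩
  split_ifs with h
  · simp only [mem_rowGraph, Finset.mem_filter, Finset.mem_insert, Prod.mk.injEq]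
    constructor
    · rintro ⟨rfl, h1, h2⟩
      rcases Nat.lt_succ_iff_lt_or_eq.mp h2 with h3 | rfl
      · exact Or.inr ⟨rfl, h1, h3⟩
      · exact Or.inl ⟨rfl, rfl⟩
    · rintro (⟨rfl, rfl⟩ | ⟨rfl, h1, h2⟩)
      · exact ⟨rfl, h, by omega⟩
      · exact ⟨rfl, h1, by omega⟩
  · simp only [mem_rowGraph, Finset.mem_filter]
    constructor
    · rintro ⟨rfl, h1, h2⟩
      refine ⟨rfl, h1, ?_⟩
      rcases Nat.lt_succ_iff_lt_or_eq.mp h2 with h3 | rfl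
      · exact h3
      · exact absurd h1 h
    · rintro ⟨rfl, h1, h2⟩
      exact ⟨rfl, h1, by omega⟩

/-- The strands after the crossings in columns `< j` of row `l`. -/
theorem graphPerm_partialRow (hl : 1 ≤ l) (hL : IsGraph L) (hrows : ∀ p ∈ L, l < p.1) (hA : 0 ∉ A)
    {j : ℕ} (hj : 1 ≤ j) :
    (graphPerm (L ∪ rowGraph l (A.filter (· < j)))).symm (l + j - 1) = carry (below L l) A j ∧
    (∀ m, l + j ≤ m ∨ m < l → (graphPerm (L ∪ rowGraph l (A.filter (· < j)))).symm m =
      (graphPerm L).symm m) ∧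
    ∀ i, 1 ≤ i → i < j → (graphPerm (L ∪ rowGraph l (A.filter (· < j)))).symm (l + i - 1) =
      exitStrand (below L l) A i := by
  induction j, hj using Nat.le_induction with
  | base =>
    have : A.filter (· < 1) = ∅ := by
      ext x
      simp only [Finset.mem_filter, Finset.notMem_empty, iff_false, not_and]
      intro h1 h2
      have : x = 0 := by omega
      exact hA (this ▸ h1)
    rw [this]
    have : rowGraph l ∅ = ∅ := rfl
    rw [this, Finset.union_empty]
    refine ⟨?_, fun _ _ => rfl, fun i h1 h2 => by omega⟩
    rw [show (1 : ℕ) = 0 + 1 from rfl, carry_succ_of_notMem hA]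
    rfl
  | succ j hj ih =>
    obtain ⟨ih1, ih2, ih3⟩ := ih
    by_cases h : j ∈ A
    · have e1 : L ∪ rowGraph l (A.filter (· < j + 1)) =
          insert (l, j) (L ∪ rowGraph l (A.filter (· < j))) := by
        rw [rowGraph_filter_succ, if_pos h, Finset.union_insert]
      have e2 : graphPerm (L ∪ rowGraph l (A.filter (· < j + 1))) =
          Equiv.swap (l + j - 1) (l + j) * graphPerm (L ∪ rowGraph l (A.filter (· < j))) := by
        rw [e1]
        refine graphPerm_insert_first (p := (l, j)) ?_ ?_
        · rw [← e1]
          exact isGraph_rowUnion hl hL fun h => hA (Finset.mem_filter.mp h).1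
        · intro q hq
          rcases Finset.mem_union.mp hq with hq | hq
          · exact Or.inl (hrows q hq)
          · rw [mem_rowGraph, Finset.mem_filter] at hq
            exact Or.inr ⟨hq.1, hq.2.2⟩
      simp only [e2, symm_swap_mul]
      refine ⟨?_, ?_, ?_⟩
      · rw [show l + (j + 1) - 1 = l + j by omega, Equiv.swap_apply_right, ih1,
          carry_succ_of_mem h]
      · intro m hm
        rw [Equiv.swap_apply_of_ne_of_ne (by omega) (by omega), ih2 m (by omega)]
      · intro i h1 h2
        rcases Nat.lt_succ_iff_lt_or_eq.mp h2 with h3 | rfl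
        · rw [Equiv.swap_apply_of_ne_of_ne (by omega) (by omega), ih3 i h1 h3]
        · rw [Equiv.swap_apply_left, ih2 _ (by omega), exitStrand, if_pos h, below]
    · rw [rowGraph_filter_succ, if_neg h]
      refine ⟨?_, ?_, ?_⟩
      · rw [show l + (j + 1) - 1 = l + j by omega, ih2 _ (by omega), carry_succ_of_notMem h, below]
      · intro m hm
        exact ih2 m (by omega)
      · intro i h1 h2
        rcases Nat.lt_succ_iff_lt_or_eq.mp h2 with h3 | rfl
        · exact ih3 i h1 h3
        · rw [ih1, exitStrand, if_neg h]

theorem strands_row (hl : 1 ≤ l) (hL : IsGraph L) (hrows : ∀ p ∈ L, l < p.1) (hA : 0 ∉ A)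
    {j : ℕ} (hj : 1 ≤ j) :
    strands (L ∪ rowGraph l A) l j = (carry (below L l) A j, below L l j) := by
  have e : earlier (L ∪ rowGraph l A) (l, j) = L ∪ rowGraph l (A.filter (· < j)) := by
    ext p
    simp only [earlier, Finset.mem_filter, Finset.mem_union, mem_rowGraph]
    constructor
    · rintro ⟨h1 | h1, h2⟩
      · exact Or.inl h1
      · exact Or.inr ⟨h1.1, h1.2, by omega⟩
    · rintro (h1 | h1)
      · exact ⟨Or.inl h1, Or.inl (hrows p h1)⟩
      · exact ⟨Or.inr ⟨h1.1, h1.2.1⟩, Or.inr ⟨h1.1, h1.2.2⟩⟩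
  have h1 := strands_eq (L ∪ rowGraph l A) (l, j)
  rw [e] at h1
  obtain ⟨h2, h3, -⟩ := graphPerm_partialRow hl hL hrows hA hj
  rw [h2, h3 _ (by simp)] at h1
  exact h1

theorem exists_filter_eq (A : Finset ℕ) (j : ℕ) : ∃ N, j < N ∧ A.filter (· < N) = A := by
  refine ⟨j + A.sup id + 1, by omega, Finset.filter_true_of_mem fun x hx => ?_⟩
  have := Finset.le_sup (f := id) hx
  simp only [id] at this
  omega

/-- The strand in position `l + j - 1` above row `l`. -/
theorem graphPerm_rowUnion_symm (hl : 1 ≤ l) (hL : IsGraph L) (hrows : ∀ p ∈ L, l < p.1)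
    (hA : 0 ∉ A) {j : ℕ} (hj : 1 ≤ j) :
    (graphPerm (L ∪ rowGraph l A)).symm (l + j - 1) = exitStrand (below L l) A j := by
  obtain ⟨N, h1, h2⟩ := exists_filter_eq A j
  have := (graphPerm_partialRow hl hL hrows hA (j := N) (by omega)).2.2 j hj h1
  rwa [h2] at this

theorem strands_lower {i : ℕ} (hi : l < i) (j : ℕ) :
    strands (L ∪ rowGraph l A) i j = strands L i j := by
  refine strands_congr ?_
  ext p
  simp only [earlier, Finset.mem_filter, Finset.mem_union, mem_rowGraph]
  constructor
  · rintro ⟨h1 | h1, h2⟩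
    · exact ⟨h1, h2⟩
    · omega
  · rintro ⟨h1, h2⟩
    exact ⟨Or.inl h1, h2⟩

theorem isRCGraph_rowUnion (hl : 1 ≤ l) (hL : IsGraph L) (hrows : ∀ p ∈ L, l < p.1) (hA : 0 ∉ A) :
    IsRCGraph (L ∪ rowGraph l A) ↔
      IsRCGraph L ∧ ∀ j ∈ A, carry (below L l) A j < below L l j := by
  rw [isRCGraph_iff (isGraph_rowUnion hl hL hA), isRCGraph_iff hL]
  constructor
  · intro h
    constructor
    · intro p hp
      have := h p (Finset.mem_union_left _ hp)
      rwa [strands_lower (hrows p hp)] at this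
    · intro j hj
      have hj1 : 1 ≤ j := Nat.one_le_iff_ne_zero.mpr fun e => hA (e ▸ hj)
      have := h (l, j) (Finset.mem_union_right _ (mem_rowGraph.mpr ⟨rfl, hj⟩))
      simp only at this
      rwa [strands_row hl hL hrows hA hj1] at this
  · rintro ⟨h1, h2⟩ ⟨i, j⟩ hp
    rcases Finset.mem_union.mp hp with hp | hp
    · rw [strands_lower (hrows _ hp)]
      exact h1 _ hp
    · rw [mem_rowGraph] at hp
      obtain ⟨rfl, hj⟩ := hp
      have hj1 : 1 ≤ j := Nat.one_le_iff_ne_zero.mpr fun e => hA (e ▸ hj)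
      simp only
      rw [strands_row hl hL hrows hA hj1]
      exact h2 j hj

theorem card_rowUnion (hrows : ∀ p ∈ L, l < p.1) : (L ∪ rowGraph l A).card = L.card + A.card := by
  rw [Finset.card_union_of_disjoint, rowGraph, Finset.card_image_of_injective]
  · intro a b h
    simpa using h
  · rw [Finset.disjoint_left]
    intro p hp hp'
    have := hrows p hp
    rw [mem_rowGraph] at hp'
    omega

/-- A crossing in row `l` contributes a transposition on the right. -/
theorem graphPerm_rowUnion_insert (hl : 1 ≤ l) (hL : IsGraph L) (hrows : ∀ p ∈ L, l < p.1)
    (hA : 0 ∉ A) {j : ℕ} (hj : 1 ≤ j) (hjA : j ∉ A) :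
    graphPerm (L ∪ rowGraph l (insert j A)) =
      graphPerm (L ∪ rowGraph l A) * Equiv.swap (carry (below L l) A j) (below L l j) := by
  have hA' : 0 ∉ insert j A := by
    rw [Finset.mem_insert, not_or]
    exact ⟨by omega, hA⟩
  have hmem : (l, j) ∈ L ∪ rowGraph l (insert j A) :=
    Finset.mem_union_right _ (mem_rowGraph.mpr ⟨rfl, Finset.mem_insert_self _ _⟩)
  have h1 := graphPerm_erase (isGraph_rowUnion hl hL hA') hmem
  have h2 : (L ∪ rowGraph l (insert j A)).erase (l, j) = L ∪ rowGraph l A := by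
    have e : rowGraph l (insert j A) = insert (l, j) (rowGraph l A) := Finset.image_insert _ _ _
    rw [e, Finset.union_insert, Finset.erase_insert]
    rw [mem_rowUnion hrows]
    exact hjA
  rw [h2] at h1
  simp only at h1
  rw [strands_row hl hL hrows hA' hj, carry_insert_of_le le_rfl] at h1
  rw [h1, mul_assoc, Equiv.swap_mul_self, mul_one]

/-- Multiplying the lower part by a transposition of strands on the right. -/
theorem below_mul_swap {L' : Graph} {a b : ℕ} (h : graphPerm L' = graphPerm L * Equiv.swap a b) :
    below L' l = Equiv.swap a b ∘ below L l := by
  funext j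
  simp only [below, h, Function.comp]
  rw [Equiv.symm_apply_eq]
  simp

end row

theorem rowsGE_isGraph {R : Graph} (hR : IsGraph R) (l : ℕ) : IsGraph (rowsGE R l) :=
  hR.mono (Finset.filter_subset _ _)

theorem rowsGE_succ_rows (R : Graph) (l : ℕ) : ∀ p ∈ rowsGE R (l + 1), l < p.1 := fun p hp => by
  have := (Finset.mem_filter.mp hp).2
  omega

theorem rowsGE_eq_union (R : Graph) (l : ℕ) :
    rowsGE R l = rowsGE R (l + 1) ∪ rowGraph l (rowCols R l) := by
  ext ⟨i, j⟩
  simp only [rowsGE, Finset.mem_filter, Finset.mem_union, mem_rowGraph, mem_rowCols]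
  constructor
  · rintro ⟨h1, h2⟩
    rcases Nat.eq_or_lt_of_le h2 with rfl | h3
    · exact Or.inr ⟨rfl, h1⟩
    · exact Or.inl ⟨h1, h3⟩
  · rintro (⟨h1, h2⟩ | ⟨rfl, h2⟩)
    · exact ⟨h1, by omega⟩
    · exact ⟨h2, le_rfl⟩

theorem zero_notMem_rowCols {R : Graph} (hR : IsGraph R) (l : ℕ) : 0 ∉ rowCols R l := fun h => by
  have := (hR _ (mem_rowCols.mp h)).2
  simp at this

/-! ### Products of transpositions -/

/-- The product of a list of transpositions. -/
def transProd (T : List (ℕ × ℕ)) : Equiv.Perm ℕ := (T.map fun t => Equiv.swap t.1 t.2).prod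

theorem transProd_snoc (T : List (ℕ × ℕ)) (a b : ℕ) :
    transProd (T ++ [(a, b)]) = transProd T * Equiv.swap a b := by
  simp [transProd]

theorem swap_mul_swap_exchange {e g d : ℕ} (h2 : e ≠ d) (h3 : g ≠ d) :
    Equiv.swap e g * Equiv.swap g d = Equiv.swap e d * Equiv.swap e g := by
  rw [swap_mul_eq_mul_swap (Equiv.swap e g) e d]
  simp only [Equiv.symm_swap, Equiv.swap_apply_left, Equiv.swap_apply_of_ne_of_ne h2.symm h3.symm]

theorem graphPerm_rowUnion {L : Graph} {l : ℕ} {A : Finset ℕ} (hl : 1 ≤ l) (hL : IsGraph L)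
    (hrows : ∀ p ∈ L, l < p.1) (hA : 0 ∉ A) :
    graphPerm (L ∪ rowGraph l A) = graphPerm (rowGraph l A) * graphPerm L := by
  induction A using Finset.induction_on_max with
  | empty =>
    have : rowGraph l ∅ = ∅ := rfl
    rw [this, Finset.union_empty, graphPerm_empty, one_mul]
  | insert j A hj ih =>
    have hA' : 0 ∉ A := fun h => hA (Finset.mem_insert_of_mem h)
    have e : rowGraph l (insert j A) = insert (l, j) (rowGraph l A) := Finset.image_insert _ _ _
    have hrow : ∀ q ∈ rowGraph l A, ReadsBefore (l, j) q := fun q hq => by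
      rw [mem_rowGraph] at hq
      exact Or.inr ⟨hq.1, hj _ hq.2⟩
    have h1 : IsGraph (L ∪ rowGraph l (insert j A)) := isGraph_rowUnion hl hL hA
    have h2 : IsGraph (rowGraph l (insert j A)) := h1.mono Finset.subset_union_right
    rw [e] at h1 h2 ⊢
    rw [Finset.union_insert] at h1 ⊢
    rw [graphPerm_insert_first h1, graphPerm_insert_first h2 hrow, ih hA', mul_assoc]
    intro q hq
    rcases Finset.mem_union.mp hq with hq | hq
    · exact Or.inl (hrows q hq)
    · exact hrow q hq

/-! ### Configurations of a row -/

/-- The data within row `l` of the algorithm: the graph below the row, the columns of the crossings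
in the row, and the word of the tableau. -/
structure Config where
  lower : Graph
  cols : Finset ℕ
  word : List (ℕ × ℕ)

/-- The graph of a configuration of row `l`. -/
def Config.graph (l : ℕ) (s : Config) : Graph := s.lower ∪ rowGraph l s.cols

/-- The lengths grow by one along the word `T`, starting from `w`. -/
def IsChain (w : Equiv.Perm ℕ) (T : List (ℕ × ℕ)) : Prop :=
  ∀ i ≤ T.length, permLength (w * transProd (T.take i)) = permLength w + i

theorem IsChain.snoc {w : Equiv.Perm ℕ} {T : List (ℕ × ℕ)} {t : ℕ × ℕ} (h : IsChain w T)
    (h' : permLength (w * transProd (T ++ [t])) = permLength w + (T.length + 1)) :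
    IsChain w (T ++ [t]) := by
  intro i hi
  rw [List.length_append, List.length_singleton] at hi
  rcases Nat.lt_or_ge i (T.length + 1) with h1 | h1
  · rw [List.take_append_of_le_length (by omega)]
    exact h i (by omega)
  · obtain rfl : i = T.length + 1 := by omega
    rw [List.take_of_length_le (by simp), h']

theorem IsChain.of_append {w : Equiv.Perm ℕ} {T T' : List (ℕ × ℕ)} (h : IsChain w (T ++ T')) :
    IsChain w T := by
  intro i hi
  have := h i (by simp; omega)
  rwa [List.take_append_of_le_length hi] at this

theorem IsChain.length {w : Equiv.Perm ℕ} {T : List (ℕ × ℕ)} (h : IsChain w T) :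
    permLength (w * transProd T) = permLength w + T.length := by
  have := h T.length le_rfl
  rwa [List.take_length] at this

/-- The crossings are reduced: at each one the carried strand has the smaller number. -/
def RowReduced (z : ℕ → ℕ) (A : Finset ℕ) : Prop := ∀ j ∈ A, carry z A j < z j

/-- A configuration of row `l` whose graph and word form an `r`-Bruhat package of `w`. -/
structure Config.Valid (r l : ℕ) (w : Equiv.Perm ℕ) (s : Config) : Prop where
  rc : IsRCGraph s.lower
  rows : ∀ p ∈ s.lower, l < p.1
  zero : 0 ∉ s.cols
  reduced : RowReduced (below s.lower l) s.cols
  range : ∀ t ∈ s.word, 1 ≤ t.1 ∧ t.1 ≤ r ∧ r < t.2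
  perm : w * transProd s.word = graphPerm (s.graph l)
  chain : IsChain w s.word

section valid

variable {r l : ℕ} {w : Equiv.Perm ℕ} {s : Config}

theorem Config.Valid.isRC (hs : s.Valid r l w) (hl : 1 ≤ l) : IsRCGraph (s.graph l) :=
  (isRCGraph_rowUnion hl hs.rc.1 hs.rows hs.zero).mpr ⟨hs.rc, hs.reduced⟩

theorem Config.Valid.card (hs : s.Valid r l w) (hl : 1 ≤ l) :
    s.lower.card + s.cols.card = permLength w + s.word.length := by
  have h := hs.isRC hl
  have h1 := (isRCGraph_iff_card h.1).mp h
  rw [← hs.perm, hs.chain.length, Config.graph, card_rowUnion hs.rows] at h1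
  exact h1.symm

theorem exitStrand_injOn {L : Graph} {A : Finset ℕ} (hl : 1 ≤ l) (hL : IsGraph L)
    (hrows : ∀ p ∈ L, l < p.1) (hA : 0 ∉ A) {i j : ℕ} (hi : 1 ≤ i) (hj : 1 ≤ j)
    (h : exitStrand (below L l) A i = exitStrand (below L l) A j) : i = j := by
  rw [← graphPerm_rowUnion_symm hl hL hrows hA hi, ← graphPerm_rowUnion_symm hl hL hrows hA hj] at h
  have := (graphPerm (L ∪ rowGraph l A)).symm.injective h
  omega

/-- Where the strands of the last transposition of the word leave the row. -/
theorem Config.Valid.lastCover (hs : s.Valid r l w) (hl : 1 ≤ l) (hlr : l ≤ r)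
    {T : List (ℕ × ℕ)} {e g : ℕ} (hT : s.word = T ++ [(e, g)]) :
    ∃ p q, 1 ≤ p ∧ p < q ∧ exitStrand (below s.lower l) s.cols p = g ∧
      exitStrand (below s.lower l) s.cols q = e ∧
      (∀ k, p < k → k < q → ¬ (e < exitStrand (below s.lower l) s.cols k ∧
        exitStrand (below s.lower l) s.cols k < g)) ∧
      graphPerm (s.graph l) g = l + p - 1 ∧ graphPerm (s.graph l) e = l + q - 1 := by
  have hr := hs.range (e, g) (by simp [hT])
  simp only at hr
  have hG := hs.isRC hl
  have hperm := hs.perm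
  set Y := graphPerm (s.graph l) with hY
  have hYs := inSInf_graphPerm hG.1
  rw [hT, transProd_snoc, ← mul_assoc] at hperm
  have hch := hs.chain
  rw [hT] at hch
  have h1 := hch.length
  have h2 := hch.of_append.length
  rw [transProd_snoc, ← mul_assoc] at h1
  have hY0 : w * transProd T = Y * Equiv.swap e g := by
    rw [← hperm, mul_assoc, Equiv.swap_mul_self, mul_one]
  have hY0s : InSInf (w * transProd T) := by
    rw [hY0]
    exact hYs.mul (inSInf_swap (by omega) (by omega))
  have hcov := (permLength_mul_swap_eq_succ hY0s (a := e) (b := g) (by omega) (by omega)).mp (by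
    rw [h1, h2]
    simp
    omega)
  obtain ⟨hlt, hnb⟩ := hcov
  rw [hY0] at hlt hnb
  simp only [Equiv.Perm.mul_apply, Equiv.swap_apply_left, Equiv.swap_apply_right] at hlt
  have hfix : ∀ m, m < l → Y m = m := fun m hm =>
    graphPerm_fix (l := l - 1) hG.1 (fun p hp => by
      rcases Finset.mem_union.mp hp with hp | hp
      · have := hs.rows p hp
        omega
      · have := (mem_rowGraph.mp hp).1
        omega) (by omega)
  have hgl : l ≤ Y g := by
    by_contra hc
    have := Y.injective (hfix (Y g) (by omega))
    omega
  have hex : ∀ j, 1 ≤ j → exitStrand (below s.lower l) s.cols j = Y.symm (l + j - 1) := fun j hj =>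
    (graphPerm_rowUnion_symm hl hs.rc.1 hs.rows hs.zero hj).symm
  refine ⟨Y g - l + 1, Y e - l + 1, by omega, by omega, ?_, ?_, ?_, by omega, by omega⟩
  · rw [hex _ (by omega), Equiv.symm_apply_eq]
    omega
  · rw [hex _ (by omega), Equiv.symm_apply_eq]
    omega
  · intro k hk1 hk2 ⟨h3, h4⟩
    rw [hex _ (by omega)] at h3 h4
    set c := Y.symm (l + k - 1) with hc
    have hYc : Y c = l + k - 1 := by rw [hc, Equiv.apply_symm_apply]
    refine hnb c h3 h4 ?_
    simp only [Equiv.Perm.mul_apply, Equiv.swap_apply_left, Equiv.swap_apply_right,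
      Equiv.swap_apply_of_ne_of_ne h3.ne' h4.ne, hYc]
    omega

end valid

/-- The graph `L'` arises from `L` by one crossing that multiplies the permutation by the
transposition of the strands `a ≤ r < b`; both are rc-graphs in rows below `l`. -/
structure LowerCover (r l : ℕ) (L L' : Graph) (a b : ℕ) : Prop where
  ha : a ≤ r
  hb : r < b
  rc : IsRCGraph L
  rc' : IsRCGraph L'
  rows' : ∀ p ∈ L', l < p.1
  sub : ∃ q ∉ L, L' = insert q L
  perm : graphPerm L' = graphPerm L * Equiv.swap a b

section cover

variable {r l : ℕ} {L L' : Graph} {a b : ℕ}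

theorem LowerCover.rows (h : LowerCover r l L L' a b) : ∀ p ∈ L, l < p.1 := by
  obtain ⟨q, -, e⟩ := h.sub
  exact fun p hp => h.rows' p (e ▸ Finset.mem_insert_of_mem hp)

theorem LowerCover.card (h : LowerCover r l L L' a b) : L'.card = L.card + 1 := by
  obtain ⟨q, hq, e⟩ := h.sub
  rw [e, Finset.card_insert_of_notMem hq]

theorem LowerCover.below_eq (h : LowerCover r l L L' a b) :
    below L' l = Equiv.swap a b ∘ below L l := below_mul_swap h.perm

theorem LowerCover.lt (h : LowerCover r l L L' a b) : a < b := h.ha.trans_lt h.hb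

theorem LowerCover.one_le (h : LowerCover r l L L' a b) : 1 ≤ a := by
  by_contra h0
  obtain rfl : a = 0 := by omega
  have h1 := (inSInf_graphPerm h.rc.1).1
  have h2 := (inSInf_graphPerm h.rc'.1).1
  have h3 := h.lt
  rw [h.perm, Equiv.Perm.mul_apply, Equiv.swap_apply_left, ← h1] at h2
  have := (graphPerm L).injective h2
  omega

/-- The columns where the strands `a`, `b` enter row `l`. -/
theorem LowerCover.columns (h : LowerCover r l L L' a b) :
    ∃ P Q, 1 ≤ P ∧ P < Q ∧ below L l P = a ∧ below L l Q = b ∧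
      ∀ k, P < k → k < Q → ¬ (a < below L l k ∧ below L l k < b) := by
  have h1 := inSInf_graphPerm h.rc.1
  have h2 := (permLength_mul_swap_eq_succ h1 h.one_le h.lt).mp (by
    rw [← h.perm, (isRCGraph_iff_card h.rc.1).mp h.rc, (isRCGraph_iff_card h.rc'.1).mp h.rc',
        h.card])
  obtain ⟨hlt, hnb⟩ := h2
  have hb := h.hb
  have ha : l < graphPerm L a := by
    by_contra hc
    have h3 := graphPerm_fix h.rc.1 h.rows (not_lt.mp hc)
    have h4 := (graphPerm L).injective h3
    have h5 := graphPerm_fix h.rc'.1 h.rows' (m := a) (by omega)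
    rw [h.perm, Equiv.Perm.mul_apply, Equiv.swap_apply_left] at h5
    omega
  refine ⟨graphPerm L a - l, graphPerm L b - l, by omega, by omega, ?_, ?_, ?_⟩
  · rw [below, Equiv.symm_apply_eq]
    omega
  · rw [below, Equiv.symm_apply_eq]
    omega
  · intro k hk1 hk2 ⟨h3, h4⟩
    refine hnb _ h3 h4 ?_
    simp only [below, Equiv.apply_symm_apply]
    omega

theorem graphPerm_rowUnion_lower {A : Finset ℕ} (hl : 1 ≤ l) (h : LowerCover r l L L' a b)
    (hA : 0 ∉ A) :
    graphPerm (L' ∪ rowGraph l A) = graphPerm (L ∪ rowGraph l A) * Equiv.swap a b := by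
  rw [graphPerm_rowUnion hl h.rc'.1 h.rows' hA, graphPerm_rowUnion hl h.rc.1 h.rows hA, h.perm,
    mul_assoc]

end cover

/-! ### The steps of the algorithm within a row -/

/-- Column `j` is a non-crossing with a small strand from the left and a large one from below. -/
def Free (r : ℕ) (z : ℕ → ℕ) (A : Finset ℕ) (j : ℕ) : Prop :=
  1 ≤ j ∧ j ∉ A ∧ carry z A j ≤ r ∧ r < z j

/-- Column `j` is a non-crossing with the strand `g` from the left, where `(e g)` is the last entry
of `T`, and a large one from below. -/
def FreeNext (r : ℕ) (z : ℕ → ℕ) (A : Finset ℕ) (T : List (ℕ × ℕ)) (j : ℕ) : Prop :=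
  1 ≤ j ∧ j ∉ A ∧ (∃ e, T.getLast? = some (e, carry z A j)) ∧ r < z j

/-- Column `j` is a non-crossing with a large strand from the left and a small one from below. -/
def InvFree (r : ℕ) (z : ℕ → ℕ) (A : Finset ℕ) (j : ℕ) : Prop :=
  1 ≤ j ∧ j ∉ A ∧ z j ≤ r ∧ r < carry z A j

/-- The second half of a rectification after the removal of a crossing in column `Q`. -/
def Reinserted (r : ℕ) (z : ℕ → ℕ) (A : Finset ℕ) (T : List (ℕ × ℕ)) (Q : ℕ) (A' : Finset ℕ)
    (T' : List (ℕ × ℕ)) : Prop :=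
  ∃ j, j < Q ∧ (Free r z A j ∨ FreeNext r z A T j) ∧
    (∀ k, j < k → k < Q → ¬ Free r z A k ∧ ¬ FreeNext r z A T k) ∧ A' = insert j A ∧
    ((carry z A j ≤ r ∧ T' = T ++ [(carry z A j, z j)]) ∨
      (r < carry z A j ∧ ∃ e T₀, T = T₀ ++ [(e, carry z A j)] ∧
        T' = T₀ ++ [(e, z j), (e, carry z A j)]))

/-- The steps of the algorithm in row `l`, without reference to the shape of the tableau.  The first
argument is `none` for an insertion and the transposition `(a b)` of the lower tableau for a
rectification. -/
inductive Step (r l : ℕ) : Option (ℕ × ℕ) → Config → Config → Prop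
  | insertion {L : Graph} {A : Finset ℕ} {T : List (ℕ × ℕ)} {j : ℕ}
      (hj : Free r (below L l) A j) (hmax : ∀ k, j < k → ¬ Free r (below L l) A k) :
      Step r l none ⟨L, A, T⟩ ⟨L, insert j A, T ++ [(carry (below L l) A j, below L l j)]⟩
  | accept {L L' : Graph} {A : Finset ℕ} {T : List (ℕ × ℕ)} {a b : ℕ}
      (hcov : LowerCover r l L L' a b)
      (h1 : ∀ j ∈ A, (carry (below L' l) A j, below L' l j) ≠ (b, a))
      (h2 : ∀ f, T.getLast? = some (a, f) → ∀ j ∈ A,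
        (carry (below L' l) A j, below L' l j) ≠ (b, f)) :
      Step r l (some (a, b)) ⟨L, A, T⟩ ⟨L', A, T ++ [(a, b)]⟩
  | bump {L L' : Graph} {A A' : Finset ℕ} {T T' : List (ℕ × ℕ)} {a b Q : ℕ}
      (hcov : LowerCover r l L L' a b) (hQ : Q ∈ A)
      (h1 : (carry (below L' l) A Q, below L' l Q) = (b, a))
      (h2 : Reinserted r (below L' l) (A.erase Q) T Q A' T') :
      Step r l (some (a, b)) ⟨L, A, T⟩ ⟨L', A', T'⟩
  | exchange {L L' : Graph} {A A' : Finset ℕ} {T T' : List (ℕ × ℕ)} {a b f Q : ℕ}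
      (hcov : LowerCover r l L L' a b)
      (h1 : ∀ j ∈ A, (carry (below L' l) A j, below L' l j) ≠ (b, a)) (hQ : Q ∈ A)
      (h2 : (carry (below L' l) A Q, below L' l Q) = (b, f))
      (h3 : Reinserted r (below L' l) (A.erase Q) (T ++ [(a, b)]) Q A' T') :
      Step r l (some (a, b)) ⟨L, A, T ++ [(a, f)]⟩ ⟨L', A', T'⟩

/-! ### Reducedness of a row under the moves -/

section reduced

variable {z : ℕ → ℕ} {A : Finset ℕ}

theorem RowReduced.insert (hz : z.Injective) (h0 : 0 ∉ A) (h : RowReduced z A) {j : ℕ} (hj : 1 ≤ j)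
    (hjA : j ∉ A) (hlt : carry z A j < z j) : RowReduced z (insert j A) := by
  intro k hk
  rcases Finset.mem_insert.mp hk with rfl | hkA
  · rwa [carry_insert_of_le le_rfl]
  · rcases le_or_gt k j with hkj | hkj
    · rw [carry_insert_of_le hkj]
      exact h k hkA
    · rw [carry_insert_of_lt hz h0 hj hjA hkj]
      have h1 := h k hkA
      have hne : carry z A k ≠ carry z A j := by
        obtain ⟨i, hi, hiA, e, -⟩ := exists_carry_eq (z := z) h0 hj
        rw [e]
        intro e'
        exact hjA (((carry_eq_iff hz h0 (by omega)).mp e').2.2 j hi hkj)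
      rw [Equiv.swap_apply_def]
      split_ifs <;> omega

/-- Removing the crossing in column `Q` keeps the row reduced if the strand from below `Q` can
pass the crossings that follow. -/
theorem RowReduced.erase (hz : z.Injective) (h0 : 0 ∉ A) (h : RowReduced z A) {Q : ℕ} (hQ : Q ∈ A)
    (hrun : ∀ k ∈ A, Q < k → (∀ i, Q < i → i < k → i ∈ A) → z Q < z k) :
    RowReduced z (A.erase Q) := by
  have hQ1 : 1 ≤ Q := Nat.one_le_iff_ne_zero.mpr fun e => h0 (e ▸ hQ)
  intro k hk
  obtain ⟨hkQ, hkA⟩ := Finset.mem_erase.mp hk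
  rcases lt_or_gt_of_ne hkQ with hlt | hgt
  · rw [carry_erase_of_le hlt.le]
    exact h k hkA
  · rw [carry_erase_of_lt hz h0 hQ1 hQ hgt]
    have h1 := h k hkA
    have hne : carry z A k ≠ z Q := fun e => ((carry_eq_iff hz h0 (by omega)).mp e).2.1 hQ
    -- only where the strand that passed column `Q` is carried, it is replaced by `z Q`
    by_cases hc : carry z A k = carry z A Q
    · rw [hc, Equiv.swap_apply_left]
      obtain ⟨i, hi, hiA, e, -⟩ := exists_carry_eq (z := z) h0 hQ1
      rw [e] at hc
      exact hrun k hkA hgt fun m h2 h3 =>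
        ((carry_eq_iff hz h0 (by omega)).mp hc).2.2 m (by omega) h3
    · rwa [Equiv.swap_apply_of_ne_of_ne hc hne]

/-- If the strands `a`, `b` cross in column `Q` after the lower swap, then removing this crossing
restores reducedness. -/
theorem RowReduced.swap_erase (hz : z.Injective) (h0 : 0 ∉ A) (h : RowReduced z A) {P Q : ℕ}
    (hPQ : P < Q) (hnb : ∀ k, P < k → k < Q → ¬ (z P < z k ∧ z k < z Q))
    (hQ : Q ∈ A) (hc : carry z A Q = z P) :
    RowReduced (Equiv.swap (z P) (z Q) ∘ z) (A.erase Q) := by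
  have hQ1 : 1 ≤ Q := by omega
  have hz' : (Equiv.swap (z P) (z Q) ∘ z).Injective := (Equiv.injective _).comp hz
  obtain ⟨-, hPA, hrun⟩ := (carry_eq_iff hz h0 hQ1).mp hc
  intro k hk
  obtain ⟨hkQ, hkA⟩ := Finset.mem_erase.mp hk
  have hkP : k ≠ P := fun e => hPA (e ▸ hkA)
  have hk1 : 1 ≤ k := Nat.one_le_iff_ne_zero.mpr fun e => h0 (e ▸ hkA)
  have hzk : (Equiv.swap (z P) (z Q) ∘ z) k = z k :=
    Equiv.swap_apply_of_ne_of_ne (hz.ne hkP) (hz.ne hkQ)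
  rw [hzk]
  have h1 := h k hkA
  -- between the columns `P` and `Q` the carried strand changes from `a` to `b`, elsewhere nothing
  -- changes
  rcases lt_or_gt_of_ne hkQ with hlt | hgt
  · rw [carry_erase_of_le hlt.le, carry_comp]
    rcases lt_or_gt_of_ne hkP with hlt' | hgt'
    · rwa [Equiv.swap_apply_of_ne_of_ne (carry_ne hz h0 hk1 hlt'.le) (carry_ne hz h0 hk1 hlt.le)]
    · have e : carry z A k = z P := carry_eq_of_run hgt' hPA fun i h2 h3 => hrun i h2 (by omega)
      rw [e, Equiv.swap_apply_left]
      have := hnb k hgt' hlt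
      have := hz.ne hkQ
      omega
  · rw [carry_erase_of_lt hz' h0 hQ1 hQ hgt, carry_comp, carry_comp, hc]
    simp only [Function.comp, Equiv.swap_apply_left, Equiv.swap_apply_right]
    rw [Equiv.swap_comm, Equiv.swap_apply_self]
    exact h1

/-- If the strands `a`, `b` do not cross in the row, the lower swap keeps the row reduced. -/
theorem RowReduced.swap (hz : z.Injective) (h0 : 0 ∉ A) (h : RowReduced z A) {P Q : ℕ}
    (hPQ : P < Q) (hab : z P < z Q) (hnb : ∀ k, P < k → k < Q → ¬ (z P < z k ∧ z k < z Q))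
    (hc : Q ∈ A → carry z A Q ≠ z P) : RowReduced (Equiv.swap (z P) (z Q) ∘ z) A := by
  intro k hkA
  have hk1 : 1 ≤ k := Nat.one_le_iff_ne_zero.mpr fun e => h0 (e ▸ hkA)
  have h1 := h k hkA
  rw [carry_comp]
  simp only [Function.comp]
  -- the order is at stake only in the columns `P`, `Q` and where `a` or `b` is carried
  by_cases hkQ : k = Q
  · subst hkQ
    rw [Equiv.swap_apply_right, Equiv.swap_apply_of_ne_of_ne (hc hkA) (by omega)]
    obtain ⟨i, hi, hiA, e, hrun⟩ := exists_carry_eq (z := z) h0 hk1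
    rcases lt_trichotomy i P with h2 | rfl | h2
    · have hPA := hrun P h2 hPQ
      have := h P hPA
      rwa [carry_eq_of_run h2 hiA fun m h3 h4 => hrun m h3 (by omega), ← e] at this
    · exact absurd e (hc hkA)
    · have := hnb i h2 hi
      have h3 : z i ≠ z P := hz.ne (by omega)
      omega
  by_cases hkP : k = P
  · subst hkP
    rw [Equiv.swap_apply_left, Equiv.swap_apply_of_ne_of_ne (by omega) (by omega)]
    omega
  · rw [Equiv.swap_apply_of_ne_of_ne (hz.ne hkP) (hz.ne hkQ), Equiv.swap_apply_def]
    split_ifs with h2 h3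
    · obtain ⟨h4, hPA, hrun⟩ := (carry_eq_iff hz h0 hk1).mp h2
      have hkQ' : k < Q := by
        by_contra h5
        exact hc (hrun Q hPQ (by omega))
          (carry_eq_of_run hPQ hPA fun i h6 h7 => hrun i h6 (by omega))
      have := hnb k h4 hkQ'
      have := hz.ne hkQ
      omega
    · omega
    · exact h1

end reduced

theorem exists_greatest {P : ℕ → Prop} (h : ∃ j, P j) {B : ℕ} (hB : ∀ j, P j → j ≤ B) :
    ∃ j, P j ∧ ∀ k, j < k → ¬ P k := by
  classical
  obtain ⟨j, hj⟩ := h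
  refine ⟨Nat.findGreatest P B, Nat.findGreatest_spec (hB j hj) hj, fun k hk hPk => ?_⟩
  exact Nat.findGreatest_is_greatest hk (hB k hPk) hPk

/-! ### Steps preserve validity -/

section valid

variable {r l : ℕ} {w : Equiv.Perm ℕ}

theorem one_le_carry {L : Graph} {A : Finset ℕ} (hl : 1 ≤ l) (hL : IsGraph L)
    (hrows : ∀ p ∈ L, l < p.1) (hA : 0 ∉ A) {j : ℕ} (hj : 1 ≤ j) : 1 ≤ carry (below L l) A j := by
  obtain ⟨i, -, -, e, -⟩ := exists_carry_eq (z := below L l) hA hj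
  rw [e]
  rcases Nat.eq_zero_or_pos i with rfl | hi
  · rw [below_zero hL hrows]
    exact hl
  · have := below_gt hL hrows hi
    omega

theorem Config.valid_snoc {L : Graph} {A : Finset ℕ} {T : List (ℕ × ℕ)} {t : ℕ × ℕ} (hl : 1 ≤ l)
    (rc : IsRCGraph L) (rows : ∀ p ∈ L, l < p.1) (zero : 0 ∉ A)
    (reduced : RowReduced (below L l) A) (range : ∀ t ∈ T, 1 ≤ t.1 ∧ t.1 ≤ r ∧ r < t.2)
    (ht : 1 ≤ t.1 ∧ t.1 ≤ r ∧ r < t.2)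
    (perm : w * transProd (T ++ [t]) = graphPerm (L ∪ rowGraph l A)) (chain : IsChain w T)
    (card : L.card + A.card = permLength w + (T.length + 1)) :
    Config.Valid r l w ⟨L, A, T ++ [t]⟩ := by
  refine ⟨rc, rows, zero, reduced, ?_, perm, chain.snoc ?_⟩
  · intro t' ht'
    rcases List.mem_append.mp ht' with h | h
    · exact range t' h
    · rw [List.mem_singleton.mp h]
      exact ht
  · have hG := (isRCGraph_rowUnion hl rc.1 rows zero).mpr ⟨rc, reduced⟩
    rw [perm, (isRCGraph_iff_card hG.1).mp hG, card_rowUnion rows, card]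

/-- The situation in which the strand `g` of the last entry `(e g)` leaves the row upwards in
column `j`, where it meets the large strand `z j`. -/
theorem Config.Valid.next (hl : 1 ≤ l) (hlr : l ≤ r) {L : Graph} {A : Finset ℕ}
    {T : List (ℕ × ℕ)} {e j : ℕ}
    (hs : Config.Valid r l w ⟨L, A, T ++ [(e, carry (below L l) A j)]⟩) (hj : 1 ≤ j) (hjA : j ∉ A)
    (hd : r < below L l j) :
    carry (below L l) A j < below L l j ∧ IsChain w (T ++ [(e, below L l j)]) ∧
      ∃ m q, j < m ∧ m < q ∧ m ∉ A ∧ (∀ k, j < k → k < m → k ∈ A) ∧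
        exitStrand (below L l) A q = e ∧
        (∀ k, j < k → k < q → ¬ (e < exitStrand (below L l) A k ∧
          exitStrand (below L l) A k < carry (below L l) A j)) := by
  obtain ⟨p, q, hp, hpq, hyp, hyq, hnb, hGp, hGq⟩ := hs.lastCover hl hlr rfl
  have hrange := hs.range (e, carry (below L l) A j) (by simp)
  have hG := hs.isRC hl
  have hperm := hs.perm
  have hzero := hs.zero
  have hred := hs.reduced
  have hz := below_injective L l
  have hrc := hs.rc
  have hrows := hs.rows
  have hchain := hs.chain
  simp only at hyp hyq hnb hrange hperm hzero hred hrc hrows hchain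
  set z := below L l with hzdef
  set g := carry z A j with hg
  have hyj : exitStrand z A j = g := by rw [exitStrand, if_neg hjA]
  obtain rfl : p = j := exitStrand_injOn hl hrc.1 hrows hzero hp hj (by rw [hyp, hyj])
  -- the strand `z p` leaves the row in the next non-crossing `m`
  obtain ⟨m, hm, hmA, hrun⟩ := exists_next_notMem A p
  have hcm : carry z A m = z p := carry_eq_of_run hm hjA hrun
  have hym : exitStrand z A m = z p := by rw [exitStrand, if_neg hmA, hcm]
  have hmq : m < q := by
    rcases lt_trichotomy m q with h | h | h
    · exact h
    · rw [h, hyq] at hym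
      omega
    · have hqA := hrun q hpq h
      have h1 := hred q hqA
      rw [carry_eq_of_run hpq hjA fun i h2 h3 => hrun i h2 (by omega)] at h1
      rw [exitStrand, if_pos hqA] at hyq
      omega
  have hgd : g ≠ z p := carry_ne hz hzero hj le_rfl
  -- otherwise the number `z p` would be between `e` and `g`, against the cover
  have hlt : g < z p := by
    have := hnb m hm hmq
    rw [hym] at this
    omega
  refine ⟨hlt, ?_, m, q, hm, hmq, hmA, hrun, hyq, hnb⟩
  have hT0 : IsChain w T := hchain.of_append
  refine hT0.snoc ?_
  set Y := graphPerm (Config.graph l ⟨L, A, T ++ [(e, g)]⟩) with hY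
  rw [transProd_snoc, ← mul_assoc] at hperm
  have hY0 : w * transProd T = Y * Equiv.swap e g := by
    rw [← hperm, mul_assoc, Equiv.swap_mul_self, mul_one]
  have hY0s : InSInf (w * transProd T) := by
    rw [hY0]
    exact (inSInf_graphPerm hG.1).mul (inSInf_swap (by omega) (by omega))
  rw [transProd_snoc, ← mul_assoc, ← add_assoc, ← hT0.length]
  refine (permLength_mul_swap_eq_succ hY0s (a := e) (b := z p) (by omega) (by omega)).mpr ?_
  have hex : ∀ i, 1 ≤ i → Y (exitStrand z A i) = l + i - 1 := fun i hi => by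
    rw [← graphPerm_rowUnion_symm hl hrc.1 hrows hzero hi]
    exact Equiv.apply_symm_apply _ _
  have hYd : (w * transProd T) (z p) = l + m - 1 := by
    rw [hY0, Equiv.Perm.mul_apply, Equiv.swap_apply_of_ne_of_ne (by omega) hgd.symm, ← hym,
      hex m (by omega)]
  have hYe : (w * transProd T) e = l + p - 1 := by
    rw [hY0, Equiv.Perm.mul_apply, Equiv.swap_apply_left, ← hGp]
  -- the strands that leave the row between `p` and `m` cross the strand `z p`, so they have larger
  -- numbers
  refine ⟨by omega, fun c hc1 hc2 => ?_⟩
  rw [hYd, hYe]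
  rintro ⟨h1, h2⟩
  have hcg : c ≠ g := by
    rintro rfl
    rw [hY0, Equiv.Perm.mul_apply, Equiv.swap_apply_right, hGq] at h2
    omega
  have hYc : (w * transProd T) c = Y c := by
    rw [hY0, Equiv.Perm.mul_apply, Equiv.swap_apply_of_ne_of_ne (by omega) hcg]
  rw [hYc] at h1 h2
  have hk : Y c - l + 1 ∈ A := hrun _ (by omega) (by omega)
  have hyc : exitStrand z A (Y c - l + 1) = c := by
    apply Y.injective
    rw [hex _ (by omega)]
    omega
  have h3 := hred _ hk
  rw [exitStrand, if_pos hk] at hyc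
  rw [hyc, carry_eq_of_run (i := p) (by omega) hjA fun i h4 h5 => hrun i h4 (by omega)] at h3
  omega

theorem Reinserted.valid (hl : 1 ≤ l) (hlr : l ≤ r) {L : Graph} {A A' : Finset ℕ}
    {T T' : List (ℕ × ℕ)} {Q : ℕ} (hs : Config.Valid r l w ⟨L, A, T⟩)
    (h : Reinserted r (below L l) A T Q A' T') : Config.Valid r l w ⟨L, A', T'⟩ := by
  obtain ⟨j, -, hsel, -, rfl, hT⟩ := h
  have hj : 1 ≤ j := hsel.elim (fun h => h.1) fun h => h.1
  have hjA : j ∉ A := hsel.elim (fun h => h.2.1) fun h => h.2.1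
  have hd : r < below L l j := hsel.elim (fun h => h.2.2.2) fun h => h.2.2.2
  have hz := below_injective L l
  have hzero : 0 ∉ A := hs.zero
  have hzero' : 0 ∉ insert j A := by
    rw [Finset.mem_insert, not_or]
    exact ⟨by omega, hzero⟩
  have hcard := hs.card hl
  simp only at hcard
  have hperm : w * transProd T = graphPerm (L ∪ rowGraph l A) := hs.perm
  have hins := graphPerm_rowUnion_insert hl hs.rc.1 hs.rows hzero hj hjA
  simp only at hins
  have hc1 := one_le_carry hl hs.rc.1 hs.rows hzero hj
  simp only at hc1
  rcases hT with ⟨hc, rfl⟩ | ⟨hc, e, T₀, rfl, rfl⟩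
  · refine Config.valid_snoc hl hs.rc hs.rows hzero'
      (RowReduced.insert hz hzero hs.reduced hj hjA (by omega)) hs.range
      ⟨hc1, hc, hd⟩ ?_ hs.chain ?_
    · rw [transProd_snoc, ← mul_assoc, hperm, hins]
    · simp only [Finset.card_insert_of_notMem hjA]
      omega
  · obtain ⟨hlt, hch, -⟩ := hs.next hl hlr hj hjA hd
    have hre := hs.range (e, carry (below L l) A j) (by simp)
    simp only at hre
    have e1 : T₀ ++ [(e, below L l j), (e, carry (below L l) A j)] =
        (T₀ ++ [(e, below L l j)]) ++ [(e, carry (below L l) A j)] := by simp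
    rw [e1]
    refine Config.valid_snoc hl hs.rc hs.rows hzero'
      (RowReduced.insert hz hzero hs.reduced hj hjA hlt) ?_ hre ?_ hch ?_
    · intro t ht
      rcases List.mem_append.mp ht with h | h
      · exact hs.range t (by simp [h])
      · rw [List.mem_singleton.mp h]
        exact ⟨hre.1, hre.2.1, hd⟩
    · rw [transProd_snoc] at hperm
      rw [hins, ← hperm, transProd_snoc, transProd_snoc, mul_assoc, mul_assoc, mul_assoc,
        swap_mul_swap_exchange (by omega) hlt.ne]
    · simp only [Finset.card_insert_of_notMem hjA]
      simp only [List.length_append, List.length_singleton] at hcard ⊢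
      omega

/-- The configuration after the removal of a crossing of the strands of the lower transposition. -/
theorem bump_valid (hl : 1 ≤ l) {L L' : Graph} {A : Finset ℕ} {T : List (ℕ × ℕ)} {a b Q : ℕ}
    (hs : Config.Valid r l w ⟨L, A, T⟩) (hcov : LowerCover r l L L' a b) (hQ : Q ∈ A)
    (h1 : (carry (below L' l) A Q, below L' l Q) = (b, a)) :
    Config.Valid r l w ⟨L', A.erase Q, T⟩ := by
  obtain ⟨P, Q', hP, hPQ, rfl, rfl, hnb⟩ := hcov.columns
  have hz := below_injective L l
  have hzero : 0 ∉ A := hs.zero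
  have hzero' : 0 ∉ A.erase Q := fun h => hzero (Finset.mem_of_mem_erase h)
  have hQ1 : 1 ≤ Q := Nat.one_le_iff_ne_zero.mpr fun e => hzero (e ▸ hQ)
  rw [hcov.below_eq, carry_comp, Prod.mk.injEq] at h1
  obtain ⟨h2, h3⟩ := h1
  have hc : carry (below L l) A Q = below L l P := by
    rw [Equiv.swap_apply_eq_iff, Equiv.swap_apply_right] at h2
    exact h2
  obtain rfl : Q = Q' := by
    simp only [Function.comp, Equiv.swap_apply_eq_iff, Equiv.swap_apply_left] at h3
    exact hz h3
  refine ⟨hcov.rc', hcov.rows', hzero', ?_, hs.range, ?_, hs.chain⟩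
  · simp only
    rw [hcov.below_eq]
    exact RowReduced.swap_erase hz hzero hs.reduced hPQ hnb hQ hc
  · have hins := graphPerm_rowUnion_insert hl hcov.rc'.1 hcov.rows' hzero' hQ1
      (Finset.notMem_erase Q A)
    rw [Finset.insert_erase hQ, carry_erase_of_le le_rfl, hcov.below_eq, carry_comp, hc,
      Equiv.swap_apply_left, Function.comp, Equiv.swap_apply_right,
      graphPerm_rowUnion_lower hl hcov hzero, Equiv.swap_comm (below L l Q),
      mul_left_inj] at hins
    exact hs.perm.trans hins

theorem rowReduced_of_no_crossing {L L' : Graph} {A : Finset ℕ} {a b : ℕ} (hzero : 0 ∉ A)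
    (hred : RowReduced (below L l) A) (hcov : LowerCover r l L L' a b)
    (h1 : ∀ j ∈ A, (carry (below L' l) A j, below L' l j) ≠ (b, a)) :
    RowReduced (below L' l) A := by
  obtain ⟨P, Q', hP, hPQ, rfl, rfl, hnb⟩ := hcov.columns
  have hz := below_injective L l
  rw [hcov.below_eq]
  refine RowReduced.swap hz hzero hred hPQ hcov.lt hnb fun hQ hc => ?_
  refine h1 Q' hQ ?_
  rw [hcov.below_eq, carry_comp, hc]
  simp

theorem accept_valid (hl : 1 ≤ l) {L L' : Graph} {A : Finset ℕ} {T : List (ℕ × ℕ)} {a b : ℕ}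
    (hs : Config.Valid r l w ⟨L, A, T⟩) (hcov : LowerCover r l L L' a b)
    (h1 : ∀ j ∈ A, (carry (below L' l) A j, below L' l j) ≠ (b, a)) :
    Config.Valid r l w ⟨L', A, T ++ [(a, b)]⟩ := by
  have hcard := hs.card hl
  simp only at hcard
  refine Config.valid_snoc hl hcov.rc' hcov.rows' hs.zero
    (rowReduced_of_no_crossing hs.zero hs.reduced hcov h1) hs.range
    ⟨hcov.one_le, hcov.ha, hcov.hb⟩ ?_ hs.chain ?_
  · rw [transProd_snoc, ← mul_assoc, graphPerm_rowUnion_lower hl hcov hs.zero]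
    exact congrArg (· * _) hs.perm
  · rw [hcov.card]
    omega

/-- The configuration after the lower transposition `(a b)` has replaced the last entry `(a f)`. -/
theorem exchange_valid (hl : 1 ≤ l) (hlr : l ≤ r) {L L' : Graph} {A : Finset ℕ}
    {T : List (ℕ × ℕ)} {a b f Q : ℕ}
    (hs : Config.Valid r l w ⟨L, A, T ++ [(a, f)]⟩) (hcov : LowerCover r l L L' a b)
    (h1 : ∀ j ∈ A, (carry (below L' l) A j, below L' l j) ≠ (b, a)) (hQ : Q ∈ A)
    (h2 : (carry (below L' l) A Q, below L' l Q) = (b, f)) :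
    Config.Valid r l w ⟨L', A.erase Q, T ++ [(a, b)]⟩ := by
  have hs' := accept_valid hl hs hcov h1
  have hzero : 0 ∉ A := hs.zero
  have hzero' : 0 ∉ A.erase Q := fun h => hzero (Finset.mem_of_mem_erase h)
  have hQ1 : 1 ≤ Q := Nat.one_le_iff_ne_zero.mpr fun e => hzero (e ▸ hQ)
  have hrf := hs.range (a, f) (by simp)
  have hab := hcov.lt
  have hb := hcov.hb
  have hcard := hs.card hl
  simp only at hrf hcard
  have hred' : RowReduced (below L' l) A := hs'.reduced
  have hred : RowReduced (below L l) A := hs.reduced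
  have hz := below_injective L l
  have hz' := below_injective L' l
  rw [Prod.mk.injEq] at h2
  obtain ⟨hcQ, hzQ⟩ := h2
  have hbf : b < f := by
    have := hred' Q hQ
    omega
  -- the strand `a` passes column `Q` before the lower swap
  have hcQ' : carry (below L l) A Q = a := by
    rw [hcov.below_eq, carry_comp, Equiv.swap_apply_eq_iff, Equiv.swap_apply_right] at hcQ
    exact hcQ
  have hzQ' : below L l Q = f := by
    rw [hcov.below_eq, Function.comp, Equiv.swap_apply_eq_iff,
      Equiv.swap_apply_of_ne_of_ne (by omega) (by omega)] at hzQ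
    exact hzQ
  obtain ⟨p, q, hp, hpq, hyp, hyq, hnb, -⟩ := hs.lastCover hl hlr rfl
  simp only at hyp hyq hnb
  have hyQ : exitStrand (below L l) A Q = f := by rw [exitStrand, if_pos hQ, hzQ']
  obtain rfl : p = Q := exitStrand_injOn hl hs.rc.1 hs.rows hzero hp hQ1 (by
    simp only
    rw [hyp, hyQ])
  refine Config.valid_snoc hl hcov.rc' hcov.rows' hzero' ?_ (fun t ht => hs.range t (by simp [ht]))
    ⟨hcov.one_le, hcov.ha, hcov.hb⟩ ?_ hs.chain.of_append ?_
  -- the strand `f` passes only crossings to the left of column `q`, where `a` leaves the row; there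
  -- the cover excludes the strands between `a` and `f`
  · refine RowReduced.erase hz' hzero hred' hQ fun k hkA hpk hrun => ?_
    have hck : carry (below L' l) A k = b := by
      rw [carry_run (i := p) hpk.le (fun i h3 h4 => by
        rcases Nat.eq_or_lt_of_le h3 with rfl | h5
        · exact hQ
        · exact hrun i h5 h4), hcQ]
    have hck' : carry (below L l) A k = a := by
      rw [carry_run (i := p) hpk.le (fun i h3 h4 => by
        rcases Nat.eq_or_lt_of_le h3 with rfl | h5
        · exact hQ
        · exact hrun i h5 h4), hcQ']
    have hkq : k < q := by
      by_contra h3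
      have hqA : q ∈ A := by
        rcases Nat.eq_or_lt_of_le (not_lt.mp h3) with h4 | h4
        · exact h4 ▸ hkA
        · exact hrun q hpq h4
      have h5 := hred q hqA
      rw [carry_run (i := p) hpq.le (fun i h3' h4 => by
        rcases Nat.eq_or_lt_of_le h3' with rfl | h5
        · exact hQ
        · exact hrun i h5 (by omega)), hcQ'] at h5
      rw [exitStrand, if_pos hqA] at hyq
      omega
    have h4 := hnb k hpk hkq
    rw [exitStrand, if_pos hkA] at h4
    have h5 := hred k hkA
    rw [hck'] at h5
    have h6 : below L l k ≠ f := fun e => by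
      rw [← hzQ'] at e
      have := hz e
      omega
    have h7 : below L l k ≠ b := fun e => h1 k hkA (by
      rw [hck, hcov.below_eq, Function.comp, e, Equiv.swap_apply_right])
    rw [hzQ, hcov.below_eq, Function.comp, Equiv.swap_apply_of_ne_of_ne h5.ne' h7]
    omega
  · have hins := graphPerm_rowUnion_insert hl hcov.rc'.1 hcov.rows' hzero' hQ1
      (Finset.notMem_erase p A)
    rw [Finset.insert_erase hQ, carry_erase_of_le le_rfl, hcQ, hzQ] at hins
    have hperm : w * transProd (T ++ [(a, f)] ++ [(a, b)]) = graphPerm (L' ∪ rowGraph l A) :=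
      hs'.perm
    rw [hins, transProd_snoc, transProd_snoc, mul_assoc,
      ← swap_mul_swap_exchange (e := a) (g := b) (d := f) (by omega) (by omega), ← mul_assoc,
      ← mul_assoc, mul_left_inj] at hperm
    rw [transProd_snoc, ← mul_assoc, ← hperm]
  · rw [hcov.card, Finset.card_erase_of_mem hQ]
    have : 1 ≤ A.card := Finset.card_pos.mpr ⟨p, hQ⟩
    simp only [List.length_append, List.length_singleton] at hcard
    omega

theorem Step.valid (hl : 1 ≤ l) (hlr : l ≤ r) {o : Option (ℕ × ℕ)} {s s' : Config}
    (h : Step r l o s s') (hs : s.Valid r l w) : s'.Valid r l w := by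
  cases h with
  | insertion hj hmax =>
    exact Reinserted.valid hl hlr (Q := _ + 1) hs ⟨_, Nat.lt_succ_self _, Or.inl hj,
      fun k h1 h2 => by omega, rfl, Or.inl ⟨hj.2.2.1, rfl⟩⟩
  | accept hcov h1 h2 => exact accept_valid hl hs hcov h1
  | bump hcov hQ h1 h2 => exact h2.valid hl hlr (bump_valid hl hs hcov hQ h1)
  | exchange hcov h1 hQ h2 h3 => exact h3.valid hl hlr (exchange_valid hl hlr hs hcov h1 hQ h2)

end valid

/-! ### Existence of steps -/

section existence

variable {r l : ℕ} {w : Equiv.Perm ℕ}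

theorem exists_reinserted {z : ℕ → ℕ} {A : Finset ℕ} (T : List (ℕ × ℕ)) {Q : ℕ}
    (h0 : 0 ∉ A) (hz0 : z 0 ≤ r) (hQ1 : 1 ≤ Q) (hQ : r < carry z A Q) :
    ∃ A' T', Reinserted r z A T Q A' T' := by
  -- the strand at the start of the row is small, the one in column `Q` is large
  obtain ⟨k, hk1, hkQ, hkA, hk2, hk3⟩ := exists_transition (z := z) (A := A) (· ≤ r) hQ1
    (by rw [show 1 = 0 + 1 from rfl, carry_succ_of_notMem h0]; exact hz0) (by omega)
  obtain ⟨j, ⟨hjQ, hj⟩, hmax⟩ := exists_greatest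
    (P := fun j => j < Q ∧ (Free r z A j ∨ FreeNext r z A T j))
    ⟨k, hkQ, Or.inl ⟨hk1, hkA, hk2, by omega⟩⟩ (B := Q) (fun j hj => hj.1.le)
  have hmax' : ∀ k, j < k → k < Q → ¬ Free r z A k ∧ ¬ FreeNext r z A T k := fun k h1 h2 => by
    have := hmax k h1
    tauto
  rcases le_or_gt (carry z A j) r with hc | hc
  · exact ⟨_, _, j, hjQ, hj, hmax', rfl, Or.inl ⟨hc, rfl⟩⟩
  · rcases hj with hj | hj
    · exact absurd hj.2.2.1 (not_le.mpr hc)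
    · obtain ⟨e, he⟩ := hj.2.2.1
      exact ⟨_, _, j, hjQ, Or.inr hj, hmax', rfl, Or.inr ⟨hc, e, T.dropLast,
        (List.dropLast_append_getLast? _ he).symm, rfl⟩⟩

theorem exists_step_insertion (hlr : l ≤ r) {s : Config} (hs : s.Valid r l w) :
    ∃ s', Step r l none s s' := by
  obtain ⟨L, A, T⟩ := s
  have hzero : 0 ∉ A := hs.zero
  have hz0 : below L l 0 = l := below_zero hs.rc.1 hs.rows
  -- far to the right only large strands enter the row
  obtain ⟨N, hN⟩ := exists_below_bound hs.rc.1 l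
  simp only at hN
  obtain ⟨m, hm, hmA, -⟩ := exists_next_notMem A (N + r + 1)
  have hlarge : ∀ k, m ≤ k → r < below L l k := fun k hk => by
    rw [hN k (by omega)]
    omega
  have hcm : carry (below L l) A (m + 1) = below L l m := carry_succ_of_notMem hmA
  obtain ⟨k, hk1, hkQ, hkA, hk2, hk3⟩ := exists_transition (z := below L l) (A := A) (· ≤ r)
    (i := 1) (j := m + 1) (by omega)
    (by rw [show 1 = 0 + 1 from rfl, carry_succ_of_notMem hzero]; omega)
    (by rw [hcm]; exact not_le.mpr (hlarge m le_rfl))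
  obtain ⟨j, hj, hmax⟩ := exists_greatest (P := Free r (below L l) A)
    ⟨k, hk1, hkA, hk2, by omega⟩ (B := m) (fun j hj => by
      by_contra hjm
      obtain ⟨i, hi, hiA, e, hrun⟩ := exists_carry_eq (z := below L l) hzero hj.1
      have h1 := hj.2.2.1
      have h2 : m ≤ i := by
        by_contra h3
        exact hmA (hrun m (by omega) (by omega))
      have := hlarge i h2
      omega)
  exact ⟨_, Step.insertion hj hmax⟩

theorem exists_step_rectification (hlr : l ≤ r) {L L' : Graph} {A : Finset ℕ} {T : List (ℕ × ℕ)}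
    {a b : ℕ} (hs : Config.Valid r l w ⟨L, A, T⟩) (hcov : LowerCover r l L L' a b) :
    ∃ A' T', Step r l (some (a, b)) ⟨L, A, T⟩ ⟨L', A', T'⟩ := by
  have hzero : 0 ∉ A := hs.zero
  have hz0 : below L' l 0 ≤ r := by
    rw [below_zero hcov.rc'.1 hcov.rows']
    exact hlr
  have hb := hcov.hb
  have key : ∀ Q ∈ A, ∀ T, carry (below L' l) A Q = b →
      ∃ A' T', Reinserted r (below L' l) (A.erase Q) T Q A' T' := fun Q hQ T hc =>
    exists_reinserted T (fun h => hzero (Finset.mem_of_mem_erase h)) hz0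
      (Nat.one_le_iff_ne_zero.mpr fun e => hzero (e ▸ hQ))
      (by rw [carry_erase_of_le le_rfl, hc]; exact hb)
  by_cases h1 : ∃ Q ∈ A, (carry (below L' l) A Q, below L' l Q) = (b, a)
  · obtain ⟨Q, hQ, h1⟩ := h1
    obtain ⟨A', T', h2⟩ := key Q hQ T (Prod.mk.inj h1).1
    exact ⟨A', T', Step.bump hcov hQ h1 h2⟩
  · push Not at h1
    by_cases h2 : ∃ f, T.getLast? = some (a, f) ∧ ∃ Q ∈ A,
        (carry (below L' l) A Q, below L' l Q) = (b, f)
    · obtain ⟨f, hf, Q, hQ, h2⟩ := h2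
      obtain ⟨A', T', h3⟩ := key Q hQ (T.dropLast ++ [(a, b)]) (Prod.mk.inj h2).1
      refine ⟨A', T', ?_⟩
      rw [← List.dropLast_append_getLast? _ hf]
      exact Step.exchange hcov h1 hQ h2 h3
    · push Not at h2
      exact ⟨A, T ++ [(a, b)], Step.accept hcov h1 h2⟩

end existence

/-! ### Reversing a step -/

section reverse

variable {r l : ℕ} {w : Equiv.Perm ℕ}

/-- A transition of the carried strand from large to small happens at an inversely free column. -/
theorem exists_invFree {z : ℕ → ℕ} {A : Finset ℕ} {i j : ℕ} (hi : 1 ≤ i) (hij : i ≤ j)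
    (h1 : r < carry z A i) (h2 : carry z A j ≤ r) : ∃ k, i ≤ k ∧ k < j ∧ InvFree r z A k := by
  obtain ⟨k, hk1, hk2, hkA, hk3, hk4⟩ := exists_transition (z := z) (A := A) (r < ·) hij h1
    (by omega)
  exact ⟨k, hk1, hk2, by omega, hkA, by omega, hk3⟩

theorem exists_free {z : ℕ → ℕ} {A : Finset ℕ} {i j : ℕ} (hi : 1 ≤ i) (hij : i ≤ j)
    (h1 : carry z A i ≤ r) (h2 : r < carry z A j) : ∃ k, i ≤ k ∧ k < j ∧ Free r z A k := by
  obtain ⟨k, hk1, hk2, hkA, hk3, hk4⟩ := exists_transition (z := z) (A := A) (· ≤ r) hij h1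
    (by omega)
  exact ⟨k, hk1, hk2, by omega, hkA, hk3, by omega⟩

theorem not_free_of_not_invFree {z : ℕ → ℕ} {A : Finset ℕ} {i j : ℕ} (hi : 1 ≤ i) (hiA : i ∉ A)
    (hzi : r < z i) (hij : i < j) (h : ∀ k, i < k → k < j → ¬ InvFree r z A k) :
    ¬ Free r z A j := fun hf => by
  obtain ⟨k, h1, h2, h3⟩ := exists_invFree (r := r) (z := z) (A := A) (i := i + 1) (j := j)
    (by omega) (by omega) (by rw [carry_succ_of_notMem hiA]; exact hzi) hf.2.2.1
  exact h k (by omega) h2 h3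

theorem erase_rowUnion {L : Graph} {A : Finset ℕ} {p : ℕ × ℕ} (hp : l < p.1) :
    (L ∪ rowGraph l A).erase p = L.erase p ∪ rowGraph l A := by
  rw [Finset.erase_union_distrib]
  congr 1
  refine Finset.erase_eq_of_notMem fun h => ?_
  have := (mem_rowGraph.mp h).1
  omega

theorem erase_rowUnion_row {L : Graph} {A : Finset ℕ} {j : ℕ} (hrows : ∀ p ∈ L, l < p.1) :
    (L ∪ rowGraph l A).erase (l, j) = L ∪ rowGraph l (A.erase j) := by
  rw [Finset.erase_union_distrib, Finset.erase_eq_of_notMem (notMem_lower hrows j)]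
  congr 1
  ext ⟨p, q⟩
  simp only [Finset.mem_erase, mem_rowGraph, ne_eq, Prod.mk.injEq]
  tauto

theorem insert_rowUnion_row {L : Graph} {A : Finset ℕ} {j : ℕ} :
    insert (l, j) (L ∪ rowGraph l A) = L ∪ rowGraph l (insert j A) := by
  rw [← Finset.union_insert]
  congr 1
  exact (Finset.image_insert _ _ _).symm

/-- The place where the strands of the last transposition cross. -/
theorem Config.Valid.lastCrossing (hl : 1 ≤ l) (hlr : l ≤ r) {s : Config} {T : List (ℕ × ℕ)}
    {e g : ℕ} (hs : s.Valid r l w) (hT : s.word = T ++ [(e, g)]) :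
    ∃! p, p ∈ s.graph l ∧ strands (s.graph l) p.1 p.2 = (e, g) := by
  obtain ⟨p, q, hp, hpq, hyp, hyq, hnb, hGp, hGq⟩ := hs.lastCover hl hlr hT
  have hr := hs.range (e, g) (by simp [hT])
  simp only at hr
  exact (strands_crossing (hs.isRC hl) (by omega)).1 (by omega)

/-- The strands of the last transposition cross in the row: remove this crossing. -/
theorem Config.Valid.erase_last (hl : 1 ≤ l) {L : Graph} {A : Finset ℕ} {T : List (ℕ × ℕ)}
    {j : ℕ} (hs : Config.Valid r l w ⟨L, A, T ++ [(carry (below L l) A j, below L l j)]⟩)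
    (hj : j ∈ A) : Config.Valid r l w ⟨L, A.erase j, T⟩ := by
  have hzero : 0 ∉ A := hs.zero
  have hzero' : 0 ∉ A.erase j := fun h => hzero (Finset.mem_of_mem_erase h)
  have hj1 : 1 ≤ j := Nat.one_le_iff_ne_zero.mpr fun e => hzero (e ▸ hj)
  have hG := hs.isRC hl
  have hperm := hs.perm
  have hch := hs.chain
  simp only [Config.graph] at hG hperm hch
  have hins := graphPerm_rowUnion_insert hl hs.rc.1 hs.rows hzero' hj1 (Finset.notMem_erase j A)
  simp only at hins
  rw [Finset.insert_erase hj, carry_erase_of_le le_rfl] at hins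
  rw [hins, transProd_snoc, ← mul_assoc, mul_left_inj] at hperm
  have hlen := hch.length
  have hlen' := hch.of_append.length
  have hrc : IsRCGraph (L ∪ rowGraph l (A.erase j)) := by
    rw [← erase_rowUnion_row hs.rows]
    refine hG.erase_of_permLength ((mem_rowUnion hs.rows).mpr hj) ?_
    rw [erase_rowUnion_row hs.rows]
    simp only
    rw [← hperm, hlen', hins, ← hperm, mul_assoc, ← transProd_snoc, hlen, List.length_append,
      List.length_singleton, add_assoc]
  exact ⟨hs.rc, hs.rows, hzero', ((isRCGraph_rowUnion hl hs.rc.1 hs.rows hzero').mp hrc).2,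
    fun t ht => hs.range t (by simp [ht]), hperm, hch.of_append⟩

/-- The strands of the last transposition do not cross in the row: remove their crossing below. -/
theorem Config.Valid.uncover (hl : 1 ≤ l) (hlr : l ≤ r) {L' : Graph} {A : Finset ℕ}
    {T : List (ℕ × ℕ)} {e g : ℕ} (hs : Config.Valid r l w ⟨L', A, T ++ [(e, g)]⟩)
    (hno : ∀ j ∈ A, (carry (below L' l) A j, below L' l j) ≠ (e, g)) :
    ∃ L, LowerCover r l L L' e g ∧ Config.Valid r l w ⟨L, A, T⟩ := by
  have hzero : 0 ∉ A := hs.zero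
  have hrows : ∀ p ∈ L', l < p.1 := hs.rows
  have hrc' : IsRCGraph L' := hs.rc
  have hr := hs.range (e, g) (by simp)
  simp only at hr
  have hG := hs.isRC hl
  have hperm := hs.perm
  have hch := hs.chain
  obtain ⟨⟨i, j⟩, ⟨hp, hps⟩, -⟩ := hs.lastCrossing hl hlr rfl
  simp only [Config.graph] at hG hperm hch hp hps
  have hpL : (i, j) ∈ L' := by
    rcases Finset.mem_union.mp hp with h | h
    · exact h
    · obtain ⟨h1, h2⟩ := mem_rowGraph.mp h
      simp only at h1 h2
      subst h1
      have hj1 : 1 ≤ j := Nat.one_le_iff_ne_zero.mpr fun e => hzero (e ▸ h2)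
      rw [strands_row hl hrc'.1 hrows hzero hj1] at hps
      exact absurd hps (hno j h2)
  have hi := hrows _ hpL
  simp only at hi
  rw [strands_lower hi] at hps
  have hpe := graphPerm_erase hrc'.1 hpL
  rw [hps] at hpe
  simp only at hpe
  have hrowsL : ∀ p ∈ L'.erase (i, j), l < p.1 := fun p hp => hrows p (Finset.mem_of_mem_erase hp)
  have hgL : IsGraph (L'.erase (i, j)) := hrc'.1.mono (Finset.erase_subset _ _)
  have hGe : graphPerm (L'.erase (i, j) ∪ rowGraph l A) = w * transProd T := by
    rw [graphPerm_rowUnion hl hgL hrowsL hzero, hpe, ← mul_assoc,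
      ← graphPerm_rowUnion hl hrc'.1 hrows hzero, ← hperm, transProd_snoc, mul_assoc, mul_assoc,
      Equiv.swap_mul_self, mul_one]
  -- the chain shows that removing the crossing lowers the length
  have hrc : IsRCGraph (L'.erase (i, j) ∪ rowGraph l A) := by
    rw [← erase_rowUnion (by exact hi)]
    refine hG.erase_of_permLength hp ?_
    rw [erase_rowUnion (by exact hi), hGe, ← hperm, hch.length, hch.of_append.length,
      List.length_append, List.length_singleton, add_assoc]
  obtain ⟨hrcL, hred⟩ := (isRCGraph_rowUnion hl hgL hrowsL hzero).mp hrc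
  refine ⟨L'.erase (i, j), ⟨hr.2.1, hr.2.2, hrcL, hrc', hrows,
    ⟨(i, j), Finset.notMem_erase _ _, (Finset.insert_erase hpL).symm⟩, ?_⟩,
    hrcL, hrowsL, hzero, hred, fun t ht => hs.range t (by simp [ht]), hGe.symm, hch.of_append⟩
  rw [hpe, mul_assoc, Equiv.swap_mul_self, mul_one]

/-- Move a crossing of two strands, that meet a second time in an inversely free column, from the
lower rows to this column. -/
theorem Config.Valid.unbump (hl : 1 ≤ l) {L' : Graph} {A : Finset ℕ} {T : List (ℕ × ℕ)} {j : ℕ}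
    (hs : Config.Valid r l w ⟨L', A, T⟩) (hj : InvFree r (below L' l) A j) :
    ∃ L, LowerCover r l L L' (below L' l j) (carry (below L' l) A j) ∧
      Config.Valid r l w ⟨L, insert j A, T⟩ := by
  obtain ⟨hj1, hjA, ha, hb⟩ := hj
  have hzero : 0 ∉ A := hs.zero
  have hzero' : 0 ∉ insert j A := by
    rw [Finset.mem_insert, not_or]
    exact ⟨by omega, hzero⟩
  have hrows : ∀ p ∈ L', l < p.1 := hs.rows
  have hrc' : IsRCGraph L' := hs.rc
  have hcard := hs.card hl
  have hperm := hs.perm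
  have hch := hs.chain
  simp only [Config.graph] at hcard hperm hch
  set b := carry (below L' l) A j with hbdef
  set a := below L' l j with hadef
  obtain ⟨i, hij, hiA, ei, -⟩ := exists_carry_eq (z := below L' l) hzero hj1
  rw [← hbdef] at ei
  have hab : a < b := by omega
  -- the strand `b > a` enters the row to the left of `a`, so the two have crossed below
  have hinv : graphPerm L' b < graphPerm L' a := by
    rw [ei, hadef, below, below, Equiv.apply_symm_apply, Equiv.apply_symm_apply]
    omega
  obtain ⟨p, ⟨hp, hps⟩, -⟩ := (strands_crossing hrc' hab).1 hinv
  have hi := hrows _ hp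
  have hpe := graphPerm_erase hrc'.1 hp
  rw [hps] at hpe
  simp only at hpe
  have hrowsL : ∀ q ∈ L'.erase p, l < q.1 := fun q hq => hrows q (Finset.mem_of_mem_erase hq)
  have hgL : IsGraph (L'.erase p) := hrc'.1.mono (Finset.erase_subset _ _)
  have hbe : below (L'.erase p) l = Equiv.swap a b ∘ below L' l := below_mul_swap hpe
  have hGe : graphPerm (L'.erase p ∪ rowGraph l (insert j A)) = w * transProd T := by
    rw [graphPerm_rowUnion_insert hl hgL hrowsL hzero hj1 hjA, hbe, carry_comp, ← hbdef,
      Function.comp, ← hadef, Equiv.swap_apply_left, Equiv.swap_apply_right,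
      graphPerm_rowUnion hl hgL hrowsL hzero, hpe, ← mul_assoc,
      ← graphPerm_rowUnion hl hrc'.1 hrows hzero, ← hperm, mul_assoc,
      Equiv.swap_mul_self, mul_one]
  -- neither the permutation nor the number of crossings has changed
  have hrc : IsRCGraph (L'.erase p ∪ rowGraph l (insert j A)) := by
    rw [isRCGraph_iff_card (isGraph_rowUnion hl hgL hzero'), hGe, hch.length, card_rowUnion hrowsL,
      Finset.card_insert_of_notMem hjA, Finset.card_erase_of_mem hp]
    have : 1 ≤ L'.card := Finset.card_pos.mpr ⟨p, hp⟩
    omega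
  obtain ⟨hrcL, hred⟩ := (isRCGraph_rowUnion hl hgL hrowsL hzero').mp hrc
  refine ⟨L'.erase p, ⟨ha, hb, hrcL, hrc', hrows, ⟨p, Finset.notMem_erase _ _,
    (Finset.insert_erase hp).symm⟩, ?_⟩, hrcL, hrowsL, hzero', hred, hs.range, hGe.symm, hch⟩
  rw [hpe, mul_assoc, Equiv.swap_mul_self, mul_one]

/-- Undo the reinsertion in a column where two large strands meet. -/
theorem Config.Valid.unnext (hl : 1 ≤ l) {L : Graph} {A : Finset ℕ} {T : List (ℕ × ℕ)} {e j : ℕ}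
    (hs : Config.Valid r l w ⟨L, A, T ++ [(e, below L l j), (e, carry (below L l) A j)]⟩)
    (hj : j ∈ A) : Config.Valid r l w ⟨L, A.erase j, T ++ [(e, carry (below L l) A j)]⟩ := by
  have hzero : 0 ∉ A := hs.zero
  have hzero' : 0 ∉ A.erase j := fun h => hzero (Finset.mem_of_mem_erase h)
  have hj1 : 1 ≤ j := Nat.one_le_iff_ne_zero.mpr fun e => hzero (e ▸ hj)
  have hred : RowReduced (below L l) A := hs.reduced
  have hG := hs.isRC hl
  have hperm := hs.perm
  have hch := hs.chain
  have hcard := hs.card hl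
  have hr := hs.range (e, carry (below L l) A j) (by simp)
  have hlt := hred j hj
  simp only [Config.graph] at hG hperm hch hr hcard
  set g := carry (below L l) A j with hg
  set d := below L l j with hd
  have hins := graphPerm_rowUnion_insert hl hs.rc.1 hs.rows hzero' hj1 (Finset.notMem_erase j A)
  simp only at hins
  rw [Finset.insert_erase hj, carry_erase_of_le le_rfl, ← hg, ← hd] at hins
  have e1 : T ++ [(e, d), (e, g)] = (T ++ [(e, d)]) ++ [(e, g)] := by simp
  rw [e1] at hperm hch
  have hP : w * transProd (T ++ [(e, g)]) = graphPerm (L ∪ rowGraph l (A.erase j)) := by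
    rw [hins, transProd_snoc, transProd_snoc, mul_assoc,
      ← swap_mul_swap_exchange (e := e) (g := g) (d := d) (by omega) (by omega), ← mul_assoc,
      ← mul_assoc, mul_left_inj] at hperm
    rw [transProd_snoc, ← mul_assoc, ← hperm]
  have hT0 := hch.of_append.of_append
  -- `w w(T)` maps `e`, `d`, `g` to an increasing sequence
  have h1 := hch.of_append.length
  have h2 := hch.length
  set x := w * transProd T with hx
  have hxs : InSInf x := by
    have h4 : graphPerm (L ∪ rowGraph l A) * Equiv.swap e g * Equiv.swap e d = x := by
      rw [← hperm, transProd_snoc, transProd_snoc, hx]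
      simp only [mul_assoc, Equiv.swap_mul_self, mul_one]
    rw [← h4]
    exact ((inSInf_graphPerm hG.1).mul (inSInf_swap (by omega) (by omega))).mul
      (inSInf_swap (by omega) (by omega))
  have hxs' : InSInf (x * Equiv.swap e d) := hxs.mul (inSInf_swap (by omega) (by omega))
  have h5 : permLength (x * Equiv.swap e d) = permLength x + 1 := by
    rw [hx, mul_assoc, ← transProd_snoc, h1, hT0.length]
    simp only [List.length_append, List.length_singleton, add_assoc]
  have h6 : permLength (x * Equiv.swap e d * Equiv.swap e g) =
      permLength (x * Equiv.swap e d) + 1 := by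
    rw [h5, hx, mul_assoc, mul_assoc, ← mul_assoc (transProd T), ← transProd_snoc,
      ← transProd_snoc, h2, hT0.length]
    simp only [List.length_append, List.length_singleton, add_assoc]
  have h7 := ((permLength_mul_swap_eq_succ hxs (by omega) (by omega)).mp h5).1
  have h8 := ((permLength_mul_swap_eq_succ hxs' (by omega) (by omega)).mp h6).1
  rw [Equiv.Perm.mul_apply x, Equiv.Perm.mul_apply x, Equiv.swap_apply_left,
    Equiv.swap_apply_of_ne_of_ne (by omega) (by omega)] at h8
  have h9 := permLength_mul_swap hxs (a := e) (b := g) (by omega) (by omega) (by omega)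
  have h10 : permLength x < permLength (x * Equiv.swap e g) := by omega
  have hgG := isGraph_rowUnion hl hs.rc.1 hzero'
  have hA1 : 1 ≤ A.card := Finset.card_pos.mpr ⟨j, hj⟩
  -- the length is bounded by the number of crossings
  have h11 : permLength (x * Equiv.swap e g) = L.card + (A.erase j).card := by
    refine le_antisymm ?_ ?_
    · rw [hx, mul_assoc, ← transProd_snoc, hP, ← card_rowUnion hs.rows]
      exact permLength_graphPerm_le hgG
    · rw [Finset.card_erase_of_mem hj]
      have := hT0.length
      rw [← hx] at this
      simp only [List.length_append, List.length_cons, List.length_nil] at hcard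
      omega
  have hrc : IsRCGraph (L ∪ rowGraph l (A.erase j)) := by
    rw [isRCGraph_iff_card hgG, card_rowUnion hs.rows, ← hP, transProd_snoc, ← mul_assoc, ← hx, h11]
  refine ⟨hs.rc, hs.rows, hzero', ((isRCGraph_rowUnion hl hs.rc.1 hs.rows hzero').mp hrc).2,
    fun t ht => hs.range t (by simp at ht ⊢; tauto), hP, hT0.snoc ?_⟩
  rw [transProd_snoc, ← mul_assoc, ← hx, h11, Finset.card_erase_of_mem hj]
  simp only [List.length_append, List.length_cons, List.length_nil] at hcard
  omega

/-- Every nonempty configuration is the result of a step. -/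
theorem exists_step_to (hl : 1 ≤ l) (hlr : l ≤ r) {s' : Config} (hs' : s'.Valid r l w)
    (hne : s'.word ≠ []) : ∃ o s, s.Valid r l w ∧ Step r l o s s' := by
  classical
  obtain ⟨L', A, W⟩ := s'
  obtain ⟨T, ⟨c, d⟩, rfl⟩ : ∃ T t, W = T ++ [t] :=
    ⟨_, _, (List.dropLast_append_getLast hne).symm⟩
  have hzero : 0 ∉ A := hs'.zero
  have hred : RowReduced (below L' l) A := hs'.reduced
  have hz := below_injective L' l
  have hr := hs'.range (c, d) (by simp)
  simp only at hr
  have hpos : ∀ {j}, j ∈ A → 1 ≤ j := fun hj => Nat.one_le_iff_ne_zero.mpr fun e => hzero (e ▸ hj)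
  -- the strands `c`, `d` of the last entry cross in the row: the step was an insertion or a
  -- rectification with a reinsertion at this place
  by_cases hcr : ∃ j ∈ A, (carry (below L' l) A j, below L' l j) = (c, d)
  · obtain ⟨i, hi, e⟩ := hcr
    rw [Prod.mk.injEq] at e
    obtain ⟨rfl, rfl⟩ := e
    have hi1 := hpos hi
    have hs1 := hs'.erase_last hl hi
    have hzero1 : 0 ∉ A.erase i := hs1.zero
    have hiA : i ∉ A.erase i := Finset.notMem_erase _ _
    have hci : carry (below L' l) (A.erase i) i = carry (below L' l) A i := carry_erase_of_le le_rfl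
    have hfree : Free r (below L' l) (A.erase i) i := ⟨hi1, hiA, by rw [hci]; exact hr.2.1, hr.2.2⟩
    have hA : A = insert i (A.erase i) := (Finset.insert_erase hi).symm
    by_cases hinv : ∃ j, i < j ∧ InvFree r (below L' l) (A.erase i) j
    · obtain ⟨j₀, hj₀⟩ := hinv
      -- the first place to the right from which a crossing can have been moved here
      obtain ⟨j, ⟨hij, hj⟩, hmin⟩ := Nat.findX (p := fun j => i < j ∧
        (InvFree r (below L' l) (A.erase i) j ∨ (j ∉ A.erase i ∧
          ∃ e, T.getLast? = some (e, carry (below L' l) (A.erase i) j))))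
        ⟨j₀, hj₀.1, Or.inl hj₀.2⟩
      have hmin' : ∀ k, i < k → k < j → ¬ Free r (below L' l) (A.erase i) k ∧
          ¬ FreeNext r (below L' l) (A.erase i) T k := fun k h1 h2 =>
        ⟨not_free_of_not_invFree hi1 hiA hr.2.2 h1 fun m h3 h4 h5 =>
          hmin m (h4.trans h2) ⟨h3, Or.inl h5⟩,
        fun h3 => hmin k h2 ⟨h1, Or.inr ⟨h3.2.1, h3.2.2.1⟩⟩⟩
      have hzj : r < below L' l j ∨ InvFree r (below L' l) (A.erase i) j := by
        rcases hj with hj | ⟨hjA, e, he⟩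
        · exact Or.inr hj
        · by_contra hc
          rw [not_or] at hc
          have := hs1.range _ (List.mem_of_getLast? he)
          exact hc.2 ⟨by omega, hjA, not_lt.mp hc.1, this.2.2⟩
      by_cases hjf : InvFree r (below L' l) (A.erase i) j
      · obtain ⟨L, hcov, hs⟩ := hs1.unbump hl hjf
        refine ⟨_, _, hs, Step.bump (A := insert j (A.erase i)) (Q := j) hcov
          (Finset.mem_insert_self _ _) ?_ ?_⟩
        · rw [carry_insert_of_le le_rfl]
        · rw [Finset.erase_insert hjf.2.1]
          exact ⟨i, hij, Or.inl hfree, hmin', hA, Or.inl ⟨hfree.2.2.1, by rw [hci]⟩⟩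
      · have hd := hzj.resolve_right hjf
        obtain ⟨hjA, e, he⟩ := hj.resolve_left hjf
        have hT := List.dropLast_append_getLast? _ he
        set T₀ := T.dropLast with hT₀
        rw [← hT] at hs1
        have hs2 : Config.Valid r l w ⟨L', insert j (A.erase i), T₀ ++ [(e, below L' l j),
            (e, carry (below L' l) (A.erase i) j)]⟩ :=
          Reinserted.valid (Q := j + 1) hl hlr hs1 ⟨j, Nat.lt_succ_self _,
            Or.inr ⟨by omega, hjA, ⟨e, by simp⟩, hd⟩, fun k h1 h2 => by omega, rfl,
            Or.inr ⟨(hs1.range (e, _) (by simp)).2.2, e, T₀, rfl, rfl⟩⟩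
        obtain ⟨m, hm, hmA, em, -⟩ := exists_carry_eq (z := below L' l) hzero1 (j := j) (by omega)
        have hs3 : Config.Valid r l w ⟨L', insert j (A.erase i), (T₀ ++ [(e, below L' l j)]) ++
            [(e, carry (below L' l) (A.erase i) j)]⟩ := by
          simpa using hs2
        obtain ⟨L, hcov, hs⟩ := hs3.uncover hl hlr fun k hk e' => by
          rw [em, Prod.mk.injEq] at e'
          obtain rfl := hz e'.2
          rcases Finset.mem_insert.mp hk with h | h
          · omega
          · exact hmA h
        refine ⟨_, _, hs, Step.exchange (Q := j) hcov ?_ (Finset.mem_insert_self _ _)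
          (by rw [carry_insert_of_le le_rfl]) ?_⟩
        · intro k hk e'
          rw [Prod.mk.injEq] at e'
          have hred2 : RowReduced (below L' l) (insert j (A.erase i)) := hs2.reduced
          have h1 := hred2 k hk
          have := hs2.range (e, carry (below L' l) (A.erase i) j) (by simp)
          simp only at this
          omega
        · rw [Finset.erase_insert hjA, hT]
          exact ⟨i, hij, Or.inl hfree, hmin', hA, Or.inl ⟨hfree.2.2.1, by rw [hci]⟩⟩
    · push Not at hinv
      have := Step.insertion (L := L') (T := T) (l := l) hfree fun k hk =>
        not_free_of_not_invFree hi1 hiA hr.2.2 hk fun m h1 _ => hinv m h1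
      rw [← hA, hci] at this
      exact ⟨_, _, hs1, this⟩
  · push Not at hcr
    -- otherwise the last crossing in the row was added where two large strands `d`, `f` meet, or
    -- the lower transposition was accepted
    by_cases hex : ∃ f, T.getLast? = some (c, f) ∧ ∃ j ∈ A,
        (carry (below L' l) A j, below L' l j) = (d, f)
    · obtain ⟨f, hf, i, hi, e⟩ := hex
      rw [Prod.mk.injEq] at e
      obtain ⟨rfl, rfl⟩ := e
      have hT := List.dropLast_append_getLast? _ hf
      set T₀ := T.dropLast with hT₀
      have hi1 := hpos hi
      rw [← hT] at hs'
      have hd : r < below L' l i := (hs'.range (c, below L' l i) (by simp)).2.2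
      have hs1 := Config.Valid.unnext hl (by simpa using hs') hi
      have hiA : i ∉ A.erase i := Finset.notMem_erase _ _
      have hci : carry (below L' l) (A.erase i) i = carry (below L' l) A i :=
        carry_erase_of_le le_rfl
      have hA : A = insert i (A.erase i) := (Finset.insert_erase hi).symm
      rw [← hci] at hs1
      obtain ⟨-, -, m, q, hm, hmq, hmA, hrun, hyq, -⟩ := hs1.next hl hlr hi1 hiA hd
      have hcq : carry (below L' l) (A.erase i) q ≤ r := by
        by_cases hq : q ∈ A.erase i
        · have hred1 : RowReduced (below L' l) (A.erase i) := hs1.reduced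
          have h1 := hred1 q hq
          rw [exitStrand, if_pos hq] at hyq
          omega
        · rw [exitStrand, if_neg hq] at hyq
          omega
      obtain ⟨j₀, hj₀, -, hj₀'⟩ := exists_invFree (i := i + 1) (j := q) (by omega) (by omega)
        (by rw [carry_succ_of_notMem hiA]; exact hd) hcq
      obtain ⟨j, ⟨hij, hj⟩, hmin⟩ := Nat.findX (p := fun j => i < j ∧
        InvFree r (below L' l) (A.erase i) j) ⟨j₀, by omega, hj₀'⟩
      obtain ⟨L, hcov, hs⟩ := hs1.unbump hl hj
      refine ⟨_, _, hs, Step.bump (A := insert j (A.erase i)) (Q := j) hcov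
          (Finset.mem_insert_self _ _) ?_ ?_⟩
      · rw [carry_insert_of_le le_rfl]
      · rw [Finset.erase_insert hj.2.1]
        refine ⟨i, hij, Or.inr ⟨hi1, hiA, ⟨c, by simp⟩, hd⟩, fun k h1 h2 =>
          ⟨not_free_of_not_invFree hi1 hiA hd h1 fun m h3 h4 h5 =>
            hmin m (h4.trans h2) ⟨h3, h5⟩, fun h3 => ?_⟩, hA,
          Or.inr ⟨by rw [hci]; exact hr.2.2, c, T₀, rfl, by rw [hci, ← hT]; simp⟩⟩
        obtain ⟨-, hkA, ⟨e, he⟩, hzk⟩ := h3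
        simp only [List.getLast?_append, List.getLast?_singleton, Option.some_or, Option.some.injEq,
          Prod.mk.injEq] at he
        obtain ⟨u, hu, huA, eu, -⟩ := exists_carry_eq (z := below L' l)
          (fun h => hzero (Finset.mem_of_mem_erase h)) (A := A.erase i) (j := i) (by omega)
        have h4 := he.2.symm.trans eu
        have := ((carry_eq_iff hz (fun h => hzero (Finset.mem_of_mem_erase h)) (by omega)).mp
          h4).2.2 i hu h1
        exact hiA this
    · push Not at hex
      obtain ⟨L, hcov, hs⟩ := hs'.uncover hl hlr hcr
      refine ⟨_, _, hs, Step.accept hcov ?_ hex⟩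
      intro j hj e
      rw [Prod.mk.injEq] at e
      have := hred j hj
      omega

end reverse

/-! ### The algorithms perform the steps of a row -/

theorem theUnique_eq_some {α : Type} {P : α → Prop} {x : α} (h : P x) (h' : ∀ y, P y → y = x) :
    theUnique P = some x := by
  have hu : ∃! x, P x := ⟨x, h, h'⟩
  rw [theUnique, dif_pos hu]
  exact congrArg some (h' _ hu.choose_spec.1)

theorem theUnique_eq_none {α : Type} {P : α → Prop} (h : ∀ x, ¬ P x) : theUnique P = none :=
  dif_neg fun ⟨x, hx, _⟩ => h x hx

theorem rightmost_eq_some {P : ℕ → Prop} {j : ℕ} (h : P j) (h' : ∀ k, j < k → ¬ P k) :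
    rightmost P = some j := by
  have hg : IsGreatest {k | P k} j := ⟨h, fun k hk => not_lt.mp fun hl => h' k hl hk⟩
  exact theUnique_eq_some hg fun k hk => hk.unique hg

theorem leftmost_eq_some {P : ℕ → Prop} {j : ℕ} (h : P j) (h' : ∀ k, k < j → ¬ P k) :
    leftmost P = some j := by
  have hg : IsLeast {k | P k} j := ⟨h, fun k hk => not_lt.mp fun hl => h' k hl hk⟩
  exact theUnique_eq_some hg fun k hk => hk.unique hg

section bridge

variable {r l : ℕ} {L L' : Graph} {A : Finset ℕ}

theorem allowed_iff (hl : 1 ≤ l) (hL : IsGraph L) (hrows : ∀ p ∈ L, l < p.1) (hA : 0 ∉ A) (j : ℕ) :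
    Allowed r (L ∪ rowGraph l A) l j ↔ Free r (below L l) A j := by
  refine and_congr_right fun hj => ?_
  rw [mem_rowUnion hrows, strands_row hl hL hrows hA hj]

theorem allowedNext_iff (hl : 1 ≤ l) (hL : IsGraph L) (hrows : ∀ p ∈ L, l < p.1) (hA : 0 ∉ A)
    (T : List (ℕ × ℕ)) (j : ℕ) :
    AllowedNext r (L ∪ rowGraph l A) T l j ↔ FreeNext r (below L l) A T j := by
  refine and_congr_right fun hj => ?_
  rw [mem_rowUnion hrows, strands_row hl hL hrows hA hj]

theorem invAllowed_iff (hl : 1 ≤ l) (hL : IsGraph L) (hrows : ∀ p ∈ L, l < p.1) (hA : 0 ∉ A)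
    (j : ℕ) : InvAllowed r (L ∪ rowGraph l A) l j ↔ InvFree r (below L l) A j := by
  refine and_congr_right fun hj => ?_
  rw [mem_rowUnion hrows, strands_row hl hL hrows hA hj]

theorem invAllowedNext_iff (hl : 1 ≤ l) (hL : IsGraph L) (hrows : ∀ p ∈ L, l < p.1) (hA : 0 ∉ A)
    (T : List (ℕ × ℕ)) (j : ℕ) : InvAllowedNext (L ∪ rowGraph l A) T l j ↔
      1 ≤ j ∧ j ∉ A ∧ ∃ e, T.getLast? = some (e, carry (below L l) A j) := by
  refine and_congr_right fun hj => ?_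
  rw [mem_rowUnion hrows, strands_row hl hL hrows hA hj]

theorem crossAt_rowUnion_lower (hrows : ∀ p ∈ L, l < p.1) {a b : ℕ} {q : ℕ × ℕ} :
    l < q.1 ∧ CrossAt (L ∪ rowGraph l A) a b q ↔ CrossAt L a b q := by
  constructor
  · rintro ⟨h1, h2, h3⟩
    rw [strands_lower h1] at h3
    refine ⟨(Finset.mem_union.mp h2).resolve_right fun h => ?_, h3⟩
    have := (mem_rowGraph.mp h).1
    omega
  · rintro ⟨h1, h2⟩
    have h3 := hrows q h1
    refine ⟨h3, Finset.mem_union_left _ h1, ?_⟩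
    rwa [strands_lower h3]

theorem LowerCover.crossAt {a b : ℕ} (h : LowerCover r l L L' a b) :
    ∃ q, l < q.1 ∧ L'.erase q = L ∧ ∀ p, CrossAt L' a b p ↔ p = q := by
  obtain ⟨q, hq, e⟩ := h.sub
  have hqL : q ∈ L' := e ▸ Finset.mem_insert_self _ _
  have he : L'.erase q = L := by rw [e, Finset.erase_insert hq]
  have hc : CrossAt L' a b q := by
    rw [crossAt_iff_graphPerm_erase h.rc'.1 hqL, he, h.perm, mul_assoc, Equiv.swap_mul_self,
        mul_one]
  obtain ⟨P, Q, hP, hPQ, eP, eQ, -⟩ := h.columns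
  have h1 : graphPerm L' b < graphPerm L' a := by
    rw [h.perm, Equiv.Perm.mul_apply, Equiv.Perm.mul_apply, Equiv.swap_apply_left,
      Equiv.swap_apply_right, ← eP, ← eQ, below, below, Equiv.apply_symm_apply,
      Equiv.apply_symm_apply]
    omega
  obtain ⟨q', -, hq'⟩ := existsUnique_crossAt h.rc' h.lt h1
  refine ⟨q, h.rows' q hqL, he, fun p => ⟨fun hp => ?_, fun hp => hp ▸ hc⟩⟩
  rw [hq' p hp, hq' q hc]

variable {T : List (ℕ × ℕ)} {j₀ j : ℕ}

theorem invReinsert_of_invFree (hl : 1 ≤ l) (hA : 0 ∉ A)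
    (hcov : LowerCover r l L L' (below L' l j) (carry (below L' l) A j)) (hj₀ : j₀ < j)
    (hj : InvFree r (below L' l) A j)
    (hmin : ∀ k, j₀ < k → k < j → ¬ InvFree r (below L' l) A k ∧
      ¬ (k ∉ A ∧ ∃ e, T.getLast? = some (e, carry (below L' l) A k))) :
    invReinsert r l j₀ (L' ∪ rowGraph l A) T = some (true, L ∪ rowGraph l (insert j A), T) := by
  have hg := hcov.rc'.1
  have hrows := hcov.rows'
  obtain ⟨q, hlq, hq, hq'⟩ := hcov.crossAt
  have h1 : leftmost (fun j => j₀ < j ∧ (InvAllowed r (L' ∪ rowGraph l A) l j ∨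
      InvAllowedNext (L' ∪ rowGraph l A) T l j)) = some j := by
    refine leftmost_eq_some ⟨hj₀, Or.inl ((invAllowed_iff hl hg hrows hA j).mpr hj)⟩ ?_
    rintro k hk ⟨h1, h2⟩
    rw [invAllowed_iff hl hg hrows hA, invAllowedNext_iff hl hg hrows hA] at h2
    have := hmin k h1 hk
    tauto
  have h2 : theUnique (fun q => l < q.1 ∧ CrossAt (L' ∪ rowGraph l (insert j A))
      (below L' l j) (carry (below L' l) A j) q) = some q := by
    refine theUnique_eq_some ?_ fun p hp => ?_
    · rw [crossAt_rowUnion_lower hrows, hq']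
    · rwa [crossAt_rowUnion_lower hrows, hq'] at hp
  simp only [invReinsert, h1, Option.bind_eq_bind, Option.bind_some,
    strands_row hl hg hrows hA hj.1, insert_rowUnion_row, h2, erase_rowUnion hlq, hq, hj.2.2.1,
    if_true, Option.pure_def]

theorem invReinsert_of_next (hl : 1 ≤ l) (hA : 0 ∉ A) {e : ℕ}
    (hcov : LowerCover r l L L' e (carry (below L' l) A j)) (hj₀ : j₀ < j) (hjA : j ∉ A)
    (hd : r < below L' l j)
    (hmin : ∀ k, j₀ < k → k < j → ¬ InvFree r (below L' l) A k ∧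
      ¬ (k ∉ A ∧ ∃ e', (T ++ [(e, carry (below L' l) A j)]).getLast? =
        some (e', carry (below L' l) A k))) :
    invReinsert r l j₀ (L' ∪ rowGraph l A) (T ++ [(e, carry (below L' l) A j)]) =
      some (true, L ∪ rowGraph l (insert j A), T ++ [(e, below L' l j)]) := by
  have hg := hcov.rc'.1
  have hrows := hcov.rows'
  have hj1 : 1 ≤ j := by omega
  obtain ⟨q, hlq, hq, hq'⟩ := hcov.crossAt
  have h1 : leftmost (fun k => j₀ < k ∧ (InvAllowed r (L' ∪ rowGraph l A) l k ∨
      InvAllowedNext (L' ∪ rowGraph l A) (T ++ [(e, carry (below L' l) A j)]) l k)) = some j := by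
    refine leftmost_eq_some ⟨hj₀, Or.inr ((invAllowedNext_iff hl hg hrows hA _ j).mpr
      ⟨hj1, hjA, e, by simp⟩)⟩ ?_
    rintro k hk ⟨h1, h2⟩
    rw [invAllowed_iff hl hg hrows hA, invAllowedNext_iff hl hg hrows hA] at h2
    have := hmin k h1 hk
    tauto
  have h2 : theUnique (fun q => l < q.1 ∧ CrossAt (L' ∪ rowGraph l (insert j A))
      e (carry (below L' l) A j) q) = some q := by
    refine theUnique_eq_some ?_ fun p hp => ?_
    · rw [crossAt_rowUnion_lower hrows, hq']
    · rwa [crossAt_rowUnion_lower hrows, hq'] at hp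
  simp only [invReinsert, h1, Option.bind_eq_bind, Option.bind_some,
    strands_row hl hg hrows hA hj1, insert_rowUnion_row, List.getLast?_append,
    List.getLast?_singleton, Option.some_or, h2, erase_rowUnion hlq, hq, not_le.mpr hd,
    if_false, Option.pure_def, List.dropLast_concat]

end bridge

section invStep

variable {r l : ℕ} {w : Equiv.Perm ℕ}

theorem Config.Valid.theUnique_crossAt (hl : 1 ≤ l) (hlr : l ≤ r) {s : Config} {T : List (ℕ × ℕ)}
    {e g : ℕ} (hs : s.Valid r l w) (hT : s.word = T ++ [(e, g)]) {p : ℕ × ℕ} (hp : p ∈ s.graph l)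
    (hps : strands (s.graph l) p.1 p.2 = (e, g)) :
    theUnique (CrossAt (s.graph l) e g) = some p := by
  have hr := hs.range (e, g) (by simp [hT])
  simp only at hr
  have hab : e < g := by omega
  have hG := hs.isRC hl
  refine theUnique_eq_some ⟨hp, Or.inl hps⟩ fun q hq => ?_
  obtain ⟨q', -, hq'⟩ := hs.lastCrossing hl hlr hT
  rw [hq' p ⟨hp, hps⟩, hq' q ((crossAt_iff hG hab).mp hq)]

theorem not_invFree_of_not_free {z : ℕ → ℕ} {A : Finset ℕ} {i j : ℕ}
    (h : ∀ k, i < k → k < j → ¬ Free r z A k) (hj : r < carry z A j) {k : ℕ}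
    (hik : i < k) (hkj : k < j) : ¬ InvFree r z A k := fun hk => by
  obtain ⟨m, h1, h2, h3⟩ := exists_free (r := r) (z := z) (A := A) (i := k + 1) (j := j)
    (by omega) (by omega) (by rw [carry_succ_of_notMem hk.2.1]; exact hk.2.2.1) hj
  exact h m (by omega) h2 h3

/-- The inverse algorithm undoes every step. -/
theorem Step.invStep_eq (hl : 1 ≤ l) (hlr : l ≤ r) {o : Option (ℕ × ℕ)} {s s' : Config}
    (h : Step r l o s s') (hs : s.Valid r l w) :
    invStep r l (s'.graph l) s'.word = some (o.isSome, s.graph l, s.word) := by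
  have hs' := h.valid hl hlr hs
  have hG' := hs'.isRC hl
  have hzero' : 0 ∉ s'.cols := hs'.zero
  -- the first branch of the inverse step, when the last crossing is in row `l`
  have row : ∀ {L : Graph} {A : Finset ℕ} {T : List (ℕ × ℕ)} {j : ℕ},
      s' = ⟨L, insert j A, T ++ [(carry (below L l) A j, below L l j)]⟩ → j ∉ A → 1 ≤ j →
      ((∃ k, j < k ∧ InvFree r (below L l) A k) →
        invStep r l (s'.graph l) s'.word = invReinsert r l j (L ∪ rowGraph l A) T) ∧
      ((¬ ∃ k, j < k ∧ InvFree r (below L l) A k) →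
        invStep r l (s'.graph l) s'.word = some (false, L ∪ rowGraph l A, T)) := by
    rintro L A T j rfl hjA hj1
    have hrows : ∀ p ∈ L, l < p.1 := hs'.rows
    have hzero : 0 ∉ A := fun h => hzero' (Finset.mem_insert_of_mem h)
    have hu := hs'.theUnique_crossAt hl hlr rfl (p := (l, j))
      ((mem_rowUnion hrows).mpr (Finset.mem_insert_self _ _)) (by
        simp only [Config.graph]
        rw [strands_row hl hs'.rc.1 hrows hzero' hj1, carry_insert_of_le le_rfl])
    have he : (Config.graph l ⟨L, insert j A, T ++ [(carry (below L l) A j, below L l j)]⟩).erase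
        (l, j) = L ∪ rowGraph l A := by
      rw [Config.graph, erase_rowUnion_row hrows, Finset.erase_insert hjA]
    have hiff := invAllowed_iff (r := r) hl hs'.rc.1 hrows hzero
    simp only at hiff
    simp only [← hiff, ← he]
    constructor
    · intro hk
      simp only [invStep, List.getLast?_append, List.getLast?_singleton, Option.some_or,
        Option.bind_eq_bind, Option.bind_some, hu, if_true, List.dropLast_concat, if_pos hk]
    · intro hk
      simp only [invStep, List.getLast?_append, List.getLast?_singleton, Option.some_or,
        Option.bind_eq_bind, Option.bind_some, hu, if_true, List.dropLast_concat, if_neg hk,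
        Option.pure_def]
  cases h with
  | @insertion L A T j hj hmax =>
    -- an inversely free column to the right would be followed by a free one
    refine (row rfl hj.2.1 hj.1).2 ?_
    · rintro ⟨k, hk, hkf⟩
      have hzero : 0 ∉ A := hs.zero
      obtain ⟨N, hN⟩ := exists_below_bound hs.rc.1 l
      simp only at hN
      obtain ⟨m, hm, hmA, -⟩ := exists_next_notMem A (N + r + k)
      obtain ⟨i, h1, -, h3⟩ := exists_free (r := r) (z := below L l) (A := A) (i := k + 1)
        (j := m + 1) (by omega) (by omega)
        (by rw [carry_succ_of_notMem hkf.2.1]; exact hkf.2.2.1)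
        (by rw [carry_succ_of_notMem hmA, hN m (by omega)]; omega)
      exact hmax i (by omega) h3
  | @accept L L' A T a b hcov h1 h2 =>
    obtain ⟨q, hlq, hq, hq'⟩ := hcov.crossAt
    have hrows := hcov.rows'
    have hzero : 0 ∉ A := hs.zero
    have hpos : ∀ {j}, j ∈ A → 1 ≤ j := fun hj => Nat.one_le_iff_ne_zero.mpr fun e => hzero (e ▸ hj)
    have hc := crossAt_rowUnion_lower (A := A) hrows |>.mpr ((hq' q).mpr rfl)
    have hu := hs'.theUnique_crossAt hl hlr rfl hc.2.1 ((crossAt_iff hG' hcov.lt).mp hc.2).2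
    have he : (Config.graph l ⟨L', A, T ++ [(a, b)]⟩).erase q = L ∪ rowGraph l A := by
      rw [Config.graph, erase_rowUnion hlq, hq]
    -- no crossing of the row fits the pattern of the inverse exchange
    have hm : (do
        let ef ← T.getLast?
        theUnique fun j => ef.1 = a ∧ (l, j) ∈ Config.graph l ⟨L', A, T ++ [(a, b)]⟩ ∧
          strands (Config.graph l ⟨L', A, T ++ [(a, b)]⟩) l j = (b, ef.2)) = none := by
      rcases hT : T.getLast? with _ | ⟨e, f⟩
      · rfl
      · refine theUnique_eq_none fun j => ?_
        rintro ⟨h3, h4, h5⟩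
        simp only at h3
        subst h3
        have h4' : j ∈ A := (mem_rowUnion hrows).mp h4
        rw [Config.graph, strands_row hl hcov.rc'.1 hrows hzero (hpos h4')] at h5
        exact h2 f hT j h4' h5
    simp only [invStep, List.getLast?_append, List.getLast?_singleton, Option.some_or,
      Option.bind_eq_bind, Option.bind_some, hu, hlq.ne', if_false, List.dropLast_concat,
      Option.pure_def] at hm ⊢
    rw [hm]
    simp only [he]
    rfl
  | @bump L L' A A' T T' a b Q hcov hQ h1 h2 =>
    have hs1 := bump_valid hl hs hcov hQ h1
    have hzero : 0 ∉ A.erase Q := hs1.zero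
    have hcQ : carry (below L' l) (A.erase Q) Q = b := by
      rw [carry_erase_of_le le_rfl]
      exact (Prod.mk.inj h1).1
    have hzQ : below L' l Q = a := (Prod.mk.inj h1).2
    have hQ1 : 1 ≤ Q := Nat.one_le_iff_ne_zero.mpr fun e => hs.zero (e ▸ hQ)
    have hQf : InvFree r (below L' l) (A.erase Q) Q :=
      ⟨hQ1, Finset.notMem_erase _ _, hzQ ▸ hcov.ha, hcQ ▸ hcov.hb⟩
    have hcov' := hcov
    rw [← hzQ, ← hcQ] at hcov'
    obtain ⟨j, hjQ, hsel, hmax, rfl, hT⟩ := h2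
    have hj : 1 ≤ j := hsel.elim (fun h => h.1) fun h => h.1
    have hjA : j ∉ A.erase Q := hsel.elim (fun h => h.2.1) fun h => h.2.1
    have hd : r < below L' l j := hsel.elim (fun h => h.2.2.2) fun h => h.2.2.2
    -- the inverse step selects no column before `Q`
    have hmin : ∀ k, j < k → k < Q → ¬ InvFree r (below L' l) (A.erase Q) k ∧
        ¬ (k ∉ A.erase Q ∧ ∃ e, T.getLast? = some (e, carry (below L' l) (A.erase Q) k)) := by
      intro k hk1 hk2
      have h3 := not_invFree_of_not_free (fun k h3 h4 => (hmax k h3 h4).1) hQf.2.2.2 hk1 hk2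
      refine ⟨h3, ?_⟩
      rintro ⟨hkA, e, he⟩
      have h4 := (hs.range _ (List.mem_of_getLast? he)).2.2
      refine (hmax k hk1 hk2).2 ⟨by omega, hkA, ⟨e, he⟩, ?_⟩
      by_contra h5
      exact h3 ⟨by omega, hkA, by omega, h4⟩
    have hins : insert Q (A.erase Q) = A := Finset.insert_erase hQ
    have hinv := invReinsert_of_invFree hl hzero hcov' hjQ hQf hmin
    rw [hins] at hinv
    rcases hT with ⟨hc, rfl⟩ | ⟨hc, e, T₀, rfl, rfl⟩
    · rw [(row rfl hjA hj).1 ⟨Q, hjQ, hQf⟩, hinv]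
      rfl
    · -- the last two strands cross below row `l`
      have hrows := hcov.rows'
      set g := carry (below L' l) (A.erase Q) j with hg
      have hr := hs.range (e, g) (by simp)
      simp only at hr
      obtain ⟨m, hm, hmA, em, -⟩ := exists_carry_eq (z := below L' l) hzero hj
      obtain ⟨p, ⟨hp, hps⟩, -⟩ := hs'.lastCrossing hl hlr (T := T₀ ++ [(e, below L' l j)]) (e := e)
        (g := g) (by simp)
      have hu := hs'.theUnique_crossAt hl hlr (T := T₀ ++ [(e, below L' l j)]) (by simp) hp hps
      have hpl : ¬ p.1 = l := fun hpl => by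
        obtain ⟨i, k⟩ := p
        simp only at hpl
        subst hpl
        have hk : k ∈ insert j (A.erase Q) := (mem_rowUnion hrows).mp hp
        have hk1 : 1 ≤ k := Nat.one_le_iff_ne_zero.mpr fun e => hzero' (e ▸ hk)
        simp only [Config.graph] at hps
        rw [strands_row hl hcov.rc'.1 hrows hzero' hk1, hg, em, Prod.mk.injEq] at hps
        have := below_injective _ _ hps.2
        subst this
        rcases Finset.mem_insert.mp hk with h | h
        · omega
        · exact hmA h
      have hsj : strands (L' ∪ rowGraph l (insert j (A.erase Q))) l j = (g, below L' l j) := by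
        rw [strands_row hl hcov.rc'.1 hrows hzero' hj, carry_insert_of_le le_rfl]
      have huj : theUnique (fun k => (l, k) ∈ L' ∪ rowGraph l (insert j (A.erase Q)) ∧
          strands (L' ∪ rowGraph l (insert j (A.erase Q))) l k = (g, below L' l j)) = some j := by
        refine theUnique_eq_some ⟨(mem_rowUnion hrows).mpr (Finset.mem_insert_self _ _), hsj⟩ ?_
        rintro k ⟨hk, hks⟩
        have hk : k ∈ insert j (A.erase Q) := (mem_rowUnion hrows).mp hk
        have hk1 : 1 ≤ k := Nat.one_le_iff_ne_zero.mpr fun e => hzero' (e ▸ hk)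
        rw [strands_row hl hcov.rc'.1 hrows hzero' hk1, Prod.mk.injEq] at hks
        exact below_injective _ _ hks.2
      have e1 : T₀ ++ [(e, below L' l j), (e, g)] = (T₀ ++ [(e, below L' l j)]) ++ [(e, g)] := by
        simp
      rw [e1] at hu ⊢
      simp only [Config.graph] at hu ⊢
      simp only [invStep, List.getLast?_append, List.getLast?_singleton, Option.some_or,
        Option.bind_eq_bind, Option.bind_some, hu, if_neg hpl, List.dropLast_concat,
        true_and, huj, erase_rowUnion_row hrows, Finset.erase_insert hjA]
      exact hinv
  | @exchange L L' A A' T T' a b f Q hcov h1 hQ h2 h3 =>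
    have hs1 := exchange_valid hl hlr hs hcov h1 hQ h2
    have hzero : 0 ∉ A.erase Q := hs1.zero
    have hzero0 : 0 ∉ A := hs.zero
    have hcQ : carry (below L' l) (A.erase Q) Q = b := by
      rw [carry_erase_of_le le_rfl]
      exact (Prod.mk.inj h2).1
    have hzQ : below L' l Q = f := (Prod.mk.inj h2).2
    have hf : r < f := (hs.range (a, f) (by simp)).2.2
    have hQ1 : 1 ≤ Q := Nat.one_le_iff_ne_zero.mpr fun e => hs.zero (e ▸ hQ)
    have hQA : Q ∉ A.erase Q := Finset.notMem_erase _ _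
    obtain ⟨j, hjQ, hsel, hmax, rfl, hT⟩ := h3
    have hjA : j ∉ A.erase Q := hsel.elim (fun h => h.2.1) fun h => h.2.1
    have hj1 : 1 ≤ j := hsel.elim (fun h => h.1) fun h => h.1
    obtain ⟨m, hm, hmA, em, hrun⟩ := exists_carry_eq (z := below L' l) hzero hQ1
    -- the strand `b` leaves the row only in column `Q`
    have hcb : ∀ k, k < Q → 1 ≤ k → carry (below L' l) (A.erase Q) k = b → k ∈ A.erase Q := by
      intro k hk hk1 e
      rw [← hcQ, em] at e
      obtain ⟨h4, -, -⟩ := (carry_eq_iff (below_injective _ _) hzero hk1).mp e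
      exact hrun k h4 hk
    have hc : carry (below L' l) (A.erase Q) j ≤ r := by
      rcases hsel with h | h
      · exact h.2.2.1
      · obtain ⟨e, he⟩ := h.2.2.1
        simp only [List.getLast?_append, List.getLast?_singleton, Option.some_or, Option.some.injEq,
          Prod.mk.injEq] at he
        exact absurd (hcb j hjQ hj1 he.2.symm) hjA
    obtain ⟨-, rfl⟩ := hT.resolve_right fun h => absurd hc (not_le.mpr h.1)
    have hs1' : Config.Valid r l w ⟨L', A.erase Q,
        T ++ [(a, carry (below L' l) (A.erase Q) Q)]⟩ := hcQ ▸ hs1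
    obtain ⟨-, -, p, q, hp, hpq, -, -, hyq, -⟩ := hs1'.next hl hlr hQ1 hQA (hzQ ▸ hf)
    have hcq : carry (below L' l) (A.erase Q) q ≤ r := by
      have ha := hcov.ha
      by_cases hq : q ∈ A.erase Q
      · have hred1 : RowReduced (below L' l) (A.erase Q) := hs1.reduced
        have h4 := hred1 q hq
        rw [exitStrand, if_pos hq] at hyq
        omega
      · rw [exitStrand, if_neg hq] at hyq
        omega
    -- the small strand `a` leaves the row to the right of `Q`, so some column there is inversely
    -- free
    obtain ⟨j₁, hj₁, -, hj₁'⟩ := exists_invFree (i := Q + 1) (j := q) (by omega) (by omega)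
      (by rw [carry_succ_of_notMem hQA, hzQ]; exact hf) hcq
    have hmin : ∀ k, j < k → k < Q → ¬ InvFree r (below L' l) (A.erase Q) k ∧
        ¬ (k ∉ A.erase Q ∧ ∃ e, (T ++ [(a, carry (below L' l) (A.erase Q) Q)]).getLast? =
          some (e, carry (below L' l) (A.erase Q) k)) := by
      intro k hk1 hk2
      refine ⟨not_invFree_of_not_free (fun k h3 h4 => (hmax k h3 h4).1)
        (by rw [hcQ]; exact hcov.hb) hk1 hk2, ?_⟩
      rintro ⟨hkA, e, he⟩
      simp only [List.getLast?_append, List.getLast?_singleton, Option.some_or, Option.some.injEq,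
        Prod.mk.injEq] at he
      exact hkA (hcb k hk2 (by omega) (he.2.symm.trans hcQ))
    have hinv := invReinsert_of_next hl hzero (T := T) (e := a) (by rw [hcQ]; exact hcov) hjQ hQA
      (by rw [hzQ]; exact hf) hmin
    rw [Finset.insert_erase hQ, hcQ, hzQ] at hinv
    rw [(row rfl hjA hj1).1 ⟨j₁, by omega, hj₁'⟩, hinv]
    rfl

end invStep

/-! ### Consecutive steps -/

section history

variable {r l : ℕ} {w : Equiv.Perm ℕ}

/-- The situation after the removal of the crossing in column `R`, where the large strand `z P`
passes: the rightmost free column `j` is at most `P`. -/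
theorem reinserted_facts {z : ℕ → ℕ} {A : Finset ℕ} {R j P : ℕ} (hz : z.Injective) (h0 : 0 ∉ A)
    (hred : RowReduced z A) (hjR : j < R) (hjA : j ∉ A) (hd : r < z j)
    (hmax : ∀ k, j < k → k < R → ¬ Free r z A k) (hc : carry z A R = z P) (hb : r < z P) :
    P < R ∧ P ∉ A ∧ (∀ k, P < k → k < R → k ∈ A) ∧ j ≤ P ∧
      (∀ k, j < k → k ≤ R → r < carry z A k) ∧ ∀ k, j ≤ k → k ≤ P → r < z k := by
  obtain ⟨h1, h2, h3⟩ := (carry_eq_iff hz h0 (by omega)).mp hc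
  have h4 : j ≤ P := by
    by_contra h
    exact hjA (h3 j (by omega) hjR)
  have h5 : ∀ k, j < k → k ≤ R → r < carry z A k := by
    intro k hk1 hk2
    by_contra hk3
    obtain ⟨m, h6, h7, h8⟩ := exists_free (r := r) (z := z) (A := A) (i := k) (j := R)
        (by omega) hk2
      (by omega) (by omega)
    exact hmax m (by omega) h7 h8
  refine ⟨h1, h2, h3, h4, h5, fun k hk1 hk2 => ?_⟩
  by_cases hkA : k ∈ A
  · rcases Nat.eq_or_lt_of_le hk1 with rfl | hk
    · exact hd
    · have := hred k hkA
      have := h5 k hk (by omega)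
      omega
  · have := h5 (k + 1) (by omega) (by omega)
    rwa [carry_succ_of_notMem hkA] at this

/-- The outcome of a rectification in which a crossing in column `R` is replaced by one in
column `j`; the strand `b` enters the row in column `P` after the lower swap. -/
structure Moved (r : ℕ) (z' : ℕ → ℕ) (a b P : ℕ) (A : Finset ℕ) (T : List (ℕ × ℕ)) (A' : Finset ℕ)
    (T' : List (ℕ × ℕ)) (R j : ℕ) : Prop where
  mem : R ∈ A
  lt : P < R
  notMem : P ∉ A
  run : ∀ k, P < k → k < R → k ∈ A
  one_le : 1 ≤ j
  le : j ≤ P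
  notMem' : j ∉ A
  cols : A' = insert j (A.erase R)
  carry_eq : carry z' (A.erase R) R = b
  carry_large : ∀ k, j < k → k ≤ R → r < carry z' (A.erase R) k
  large : ∀ k, j ≤ k → k ≤ P → r < z' k
  not_free : ∀ k, j < k → k < R → ¬ Free r z' (A.erase R) k
  word : (z' R = a ∧ (∀ k, j < k → k < R → ¬ FreeNext r z' (A.erase R) T k) ∧
      ((carry z' A j ≤ r ∧ T' = T ++ [(carry z' A j, z' j)]) ∨
        (r < carry z' A j ∧ ∃ e T₀, T = T₀ ++ [(e, carry z' A j)] ∧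
          T' = T₀ ++ [(e, z' j), (e, carry z' A j)]))) ∨
    ((∀ k ∈ A, (carry z' A k, z' k) ≠ (b, a)) ∧ carry z' A j ≤ r ∧ ∃ T₀ f, T = T₀ ++ [(a, f)] ∧
      z' R = f ∧ T' = T₀ ++ [(a, b), (carry z' A j, z' j)])

/-- The outcome of a rectification in which the lower transposition is accepted. -/
structure Accepted (z' : ℕ → ℕ) (a b : ℕ) (A : Finset ℕ) (T : List (ℕ × ℕ)) (A' : Finset ℕ)
    (T' : List (ℕ × ℕ)) : Prop where
  cols : A' = A
  word : T' = T ++ [(a, b)]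
  no_crossing : ∀ j ∈ A, (carry z' A j, z' j) ≠ (b, a)
  no_exchange : ∀ f, T.getLast? = some (a, f) → ∀ j ∈ A, (carry z' A j, z' j) ≠ (b, f)

/-- A rectification either accepts the lower transposition or moves a crossing. -/
theorem Step.rect_cases (hl : 1 ≤ l) (hlr : l ≤ r) {a b : ℕ} {s s' : Config}
    (h : Step r l (some (a, b)) s s') (hs : s.Valid r l w) {P : ℕ}
    (hP : below s'.lower l P = b) : LowerCover r l s.lower s'.lower a b ∧
      (Accepted (below s'.lower l) a b s.cols s.word s'.cols s'.word ∨
        ∃ R j, Moved r (below s'.lower l) a b P s.cols s.word s'.cols s'.word R j) := by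
  cases h with
  | @accept L L' A T a b hcov h1 h2 => exact ⟨hcov, Or.inl ⟨rfl, rfl, h1, h2⟩⟩
  | @bump L L' A A' T T' a b R hcov hR h1 h2 =>
    refine ⟨hcov, Or.inr ?_⟩
    have hs1 := bump_valid hl hs hcov hR h1
    obtain ⟨j, hjR, hsel, hmax, rfl, hT⟩ := h2
    have hj : 1 ≤ j := hsel.elim (fun h => h.1) fun h => h.1
    have hjA : j ∉ A.erase R := hsel.elim (fun h => h.2.1) fun h => h.2.1
    have hd : r < below L' l j := hsel.elim (fun h => h.2.2.2) fun h => h.2.2.2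
    have hc : carry (below L' l) (A.erase R) R = b := by
      rw [carry_erase_of_le le_rfl]
      exact (Prod.mk.inj h1).1
    simp only at hP
    obtain ⟨f1, f2, f3, f4, f5, f6⟩ := reinserted_facts (below_injective L' l) hs1.zero hs1.reduced
      hjR hjA hd (fun k h1 h2 => (hmax k h1 h2).1) (hc.trans hP.symm) (hP ▸ hcov.hb)
    have hcj : carry (below L' l) (A.erase R) j = carry (below L' l) A j :=
      carry_erase_of_le hjR.le
    rw [hcj] at hT
    exact ⟨R, j, hR, f1, fun h => f2 (Finset.mem_erase.mpr ⟨f1.ne, h⟩),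
      fun k h1 h2 => Finset.mem_of_mem_erase (f3 k h1 h2), hj, f4,
      fun h => hjA (Finset.mem_erase.mpr ⟨hjR.ne, h⟩), rfl, hc, f5, f6,
      fun k h1 h2 => (hmax k h1 h2).1,
      Or.inl ⟨(Prod.mk.inj h1).2, fun k h1 h2 => (hmax k h1 h2).2, hT⟩⟩
  | @exchange L L' A A' T T' a b f R hcov h1 hR h2 h3 =>
    refine ⟨hcov, Or.inr ?_⟩
    have hs1 := exchange_valid hl hlr hs hcov h1 hR h2
    have hzero : 0 ∉ A.erase R := hs1.zero
    obtain ⟨j, hjR, hsel, hmax, rfl, hT⟩ := h3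
    have hj : 1 ≤ j := hsel.elim (fun h => h.1) fun h => h.1
    have hjA : j ∉ A.erase R := hsel.elim (fun h => h.2.1) fun h => h.2.1
    have hd : r < below L' l j := hsel.elim (fun h => h.2.2.2) fun h => h.2.2.2
    have hc : carry (below L' l) (A.erase R) R = b := by
      rw [carry_erase_of_le le_rfl]
      exact (Prod.mk.inj h2).1
    simp only at hP
    obtain ⟨f1, f2, f3, f4, f5, f6⟩ := reinserted_facts (below_injective L' l) hzero hs1.reduced
      hjR hjA hd (fun k h1 h2 => (hmax k h1 h2).1) (hc.trans hP.symm) (hP ▸ hcov.hb)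
    have hcj : carry (below L' l) (A.erase R) j = carry (below L' l) A j :=
      carry_erase_of_le hjR.le
    have hsmall : carry (below L' l) A j ≤ r := by
      rcases hsel with h | h
      · exact hcj ▸ h.2.2.1
      · obtain ⟨e, he⟩ := h.2.2.1
        simp only [List.getLast?_append, List.getLast?_singleton, Option.some_or, Option.some.injEq,
          Prod.mk.injEq] at he
        have := ((carry_eq_iff (below_injective L' l) hzero hj).mp (he.2.symm.trans hP.symm)).1
        omega
    rw [hcj] at hT
    obtain ⟨-, rfl⟩ := hT.resolve_right fun h => absurd hsmall (not_le.mpr h.1)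
    exact ⟨R, j, hR, f1, fun h => f2 (Finset.mem_erase.mpr ⟨f1.ne, h⟩),
      fun k h1 h2 => Finset.mem_of_mem_erase (f3 k h1 h2), hj, f4,
      fun h => hjA (Finset.mem_erase.mpr ⟨hjR.ne, h⟩), rfl, hc, f5, f6,
      fun k h1 h2 => (hmax k h1 h2).1,
      Or.inr ⟨h1, hsmall, T, f, rfl, (Prod.mk.inj h2).2, by simp⟩⟩

/-- Column `p` is where the strand `g` of the last entry `(e g)` of the word leaves the row. -/
def Config.LastAt (l : ℕ) (s : Config) (e g p : ℕ) : Prop :=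
  s.word.getLast? = some (e, g) ∧ 1 ≤ p ∧ exitStrand (below s.lower l) s.cols p = g

theorem Config.LastAt.unique {s : Config} {e g p e' g' p' : ℕ} (h : s.LastAt l e g p)
    (h' : s.LastAt l e' g' p') (hl : 1 ≤ l) (hs : s.Valid r l w) : e = e' ∧ g = g' ∧ p = p' := by
  have h1 := h.1.symm.trans h'.1
  simp only [Option.some.injEq, Prod.mk.injEq] at h1
  refine ⟨h1.1, h1.2, exitStrand_injOn hl hs.rc.1 hs.rows hs.zero h.2.1 h'.2.1 ?_⟩
  rw [h.2.2, h'.2.2, h1.2]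

theorem Config.Valid.exists_lastAt {s : Config} (hl : 1 ≤ l) (hlr : l ≤ r) (hs : s.Valid r l w)
    (hne : s.word ≠ []) :
    ∃ e g p, s.LastAt l e g p ∧ graphPerm (s.graph l) g = l + p - 1 := by
  obtain ⟨T, ⟨e, g⟩, hT⟩ : ∃ T t, s.word = T ++ [t] :=
    ⟨_, _, (List.dropLast_append_getLast hne).symm⟩
  obtain ⟨p, q, hp, -, hyp, -, -, hG, -⟩ := hs.lastCover hl hlr hT
  exact ⟨e, g, p, ⟨by rw [hT]; simp, hp, hyp⟩, hG⟩

/-- What is known after a rectification about the column `p` of the last entry; `P` and `Q` are the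
columns where the strands of the lower transposition enter the row. -/
structure RectHistory (r : ℕ) (z : ℕ → ℕ) (A : Finset ℕ) (e g p P Q : ℕ) : Prop where
  lt : P < Q
  le : p ≤ Q
  small : z Q ≤ r
  hP : r < z P
  large : ∀ k, p ≤ k → k ≤ P → r < z k
  cases : (p ∈ A ∧ z p = g ∧ carry z A p ≤ r ∧ p ≤ P ∧ (carry z A p = e ∨
      (p = P ∧ carry z A p < z Q ∧ ∀ k, P < k → k < Q → ¬ (z Q < z k ∧ z k < z P)))) ∨
    (p ∉ A ∧ carry z A p = g ∧ (p ≤ P ∨ ∀ k, P < k → k < p → k ∈ A))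

/-- After an insertion in column `p` only large strands enter the row from `p` on, and only large
ones leave the row to the right of it. -/
theorem Step.history_insertion {s s' : Config} (h : Step r l none s s') (hl : 1 ≤ l)
    (hlr : l ≤ r) (hs : s.Valid r l w) {e g p : ℕ} (hp : s'.LastAt l e g p) :
    p ∈ s'.cols ∧ carry (below s'.lower l) s'.cols p = e ∧ below s'.lower l p = g ∧
      (∀ k, p ≤ k → r < below s'.lower l k) ∧
      ∀ k, p < k → r < exitStrand (below s.lower l) s.cols k := by
  have hs' := h.valid hl hlr hs
  cases h with
  | @insertion L A T j hj hmax =>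
    have hj' : Config.LastAt l ⟨L, insert j A, T ++ [(carry (below L l) A j, below L l j)]⟩
        (carry (below L l) A j) (below L l j) j :=
      ⟨by simp, hj.1, by simp [exitStrand]⟩
    obtain ⟨rfl, rfl, rfl⟩ := hp.unique hj' hl hs'
    have hlarge : ∀ k, p < k → r < carry (below L l) A k := by
      intro k hk
      by_contra hc
      obtain ⟨N, hN⟩ := exists_below_bound hs.rc.1 l
      simp only at hN
      obtain ⟨m, hm, hmA, -⟩ := exists_next_notMem A (N + r + k)
      obtain ⟨i, h1, -, h3⟩ := exists_free (r := r) (z := below L l) (A := A) (i := k)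
        (j := m + 1) (by omega) (by omega) (by omega)
        (by rw [carry_succ_of_notMem hmA, hN m (by omega)]; omega)
      exact hmax i (by omega) h3
    have hred : RowReduced (below L l) A := hs.reduced
    refine ⟨Finset.mem_insert_self _ _, carry_insert_of_le le_rfl, rfl, fun k hk => ?_,
      fun k hk => ?_⟩
    · rcases Nat.eq_or_lt_of_le hk with rfl | hk'
      · exact hj.2.2.2
      by_cases hkA : k ∈ A
      · have := hred k hkA
        have := hlarge k hk'
        simp only
        omega
      · have := hlarge (k + 1) (by omega)
        rwa [carry_succ_of_notMem hkA] at this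
    · simp only [exitStrand]
      split_ifs with hkA
      · have := hred k hkA
        have := hlarge k hk
        omega
      · exact hlarge k hk

theorem swap_comp_apply {z : ℕ → ℕ} (hz : z.Injective) {P Q k : ℕ} (h1 : k ≠ P) (h2 : k ≠ Q) :
    (Equiv.swap (z P) (z Q) ∘ z) k = z k :=
  Equiv.swap_apply_of_ne_of_ne (hz.ne h1) (hz.ne h2)

/-- The columns where the strands of the lower transposition enter the row after the swap. -/
theorem LowerCover.columns' {L L' : Graph} {a b : ℕ} (h : LowerCover r l L L' a b) :
    ∃ P Q, 1 ≤ P ∧ P < Q ∧ below L' l P = b ∧ below L' l Q = a ∧ below L l P = a ∧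
      below L l Q = b ∧ (∀ k, k ≠ P → k ≠ Q → below L' l k = below L l k) ∧
      ∀ k, P < k → k < Q → ¬ (a < below L' l k ∧ below L' l k < b) := by
  obtain ⟨P, Q, hP, hPQ, rfl, rfl, hnb⟩ := h.columns
  have h1 : ∀ k, k ≠ P → k ≠ Q → below L' l k = below L l k := fun k h1 h2 => by
    rw [h.below_eq]
    exact swap_comp_apply (below_injective L l) h1 h2
  refine ⟨P, Q, hP, hPQ, ?_, ?_, rfl, rfl, h1, fun k hk1 hk2 => ?_⟩
  · rw [h.below_eq]
    simp
  · rw [h.below_eq]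
    simp
  · rw [h1 k (by omega) (by omega)]
    exact hnb k hk1 hk2

/-- Where the last entry `(a b)` leaves the row after it was accepted. -/
theorem Accepted.column {L' : Graph} {A A' : Finset ℕ} {T T' : List (ℕ × ℕ)} {a b P Q p : ℕ}
    (hl : 1 ≤ l) (hs : Config.Valid r l w ⟨L', A', T'⟩)
    (h : Accepted (below L' l) a b A T A' T') (hPQ : P < Q)
    (hP1 : 1 ≤ P) (hP : below L' l P = b) (hQ : below L' l Q = a) (hp1 : 1 ≤ p)
    (hp : exitStrand (below L' l) A' p = b) :
    (P ∈ A ∧ p = P) ∨ (P ∉ A ∧ P < p ∧ p ≤ Q ∧ p ∉ A ∧ ∀ k, P < k → k < p → k ∈ A) := by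
  obtain rfl := h.cols
  have huniq : ∀ m, 1 ≤ m → exitStrand (below L' l) A' m = b → p = m := fun m hm e =>
    exitStrand_injOn hl hs.rc.1 hs.rows hs.zero hp1 hm (hp.trans e.symm)
  by_cases hPA : P ∈ A'
  · exact Or.inl ⟨hPA, huniq P hP1 (by rw [exitStrand, if_pos hPA, hP])⟩
  · obtain ⟨m, hm, hmA, hrun⟩ := exists_next_notMem A' P
    have hcm := carry_eq_of_run (z := below L' l) hm hPA hrun
    obtain rfl := huniq m (by omega) (by rw [exitStrand, if_neg hmA, hcm, hP])
    refine Or.inr ⟨hPA, hm, ?_, hmA, hrun⟩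
    by_contra hc
    refine h.no_crossing Q (hrun Q hPQ (by omega)) ?_
    rw [carry_eq_of_run hPQ hPA fun i h1 h2 => hrun i h1 (by omega), hP, hQ]

/-- Where the last entry leaves the row after a crossing was moved to column `j`: in this column,
or, if two large strands meet there, at the next non-crossing. -/
theorem Moved.column {L' : Graph} {A A' : Finset ℕ} {T T' : List (ℕ × ℕ)} {a b P p R j e g : ℕ}
    (hl : 1 ≤ l) (hs : Config.Valid r l w ⟨L', A', T'⟩)
    (h : Moved r (below L' l) a b P A T A' T' R j)
    (hp : Config.LastAt l ⟨L', A', T'⟩ e g p) :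
    (p = j ∧ p ∈ A' ∧ below L' l p = g ∧ carry (below L' l) A' p = e ∧ e ≤ r) ∨
      (r < carry (below L' l) A j ∧ (∃ T₀, T = T₀ ++ [(e, g)]) ∧ g = carry (below L' l) A j ∧
        p ∉ A' ∧ carry (below L' l) A' p = g ∧ j < p ∧ (p ≤ P ∨ (j = P ∧ p = R))) := by
  have hlast := hp.1
  have hcj : carry (below L' l) A' j = carry (below L' l) A j := by
    rw [h.cols, carry_insert_of_le le_rfl, carry_erase_of_le (by have := h.lt; have := h.le; omega)]
  have huniq : ∀ m, 1 ≤ m → exitStrand (below L' l) A' m = g → p = m := fun m hm e =>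
    exitStrand_injOn hl hs.rc.1 hs.rows hs.zero hp.2.1 hm (hp.2.2.trans e.symm)
  have hjA' : j ∈ A' := h.cols ▸ Finset.mem_insert_self _ _
  have free : carry (below L' l) A j ≤ r →
      T'.getLast? = some (carry (below L' l) A j, below L' l j) →
      (p = j ∧ p ∈ A' ∧ below L' l p = g ∧ carry (below L' l) A' p = e ∧ e ≤ r) := by
    intro h1 h2
    have h3 := hlast.symm.trans h2
    simp only [Option.some.injEq, Prod.mk.injEq] at h3
    obtain ⟨rfl, rfl⟩ := h3
    obtain rfl := huniq j h.one_le (by rw [exitStrand, if_pos hjA'])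
    exact ⟨rfl, hjA', rfl, hcj, h1⟩
  rcases h.word with ⟨-, -, h1 | ⟨h1, e', T₀, h2, h3⟩⟩ | ⟨-, h1, T₀, f, h2, h3, h4⟩
  · exact Or.inl (free h1.1 (by rw [h1.2]; simp))
  · right
    have h4 := hlast
    simp only [h3, List.getLast?_append, List.getLast?_cons, List.getLast?_nil, Option.getD_none,
      Option.getD_some, Option.some_or, Option.some.injEq, Prod.mk.injEq] at h4
    obtain ⟨rfl, rfl⟩ := h4
    obtain ⟨m, hm, hmA, hrun⟩ := exists_next_notMem A' j
    have hcm : carry (below L' l) A' m = carry (below L' l) A j := by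
      rw [← hcj]
      refine carry_run hm.le fun k h5 h6 => ?_
      rcases Nat.eq_or_lt_of_le h5 with rfl | h5
      · exact hjA'
      · exact hrun k h5 h6
    obtain rfl := huniq m (by omega) (by rw [exitStrand, if_neg hmA, hcm])
    refine ⟨h1, ⟨T₀, h2⟩, rfl, hmA, hcm, hm, ?_⟩
    have hlt := h.lt
    rcases Nat.eq_or_lt_of_le h.le with hjP | hjP
    · right
      refine ⟨hjP, ?_⟩
      have hR : R ∉ A' := by
        rw [h.cols, Finset.mem_insert, not_or]
        exact ⟨by omega, Finset.notMem_erase _ _⟩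
      rcases lt_trichotomy p R with h5 | h5 | h5
      · refine absurd ?_ hmA
        rw [h.cols]
        exact Finset.mem_insert_of_mem (Finset.mem_erase.mpr ⟨h5.ne, h.run p (by omega) h5⟩)
      · exact h5
      · exact absurd (hrun R (by omega) h5) hR
    · left
      by_contra hc
      have h5 := hrun P hjP (by omega)
      rw [h.cols, Finset.mem_insert] at h5
      rcases h5 with h5 | h5
      · omega
      · exact h.notMem (Finset.mem_of_mem_erase h5)
  · exact Or.inl (free h1 (by rw [h4]; simp))

/-- Every rectification has the properties listed in `RectHistory`. -/
theorem Step.history_rect {s s' : Config} {a b : ℕ} (h : Step r l (some (a, b)) s s') (hl : 1 ≤ l)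
    (hlr : l ≤ r) (hs : s.Valid r l w) {e g p : ℕ} (hp : s'.LastAt l e g p) :
    ∃ P Q, below s'.lower l P = b ∧ below s'.lower l Q = a ∧
      RectHistory r (below s'.lower l) s'.cols e g p P Q := by
  have hs' := h.valid hl hlr hs
  have hcov : LowerCover r l s.lower s'.lower a b := by
    cases h <;> assumption
  obtain ⟨P, Q, hP1, hPQ, hP, hQ, hP0, hQ0, hne, hnb⟩ := hcov.columns'
  have ha := hcov.ha
  have hb := hcov.hb
  refine ⟨P, Q, hP, hQ, ?_⟩
  obtain ⟨L, A, T⟩ := s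
  obtain ⟨L', A', T'⟩ := s'
  simp only at hP hQ hP0 hQ0 hne hnb
  obtain ⟨-, hacc | ⟨R, j, hm⟩⟩ := h.rect_cases hl hlr hs hP
  · simp only at hacc
    have h1 := hp.1
    simp only [hacc.word, List.getLast?_append, List.getLast?_singleton, Option.some_or,
      Option.some.injEq, Prod.mk.injEq] at h1
    obtain ⟨rfl, rfl⟩ := h1
    have hcases := hacc.column hl hs' hPQ hP1 hP hQ hp.2.1 hp.2.2
    obtain rfl := hacc.cols
    rcases hcases with ⟨hPA, rfl⟩ | ⟨hPA, hPp, hpQ, hpA, hrun⟩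
    · have hzero : 0 ∉ A' := hs.zero
      have hred : RowReduced (below L l) A' := hs.reduced
      have hc : carry (below L' l) A' p < a := by
        rw [carry_congr (z' := below L l) (A' := A') hP1
          fun i hi => ⟨hne i (by omega) (by omega), Iff.rfl⟩, ← hP0]
        exact hred p hPA
      refine ⟨hPQ, hPQ.le, by simp only; omega, by simp only; omega, fun k h1 h2 => ?_,
        Or.inl ⟨hPA, hP, by simp only; omega, le_rfl, Or.inr ⟨rfl, by rw [hQ]; exact hc, ?_⟩⟩⟩
      · obtain rfl : k = p := by omega
        simp only
        omega
      · simp only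
        rw [hQ, hP]
        exact hnb
    · refine ⟨hPQ, hpQ, by simp only; omega, by simp only; omega, fun k h1 h2 => by omega,
        Or.inr ⟨hpA, ?_, Or.inr hrun⟩⟩
      simp only
      rw [carry_eq_of_run hPp hPA hrun, hP]
  · simp only at hm
    have hlt := hm.lt
    have hle := hm.le
    have hRQ : R ≤ Q := by
      by_contra hc
      have hQA := hm.run Q hPQ (by omega)
      -- in the crossing of column `Q` the strand `b` would be carried after the swap
      have h1 : carry (below L' l) A Q = b := by
        rw [← hP]
        exact carry_eq_of_run hPQ hm.notMem fun k h1 h2 => hm.run k h1 (by omega)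
      rcases hm.word with ⟨h3, -⟩ | ⟨h3, -⟩
      · exact hc (below_injective L' l (h3.trans hQ.symm)).le
      · exact h3 Q hQA (by rw [h1, hQ])
    rcases hm.column hl hs' hp with ⟨rfl, hpA, h1, h2, h3⟩ | ⟨h1, ⟨T₀, h2⟩, rfl, hpA, hcp, hjp, h3⟩
    · exact ⟨hPQ, by omega, by simp only; omega, by simp only; omega, hm.large,
        Or.inl ⟨hpA, h1, by simp only; omega, hle, Or.inl h2⟩⟩
    · refine ⟨hPQ, by omega, by simp only; omega, by simp only; omega,
        fun k h4 h5 => hm.large k (by omega) h5, Or.inr ⟨hpA, hcp, ?_⟩⟩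
      rcases h3 with h3 | ⟨rfl, rfl⟩
      · exact Or.inl h3
      · refine Or.inr fun k h4 h5 => ?_
        simp only
        rw [hm.cols]
        exact Finset.mem_insert_of_mem (Finset.mem_erase.mpr ⟨h5.ne, hm.run k h4 h5⟩)

end history

/-! ### The places of consecutive steps -/

section consecutive

variable {r l : ℕ} {w : Equiv.Perm ℕ} {s s' s'' : Config}

theorem Config.LastAt.range {e g p : ℕ} (hs : s.Valid r l w) (hp : s.LastAt l e g p) :
    1 ≤ e ∧ e ≤ r ∧ r < g := hs.range _ (List.mem_of_getLast? hp.1)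

/-- An insertion is to the right of the preceding step. -/
theorem Step.lt_of_insertion {o : Option (ℕ × ℕ)} (h : Step r l o s s')
    (h' : Step r l none s' s'') (hl : 1 ≤ l) (hlr : l ≤ r) (hs : s.Valid r l w)
    {e g p e' g' p' : ℕ} (hp : s'.LastAt l e g p) (hp' : s''.LastAt l e' g' p') : p < p' := by
  have hs' := h.valid hl hlr hs
  have hs'' := h'.valid hl hlr hs'
  have hr := hp.range hs'
  have hred : RowReduced (below s'.lower l) s'.cols := hs'.reduced
  -- a small strand is carried to the right of `p`, so a free column follows
  obtain ⟨i, hpi, hi⟩ : ∃ i, p < i ∧ carry (below s'.lower l) s'.cols i ≤ r := by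
    rcases o with _ | ⟨a, b⟩
    · obtain ⟨h1, h2, -⟩ := h.history_insertion hl hlr hs hp
      exact ⟨p + 1, by omega, by rw [carry_succ_of_mem h1, h2]; exact hr.2.1⟩
    · obtain ⟨P, Q, -, -, hh⟩ := h.history_rect hl hlr hs hp
      have h1 := hh.le
      have h2 := hh.small
      refine ⟨Q + 1, by omega, ?_⟩
      by_cases hQ : Q ∈ s'.cols
      · rw [carry_succ_of_mem hQ]
        have := hred Q hQ
        omega
      · rwa [carry_succ_of_notMem hQ]
  cases h' with
  | @insertion L A T j hj hmax =>
    have hj' : Config.LastAt l ⟨L, insert j A, T ++ [(carry (below L l) A j, below L l j)]⟩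
        (carry (below L l) A j) (below L l j) j :=
      ⟨by simp, hj.1, by simp [exitStrand]⟩
    obtain ⟨-, -, rfl⟩ := hp'.unique hj' hl hs''
    simp only at hi
    by_contra hc
    obtain ⟨N, hN⟩ := exists_below_bound hs'.rc.1 l
    simp only at hN
    obtain ⟨m, hm, hmA, -⟩ := exists_next_notMem A (N + r + i)
    obtain ⟨k, h1, -, h3⟩ := exists_free (r := r) (z := below L l) (A := A) (i := i)
      (j := m + 1) (by omega) (by omega) hi
      (by rw [carry_succ_of_notMem hmA, hN m (by omega)]; omega)
    exact hmax k (by omega) h3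

/-- If an accepted lower transposition `(a b)` follows an entry whose small strand `a` passes the
column `p` of this entry as the horizontal strand, then one of the reasons for not accepting it
would apply. -/
theorem Accepted.false_of_carry {z z' : ℕ → ℕ} {A A' : Finset ℕ} {T T' : List (ℕ × ℕ)}
    {a b g p Q : ℕ} (h : Accepted z' a b A T A' T') (hpA : p ∈ A) (hT : T.getLast? = some (a, g))
    (hg : z p = g) (hc : carry z' A p = b) (hne : p ≠ Q → z' p = z p) (hQ : z' Q = a) : False := by
  by_cases hpQ : p = Q
  · subst hpQ
    exact h.no_crossing p hpA (by rw [hc, hQ])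
  · exact h.no_exchange g hT p hpA (by rw [hc, hne hpQ, hg])

/-- A rectification is to the left of a preceding insertion. -/
theorem Step.gt_of_rect_after_insertion {a b : ℕ} (h : Step r l none s s')
    (h' : Step r l (some (a, b)) s' s'') (hl : 1 ≤ l) (hlr : l ≤ r) (hs : s.Valid r l w)
    {e g p e' g' p' : ℕ} (hp : s'.LastAt l e g p) (hp' : s''.LastAt l e' g' p') : p' < p := by
  have hs' := h.valid hl hlr hs
  have hs'' := h'.valid hl hlr hs'
  obtain ⟨hpA, hcp, hzp, hlarge, -⟩ := h.history_insertion hl hlr hs hp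
  have hcov : LowerCover r l s'.lower s''.lower a b := by cases h' <;> assumption
  obtain ⟨P, Q, hP1, hPQ, hP, hQ, hP0, hQ0, hne, hnb⟩ := hcov.columns'
  have ha := hcov.ha
  -- from column `p` on only large strands entered the row, but in column `P` the small strand `a`
  -- did
  have hPp : P < p := by
    by_contra hc
    have := hlarge P (by omega)
    omega
  obtain ⟨-, hacc | ⟨R, j, hm⟩⟩ := h'.rect_cases hl hlr hs' hP
  · have h1 := hp'.1
    simp only [hacc.word, List.getLast?_append, List.getLast?_singleton, Option.some_or,
      Option.some.injEq, Prod.mk.injEq] at h1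
    obtain ⟨rfl, rfl⟩ := h1
    rcases hacc.column hl hs'' hPQ hP1 hP hQ hp'.2.1 hp'.2.2 with ⟨-, rfl⟩ |
      ⟨hPA, hPp', hpQ, hpA', hrun⟩
    · exact hPp
    · by_contra hc
      have hpp' : p ≠ p' := fun h => hpA' (h ▸ hpA)
      have hrun' : ∀ k, P < k → k < p → k ∈ s'.cols := fun k h1 h2 => hrun k h1 (by omega)
      have hca := carry_eq_of_run (z := below s'.lower l) hPp hPA hrun'
      rw [hcp, hP0] at hca
      subst hca
      exact hacc.false_of_carry hpA hp.1 hzp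
        (by rw [carry_eq_of_run hPp hPA hrun', hP]) (hne p hPp.ne') hQ
  · have hle := hm.le
    rcases hm.column hl hs'' hp' with ⟨rfl, -⟩ | ⟨h1, ⟨T₀, h2⟩, h3, -, -, hjp, h4⟩
    · omega
    · have h5 := hp.1
      simp only [h2, List.getLast?_append, List.getLast?_singleton, Option.some_or,
        Option.some.injEq, Prod.mk.injEq] at h5
      obtain ⟨rfl, rfl⟩ := h5
      obtain ⟨i, hi, hiA, ei, -⟩ := exists_carry_eq (z := below s''.lower l) hs'.zero hm.one_le
      rw [← h3] at ei
      rw [hne i (by omega) (by omega), ← hzp] at ei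
      have := below_injective _ _ ei
      omega

/-- The columns where the strand `b` of the lower transposition enters the row after two
consecutive rectifications are ordered as the columns of the last entries. -/
theorem Step.rect_rect {a b a' b' : ℕ} (h : Step r l (some (a, b)) s s')
    (h' : Step r l (some (a', b')) s' s'') (hl : 1 ≤ l) (hlr : l ≤ r) (hs : s.Valid r l w)
    {e g p e' g' p' : ℕ} (hp : s'.LastAt l e g p) (hp' : s''.LastAt l e' g' p') :
    (graphPerm s'.lower b < graphPerm s''.lower b' ∧ p < p') ∨
      (graphPerm s''.lower b' < graphPerm s'.lower b ∧ p' < p) := by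
  have hs' := h.valid hl hlr hs
  have hs'' := h'.valid hl hlr hs'
  obtain ⟨P₁, Q₁, hP₁, hQ₁, hh⟩ := h.history_rect hl hlr hs hp
  have hcov : LowerCover r l s'.lower s''.lower a' b' := by cases h' <;> assumption
  obtain ⟨P, Q, hP1, hPQ, hP, hQ, hP0, hQ0, hne, hnb⟩ := hcov.columns'
  have ha := hcov.ha
  have hb := hcov.hb
  have hr := hp.range hs'
  have hhP := hh.hP
  have hlt := hh.lt
  have hle := hh.le
  have hzero : 0 ∉ s'.cols := hs'.zero
  have hred : RowReduced (below s'.lower l) s'.cols := hs'.reduced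
  have e1 : graphPerm s'.lower b = l + P₁ := by rw [← hP₁, below, Equiv.apply_symm_apply]
  have e2 : graphPerm s''.lower b' = l + P := by rw [← hP, below, Equiv.apply_symm_apply]
  rw [e1, e2]
  have hPP : P₁ ≠ P := fun h => by
    rw [h, hP0] at hhP
    omega
  -- the carried strands up to column `P` are not affected by the lower swap
  have hcongr : ∀ k, 1 ≤ k → k ≤ P →
      carry (below s''.lower l) s'.cols k = carry (below s'.lower l) s'.cols k := fun k hk1 hk2 =>
    carry_congr hk1 fun i hi => ⟨hne i (by omega) (by omega), Iff.rfl⟩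
  have hnext : ∀ k, 1 ≤ k → k ≤ P → k ∉ s'.cols → carry (below s''.lower l) s'.cols k = g →
      k = p := by
    intro k hk1 hk2 hkA hk
    rw [hcongr k hk1 hk2] at hk
    exact exitStrand_injOn hl hs'.rc.1 hs'.rows hs'.zero hk1 hp.2.1
      (by rw [exitStrand, if_neg hkA, hk, hp.2.2])
  -- after the two steps `b` enters the row in column `P₁` and `b'` in column `P`
  rcases lt_or_gt_of_ne hPP with hlt' | hgt'
  · left
    refine ⟨by omega, ?_⟩
    have hpP : p ≤ P := by
      by_contra hc
      rcases hh.cases with ⟨-, -, -, h1, -⟩ | ⟨hpA, hcp, h1 | h1⟩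
      · omega
      · omega
      · have hPA := h1 P hlt' (by omega)
        have h2 := hred P hPA
        rw [hP0] at h2
        have h3 : carry (below s'.lower l) s'.cols p = carry (below s'.lower l) s'.cols P :=
          carry_run (by omega) fun k h3 h4 => h1 k (by omega) h4
        omega
    obtain ⟨-, hacc | ⟨R, j, hm⟩⟩ := h'.rect_cases hl hlr hs' hP
    · have h1 := hp'.1
      simp only [hacc.word, List.getLast?_append, List.getLast?_singleton, Option.some_or,
        Option.some.injEq, Prod.mk.injEq] at h1
      obtain ⟨rfl, rfl⟩ := h1
      rcases hacc.column hl hs'' hPQ hP1 hP hQ hp'.2.1 hp'.2.2 with ⟨hPA, rfl⟩ | ⟨-, h1, -⟩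
      · rcases hh.cases with ⟨-, -, -, h1, -⟩ | ⟨hpA, -⟩
        · omega
        · have : p ≠ p' := fun h => hpA (h ▸ hPA)
          omega
      · omega
    · have hjP := hm.le
      have hPR := hm.lt
      have hzero1 : 0 ∉ s'.cols.erase R := fun h => hzero (Finset.mem_of_mem_erase h)
      have hcR : ∀ k, k ≤ R → carry (below s''.lower l) (s'.cols.erase R) k =
          carry (below s''.lower l) s'.cols k := fun k hk => carry_erase_of_le hk
      -- a free column to the right of `p`, or `p` itself
      have key : ∀ k, 1 ≤ k → k ≤ P → carry (below s'.lower l) s'.cols k ≤ r → k ≤ j := by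
        intro k hk1 hk2 hk3
        by_contra hc
        obtain ⟨i, h1, h2, h3⟩ := exists_free (r := r) (z := below s''.lower l)
          (A := s'.cols.erase R) (i := k) (j := R) hk1 (by omega)
          (by rw [hcR k (by omega), hcongr k hk1 hk2]; exact hk3) (by rw [hm.carry_eq]; exact hb)
        exact hm.not_free i (by omega) h2 h3
      have hp1 := hp.2.1
      rcases hh.cases with ⟨hpA, hzp, hcp, h1, -⟩ | ⟨hpA, hcp, -⟩
      · have h2 := key (p + 1) (by omega) (by omega) (by rw [carry_succ_of_mem hpA]; exact hcp)
        rcases hm.column hl hs'' hp' with ⟨rfl, -⟩ | ⟨-, -, -, -, -, h3, -⟩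
        · omega
        · omega
      -- otherwise `p` or a column to the right of it would have been chosen
      · have hpj : p ≤ j := by
          by_contra hc
          by_cases hz : r < below s''.lower l p
          · rcases hm.word with ⟨-, h2, -⟩ | ⟨-, -, T₀, f, h2, h3, -⟩
            · refine h2 p (by omega) (by omega) ⟨hp1, fun h => hpA (Finset.mem_of_mem_erase h),
                ⟨e, ?_⟩, hz⟩
              rw [hcR p (by omega), hcongr p hp1 hpP, hcp, hp.1]
            · have h4 := hp.1
              simp only [h2, List.getLast?_append, List.getLast?_singleton, Option.some_or,
                Option.some.injEq, Prod.mk.injEq] at h4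
              obtain ⟨rfl, rfl⟩ := h4
              have hRQ : R ≠ Q := fun h => by
                rw [h, hQ] at h3
                omega
              have h5 : exitStrand (below s'.lower l) s'.cols R = f := by
                rw [exitStrand, if_pos hm.mem, ← hne R (by omega) hRQ, h3]
              have := exitStrand_injOn hl hs'.rc.1 hs'.rows hs'.zero hp1 (by omega)
                (hp.2.2.trans h5.symm)
              omega
          · have hpP' : p ≠ P := fun h => by
              rw [h, hP] at hz
              omega
            have h2 : below s'.lower l p ≤ r := by
              rw [← hne p hpP' (by omega)]
              omega
            have := key (p + 1) (by omega) (by omega) (by rw [carry_succ_of_notMem hpA]; exact h2)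
            omega
        rcases hm.column hl hs'' hp' with ⟨rfl, -, -, h3, h4⟩ | ⟨-, -, -, -, -, h3, -⟩
        · rcases Nat.eq_or_lt_of_le hpj with rfl | h5
          · rw [hm.cols, carry_insert_of_le le_rfl, hcR p (by omega), hcongr p hp1 hpP, hcp] at h3
            omega
          · exact h5
        · omega
  · right
    refine ⟨by omega, ?_⟩
    have hpP : P < p := by
      by_contra hc
      have := hh.large P (by omega) (by omega)
      omega
    obtain ⟨-, hacc | ⟨R, j, hm⟩⟩ := h'.rect_cases hl hlr hs' hP
    · have h1 := hp'.1
      simp only [hacc.word, List.getLast?_append, List.getLast?_singleton, Option.some_or,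
        Option.some.injEq, Prod.mk.injEq] at h1
      obtain ⟨rfl, rfl⟩ := h1
      rcases hacc.column hl hs'' hPQ hP1 hP hQ hp'.2.1 hp'.2.2 with ⟨-, rfl⟩ |
        ⟨hPA, hPp', hpQ, hpA', hrun⟩
      · exact hpP
      · by_contra hc
        have hrun' : ∀ k, P < k → k < p → k ∈ s'.cols := fun k h1 h2 => hrun k h1 (by omega)
        have hca := carry_eq_of_run (z := below s'.lower l) hpP hPA hrun'
        rw [hP0] at hca
        rcases hh.cases with ⟨hpA, hzp, hcp, h1, rfl | ⟨rfl, h2, h3⟩⟩ | ⟨hpA, hcp, -⟩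
        · rw [hca] at hp hcp
          exact hacc.false_of_carry hpA hp.1 hzp
            (by rw [carry_eq_of_run hpP hPA hrun', hP]) (hne p hpP.ne') hQ
        · have hpp' : p ≠ p' := fun h => hpA' (h ▸ hpA)
          have hpQ' : p < Q := by omega
          have h4 := hnb p hpP hpQ'
          rw [hne p (by omega) (by omega), hP₁] at h4
          rw [hP₁, hQ₁] at h3
          have hs1 := hh.small
          rw [hP₁] at hhP
          rw [hQ₁] at hs1 h2
          have hz := below_injective s'.lower l
          have h5 : b ≠ b' := fun h => by
            rw [h, ← hQ0] at hP₁
            have := hz hP₁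
            omega
          have hQQ : Q < Q₁ := by
            by_contra hc
            rcases Nat.eq_or_lt_of_le (not_lt.mp hc) with h6 | h6
            · rw [← h6, hQ₁] at hQ0
              omega
            · have h7 := hnb Q₁ (by omega) h6
              rw [hne Q₁ (by omega) (by omega), hQ₁] at h7
              omega
          have h6 := h3 Q hpQ' hQQ
          rw [hQ0] at h6
          omega
        · have hpp' : p = p' := by
            by_contra h
            exact hpA (hrun p hpP (by omega))
          omega
    · have hle := hm.le
      rcases hm.column hl hs'' hp' with ⟨rfl, -⟩ | ⟨h1, ⟨T₀, h2⟩, h3, -, -, hjp, h4⟩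
      · omega
      · have h5 := hp.1
        simp only [h2, List.getLast?_append, List.getLast?_singleton, Option.some_or,
          Option.some.injEq, Prod.mk.injEq] at h5
        obtain ⟨rfl, rfl⟩ := h5
        have := hnext j hm.one_le hle hm.notMem' h3.symm
        omega

end consecutive

/-! ### Steps over a semi-shuffle -/

section semi

variable {r l : ℕ} {w : Equiv.Perm ℕ}

theorem IsSemiShuffle.lt {u : Equiv.Perm ℕ} (h : IsSemiShuffle r u) {c c' : ℕ} (hc : r < c)
    (hcc : c < c') : u c < u c' := by
  induction c', hcc using Nat.le_induction with
  | base => exact h c hc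
  | succ k hk ih => exact ih.trans (h k (by omega))

theorem IsSemiShuffle.le {u : Equiv.Perm ℕ} (h : IsSemiShuffle r u) {c c' : ℕ} (hc : r < c)
    (hcc : c ≤ c') : u c ≤ u c' := by
  rcases Nat.eq_or_lt_of_le hcc with rfl | hlt
  · exact le_rfl
  · exact (h.lt hc hlt).le

theorem IsSemiShuffle.mul_swap {u : Equiv.Perm ℕ} (h : IsSemiShuffle r u) (hu : InSInf u) {a b : ℕ}
    (ha : 1 ≤ a) (har : a ≤ r) (hb : r < b)
    (hlen : permLength (u * Equiv.swap a b) = permLength u + 1) :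
    IsSemiShuffle r (u * Equiv.swap a b) := by
  obtain ⟨hlt, hnb⟩ := (permLength_mul_swap_eq_succ hu ha (by omega)).mp hlen
  intro i hi
  rw [Equiv.Perm.mul_apply, Equiv.Perm.mul_apply]
  rcases eq_or_ne i b with rfl | h1
  · rw [Equiv.swap_apply_right, Equiv.swap_apply_of_ne_of_ne (by omega) (by omega)]
    exact hlt.trans (h i hi)
  · rw [Equiv.swap_apply_of_ne_of_ne (by omega) h1]
    rcases eq_or_ne (i + 1) b with rfl | h2
    · rw [Equiv.swap_apply_right]
      have h3 := hnb i (by omega) (by omega)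
      have h4 := h i hi
      have h5 : u i ≠ u a := u.injective.ne (by omega)
      omega
    · rw [Equiv.swap_apply_of_ne_of_ne (by omega) h2]
      exact h i hi

theorem inSInf_mul_transProd (hw : InSInf w) {T : List (ℕ × ℕ)}
    (hT : ∀ t ∈ T, 1 ≤ t.1 ∧ t.1 ≤ r ∧ r < t.2) : InSInf (w * transProd T) := by
  induction T using List.reverseRecOn with
  | nil => simpa [transProd] using hw
  | append_singleton T t ih =>
    obtain ⟨a, b⟩ := t
    have ht := hT (a, b) (by simp)
    rw [transProd_snoc, ← mul_assoc]
    exact (ih fun t ht => hT t (by simp [ht])).mul (inSInf_swap ht.1 (by omega))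

theorem IsChain.isSemiShuffle (hw : InSInf w) (h : IsSemiShuffle r w) {T : List (ℕ × ℕ)}
    (hT : ∀ t ∈ T, 1 ≤ t.1 ∧ t.1 ≤ r ∧ r < t.2) (hc : IsChain w T) :
    IsSemiShuffle r (w * transProd T) := by
  induction T using List.reverseRecOn with
  | nil => simpa [transProd] using h
  | append_singleton T t ih =>
    obtain ⟨a, b⟩ := t
    have hT' : ∀ t ∈ T, 1 ≤ t.1 ∧ t.1 ≤ r ∧ r < t.2 := fun t ht => hT t (by simp [ht])
    have ht := hT (a, b) (by simp)
    have h1 := hc.length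
    have h2 := hc.of_append.length
    rw [transProd_snoc, ← mul_assoc] at h1 ⊢
    refine (ih hT' hc.of_append).mul_swap (inSInf_mul_transProd hw hT') ht.1 ht.2.1 ht.2.2 ?_
    rw [h1, h2, List.length_append, List.length_singleton, add_assoc]

/-- Inversions of the lower rows persist in an rc-graph. -/
theorem graphPerm_lt_of_rowUnion {L : Graph} {A : Finset ℕ} (hrows : ∀ p ∈ L, l < p.1)
    (hrc : IsRCGraph (L ∪ rowGraph l A)) (hL : IsRCGraph L) {c d : ℕ} (hcd : c < d)
    (h : graphPerm (L ∪ rowGraph l A) c < graphPerm (L ∪ rowGraph l A) d) :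
    graphPerm L c < graphPerm L d := by
  rcases lt_trichotomy (graphPerm L c) (graphPerm L d) with h1 | h1 | h1
  · exact h1
  · exact absurd ((graphPerm L).injective h1) hcd.ne
  · obtain ⟨p, ⟨hp, hps⟩, -⟩ := (strands_crossing hL hcd).1 h1
    refine absurd ?_ ((strands_crossing hrc hcd).2 h p (Finset.mem_union_left _ hp))
    rw [strands_lower (hrows p hp), hps]

theorem Config.Valid.semi_graph {s : Config} (hs : s.Valid r l w) (hw : InSInf w)
    (h : IsSemiShuffle r w) : IsSemiShuffle r (graphPerm (s.graph l)) := by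
  rw [← hs.perm]
  exact hs.chain.isSemiShuffle hw h hs.range

theorem Config.Valid.semi_lower {s : Config} (hl : 1 ≤ l) (hs : s.Valid r l w) (hw : InSInf w)
    (h : IsSemiShuffle r w) : IsSemiShuffle r (graphPerm s.lower) := fun i hi =>
  graphPerm_lt_of_rowUnion hs.rows (hs.isRC hl) hs.rc (Nat.lt_succ_self i)
    (hs.semi_graph hw h i hi)

/-- Over a semi-shuffle the strand of the last entry does not leave the row upwards in a column
where it meets a large strand. -/
theorem Config.Valid.not_next (hl : 1 ≤ l) (hlr : l ≤ r) {L : Graph} {A : Finset ℕ}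
    {T : List (ℕ × ℕ)} {e j : ℕ} (hw : InSInf w) (hsemi : IsSemiShuffle r w)
    (hs : Config.Valid r l w ⟨L, A, T ++ [(e, carry (below L l) A j)]⟩) (hj : 1 ≤ j) (hjA : j ∉ A)
    (hd : r < below L l j) : False := by
  obtain ⟨hlt, -, m, q, hm, hmq, hmA, hrun, hyq, -⟩ := hs.next hl hlr hj hjA hd
  have hr := hs.range (e, carry (below L l) A j) (by simp)
  have hs1 : IsSemiShuffle r (w * transProd T) :=
    IsChain.isSemiShuffle hw hsemi (fun t ht => hs.range t (by simp [ht])) hs.chain.of_append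
  have hperm := hs.perm
  have hrc := hs.rc
  have hrows := hs.rows
  have hzero := hs.zero
  simp only [Config.graph] at hperm hr hrc hrows hzero
  have hex : ∀ i, 1 ≤ i → graphPerm (L ∪ rowGraph l A) (exitStrand (below L l) A i) = l + i - 1 :=
    fun i hi => by
    rw [← graphPerm_rowUnion_symm hl hrc.1 hrows hzero hi]
    exact Equiv.apply_symm_apply _ _
  have h1 : exitStrand (below L l) A m = below L l j := by
    rw [exitStrand, if_neg hmA, carry_eq_of_run hm hjA hrun]
  set g := carry (below L l) A j with hg
  have hu : w * transProd T = graphPerm (L ∪ rowGraph l A) * Equiv.swap e g := by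
    rw [← hperm, transProd_snoc, mul_assoc, mul_assoc, Equiv.swap_mul_self, mul_one]
  have h2 := hs1.lt hr.2.2 hlt
  rw [hu, Equiv.Perm.mul_apply, Equiv.Perm.mul_apply, Equiv.swap_apply_right,
    Equiv.swap_apply_of_ne_of_ne (by omega) (by omega), ← h1, hex m (by omega), ← hyq,
    hex q (by omega)] at h2
  omega

/-- If a semi-shuffle has only large numbers in the positions from that of `c` to that of `c'`,
these are consecutive numbers. -/
theorem IsSemiShuffle.adjacent {u : Equiv.Perm ℕ} (h : IsSemiShuffle r u) {c c' k : ℕ} (hc : r < c)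
    (hlarge : ∀ m, u c ≤ m → m ≤ u c' → r < u.symm m) (hck : c ≤ k) (hkc : k < c') :
    u (k + 1) = u k + 1 := by
  have h1 := h k (by omega)
  by_contra h2
  have h3 := h.le hc hck
  have h4 := h.le (c := k + 1) (c' := c') (by omega) hkc
  have h5 := hlarge (u k + 1) (by omega) (by omega)
  have h6 : u (u.symm (u k + 1)) = u k + 1 := Equiv.apply_symm_apply _ _
  rcases lt_or_ge (u.symm (u k + 1)) (k + 1) with h7 | h7
  · have := h.le h5 (Nat.lt_succ_iff.mp h7)
    omega
  · have := h.le (c := k + 1) (by omega) h7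
    omega

/-- Adjacency of the large strands between `g` and `b` in consecutive positions. -/
def AdjacentFrom (u : Equiv.Perm ℕ) (g : ℕ) (b : ℕ∞) : Prop :=
  ∀ c, g ≤ c → (c : ℕ∞) < b → u (c + 1) = u c + 1

/-- A rectification over a semi-shuffle. -/
theorem Step.semi_rect {s s' : Config} {a b : ℕ} (h : Step r l (some (a, b)) s s') (hl : 1 ≤ l)
    (hlr : l ≤ r) (hs : s.Valid r l w) (hw : InSInf w) (hsemi : IsSemiShuffle r w) {e g p : ℕ}
    (hp : s'.LastAt l e g p) : s'.word = s.word ++ [(e, g)] ∧ g ≤ b ∧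
      AdjacentFrom (graphPerm s'.lower) g b ∧ AdjacentFrom (graphPerm (s.graph l)) g b := by
  have hs' := h.valid hl hlr hs
  have hr := hp.range hs'
  have hcov : LowerCover r l s.lower s'.lower a b := by cases h <;> assumption
  obtain ⟨P, Q, hP1, hPQ, hP, hQ, hP0, hQ0, hne, hnb⟩ := hcov.columns'
  obtain ⟨-, hacc | ⟨R, j, hm⟩⟩ := h.rect_cases hl hlr hs hP
  · have h1 := hp.1
    simp only [hacc.word, List.getLast?_append, List.getLast?_singleton, Option.some_or,
      Option.some.injEq, Prod.mk.injEq] at h1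
    obtain ⟨rfl, rfl⟩ := h1
    exact ⟨hacc.word, le_rfl, fun c h1 h2 => absurd (Nat.cast_lt.mp h2) (by omega),
      fun c h1 h2 => absurd (Nat.cast_lt.mp h2) (by omega)⟩
  · have hsl := hs'.semi_lower hl hw hsemi
    obtain ⟨L, A, T⟩ := s
    obtain ⟨L', A', T'⟩ := s'
    simp only at hP hQ hP0 hQ0 hne hnb hm hsl hcov
    have hjR : j < R := hm.le.trans_lt hm.lt
    have hjA : j ∉ A.erase R := fun h => hm.notMem' (Finset.mem_of_mem_erase h)
    have hcR : carry (below L' l) A R = b := by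
      rw [← hm.carry_eq, carry_erase_of_le le_rfl]
    have hcj : carry (below L' l) A j = carry (below L' l) (A.erase R) j :=
      (carry_erase_of_le hjR.le).symm
    have hdj := hm.large j le_rfl hm.le
    -- an exchange or a reinsertion where two large strands meet would contradict `not_next`
    rcases hm.word with ⟨h1, h2, h3⟩ | ⟨h1, h2, T₀, f, h3, h4, h5⟩
    swap
    · subst h3
      have hs1 := exchange_valid hl hlr hs hcov h1 hm.mem (by rw [hcR, h4])
      rw [← hm.carry_eq] at hs1
      refine (hs1.not_next hl hlr hw hsemi (by omega) (Finset.notMem_erase _ _) ?_).elim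
      rw [h4]
      exact (hs.range (a, f) (by simp)).2.2
    have hs1 := bump_valid hl hs hcov hm.mem (by rw [hcR, h1])
    rcases h3 with ⟨h3, rfl⟩ | ⟨h3, e', T₀, rfl, -⟩
    swap
    · rw [hcj] at hs1
      exact (hs1.not_next hl hlr hw hsemi hm.one_le hjA hdj).elim
    rcases hm.column hl hs' hp with ⟨rfl, hpA, h4, h5, h6⟩ | ⟨h4, -⟩
    swap
    · omega
    have h7 := hp.1
    simp only [List.getLast?_append, List.getLast?_singleton, Option.some_or,
      Option.some.injEq, Prod.mk.injEq] at h7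
    obtain ⟨rfl, rfl⟩ := h7
    have hpos : ∀ k, graphPerm L' (below L' l k) = l + k := fun k => Equiv.apply_symm_apply _ _
    have hgb : below L' l p ≤ b := by
      by_contra hc
      have h8 := hsl.lt hcov.hb (not_le.mp hc)
      rw [← hP, hpos, hpos] at h8
      have := hm.le
      omega
    refine ⟨rfl, hgb, fun c hc1 hc2 => hsl.adjacent (c' := b) hr.2.2 ?_ hc1 (Nat.cast_lt.mp hc2),
      fun c hc1 hc2 => (hs.semi_graph hw hsemi).adjacent (c' := b) hr.2.2 ?_ hc1
          (Nat.cast_lt.mp hc2)⟩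
    · intro m hm1 hm2
      rw [← hP, hpos] at hm2
      rw [hpos] at hm1
      have h8 := hm.large (m - l) (by omega) (by omega)
      rwa [below, show l + (m - l) = m by omega] at h8
    · -- before the step the columns `p + 1, …, R` are left by large strands
      have hperm1 : graphPerm (Config.graph l ⟨L, A, T⟩) =
          graphPerm (L' ∪ rowGraph l (A.erase R)) :=
        hs.perm.symm.trans hs1.perm
      have hzero1 : 0 ∉ A.erase R := hs1.zero
      have hex : ∀ i, 1 ≤ i → (graphPerm (L' ∪ rowGraph l (A.erase R))).symm (l + i - 1) =
          exitStrand (below L' l) (A.erase R) i := fun i hi =>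
        graphPerm_rowUnion_symm hl hs'.rc.1 hs'.rows hzero1 hi
      have hb : graphPerm (Config.graph l ⟨L, A, T⟩) b = l + R - 1 := by
        rw [hperm1, ← Equiv.eq_symm_apply, hex R (by omega), exitStrand,
          if_neg (Finset.notMem_erase _ _), hm.carry_eq]
      obtain ⟨p', q, hp', hpq, hyp, hyq, -, hGp, hGq⟩ := hs'.lastCover hl hlr rfl
      obtain rfl := exitStrand_injOn hl hs'.rc.1 hs'.rows hs'.zero hp' hp.2.1
        (hyp.trans hp.2.2.symm)
      have hd : graphPerm (Config.graph l ⟨L, A, T⟩) (below L' l p') = l + q - 1 := by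
        rw [← hGq, ← hs.perm, ← hs'.perm, transProd_snoc, ← mul_assoc,
          Equiv.Perm.mul_apply _ (Equiv.swap _ _),
          Equiv.swap_apply_left]
      intro m hm1 hm2
      rw [hd] at hm1
      rw [hb] at hm2
      have h8 : m = l + (m - l + 1) - 1 := by omega
      rw [hperm1, h8, hex _ (by omega)]
      have h9 := hm.carry_large (m - l + 1) (by omega) (by omega)
      rw [exitStrand]
      split_ifs with h10
      · have hred1 : RowReduced (below L' l) (A.erase R) := hs1.reduced
        have := hred1 _ h10
        omega
      · exact h9

/-- An insertion over a semi-shuffle. -/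
theorem Step.semi_insertion {s s' : Config} (h : Step r l none s s') (hl : 1 ≤ l)
    (hlr : l ≤ r) (hs : s.Valid r l w) (hw : InSInf w) (hsemi : IsSemiShuffle r w) {e g p : ℕ}
    (hp : s'.LastAt l e g p) : s'.word = s.word ++ [(e, g)] ∧ s'.lower = s.lower ∧
      AdjacentFrom (graphPerm s'.lower) g ⊤ ∧ AdjacentFrom (graphPerm (s.graph l)) g ⊤ := by
  have hs' := h.valid hl hlr hs
  have hr := hp.range hs'
  obtain ⟨hpA, hcp, hzp, hlarge, hlarge'⟩ := h.history_insertion hl hlr hs hp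
  have hsl := hs'.semi_lower hl hw hsemi
  obtain ⟨T, hT⟩ : ∃ T, s'.word = T ++ [(e, g)] :=
    ⟨_, (List.dropLast_append_getLast? _ hp.1).symm⟩
  obtain ⟨p', q, hp', hpq, hyp, hyq, -, hGp, hGq⟩ := hs'.lastCover hl hlr hT
  obtain rfl := exitStrand_injOn hl hs'.rc.1 hs'.rows hs'.zero hp' hp.2.1 (hyp.trans hp.2.2.symm)
  have hw' : s'.word = s.word ++ [(e, g)] ∧ s'.lower = s.lower := by
    cases h with
    | insertion hj hmax =>
      have h1 := hp.1
      simp only [List.getLast?_append, List.getLast?_singleton, Option.some_or,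
        Option.some.injEq, Prod.mk.injEq] at h1
      simp only [h1, and_self]
  have hg : graphPerm s'.lower g = l + p' := by rw [← hzp, below, Equiv.apply_symm_apply]
  have hd : graphPerm (s.graph l) g = l + q - 1 := by
    rw [← hGq, ← hs.perm, ← hs'.perm, hw'.1, transProd_snoc, ← mul_assoc,
      Equiv.Perm.mul_apply _ (Equiv.swap _ _), Equiv.swap_apply_left]
  refine ⟨hw'.1, hw'.2, fun c hc1 _ => hsl.adjacent (c' := c + 1) hr.2.2 ?_ hc1
      (Nat.lt_succ_self c),
    fun c hc1 _ => (hs.semi_graph hw hsemi).adjacent (c' := c + 1) hr.2.2 ?_ hc1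
      (Nat.lt_succ_self c)⟩
  · intro m hm1 _
    rw [hg] at hm1
    have h8 := hlarge (m - l) (by omega)
    rwa [below, show l + (m - l) = m by omega] at h8
  · intro m hm1 _
    rw [hd] at hm1
    have h8 : m = l + (m - l + 1) - 1 := by omega
    rw [h8, Config.graph, graphPerm_rowUnion_symm hl hs.rc.1 hs.rows hs.zero (by omega)]
    exact hlarge' _ (by omega)

end semi

/-! ### Ballot arguments

A sequence of permutations `X 0, X 1, …`, in which step `i` moves only the large number `c i`, to
the left (`c i = ⊤` if nothing is moved). -/

section ballot

variable {r n : ℕ} {X Y : ℕ → Equiv.Perm ℕ} {b c : ℕ → ℕ∞} {g : ℕ → ℕ}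

/-- Step `i < n` moves only the large number `c i`, to the left. -/
structure Moves (r n : ℕ) (X : ℕ → Equiv.Perm ℕ) (c : ℕ → ℕ∞) : Prop where
  semi : ∀ i ≤ n, IsSemiShuffle r (X i)
  large : ∀ i < n, (r : ℕ∞) < c i
  eq : ∀ i < n, ∀ k, r < k → (k : ℕ∞) ≠ c i → X (i + 1) k = X i k
  lt : ∀ i < n, ∀ k : ℕ, (k : ℕ∞) = c i → X (i + 1) k < X i k

theorem Moves.eq_of_ne (h : Moves r n X c) {i j k : ℕ} (hij : i ≤ j) (hj : j ≤ n) (hk : r < k)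
    (hne : ∀ m, i ≤ m → m < j → (k : ℕ∞) ≠ c m) : X j k = X i k := by
  induction j, hij using Nat.le_induction with
  | base => rfl
  | succ j hij ih =>
    rw [h.eq j (by omega) k hk (hne j hij (Nat.lt_succ_self j)),
      ih (by omega) fun m h1 h2 => hne m h1 (by omega)]

theorem Moves.le (h : Moves r n X c) {i j k : ℕ} (hij : i ≤ j) (hj : j ≤ n) (hk : r < k) :
    X j k ≤ X i k := by
  induction j, hij using Nat.le_induction with
  | base => exact le_rfl
  | succ j hij ih =>
    refine le_trans ?_ (ih (by omega))
    by_cases hc : (k : ℕ∞) = c j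
    · exact (h.lt j (by omega) k hc).le
    · exact (h.eq j (by omega) k hk hc).le

/-- Moving a smaller or equal number later yields a smaller position. -/
theorem Moves.lt_of_le (h : Moves r n X c) {i j ci cj : ℕ} (hij : i < j) (hj : j < n)
    (hj' : (cj : ℕ∞) = c j) (hc : cj ≤ ci) :
    X (j + 1) cj < X (i + 1) ci := by
  have h1 : r < cj := Nat.cast_lt.mp ((h.large j hj).trans_eq hj'.symm)
  calc X (j + 1) cj < X j cj := h.lt j hj cj hj'
    _ ≤ X j ci := (h.semi j hj.le).le h1 hc
    _ ≤ X (i + 1) ci := h.le (by omega) hj.le (by omega)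

/-- Two consecutive rows of steps, of which the positions strictly decrease in columns. -/
theorem Moves.column_le (h : Moves r n X c) {o m m' μ : ℕ} (hn : o + m + m' ≤ n) (hμ : μ ≤ m)
    (hμ' : μ ≤ m') (h1 : ∀ q q', q < q' → q' < m → c (o + q) < c (o + q') ∨ c (o + q') = ⊤)
    (hE : ∀ q < μ, ∃ ci cj : ℕ, (ci : ℕ∞) = c (o + q) ∧ (cj : ℕ∞) = c (o + m + q) ∧
      X (o + m + q + 1) cj < X (o + q + 1) ci) :
    ∀ q < μ, c (o + m + q) ≤ c (o + q) := by
  intro q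
  induction q using Nat.strong_induction_on with
  | _ q ih =>
    intro hq
    obtain ⟨ci, cj, hi, hj, hlt⟩ := hE q hq
    by_contra hc
    rw [← hi, ← hj, Nat.cast_le, not_le] at hc
    have hr : r < ci := Nat.cast_lt.mp ((h.large (o + q) (by omega)).trans_eq hi.symm)
    -- if `ci < cj`, then `ci` is to the left of `cj` in the end and has not been moved since its
    -- step
    have h2 := (h.semi (o + m + q + 1) (by omega)).lt hr hc
    rw [h.eq_of_ne (i := o + q + 1) (by omega) (by omega) hr] at h2
    · omega
    · intro t ht1 ht2 ht
      rcases lt_or_ge t (o + m) with h3 | h3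
      · obtain ⟨q', rfl⟩ : ∃ q', t = o + q' := ⟨t - o, by omega⟩
        rcases h1 q q' (by omega) (by omega) with h4 | h4
        · rw [← ht, hi] at h4
          exact lt_irrefl _ h4
        · rw [h4] at ht
          exact ENat.natCast_ne_top _ ht
      · obtain ⟨q', rfl⟩ : ∃ q', t = o + m + q' := ⟨t - (o + m), by omega⟩
        rcases lt_or_ge q' q with h4 | h4
        · have h5 := ih q' h4 (by omega)
          rcases h1 q' q h4 (by omega) with h6 | h6
          · exact absurd (ht ▸ h5.trans_lt h6) (by rw [hi]; exact lt_irrefl _)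
          · rw [h6] at hi
            exact ENat.natCast_ne_top _ hi
        · obtain rfl : q' = q := by omega
          rw [← hj, Nat.cast_inj] at ht
          omega

/-- The comparison of two consecutive rows, from the lower to the upper tableau. -/
theorem Moves.ballot_forward (h : Moves r n X b) (hg : ∀ i < n, r < g i)
    (hadj : ∀ i < n, AdjacentFrom (X (i + 1)) (g i) (b i)) {o m m' : ℕ} (hn : o + m + m' ≤ n)
    (hmm : m ≤ m') (h1 : ∀ q q', q < q' → q' < m → b (o + q) < b (o + q') ∨ b (o + q') = ⊤)
    (hcol : ∀ q < m, b (o + m + q) ≤ b (o + q)) (hfin : ∀ q < m, b (o + m + q) ≠ ⊤)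
    (hg1 : ∀ q q', q < q' → q' < m → g (o + q) < g (o + q')) :
    ∀ q < m, b (o + m + q) ≤ g (o + q) := by
  intro q
  induction q using Nat.strong_induction_on with
  | _ q ih =>
    intro hq
    by_contra hc
    obtain ⟨γ, hγ⟩ := ENat.ne_top_iff_exists.mp (hfin q hq)
    have hcq := hcol q hq
    rw [← hγ, Nat.cast_le, not_le] at hc
    rw [← hγ] at hcq
    have hgr := hg (o + q) (by omega)
    -- if `b (o + m + q) = k + 1`, then `k`, `k + 1` are adjacent after step `o + q`, so `k + 1`
    -- cannot move to the left without passing `k`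
    obtain ⟨k, rfl⟩ : ∃ k, γ = k + 1 := ⟨γ - 1, by omega⟩
    have hlt : (k : ℕ∞) < b (o + q) :=
      (Nat.cast_lt.mpr (Nat.lt_succ_self k)).trans_le hcq
    have h3 := hadj (o + q) (by omega) k (by omega) hlt
    -- neither number is moved before step `o + m + q`
    have h4 : ∀ k', r < k' → k' = k ∨ k' = k + 1 → X (o + m + q) k' = X (o + q + 1) k' := by
      intro k' hk' hkk
      refine h.eq_of_ne (by omega) (by omega) hk' fun t ht1 ht2 ht => ?_
      rcases lt_or_ge t (o + m) with h5 | h5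
      · obtain ⟨q', rfl⟩ : ∃ q', t = o + q' := ⟨t - o, by omega⟩
        rcases h1 q q' (by omega) (by omega) with h4 | h4
        · rw [← ht] at h4
          have := Nat.cast_lt.mp (hcq.trans_lt h4)
          omega
        · rw [h4] at ht
          exact ENat.natCast_ne_top _ ht
      · obtain ⟨q', rfl⟩ : ∃ q', t = o + m + q' := ⟨t - (o + m), by omega⟩
        have h6 := ih q' (by omega) (by omega)
        rw [← ht, Nat.cast_le] at h6
        have := hg1 q' q (by omega) hq
        omega
    have h5 := (h.semi (o + m + q + 1) (by omega)) k (by omega)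
    have h6 := h.lt (o + m + q) (by omega) (k + 1) hγ
    rw [h.eq (o + m + q) (by omega) k (by omega) (by
      rw [← hγ, Ne, Nat.cast_inj]
      omega), h4 k (by omega) (Or.inl rfl)] at h5
    rw [h4 (k + 1) (by omega) (Or.inr rfl)] at h6
    omega

/-- The comparison of two consecutive rows, from the upper to the lower tableau. -/
theorem Moves.ballot_backward (h : Moves r n Y fun i => g i)
    (hadj : ∀ i < n, AdjacentFrom (Y i) (g i) (b i)) {o m m' : ℕ} (hn : o + m + m' ≤ n)
    (hmm : m ≤ m') (hg1 : ∀ q q', q < q' → q' < m → g (o + q) < g (o + q'))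
    (hg2 : ∀ q q', q < q' → q' < m' → g (o + m + q) < g (o + m + q'))
    (h2 : ∀ q q', q < q' → q' < m' → b (o + m + q) < b (o + m + q') ∨ b (o + m + q') = ⊤)
    (hcol : ∀ q < m, g (o + m + q) ≤ g (o + q)) :
    ∀ q < m, b (o + m + q) ≤ g (o + q) := by
  -- induction from the end of the row
  suffices H : ∀ d q, q + d + 1 = m → b (o + m + q) ≤ g (o + q) from
    fun q hq => H (m - q - 1) q (by omega)
  intro d
  induction d using Nat.strong_induction_on with
  | _ d ih =>
    intro q hqd
    by_contra hc
    rw [not_le] at hc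
    have hgr : r < g (o + q) := Nat.cast_lt.mp (h.large (o + q) (by omega))
    have hcq := hcol q (by omega)
    -- `g (o + q)` and its successor are adjacent before step `o + m + q`, hence also after step
    -- `o + q`, which has moved only the former, to the left
    have h3 := hadj (o + m + q) (by omega) (g (o + q)) hcq hc
    -- in row `o + m, …` neither number is moved before
    have h4 : ∀ k', r < k' → g (o + q) ≤ k' → Y (o + m + q) k' = Y (o + m) k' := by
      intro k' hk' hkk
      refine h.eq_of_ne (by omega) (by omega) hk' fun t ht1 ht2 ht => ?_
      obtain ⟨q', rfl⟩ : ∃ q', t = o + m + q' := ⟨t - (o + m), by omega⟩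
      have := hg2 q' q (by omega) (by omega)
      rw [Nat.cast_inj] at ht
      omega
    have h5 : ∀ k', r < k' → k' = g (o + q) ∨ k' = g (o + q) + 1 →
        Y (o + m) k' = Y (o + q + 1) k' := by
      intro k' hk' hkk
      refine h.eq_of_ne (by omega) (by omega) hk' fun t ht1 ht2 ht => ?_
      obtain ⟨q', rfl⟩ : ∃ q', t = o + q' := ⟨t - o, by omega⟩
      rw [Nat.cast_inj] at ht
      have h6 := hg1 q q' (by omega) (by omega)
      have h7 := ih (m - q' - 1) (by omega) q' (by omega)
      have h8 : b (o + m + q) < b (o + m + q') := by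
        rcases h2 q q' (by omega) (by omega) with h8 | h8
        · exact h8
        · rw [h8] at h7
          exact absurd h7 (not_le.mpr (ENat.natCast_lt_top _))
      have h9 := hc.trans_le ((Order.le_of_lt_add_one ?_ : b (o + m + q) ≤ g (o + q)))
      · exact lt_irrefl _ h9
      · have h10 := h8.trans_le h7
        rw [← ht, hkk.resolve_left (by omega)] at h10
        exact_mod_cast h10
    rw [h4 _ (by omega) (by omega), h4 _ hgr le_rfl, h5 _ (by omega) (Or.inr rfl),
      h5 _ hgr (Or.inl rfl), h.eq (o + q) (by omega) _ (by omega) (by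
        rw [Ne, Nat.cast_inj]
        omega)] at h3
    have h6 := h.lt (o + q) (by omega) (g (o + q)) rfl
    have h7 := (h.semi (o + q) (by omega)) (g (o + q)) hgr
    omega

end ballot

/-! ### Strict tableaux -/

/-- The list of the row lengths `m 0, …, m (r - 1)`. -/
def shapeOf (r : ℕ) (m : ℕ → ℕ) : List ℕ := (List.range r).map m

/-- The number of boxes below row `p`. -/
def offset (m : ℕ → ℕ) (p : ℕ) : ℕ := ∑ k ∈ Finset.range p, m k

theorem offset_succ (m : ℕ → ℕ) (p : ℕ) : offset m (p + 1) = offset m p + m p :=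
  Finset.sum_range_succ _ _

theorem offset_mono (m : ℕ → ℕ) {p p' : ℕ} (h : p ≤ p') : offset m p ≤ offset m p' :=
  Finset.sum_le_sum_of_subset (Finset.range_mono h)

theorem shapeOf_take_sum {r : ℕ} (m : ℕ → ℕ) {p : ℕ} (hp : p ≤ r) :
    ((shapeOf r m).take p).sum = offset m p := by
  rw [shapeOf, ← List.map_take, List.take_range, min_eq_left hp]
  induction p with
  | zero => rfl
  | succ p ih =>
    rw [List.range_succ, List.map_append, List.sum_append, ih (by omega), offset_succ]
    simp

theorem shapeOf_sum (r : ℕ) (m : ℕ → ℕ) : (shapeOf r m).sum = offset m r := by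
  rw [← shapeOf_take_sum m le_rfl, List.take_of_length_le (by simp [shapeOf])]

theorem shapeOf_getD (r : ℕ) (m : ℕ → ℕ) (p : ℕ) :
    (shapeOf r m).getD p 0 = if p < r then m p else 0 := by
  split_ifs with h <;> simp [shapeOf, List.getD, h]

/-- Every box is in some row. -/
theorem exists_box (m : ℕ → ℕ) {r i : ℕ} (h : i < offset m r) :
    ∃ p q, p < r ∧ q < m p ∧ i = offset m p + q := by
  induction r with
  | zero => simp [offset] at h
  | succ r ih =>
    rcases lt_or_ge i (offset m r) with h1 | h1
    · obtain ⟨p, q, h2, h3, h4⟩ := ih h1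
      exact ⟨p, q, by omega, h3, h4⟩
    · rw [offset_succ] at h
      exact ⟨r, i - offset m r, by omega, by omega, by omega⟩

/-- The numbers `e 0, …, e (n - 1)`, as entries of the first `n` boxes of the shape `m`, strictly
increase in rows and strictly decrease from every row to the rows above it. -/
structure StrictOn (r : ℕ) (m : ℕ → ℕ) (n : ℕ) (e : ℕ → ℕ) : Prop where
  row : ∀ p < r, ∀ q q', q < q' → q' < m p → offset m p + q' < n →
    e (offset m p + q) < e (offset m p + q')
  col : ∀ p p', p < p' → p' < r → ∀ q, q < m p → q < m p' → offset m p' + q < n →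
    e (offset m p' + q) < e (offset m p + q)

theorem StrictOn.of_adjacent {r : ℕ} {m : ℕ → ℕ} {n : ℕ} {e : ℕ → ℕ}
    (hm : ∀ p, p + 1 < r → m p ≤ m (p + 1))
    (hrow : ∀ p < r, ∀ q, q + 1 < m p → offset m p + q + 1 < n →
      e (offset m p + q) < e (offset m p + q + 1))
    (hcol : ∀ p, p + 1 < r → ∀ q, q < m p → offset m (p + 1) + q < n →
      e (offset m (p + 1) + q) < e (offset m p + q)) : StrictOn r m n e := by
  constructor
  · intro p hp q q' hq hq' hn
    induction q', hq using Nat.le_induction with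
    | base => exact hrow p hp q hq' hn
    | succ q' hq ih => exact (ih (by omega) (by omega)).trans (hrow p hp q' hq' hn)
  · intro p p' hp hp' q hq hq' hn
    induction p', hp using Nat.le_induction with
    | base => exact hcol p hp' q hq hn
    | succ p' hp ih =>
      have h1 : ∀ k, p + 1 ≤ k → k < r → q < m k := by
        intro k hk
        induction k, hk using Nat.le_induction with
        | base => exact fun h => hq.trans_le (hm p h)
        | succ k hk ih => exact fun h => (ih (by omega)).trans_le (hm k h)
      have h2 := h1 p' hp (by omega)
      have h3 := offset_mono m (show p' ≤ p' + 1 by omega)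
      exact (hcol p' hp' q h2 hn).trans (ih (by omega) h2 (by omega))

theorem StrictOn.mono {r : ℕ} {m : ℕ → ℕ} {n n' : ℕ} {e e' : ℕ → ℕ} (h : StrictOn r m n e)
    (hn : n' ≤ n) (he : ∀ k < n', e' k = e k) : StrictOn r m n' e' := by
  constructor
  · intro p hp q q' h1 h2 h3
    rw [he _ (by omega), he _ h3]
    exact h.row p hp q q' h1 h2 (by omega)
  · intro p p' hp hp' q h1 h2 h3
    have h4 := offset_mono m hp
    rw [offset_succ] at h4
    rw [he _ h3, he _ (by omega)]
    exact h.col p p' hp hp' q h1 h2 (by omega)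

/-- The entry of box `k + 1` of `E(w, T)`: the position of the small strand of entry `k + 1` before
this transposition is applied. -/
def evalAt (w : Equiv.Perm ℕ) (T : List (ℕ × ℕ)) (k : ℕ) : ℕ :=
  (w * transProd (T.take k)) (T.getD k (0, 0)).1

theorem take_succ_of_getElem? {T : List (ℕ × ℕ)} {k : ℕ} {t : ℕ × ℕ} (h : T[k]? = some t) :
    T.take (k + 1) = T.take k ++ [t] := by
  rw [List.take_add_one, h]
  rfl

theorem evalTableau_word (w : Equiv.Perm ℕ) (T : Tableau (ℕ × ℕ)) (k : ℕ) :
    (evalTableau w T).word[k]? =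
      if k < T.word.length then some (evalAt w T.word k) else none := by
  simp only [evalTableau, List.getElem?_mapIdx]
  split_ifs with h
  · rw [List.getElem?_eq_getElem h, Option.map_some]
    congr 1
    have h1 : T.word[k]? = some T.word[k] := List.getElem?_eq_getElem h
    rw [evalAt, List.getD_eq_getElem?_getD, h1, Option.getD_some, Tableau.perm]
    change (w * transProd (T.word.take (k + 1))) _ = _
    rw [take_succ_of_getElem? h1, transProd_snoc, ← mul_assoc,
      Equiv.Perm.mul_apply _ (Equiv.swap _ _),
      Equiv.swap_apply_right]
  · rw [List.getElem?_eq_none (by omega)]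
    rfl

theorem evalStrict_iff {r : ℕ} {w : Equiv.Perm ℕ} {m : ℕ → ℕ} {T : List (ℕ × ℕ)} :
    EvalStrict w ⟨shapeOf r m, T⟩ ↔ StrictOn r m T.length (evalAt w T) := by
  have hbox : ∀ p q x, (evalTableau w ⟨shapeOf r m, T⟩).box p q = some x ↔
      p < r ∧ q < m p ∧ offset m p + q < T.length ∧ evalAt w T (offset m p + q) = x := by
    intro p q x
    rw [Tableau.box, evalTableau_word]
    simp only [evalTableau, shapeOf_getD]
    by_cases hp : p < r
    · have h0 := shapeOf_take_sum m hp.le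
      by_cases h1 : q < m p
      · by_cases h2 : offset m p + q < T.length
        · simp [hp, h0, h1, h2]
        · simp [hp, h0, h1, h2]
      · simp [hp, h1]
    · simp [hp]
  constructor
  · rintro ⟨⟨h1, -⟩, ⟨-, h2⟩⟩
    refine ⟨fun p hp q q' hq hq' hn => ?_, fun p p' hp hp' q hq hq' hn => ?_⟩
    · exact h1 p q q' _ _ hq ((hbox _ _ _).mpr ⟨hp, by omega, by omega, rfl⟩)
        ((hbox _ _ _).mpr ⟨hp, hq', hn, rfl⟩)
    · have h3 := offset_mono m hp
      rw [offset_succ] at h3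
      exact h2 p p' q _ _ hp ((hbox _ _ _).mpr ⟨by omega, by omega, by omega, rfl⟩)
        ((hbox _ _ _).mpr ⟨hp', hq', hn, rfl⟩)
  · intro h
    have hr : ∀ p q q' x y, q < q' → (evalTableau w ⟨shapeOf r m, T⟩).box p q = some x →
        (evalTableau w ⟨shapeOf r m, T⟩).box p q' = some y → x < y := by
      intro p q q' x y hq hx hy
      obtain ⟨h1, h2, h3, rfl⟩ := (hbox _ _ _).mp hx
      obtain ⟨h4, h5, h6, rfl⟩ := (hbox _ _ _).mp hy
      exact h.row p h1 q q' hq h5 h6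
    have hc : ∀ p p' q x y, p < p' → (evalTableau w ⟨shapeOf r m, T⟩).box p q = some x →
        (evalTableau w ⟨shapeOf r m, T⟩).box p' q = some y → y < x := by
      intro p p' q x y hp hx hy
      obtain ⟨h1, h2, h3, rfl⟩ := (hbox _ _ _).mp hx
      obtain ⟨h4, h5, h6, rfl⟩ := (hbox _ _ _).mp hy
      exact h.col p p' hp h4 q h2 h5 h6
    exact ⟨⟨hr, fun p p' q x y h1 h2 h3 => (hc p p' q x y h1 h2 h3).le⟩,
      ⟨fun p q q' x y h1 h2 h3 => (hr p q q' x y h1 h2 h3).le, hc⟩⟩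

/-- An ascent may not replace a descent of a strict tableau. -/
theorem StrictOn.not_of_ascent {r : ℕ} {m : ℕ → ℕ} {k : ℕ} {e e' : ℕ → ℕ}
    (h : StrictOn r m (k + 2) e) (hk : k + 1 < offset m r)
    (h1 : e (k + 1) < e k) (h2 : e' k < e' (k + 1)) :
    ¬ StrictOn r m (k + 2) e' := by
  intro h'
  obtain ⟨p, q, hp, hq, hpq⟩ := exists_box m hk
  rcases Nat.eq_zero_or_pos q with rfl | hq0
  · -- box `k + 1` is the first one of its row
    obtain ⟨p₀, q₀, hp₀, hq₀, e₀⟩ := exists_box m (r := p) (i := k) (by omega)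
    have h3 := h'.col p₀ p hp₀ hp 0 (by omega) hq (by omega)
    rw [← hpq, add_zero] at h3
    have h4 : e' (offset m p₀) ≤ e' k := by
      rcases Nat.eq_zero_or_pos q₀ with rfl | h5
      · rw [e₀, add_zero]
      · have := h'.row p₀ (by omega) 0 q₀ h5 hq₀ (by omega)
        rw [← e₀, add_zero] at this
        exact this.le
    omega
  · have h3 := h.row p hp (q - 1) q (by omega) hq (by omega)
    rw [← hpq, show offset m p + (q - 1) = k by omega] at h3
    omega

/-! ### The entries of `E` along the steps -/

theorem evalAt_snoc (w : Equiv.Perm ℕ) (T : List (ℕ × ℕ)) (t : ℕ × ℕ) :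
    evalAt w (T ++ [t]) T.length = (w * transProd T) t.1 := by
  simp [evalAt]

theorem evalAt_append (w : Equiv.Perm ℕ) (T T' : List (ℕ × ℕ)) {k : ℕ} (hk : k < T.length) :
    evalAt w (T ++ T') k = evalAt w T k := by
  rw [evalAt, evalAt, List.take_append_of_le_length hk.le, List.getD_append _ _ _ _ hk]

theorem evalAt_change (w : Equiv.Perm ℕ) (T T' : List (ℕ × ℕ)) (e g g' : ℕ) {k : ℕ}
    (hk : k < (T ++ [(e, g)]).length) :
    evalAt w (T ++ (e, g') :: T') k = evalAt w (T ++ [(e, g)]) k := by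
  rw [List.length_append, List.length_singleton] at hk
  rcases lt_or_ge k T.length with h | h
  · rw [evalAt_append w T _ h, evalAt_append w T _ h]
  · obtain rfl : k = T.length := by omega
    rw [evalAt_snoc, List.append_cons, evalAt_append _ _ _ (by simp), evalAt_snoc]

section steps

variable {r l : ℕ} {w : Equiv.Perm ℕ}

theorem Step.length_word {o : Option (ℕ × ℕ)} {s s' : Config} (h : Step r l o s s') :
    s'.word.length = s.word.length + 1 := by
  cases h with
  | insertion => simp
  | accept => simp
  | bump hcov hQ h1 h2 =>
    obtain ⟨j, -, -, -, -, ⟨-, rfl⟩ | ⟨-, e, T₀, rfl, rfl⟩⟩ := h2 <;> simp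
  | exchange hcov h1 hQ h2 h3 =>
    obtain ⟨j, -, -, -, -, ⟨-, rfl⟩ | ⟨-, e, T₀, e', rfl⟩⟩ := h3
    · simp
    · have := congrArg List.length e'
      simp at this ⊢
      omega

theorem Step.evalAt_eq {o : Option (ℕ × ℕ)} {s s' : Config} (h : Step r l o s s') {k : ℕ}
    (hk : k < s.word.length) : evalAt w s'.word k = evalAt w s.word k := by
  cases h with
  | insertion => exact evalAt_append _ _ _ hk
  | accept => exact evalAt_append _ _ _ hk
  | bump hcov hQ h1 h2 =>
    obtain ⟨j, -, -, -, -, ⟨-, rfl⟩ | ⟨-, e, T₀, rfl, rfl⟩⟩ := h2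
    · exact evalAt_append _ _ _ hk
    · exact evalAt_change _ _ _ _ _ _ hk
  | exchange hcov h1 hQ h2 h3 =>
    obtain ⟨j, -, -, -, -, ⟨-, rfl⟩ | ⟨-, e, T₀, e', rfl⟩⟩ := h3
    · simp only [List.append_assoc, List.cons_append, List.nil_append]
      exact evalAt_change _ _ _ _ _ _ hk
    · obtain ⟨rfl, h4⟩ := List.append_inj' e' rfl
      simp only [List.cons.injEq, Prod.mk.injEq, and_true] at h4
      obtain ⟨rfl, -⟩ := h4
      exact evalAt_change _ _ _ _ _ _ hk

theorem Config.LastAt.evalAt_eq {s : Config} {e g p k : ℕ} (hl : 1 ≤ l) (hlr : l ≤ r)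
    (hs : s.Valid r l w) (hp : s.LastAt l e g p) (hk : s.word.length = k + 1) :
    evalAt w s.word k = graphPerm (s.graph l) g ∧ graphPerm (s.graph l) g = l + p - 1 := by
  obtain ⟨e', g', p', hp', hG⟩ := hs.exists_lastAt hl hlr (List.ne_nil_of_length_eq_add_one hk)
  obtain ⟨rfl, rfl, rfl⟩ := hp.unique hp' hl hs
  have hT := List.dropLast_append_getLast? _ hp.1
  refine ⟨?_, hG⟩
  have h1 : s.word.dropLast.length = k := by simp [hk]
  have h2 := evalAt_snoc w s.word.dropLast (e, g)
  rw [hT, h1] at h2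
  rw [h2, ← hs.perm]
  conv_rhs => rw [← hT]
  rw [transProd_snoc, ← mul_assoc, Equiv.Perm.mul_apply _ (Equiv.swap _ _), Equiv.swap_apply_right]

/-! ### The insertion algorithm performs the steps -/

theorem Step.insertStep_eq {s s' : Config} (h : Step r l none s s') (hl : 1 ≤ l)
    (hs : s.Valid r l w) : insertStep r l (s.graph l, s.word) = some (s'.graph l, s'.word) := by
  cases h with
  | @insertion L A T j hj hmax =>
    have hiff := allowed_iff (r := r) hl hs.rc.1 hs.rows hs.zero
    simp only at hiff
    have h1 : rightmost (Allowed r (L ∪ rowGraph l A) l) = some j :=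
      rightmost_eq_some ((hiff j).mpr hj) fun k hk => by
        rw [hiff]
        exact hmax k hk
    have h2 := strands_row hl hs.rc.1 hs.rows hs.zero hj.1
    simp only at h2
    simp only [insertStep, Config.graph, h1, Option.bind_eq_bind, Option.bind_some, h2,
      insert_rowUnion_row, Option.pure_def]

theorem reinsert_eq (hl : 1 ≤ l) {L : Graph} {A A' : Finset ℕ} {T T' : List (ℕ × ℕ)} {Q : ℕ}
    (hL : IsGraph L) (hrows : ∀ p ∈ L, l < p.1) (hA : 0 ∉ A)
    (h : Reinserted r (below L l) A T Q A' T') :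
    reinsert r l Q (L ∪ rowGraph l A) T = some (L ∪ rowGraph l A', T') := by
  obtain ⟨j, hjQ, hsel, hmax, rfl, hT⟩ := h
  have hj : 1 ≤ j := hsel.elim (fun h => h.1) fun h => h.1
  have h1 : rightmost (fun j => j < Q ∧ (Allowed r (L ∪ rowGraph l A) l j ∨
      AllowedNext r (L ∪ rowGraph l A) T l j)) = some j := by
    refine rightmost_eq_some ⟨hjQ, ?_⟩ fun k hk => ?_
    · rwa [allowed_iff hl hL hrows hA, allowedNext_iff hl hL hrows hA]
    · rw [allowed_iff hl hL hrows hA, allowedNext_iff hl hL hrows hA]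
      rintro ⟨h1, h2⟩
      have := hmax k hk h1
      tauto
  simp only [reinsert, h1, Option.bind_eq_bind, Option.bind_some, strands_row hl hL hrows hA hj,
    insert_rowUnion_row]
  rcases hT with ⟨hc, rfl⟩ | ⟨hc, e, T₀, rfl, rfl⟩
  · rw [if_pos hc]
    rfl
  · rw [if_neg (not_le.mpr hc)]
    simp

/-- A rectification step, if the resulting tableau is strict. -/
theorem Step.rectifyStep_eq {s s' : Config} {a b : ℕ} (h : Step r l (some (a, b)) s s') (hl : 1 ≤ l)
    (hlr : l ≤ r) (hs : s.Valid r l w) {m : ℕ → ℕ}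
    (hlen : s'.word.length ≤ offset m r) (hstrict : EvalStrict w ⟨shapeOf r m, s'.word⟩) :
    rectifyStep r l w (shapeOf r m) s.lower s'.lower (a, b) (s.graph l, s.word) =
      some (s'.graph l, s'.word) := by
  have hs' := h.valid hl hlr hs
  have hcov : LowerCover r l s.lower s'.lower a b := by cases h <;> assumption
  have hzero := hs.zero
  have hpos : ∀ {j}, j ∈ s.cols → 1 ≤ j := fun hj =>
    Nat.one_le_iff_ne_zero.mpr fun e => hzero (e ▸ hj)
  have hR' : s.graph l ∪ (s'.lower \ s.lower) = s'.lower ∪ rowGraph l s.cols := by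
    obtain ⟨q, hq, e⟩ := hcov.sub
    rw [Config.graph, Finset.union_right_comm, Finset.union_sdiff_of_subset]
    rw [e]
    exact Finset.subset_insert _ _
  have hsr : ∀ {j}, 1 ≤ j → strands (s'.lower ∪ rowGraph l s.cols) l j =
      (carry (below s'.lower l) s.cols j, below s'.lower l j) := fun hj =>
    strands_row hl hcov.rc'.1 hcov.rows' hzero hj
  have hmem : ∀ j, (l, j) ∈ s'.lower ∪ rowGraph l s.cols ↔ j ∈ s.cols := fun j =>
    mem_rowUnion hcov.rows'
  -- a crossing of the strands in column `Q` is unique since the lower strand determines it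
  have huniq : ∀ {Q : ℕ} {P : ℕ → Prop} {x y : ℕ}, P Q → (∀ j, P j → j ∈ s.cols ∧
      (carry (below s'.lower l) s.cols j, below s'.lower l j) = (x, y)) →
      theUnique P = some Q := fun {Q P x y} hQ hP =>
    theUnique_eq_some hQ fun j hj =>
      below_injective _ _ ((Prod.mk.inj (hP j hj).2).2.trans (Prod.mk.inj (hP Q hQ).2).2.symm)
  cases h with
  | @accept L L' A T a b hcov h1 h2 =>
    have hpkg : IsBruhatPackage r w (L' ∪ rowGraph l A) ⟨shapeOf r m, T ++ [(a, b)]⟩ := by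
      refine ⟨hs'.isRC hl, ?_, hs'.range, fun i _ hi => hs'.chain i hi⟩
      have := hs'.perm
      simp only [Tableau.perm, List.take_length]
      exact this
    rw [← hR'] at hpkg
    rw [rectifyStep, if_pos ⟨hstrict, hpkg⟩, hR']
    rfl
  | @bump L L' A A' T T' a b Q hcov hQ h1 h2 =>
    have hs1 := bump_valid hl hs hcov hQ h1
    have hnot : ¬ (EvalStrict w ⟨shapeOf r m, T ++ [(a, b)]⟩ ∧
        IsBruhatPackage r w (L' ∪ rowGraph l A) ⟨shapeOf r m, T ++ [(a, b)]⟩) := by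
      rintro ⟨-, h3, -⟩
      have h4 := ((isRCGraph_rowUnion hl hcov.rc'.1 hcov.rows' hzero).mp h3).2 Q hQ
      obtain ⟨h5, h6⟩ := Prod.mk.inj h1
      rw [h5, h6] at h4
      exact absurd h4 hcov.lt.le.not_gt
    have hu : theUnique (fun j => (l, j) ∈ L' ∪ rowGraph l A ∧
        strands (L' ∪ rowGraph l A) l j = (b, a)) = some Q := by
      refine huniq (x := b) (y := a) ⟨(hmem Q).mpr hQ, ?_⟩ fun j ⟨h3, h4⟩ => ?_
      · rw [hsr (hpos hQ), h1]
      · have h5 := (hmem j).mp h3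
        rw [hsr (hpos h5)] at h4
        exact ⟨h5, h4⟩
    rw [← hR'] at hnot
    rw [rectifyStep, if_neg hnot]
    simp only [hR', removalPlace, hu, Option.bind_eq_bind, Option.bind_some,
      erase_rowUnion_row hcov.rows']
    exact reinsert_eq hl hcov.rc'.1 hcov.rows' hs1.zero h2
  | @exchange L L' A A' T T' a b f Q hcov h1 hQ h2 h3 =>
    have hs1 := exchange_valid hl hlr hs hcov h1 hQ h2
    have hacc := accept_valid hl hs hcov h1
    have hstep : Step r l (some (a, b)) ⟨L, A, T ++ [(a, f)]⟩ ⟨L', A', T'⟩ :=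
      Step.exchange hcov h1 hQ h2 h3
    have hlenT := hstep.length_word
    simp only [List.length_append, List.length_singleton] at hlenT hlen
    -- the tableau with `(a b)` in box `i` has an ascent where the resulting tableau has a descent
    have hnot : ¬ (EvalStrict w ⟨shapeOf r m, T ++ [(a, f)] ++ [(a, b)]⟩ ∧
        IsBruhatPackage r w (L' ∪ rowGraph l A) ⟨shapeOf r m, T ++ [(a, f)] ++ [(a, b)]⟩) := by
      rintro ⟨h4, -⟩
      rw [evalStrict_iff] at h4 hstrict
      simp only [List.length_append, List.length_singleton] at h4
      rw [hlenT] at hstrict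
      have hfcol : exitStrand (below L l) A Q = f := by
        have hne : f ≠ b := fun e => by
          have h5 := (Prod.mk.inj h2).1
          have h6 := (Prod.mk.inj h2).2
          have h7 : carry (below L' l) A Q < below L' l Q := hacc.reduced Q hQ
          omega
        have h5 := (Prod.mk.inj h2).2
        have hf := (hs.range (a, f) (by simp)).2.2
        have ha := hcov.ha
        simp only at hf
        rw [exitStrand, if_pos hQ]
        rw [hcov.below_eq, Function.comp, Equiv.swap_apply_eq_iff,
          Equiv.swap_apply_of_ne_of_ne (by omega) hne] at h5
        exact h5
      have hf : Config.LastAt l ⟨L, A, T ++ [(a, f)]⟩ a f Q := ⟨by simp, hpos hQ, hfcol⟩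
      have h5 := hf.evalAt_eq hl hlr hs (k := T.length) (by simp)
      obtain ⟨e, g, p, hp, -⟩ := hs'.exists_lastAt hl hlr
        (List.ne_nil_of_length_eq_add_one hlenT)
      have h6 := hp.evalAt_eq hl hlr hs' (k := T.length + 1) (by simp only; omega)
      have hpQ : p < Q := by
        obtain ⟨P, Q', hP1, hPQ, hP, hQ', -, -, -, -⟩ := hcov.columns'
        obtain ⟨-, hacc' | ⟨R, j, hmv⟩⟩ := hstep.rect_cases hl hlr hs hP
        · exact absurd h2 (hacc'.no_exchange f (by simp) Q hQ)
        · have hRQ : R = Q := by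
            rcases hmv.word with ⟨h7, -⟩ | ⟨-, -, T₀, f', h7, h8, -⟩
            · refine absurd ?_ (h1 R hmv.mem)
              have h8 := hmv.carry_eq
              rw [carry_erase_of_le le_rfl] at h8
              rw [h8, h7]
            · have h9 := (List.append_inj' h7 rfl).2
              simp only [List.cons.injEq, Prod.mk.injEq, true_and, and_true] at h9
              exact below_injective L' l (h8.trans (h9.symm.trans (Prod.mk.inj h2).2.symm))
          subst hRQ
          have := hmv.lt
          have := hmv.le
          rcases hmv.column hl hs' hp with ⟨rfl, -⟩ | ⟨h7, -⟩
          · omega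
          · rcases hmv.word with ⟨h8, -⟩ | ⟨-, h8, -⟩
            · refine absurd ?_ (h1 R hQ)
              rw [(Prod.mk.inj h2).1, h8]
            · exact absurd h8 (not_le.mpr h7)
      refine hstrict.not_of_ascent (k := T.length) (by omega) ?_ ?_ h4
      · have h7 := hstep.evalAt_eq (w := w) (k := T.length) (by simp)
        simp only at h5 h6 h7
        rw [h7, h5.1, h5.2, h6.1, h6.2]
        have := hp.2.1
        omega
      · have h7 := evalAt_snoc w (T ++ [(a, f)]) (a, b)
        rw [List.length_append, List.length_singleton] at h7
        rw [evalAt_append _ _ _ (by simp), evalAt_snoc, h7, transProd_snoc, ← mul_assoc,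
          Equiv.Perm.mul_apply _ (Equiv.swap _ _), Equiv.swap_apply_left]
        have h8 := hs.chain.length
        have h9 := hs.chain.of_append.length
        have hr := hs.range (a, f) (by simp)
        have hw : InSInf (w * transProd T) := by
          have h10 := hs.perm
          simp only [Config.graph] at h10
          rw [transProd_snoc, ← mul_assoc] at h10
          have h11 : w * transProd T = graphPerm (L ∪ rowGraph l A) * Equiv.swap a f := by
            rw [← h10, mul_assoc, Equiv.swap_mul_self, mul_one]
          rw [h11]
          exact (inSInf_graphPerm (hs.isRC hl).1).mul (inSInf_swap hr.1 (by simp only at hr; omega))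
        simp only at h8 hr
        rw [transProd_snoc, ← mul_assoc] at h8
        exact ((permLength_mul_swap_eq_succ hw hr.1 (by omega)).mp (by
          rw [h8, h9, List.length_append, List.length_singleton, add_assoc])).1
    have hu1 : theUnique (fun j => (l, j) ∈ L' ∪ rowGraph l A ∧
        strands (L' ∪ rowGraph l A) l j = (b, a)) = none := by
      refine theUnique_eq_none fun j ⟨h3, h4⟩ => ?_
      have h5 := (hmem j).mp h3
      rw [hsr (hpos h5)] at h4
      exact h1 j h5 h4
    have hu2 : theUnique (fun j => (l, j) ∈ L' ∪ rowGraph l A ∧ True ∧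
        strands (L' ∪ rowGraph l A) l j = (b, f)) = some Q := by
      refine huniq (x := b) (y := f) ⟨(hmem Q).mpr hQ, trivial, ?_⟩ fun j ⟨h3, _, h4⟩ => ?_
      · rw [hsr (hpos hQ), h2]
      · have h5 := (hmem j).mp h3
        rw [hsr (hpos h5)] at h4
        exact ⟨h5, h4⟩
    rw [← hR'] at hnot
    rw [rectifyStep, if_neg hnot]
    simp only [hR', removalPlace, hu1, List.getLast?_append, List.getLast?_singleton,
        Option.some_or,
      Option.bind_eq_bind, Option.bind_some, hu2, Option.pure_def, erase_rowUnion_row hcov.rows',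
      List.dropLast_concat]
    exact reinsert_eq hl hcov.rc'.1 hcov.rows' hs1.zero h3

end steps

/-! ### Strictness of the tableaux of consecutive rows -/

/-- The numbers `f p q` in the boxes of the shape `m` strictly increase in rows and strictly
decrease from every row to the next one above it. -/
structure BoxStrict (r : ℕ) (m : ℕ → ℕ) (f : ℕ → ℕ → ℕ) : Prop where
  row : ∀ p < r, ∀ q q', q < q' → q' < m p → f p q < f p q'
  col : ∀ p, p + 1 < r → ∀ q, q < m p → q < m (p + 1) → f (p + 1) q < f p q

theorem strictOn_iff_boxStrict {r n : ℕ} {m e : ℕ → ℕ} (hm : ∀ p, p + 1 < r → m p ≤ m (p + 1))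
    (hn : n = offset m r) : StrictOn r m n e ↔ BoxStrict r m fun p q => e (offset m p + q) := by
  have hlt : ∀ p < r, ∀ q < m p, offset m p + q < n := fun p hp q hq => by
    have := offset_mono m (show p + 1 ≤ r from hp)
    rw [offset_succ] at this
    omega
  constructor
  · exact fun h => ⟨fun p hp q q' h1 h2 => h.row p hp q q' h1 h2 (hlt p hp q' h2),
      fun p hp q h1 h2 => h.col p (p + 1) p.lt_succ_self hp q h1 h2 (hlt _ hp q h2)⟩
  · exact fun h => StrictOn.of_adjacent hm
      (fun p hp q hq _ => h.row p hp q (q + 1) q.lt_succ_self hq)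
      fun p hp q hq _ => h.col p hp q hq (hq.trans_le (hm p hp))

theorem BoxStrict.congr {r : ℕ} {m : ℕ → ℕ} {f f' : ℕ → ℕ → ℕ} (h : BoxStrict r m f)
    (he : ∀ p < r, ∀ q < m p, f' p q = f p q) : BoxStrict r m f' := by
  constructor
  · intro p hp q q' h1 h2
    rw [he p hp q (by omega), he p hp q' h2]
    exact h.row p hp q q' h1 h2
  · intro p hp q h1 h2
    rw [he p (by omega) q h1, he (p + 1) hp q h2]
    exact h.col p hp q h1 h2

/-- The relations between the entries of consecutive boxes: `t i` tells whether step `i` is a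
rectification, `E i` is the entry of its box in the upper tableau and `F i`, for a rectification,
the entry of the corresponding box in the lower tableau. -/
structure Alternation (n : ℕ) (t : ℕ → Bool) (E F : ℕ → ℕ) : Prop where
  insertion : ∀ i, i + 1 < n → t (i + 1) = false → E i < E (i + 1)
  turn : ∀ i, i + 1 < n → t i = false → t (i + 1) = true → E (i + 1) < E i
  rect : ∀ i, i + 1 < n → t i = true → t (i + 1) = true →
    (F i < F (i + 1) ∧ E i < E (i + 1)) ∨ (F (i + 1) < F i ∧ E (i + 1) < E i)

/-- The steps of a row over a semi-shuffle: `X i` and `Y i` are the permutations of the lower rows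
and of the whole graph before step `i`, `b i` and `g i` are the large numbers that the step moves in
them (`b i = ⊤` for an insertion). -/
structure LargeMoves (r n : ℕ) (t : ℕ → Bool) (E F : ℕ → ℕ) (X Y : ℕ → Equiv.Perm ℕ) (b : ℕ → ℕ∞)
    (g : ℕ → ℕ) : Prop where
  lower : Moves r n X b
  upper : Moves r n Y fun i => g i
  adj_lower : ∀ i < n, AdjacentFrom (X (i + 1)) (g i) (b i)
  adj_upper : ∀ i < n, AdjacentFrom (Y i) (g i) (b i)
  le : ∀ i < n, g i ≤ b i
  top : ∀ i < n, b i = ⊤ ↔ t i = false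
  entry : ∀ i < n, E i = Y (i + 1) (g i)
  lower_entry : ∀ i < n, ∀ k : ℕ, k = b i → F i = X (i + 1) k

section strict

variable {r n : ℕ} {t : ℕ → Bool} {E F : ℕ → ℕ} {X Y : ℕ → Equiv.Perm ℕ} {b : ℕ → ℕ∞} {g : ℕ → ℕ}

theorem LargeMoves.lower_lt (h : LargeMoves r n t E F X Y b g) {i j : ℕ} (hij : i < j) (hj : j < n)
    (hF : t i = true → t j = true → F i < F j) (htj : t j = true → t i = true) :
    b i < b j ∨ b j = ⊤ := by
  rcases hj' : t j with _ | _
  · exact Or.inr ((h.top j hj).mpr hj')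
  · refine Or.inl (lt_of_not_ge fun hc => ?_)
    have hi' := htj hj'
    obtain ⟨ci, hi⟩ := ENat.ne_top_iff_exists.mp fun e => by
      rw [h.top i (by omega), hi'] at e
      exact Bool.noConfusion e
    obtain ⟨cj, hcj⟩ := ENat.ne_top_iff_exists.mp fun e => by
      rw [h.top j hj, hj'] at e
      exact Bool.noConfusion e
    rw [← hi, ← hcj, Nat.cast_le] at hc
    have h1 := h.lower.lt_of_le hij hj hcj hc
    rw [← h.lower_entry i (by omega) ci hi, ← h.lower_entry j hj cj hcj] at h1
    have := hF hi' hj'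
    omega

theorem LargeMoves.upper_lt (h : LargeMoves r n t E F X Y b g) {i j : ℕ} (hij : i < j) (hj : j < n)
    (hE : E i < E j) : g i < g j := by
  by_contra hc
  have h1 := h.upper.lt_of_le hij hj rfl (not_lt.mp hc)
  rw [← h.entry i (by omega), ← h.entry j hj] at h1
  omega

theorem LargeMoves.entry_lt (h : LargeMoves r n t E F X Y b g) {i j : ℕ} (hij : i < j) (hj : j < n)
    (hg : g j ≤ g i) : E j < E i := by
  rw [h.entry i (by omega), h.entry j hj]
  exact h.upper.lt_of_le hij hj rfl hg

theorem LargeMoves.lower_entry_lt (h : LargeMoves r n t E F X Y b g) {i j : ℕ} (hij : i < j)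
    (hj : j < n) (hti : t i = true) (hb : b j ≤ b i) : F j < F i := by
  obtain ⟨ci, hi⟩ := ENat.ne_top_iff_exists.mp fun e => by
    rw [h.top i (by omega), hti] at e
    exact Bool.noConfusion e
  obtain ⟨cj, hcj⟩ := ENat.ne_top_iff_exists.mp (hb.trans_lt (hi ▸ ENat.natCast_lt_top ci)).ne
  rw [← hi, ← hcj, Nat.cast_le] at hb
  rw [h.lower_entry i (by omega) ci hi, h.lower_entry j hj cj hcj]
  exact h.lower.lt_of_le hij hj hcj hb

theorem box_lt {m : ℕ → ℕ} {p q : ℕ} (hp : p < r) (hq : q < m p) :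
    offset m p + q < offset m r := by
  have := offset_mono m (show p + 1 ≤ r from hp)
  rw [offset_succ] at this
  omega

/-- Strictness passes from the lower tableau to the upper one. -/
theorem Alternation.strict_upper {sh sh' : ℕ → ℕ} (h : Alternation n t E F)
    (hn : n = offset sh' r) (ht : ∀ p < r, ∀ q < sh' p, t (offset sh' p + q) = true ↔ q < sh p)
    (hle : ∀ p < r, sh p ≤ sh' p) (hb : ∀ p, p + 1 < r → sh' p ≤ sh (p + 1))
    (hcase : (∃ X Y b g, LargeMoves r n t E F X Y b g) ∨ ∀ p, p + 1 < r → sh' p ≤ 1)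
    (hF : BoxStrict r sh fun p q => F (offset sh' p + q)) :
    BoxStrict r sh' fun p q => E (offset sh' p + q) := by
  have hstep : ∀ p < r, ∀ q, q + 1 < sh' p → E (offset sh' p + q) < E (offset sh' p + q + 1) := by
    intro p hp q hq
    have h1 := box_lt hp hq
    rcases h2 : t (offset sh' p + q + 1) with _ | _
    · exact h.insertion _ (by omega) h2
    · have h3 := (ht p hp (q + 1) hq).mp h2
      have h4 := (ht p hp q (by omega)).mpr (by omega)
      have h5 := hF.row p hp q (q + 1) (by omega) h3
      rw [← add_assoc] at h5
      rcases h.rect _ (by omega) h4 h2 with h6 | h6 <;> omega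
  have hrow : ∀ p < r, ∀ q q', q < q' → q' < sh' p →
      E (offset sh' p + q) < E (offset sh' p + q') := by
    intro p hp q q' hq hq'
    induction q', hq using Nat.le_induction with
    | base => exact hstep p hp q hq'
    | succ q' hq ih => exact (ih (by omega)).trans (hstep p hp q' hq')
  refine ⟨hrow, fun p hp q hq hq' => ?_⟩
  have hp' : p < r := by omega
  have hbp := hb p hp
  have hlast := box_lt hp hq'
  -- columns: the ballot argument over a semi-shuffle, and consecutive boxes for a hook
  rcases hcase with ⟨X, Y, b, g, hX⟩ | hone
  · have hlep := hle p hp'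
    have hlep' := hle (p + 1) hp
    have hblock : offset sh' p + sh' p + sh' (p + 1) ≤ n := by
      have h1 := offset_mono sh' (show p + 1 + 1 ≤ r from hp)
      rw [offset_succ, offset_succ] at h1
      omega
    have htp := ht p hp'
    have htp' := ht (p + 1) hp
    have hrp := hF.row p hp'
    have hcp := hF.col p hp
    rw [offset_succ] at htp' hlast ⊢
    simp only [offset_succ] at hcp
    have h1 : ∀ q q', q < q' → q' < sh' p →
        b (offset sh' p + q) < b (offset sh' p + q') ∨ b (offset sh' p + q') = ⊤ := by
      intro q q' hqq hq'
      refine hX.lower_lt (by omega) (by omega) (fun _ h2 => ?_) fun h2 => ?_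
      · exact hrp q q' hqq ((htp q' hq').mp h2)
      · rw [htp q' hq'] at h2
        exact (htp q (by omega)).mpr (by omega)
    have htop : ∀ i < n, t i = true → ∃ c : ℕ, (c : ℕ∞) = b i := fun i hi hti =>
      ENat.ne_top_iff_exists.mp fun e => by
        rw [hX.top i hi, hti] at e
        exact Bool.noConfusion e
    have h2 : ∀ q < sh p, b (offset sh' p + sh' p + q) ≤ b (offset sh' p + q) := by
      refine hX.lower.column_le (m' := sh' (p + 1)) hblock hlep (by omega) h1 fun q hq => ?_
      obtain ⟨ci, hi⟩ := htop (offset sh' p + q) (by omega) ((htp q (by omega)).mpr hq)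
      obtain ⟨cj, hj⟩ := htop (offset sh' p + sh' p + q) (by omega)
        ((htp' q (by omega)).mpr (by omega))
      refine ⟨ci, cj, hi, hj, ?_⟩
      rw [← hX.lower_entry _ (by omega) ci hi, ← hX.lower_entry _ (by omega) cj hj]
      exact hcp q hq (by omega)
    have h3 : ∀ q < sh' p, b (offset sh' p + sh' p + q) ≤ g (offset sh' p + q) := by
      refine hX.lower.ballot_forward (fun i hi => Nat.cast_lt.mp (hX.upper.large i hi)) hX.adj_lower
        (m' := sh' (p + 1)) hblock (by omega) h1 (fun q hq => ?_) (fun q hq e => ?_)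
        fun q q' hqq hq' => hX.upper_lt (by omega) (by omega) (hrow p hp' q q' hqq hq')
      · rcases lt_or_ge q (sh p) with h3 | h3
        · exact h2 q h3
        · have h4 : t (offset sh' p + q) = false :=
            Bool.eq_false_iff.mpr fun h4 => absurd ((htp q hq).mp h4) (by omega)
          rw [(hX.top _ (by omega)).mpr h4]
          exact le_top
      · have h4 := (htp' q (by omega)).mpr (by omega)
        rw [(hX.top _ (by omega)).mp e] at h4
        exact Bool.noConfusion h4
    exact hX.entry_lt (by omega) (by omega)
      (Nat.cast_le.mp ((hX.le (offset sh' p + sh' p + q) (by omega)).trans (h3 q hq)))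
  · have h1 := hone p hp
    obtain rfl : q = 0 := by omega
    have h2 : sh' p = 1 := by omega
    have htp := ht p hp' 0 hq
    have htp' := (ht (p + 1) hp 0 hq').mpr (by omega)
    have hcp := hF.col p hp 0
    simp only [offset_succ, h2, add_zero] at htp htp' hcp hlast ⊢
    rcases h3 : t (offset sh' p) with _ | _
    · exact h.turn _ (by omega) h3 htp'
    · rcases h.rect _ (by omega) h3 htp' with h4 | h4
      · have := hcp (htp.mp h3) (by omega)
        omega
      · exact h4.2

/-- Strictness passes from the upper tableau to the lower one, and the rectifications form a
subdiagram. -/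
theorem Alternation.strict_lower {sh' : ℕ → ℕ} (h : Alternation n t E F)
    (hn : n = offset sh' r) (hm : ∀ p, p + 1 < r → sh' p ≤ sh' (p + 1))
    (hcase : (∃ X Y b g, LargeMoves r n t E F X Y b g) ∨ ∀ p, p + 1 < r → sh' p ≤ 1)
    (hE : BoxStrict r sh' fun p q => E (offset sh' p + q)) :
    ∃ sh : ℕ → ℕ, (∀ p < r, sh p ≤ sh' p) ∧
      (∀ p < r, ∀ q < sh' p, t (offset sh' p + q) = true ↔ q < sh p) ∧
      (∀ p, p + 1 < r → sh' p ≤ sh (p + 1)) ∧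
      BoxStrict r sh fun p q => F (offset sh' p + q) := by
  -- a rectification after an insertion lowers the entry, so in every row the rectifications come
  -- first
  have hdown : ∀ p < r, ∀ q, q + 1 < sh' p → t (offset sh' p + q + 1) = true →
      t (offset sh' p + q) = true := by
    intro p hp q hq h1
    by_contra h2
    have h3 := box_lt hp hq
    have h4 := h.turn _ (by omega) (Bool.eq_false_iff.mpr h2) h1
    have h5 := hE.row p hp q (q + 1) (by omega) hq
    rw [← add_assoc] at h5
    omega
  have hex : ∀ p, p < r → ∃ k ≤ sh' p, ∀ q < sh' p, t (offset sh' p + q) = true ↔ q < k := by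
    intro p hp
    suffices H : ∀ M ≤ sh' p, ∃ k ≤ M, ∀ q < M, t (offset sh' p + q) = true ↔ q < k from
      H _ le_rfl
    intro M hM
    induction M with
    | zero => exact ⟨0, le_rfl, fun q hq => by omega⟩
    | succ M ih =>
      obtain ⟨k, hk, hk'⟩ := ih (by omega)
      rcases h1 : t (offset sh' p + M) with _ | _
      · refine ⟨k, by omega, fun q hq => ?_⟩
        rcases Nat.lt_succ_iff_lt_or_eq.mp hq with h2 | rfl
        · exact hk' q h2
        · rw [h1]
          simp only [Bool.false_eq_true, false_iff]
          omega
      · have hkM : k = M := by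
          by_contra h2
          have h3 := hdown p hp (M - 1) (by omega) (by
            rw [show offset sh' p + (M - 1) + 1 = offset sh' p + M by omega]
            exact h1)
          have := (hk' (M - 1) (by omega)).mp h3
          omega
        subst hkM
        refine ⟨k + 1, le_rfl, fun q hq => ?_⟩
        rcases Nat.lt_succ_iff_lt_or_eq.mp hq with h2 | rfl
        · rw [hk' q h2]
          omega
        · simp [h1]
  choose! sh hsh ht using hex
  have hrowF : ∀ p < r, ∀ q q', q < q' → q' < sh p →
      F (offset sh' p + q) < F (offset sh' p + q') := by
    have hstep : ∀ p < r, ∀ q, q + 1 < sh p → F (offset sh' p + q) < F (offset sh' p + q + 1) := by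
      intro p hp q hq
      have h0 := hsh p hp
      have h1 := box_lt hp (show q + 1 < sh' p by omega)
      have h2 := (ht p hp q (by omega)).mpr (by omega)
      have h3 := (ht p hp (q + 1) (by omega)).mpr hq
      have h4 := hE.row p hp q (q + 1) (by omega) (by omega)
      rw [← add_assoc] at h3 h4
      rcases h.rect _ (by omega) h2 h3 with h5 | h5 <;> omega
    intro p hp q q' hq hq'
    induction q', hq using Nat.le_induction with
    | base => exact hstep p hp q hq'
    | succ q' hq ih => exact (ih (by omega)).trans (hstep p hp q' hq')
  -- the comparison of consecutive rows: the ballot argument over a semi-shuffle, and consecutive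
  -- boxes for a hook
  have hmain : ∀ p, p + 1 < r → ∀ q < sh' p, q < sh (p + 1) ∧
      (q < sh p → F (offset sh' (p + 1) + q) < F (offset sh' p + q)) := by
    intro p hp q hq
    have hp' : p < r := by omega
    have hmp := hm p hp
    have hblock : offset sh' p + sh' p + sh' (p + 1) ≤ n := by
      have h1 := offset_mono sh' (show p + 1 + 1 ≤ r from hp)
      rw [offset_succ, offset_succ] at h1
      omega
    have htp := ht p hp'
    have htp' := ht (p + 1) hp
    have hsp := hsh p hp'
    have hsp' := hsh (p + 1) hp
    have hEp := hE.row p hp'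
    have hEp' := hE.row (p + 1) hp
    have hEc := hE.col p hp
    have hFp' := hrowF (p + 1) hp
    simp only [offset_succ] at htp' hEp' hEc hFp' ⊢
    rcases hcase with ⟨X, Y, b, g, hX⟩ | hone
    · have hg1 : ∀ q q', q < q' → q' < sh' p → g (offset sh' p + q) < g (offset sh' p + q') :=
        fun q q' h1 h2 => hX.upper_lt (by omega) (by omega) (hEp q q' h1 h2)
      have hg2 : ∀ q q', q < q' → q' < sh' (p + 1) →
          g (offset sh' p + sh' p + q) < g (offset sh' p + sh' p + q') :=
        fun q q' h1 h2 => hX.upper_lt (by omega) (by omega) (hEp' q q' h1 h2)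
      have hcol := hX.upper.column_le (m' := sh' (p + 1)) (μ := sh' p) hblock le_rfl hmp
        (fun q q' h1 h2 => Or.inl (Nat.cast_lt.mpr (hg1 q q' h1 h2))) fun q hq =>
          ⟨_, _, rfl, rfl, by
            rw [← hX.entry _ (by omega), ← hX.entry _ (by omega)]
            exact hEc q hq (by omega)⟩
      have hball := hX.upper.ballot_backward hX.adj_upper hblock hmp hg1 hg2
        (fun q q' h1 h2 => hX.lower_lt (by omega) (by omega)
          (fun h3 h4 => hFp' q q' h1 ((htp' q' h2).mp h4))
          fun h4 => (htp' q (by omega)).mpr (by have := (htp' q' h2).mp h4; omega))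
        fun q hq => Nat.cast_le.mp (hcol q hq)
      have hbq := hball q hq
      refine ⟨(htp' q (by omega)).mp (Bool.not_eq_false _ ▸ fun h1 => ?_), fun h1 => ?_⟩
      · rw [(hX.top _ (by omega)).mpr h1] at hbq
        exact absurd hbq (not_le.mpr (ENat.natCast_lt_top _))
      · exact hX.lower_entry_lt (by omega) (by omega) ((htp q hq).mpr h1)
          (hbq.trans (hX.le _ (by omega)))
    · have h1 := hone p hp
      obtain rfl : q = 0 := by omega
      have h2 : sh' p = 1 := by omega
      have h3 := htp' 0 (by omega)
      have h4 := htp 0 hq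
      have h5 := hEc 0 hq (by omega)
      simp only [h2, add_zero] at h3 h4 h5 ⊢
      have h6 : t (offset sh' p + 1) = true := by
        by_contra h6
        have := h.insertion _ (by omega) (Bool.eq_false_iff.mpr h6)
        omega
      refine ⟨h3.mp h6, fun h7 => ?_⟩
      rcases h.rect _ (by omega) (h4.mpr h7) h6 with h8 | h8 <;> omega
  refine ⟨sh, hsh, ht, fun p hp => ?_, hrowF, fun p hp q hq hq' => ?_⟩
  · by_contra hc
    have := (hmain p hp (sh (p + 1)) (by omega)).1
    omega
  · exact (hmain p hp q (hq.trans_le (hsh p (by omega)))).2 hq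

end strict

/-! ### The steps of a row -/

/-- The steps `0, …, n - 1` of row `l`, from `cs 0` with an empty tableau to `cs n`. -/
structure Run (r l : ℕ) (w : Equiv.Perm ℕ) (n : ℕ) (cs : ℕ → Config) (o : ℕ → Option (ℕ × ℕ)) :
    Prop where
  valid_zero : (cs 0).Valid r l w
  word_zero : (cs 0).word = []
  step : ∀ i < n, Step r l (o i) (cs i) (cs (i + 1))

/-- The word of the lower tableau of a sequence of steps. -/
def lowerWord (o : ℕ → Option (ℕ × ℕ)) (n : ℕ) : List (ℕ × ℕ) := (List.range n).filterMap o

theorem lowerWord_succ_none {o : ℕ → Option (ℕ × ℕ)} {n : ℕ} (h : o n = none) :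
    lowerWord o (n + 1) = lowerWord o n := by
  simp [lowerWord, List.range_succ, List.filterMap_append, h]

theorem lowerWord_succ_some {o : ℕ → Option (ℕ × ℕ)} {n : ℕ} {t : ℕ × ℕ} (h : o n = some t) :
    lowerWord o (n + 1) = lowerWord o n ++ [t] := by
  simp [lowerWord, List.range_succ, List.filterMap_append, h]

theorem lowerWord_prefix (o : ℕ → Option (ℕ × ℕ)) {i n : ℕ} (h : i ≤ n) :
    lowerWord o i <+: lowerWord o n := by
  obtain ⟨k, rfl⟩ := Nat.exists_eq_add_of_le h
  rw [lowerWord, lowerWord, List.range_add, List.filterMap_append]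
  exact List.prefix_append _ _

theorem lowerWord_take (o : ℕ → Option (ℕ × ℕ)) {i n : ℕ} (h : i ≤ n) :
    (lowerWord o n).take (lowerWord o i).length = lowerWord o i :=
  (List.prefix_iff_eq_take.mp (lowerWord_prefix o h)).symm

theorem lowerWord_getElem? {o : ℕ → Option (ℕ × ℕ)} {i n : ℕ} (h : i < n) {t : ℕ × ℕ}
    (ht : o i = some t) : (lowerWord o n)[(lowerWord o i).length]? = some t := by
  obtain ⟨k, hk⟩ := lowerWord_prefix o (Nat.succ_le_of_lt h)
  rw [← hk, Nat.succ_eq_add_one, lowerWord_succ_some ht]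
  simp

/-- The entry of `E` in the lower tableau that belongs to the rectification `i`. -/
def lowerEntry (cs : ℕ → Config) (o : ℕ → Option (ℕ × ℕ)) (i : ℕ) : ℕ :=
  graphPerm (cs (i + 1)).lower ((o i).getD (0, 0)).2

theorem Step.lower_eq {r l : ℕ} {s s' : Config} (h : Step r l none s s') : s'.lower = s.lower := by
  cases h
  rfl

theorem Step.lowerCover {r l a b : ℕ} {s s' : Config} (h : Step r l (some (a, b)) s s') :
    LowerCover r l s.lower s'.lower a b := by
  cases h <;> assumption

theorem LowerCover.graphPerm_lt {r l a b : ℕ} {L L' : Graph} (h : LowerCover r l L L' a b) :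
    graphPerm L a < graphPerm L b := by
  obtain ⟨P, Q, -, hPQ, hP, hQ, -⟩ := h.columns
  rw [below, Equiv.symm_apply_eq] at hP hQ
  omega

section run

variable {r l n : ℕ} {w : Equiv.Perm ℕ} {cs : ℕ → Config} {o : ℕ → Option (ℕ × ℕ)}

theorem Run.valid (h : Run r l w n cs o) (hl : 1 ≤ l) (hlr : l ≤ r) {i : ℕ} (hi : i ≤ n) :
    (cs i).Valid r l w := by
  induction i with
  | zero => exact h.valid_zero
  | succ i ih => exact (h.step i (by omega)).valid hl hlr (ih (by omega))

theorem Run.length (h : Run r l w n cs o) {i : ℕ} (hi : i ≤ n) : (cs i).word.length = i := by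
  induction i with
  | zero => rw [h.word_zero, List.length_nil]
  | succ i ih => rw [(h.step i (by omega)).length_word, ih (by omega)]

theorem Run.exists_lastAt (h : Run r l w n cs o) (hl : 1 ≤ l) (hlr : l ≤ r) {i : ℕ} (hi : i < n) :
    ∃ e g p, (cs (i + 1)).LastAt l e g p := by
  obtain ⟨e, g, p, hp, -⟩ := (h.valid hl hlr (Nat.succ_le_of_lt hi)).exists_lastAt hl hlr
    (List.ne_nil_of_length_eq_add_one (h.length hi))
  exact ⟨e, g, p, hp⟩

theorem Run.evalAt_eq (h : Run r l w n cs o) {i j : ℕ} (hij : i < j) (hj : j ≤ n) :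
    evalAt w (cs j).word i = evalAt w (cs (i + 1)).word i := by
  induction j, hij using Nat.le_induction with
  | base => rfl
  | succ j hij ih =>
    rw [(h.step j (by omega)).evalAt_eq (by rw [h.length (by omega)]; omega), ih (by omega)]

/-- The entry of `E` in the box of step `i` is the position where its large strand leaves the
row. -/
theorem Run.entry (h : Run r l w n cs o) (hl : 1 ≤ l) (hlr : l ≤ r) {i : ℕ} (hi : i < n)
    {e g p : ℕ} (hp : (cs (i + 1)).LastAt l e g p) :
    evalAt w (cs n).word i = graphPerm ((cs (i + 1)).graph l) g ∧
      evalAt w (cs n).word i = l + p - 1 := by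
  have h1 := hp.evalAt_eq hl hlr (h.valid hl hlr (Nat.succ_le_of_lt hi)) (h.length hi)
  rw [h.evalAt_eq hi le_rfl]
  exact ⟨h1.1, h1.1.trans h1.2⟩

/-- The entries of `E` along the steps of a row rise and fall as `Alternation` says. -/
theorem Run.alternation (h : Run r l w n cs o) (hl : 1 ≤ l) (hlr : l ≤ r) :
    Alternation n (fun i => (o i).isSome) (evalAt w (cs n).word) (lowerEntry cs o) := by
  have key : ∀ i, i + 1 < n → ∃ p p', evalAt w (cs n).word i = l + p - 1 ∧
      evalAt w (cs n).word (i + 1) = l + p' - 1 ∧ 1 ≤ p ∧ 1 ≤ p' ∧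
      (o (i + 1) = none → p < p') ∧
      (∀ a b, o i = none → o (i + 1) = some (a, b) → p' < p) ∧
      (∀ a b a' b', o i = some (a, b) → o (i + 1) = some (a', b') →
        (lowerEntry cs o i < lowerEntry cs o (i + 1) ∧ p < p') ∨
          (lowerEntry cs o (i + 1) < lowerEntry cs o i ∧ p' < p)) := by
    intro i hi
    obtain ⟨e, g, p, hp⟩ := h.exists_lastAt hl hlr (show i < n by omega)
    obtain ⟨e', g', p', hp'⟩ := h.exists_lastAt hl hlr hi
    have h1 := h.step i (by omega)
    have h2 := h.step (i + 1) hi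
    have hv := h.valid hl hlr (show i ≤ n by omega)
    refine ⟨p, p', (h.entry hl hlr (by omega) hp).2, (h.entry hl hlr hi hp').2, hp.2.1, hp'.2.1,
      fun h3 => ?_, fun a b h3 h4 => ?_, fun a b a' b' h3 h4 => ?_⟩
    · rw [h3] at h2
      exact h1.lt_of_insertion h2 hl hlr hv hp hp'
    · rw [h3] at h1
      rw [h4] at h2
      exact h1.gt_of_rect_after_insertion h2 hl hlr hv hp hp'
    · rw [h3] at h1
      rw [h4] at h2
      simp only [lowerEntry, h3, h4, Option.getD_some]
      exact h1.rect_rect h2 hl hlr hv hp hp'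
  refine ⟨fun i hi h1 => ?_, fun i hi h1 h2 => ?_, fun i hi h1 h2 => ?_⟩
  all_goals obtain ⟨p, p', e1, e2, hp, hp', k1, k2, k3⟩ := key i hi
  · have := k1 (by simpa using h1)
    omega
  · obtain ⟨⟨a, b⟩, h3⟩ := Option.isSome_iff_exists.mp h2
    have := k2 a b (by simpa using h1) h3
    omega
  · obtain ⟨⟨a, b⟩, h3⟩ := Option.isSome_iff_exists.mp h1
    obtain ⟨⟨a', b'⟩, h4⟩ := Option.isSome_iff_exists.mp h2
    have := k3 a b a' b' h3 h4
    omega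

/-- Over a semi-shuffle every step of a row moves one large number to the left, both in the lower
rows and in the whole graph. -/
theorem Run.largeMoves (h : Run r l w n cs o) (hl : 1 ≤ l) (hlr : l ≤ r) (hw : InSInf w)
    (hsemi : IsSemiShuffle r w) : ∃ X Y b g, LargeMoves r n (fun i => (o i).isSome)
      (evalAt w (cs n).word) (lowerEntry cs o) X Y b g := by
  choose! e g p hp using fun i (hi : i < n) => h.exists_lastAt hl hlr hi
  have hv : ∀ i ≤ n, (cs i).Valid r l w := fun i hi => h.valid hl hlr hi
  -- an insertion does not change the lower rows
  let b : ℕ → ℕ∞ := fun i => (o i).elim ⊤ fun t => (t.2 : ℕ∞)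
  have hkey : ∀ i < n, (cs (i + 1)).word = (cs i).word ++ [(e i, g i)] ∧ (g i : ℕ∞) ≤ b i ∧
      AdjacentFrom (graphPerm (cs (i + 1)).lower) (g i) (b i) ∧
      AdjacentFrom (graphPerm ((cs i).graph l)) (g i) (b i) := by
    intro i hi
    have h1 := h.step i hi
    rcases ho : o i with _ | ⟨a, c⟩
    · rw [ho] at h1
      obtain ⟨h2, -, h3, h4⟩ := h1.semi_insertion hl hlr (hv i hi.le) hw hsemi (hp i hi)
      simp only [b, ho, Option.elim_none]
      exact ⟨h2, le_top, h3, h4⟩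
    · rw [ho] at h1
      obtain ⟨h2, h3, h4, h5⟩ := h1.semi_rect hl hlr (hv i hi.le) hw hsemi (hp i hi)
      simp only [b, ho, Option.elim_some]
      exact ⟨h2, Nat.cast_le.mpr h3, h4, h5⟩
  have hY : ∀ i < n, graphPerm ((cs (i + 1)).graph l) =
      graphPerm ((cs i).graph l) * Equiv.swap (e i) (g i) := fun i hi => by
    rw [← (hv i hi.le).perm, ← (hv (i + 1) hi).perm, (hkey i hi).1, transProd_snoc, mul_assoc]
  have hX : ∀ i < n, ∀ a c, o i = some (a, c) →
      LowerCover r l (cs i).lower (cs (i + 1)).lower a c := fun i hi a c ho => by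
    have h1 := h.step i hi
    rw [ho] at h1
    exact h1.lowerCover
  refine ⟨fun i => graphPerm (cs i).lower, fun i => graphPerm ((cs i).graph l), b, g,
    ⟨fun i hi => (hv i hi).semi_lower hl hw hsemi, fun i hi => ?_, fun i hi k hk hne => ?_,
      fun i hi k hk => ?_⟩,
    ⟨fun i hi => (hv i hi).semi_graph hw hsemi,
      fun i hi => Nat.cast_lt.mpr ((hp i hi).range (hv (i + 1) hi)).2.2, fun i hi k hk hne => ?_,
      fun i hi k hk => ?_⟩,
    fun i hi => (hkey i hi).2.2.1, fun i hi => (hkey i hi).2.2.2, fun i hi => (hkey i hi).2.1,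
    fun i hi => ?_, fun i hi => (h.entry hl hlr hi (hp i hi)).1, fun i hi k hk => ?_⟩
  · rcases ho : o i with _ | ⟨a, c⟩
    · simp [b, ho]
    · simpa [b, ho] using (hX i hi a c ho).hb
  · rcases ho : o i with _ | ⟨a, c⟩
    · have h1 := h.step i hi
      rw [ho] at h1
      simp only [h1.lower_eq]
    · have h1 := hX i hi a c ho
      have h2 := h1.ha
      have h3 : k ≠ c := by simpa [b, ho] using hne
      simp only [h1.perm]
      rw [Equiv.Perm.mul_apply, Equiv.swap_apply_of_ne_of_ne (by omega) h3]
  · rcases ho : o i with _ | ⟨a, c⟩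
    · simp [b, ho] at hk
    · obtain rfl : k = c := by simpa [b, ho] using hk
      have h1 := hX i hi a k ho
      simp only [h1.perm]
      rw [Equiv.Perm.mul_apply, Equiv.swap_apply_right]
      exact h1.graphPerm_lt
  · have h1 := (hp i hi).range (hv (i + 1) hi)
    have h2 : k ≠ g i := fun e => hne (by rw [e])
    simp only [hY i hi]
    rw [Equiv.Perm.mul_apply, Equiv.swap_apply_of_ne_of_ne (by omega) h2]
  · obtain rfl : k = g i := Nat.cast_inj.mp hk
    obtain ⟨p', q, -, hpq, -, -, -, h1, h2⟩ := (hv (i + 1) hi).lastCover hl hlr (hkey i hi).1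
    have h3 := hY i hi
    have h4 : graphPerm ((cs i).graph l) (g i) = graphPerm ((cs (i + 1)).graph l) (e i) := by
      rw [h3, Equiv.Perm.mul_apply, Equiv.swap_apply_left]
    omega
  · rcases ho : o i with _ | ⟨a, c⟩ <;> simp [b, ho]
  · rcases ho : o i with _ | ⟨a, c⟩
    · simp [b, ho] at hk
    · obtain rfl : k = c := by simpa [b, ho] using hk
      simp [lowerEntry, ho]

/-! ### The lower tableau of a row -/

theorem Run.lower_perm (h : Run r l w n cs o) {i : ℕ} (hi : i ≤ n) :
    graphPerm (cs i).lower = graphPerm (cs 0).lower * transProd (lowerWord o i) := by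
  induction i with
  | zero => simp [lowerWord, transProd]
  | succ i ih =>
    have h1 := h.step i (by omega)
    rcases ho : o i with _ | ⟨a, b⟩
    · rw [ho] at h1
      rw [lowerWord_succ_none ho, h1.lower_eq, ih (by omega)]
    · rw [ho] at h1
      rw [lowerWord_succ_some ho, h1.lowerCover.perm, ih (by omega), transProd_snoc, mul_assoc]

theorem Run.lower_chain (h : Run r l w n cs o) {i : ℕ} (hi : i ≤ n) :
    IsChain (graphPerm (cs 0).lower) (lowerWord o i) := by
  induction i with
  | zero =>
    intro k hk
    simp only [lowerWord, List.range_zero, List.filterMap_nil, List.length_nil, Nat.le_zero] at hk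
    simp [hk, lowerWord, transProd]
  | succ i ih =>
    have h1 := h.step i (by omega)
    rcases ho : o i with _ | ⟨a, b⟩
    · rw [lowerWord_succ_none ho]
      exact ih (by omega)
    · rw [ho] at h1
      have h2 := h.lower_perm hi
      have h3 := h.lower_perm (show i ≤ n by omega)
      have h4 := (ih (by omega)).length
      rw [lowerWord_succ_some ho] at h2 ⊢
      refine (ih (by omega)).snoc ?_
      rw [← h3] at h4
      rw [← h2, (isRCGraph_iff_card h1.lowerCover.rc'.1).mp h1.lowerCover.rc', h1.lowerCover.card,
        ← (isRCGraph_iff_card h1.lowerCover.rc.1).mp h1.lowerCover.rc, h4, add_assoc]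

theorem Run.lower_range (h : Run r l w n cs o) {t : ℕ × ℕ} (ht : t ∈ lowerWord o n) :
    1 ≤ t.1 ∧ t.1 ≤ r ∧ r < t.2 := by
  obtain ⟨i, hi, ho⟩ := List.mem_filterMap.mp ht
  have h1 := h.step i (List.mem_range.mp hi)
  rw [ho] at h1
  exact ⟨h1.lowerCover.one_le, h1.lowerCover.ha, h1.lowerCover.hb⟩

theorem Run.evalAt_lower (h : Run r l w n cs o) {i : ℕ} (hi : i < n) (ho : (o i).isSome) :
    evalAt (graphPerm (cs 0).lower) (lowerWord o n) (lowerWord o i).length = lowerEntry cs o i := by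
  obtain ⟨⟨a, b⟩, ho⟩ := Option.isSome_iff_exists.mp ho
  have h1 := h.step i hi
  rw [ho] at h1
  rw [evalAt, lowerWord_take o hi.le, ← h.lower_perm hi.le, List.getD_eq_getElem?_getD,
    lowerWord_getElem? hi ho, lowerEntry, ho, Option.getD_some,
    h1.lowerCover.perm, Equiv.Perm.mul_apply, Equiv.swap_apply_right]

/-- The rectifications of a row form the subdiagram `sh` of the diagram `sh'`. -/
structure Subdiagram (r : ℕ) (sh sh' : ℕ → ℕ) (o : ℕ → Option (ℕ × ℕ)) : Prop where
  le : ∀ p < r, sh p ≤ sh' p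
  isSome : ∀ p < r, ∀ q < sh' p, (o (offset sh' p + q)).isSome = true ↔ q < sh p

theorem Subdiagram.length_add {sh sh' : ℕ → ℕ} (h : Subdiagram r sh sh' o) {p : ℕ} (hp : p < r)
    (h0 : (lowerWord o (offset sh' p)).length = offset sh p) {q : ℕ} (hq : q ≤ sh' p) :
    (lowerWord o (offset sh' p + q)).length = offset sh p + min q (sh p) := by
  induction q with
  | zero => simpa using h0
  | succ q ih =>
    have h1 := h.isSome p hp q hq
    rw [← add_assoc]
    rcases ho : o (offset sh' p + q) with _ | t
    · rw [ho] at h1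
      simp only [Option.isSome_none, Bool.false_eq_true, false_iff, not_lt] at h1
      rw [lowerWord_succ_none ho, ih (by omega)]
      omega
    · rw [ho] at h1
      simp only [Option.isSome_some, true_iff] at h1
      rw [lowerWord_succ_some ho, List.length_append, ih (by omega), List.length_singleton]
      omega

theorem Subdiagram.length {sh sh' : ℕ → ℕ} (h : Subdiagram r sh sh' o) {p : ℕ} (hp : p ≤ r) :
    (lowerWord o (offset sh' p)).length = offset sh p := by
  induction p with
  | zero => simp [offset, lowerWord]
  | succ p ih =>
    have h1 := h.length_add hp (ih (by omega)) le_rfl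
    have h2 := h.le p hp
    rw [offset_succ, offset_succ, h1, min_eq_right h2]

theorem Run.lower_strict_iff (h : Run r l w n cs o) {sh sh' : ℕ → ℕ} (hsub : Subdiagram r sh sh' o)
    (hn : n = offset sh' r) (hm : ∀ p, p + 1 < r → sh p ≤ sh (p + 1)) :
    StrictOn r sh (lowerWord o n).length (evalAt (graphPerm (cs 0).lower) (lowerWord o n)) ↔
      BoxStrict r sh fun p q => lowerEntry cs o (offset sh' p + q) := by
  rw [strictOn_iff_boxStrict hm (by rw [hn]; exact hsub.length le_rfl)]
  have key : ∀ p < r, ∀ q < sh p, evalAt (graphPerm (cs 0).lower) (lowerWord o n)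
      (offset sh p + q) = lowerEntry cs o (offset sh' p + q) := by
    intro p hp q hq
    have h1 := hsub.le p hp
    have h2 := hsub.length_add hp (hsub.length hp.le) (show q ≤ sh' p by omega)
    rw [min_eq_left hq.le] at h2
    have h3 : offset sh' p + q < n := by
      rw [hn]
      exact box_lt hp (by omega)
    rw [← h2]
    exact h.evalAt_lower h3 ((hsub.isSome p hp q (by omega)).mpr hq)
  exact ⟨fun H => H.congr fun p hp q hq => (key p hp q hq).symm,
    fun H => H.congr fun p hp q hq => key p hp q hq⟩

end run

/-! ### Existence of the steps of a row -/

section exist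

variable {r l n : ℕ} {w : Equiv.Perm ℕ} {cs : ℕ → Config} {o : ℕ → Option (ℕ × ℕ)}

theorem Run.congr {cs' : ℕ → Config} {o' : ℕ → Option (ℕ × ℕ)} (h : Run r l w n cs o)
    (hcs : ∀ i ≤ n, cs' i = cs i) (ho : ∀ i < n, o' i = o i) : Run r l w n cs' o' := by
  refine ⟨?_, ?_, fun i hi => ?_⟩
  · rw [hcs 0 (by omega)]
    exact h.valid_zero
  · rw [hcs 0 (by omega)]
    exact h.word_zero
  · rw [hcs i hi.le, hcs (i + 1) hi, ho i hi]
    exact h.step i hi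

theorem Run.snoc (h : Run r l w n cs o) {s' : Config} (hs : Step r l (o n) (cs n) s') :
    Run r l w (n + 1) (fun i => if i = n + 1 then s' else cs i) o := by
  refine ⟨by simpa using h.valid_zero, by simpa using h.word_zero, fun i hi => ?_⟩
  rcases Nat.lt_succ_iff_lt_or_eq.mp hi with h1 | rfl
  · simpa [h1.ne, show i ≠ n + 1 by omega] using h.step i h1
  · simpa using hs

/-- Every valid configuration is the result of the steps of a row. -/
theorem Config.Valid.exists_run (hl : 1 ≤ l) (hlr : l ≤ r) {s : Config} (hs : s.Valid r l w)
    (hn : s.word.length = n) : ∃ cs o, Run r l w n cs o ∧ cs n = s := by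
  induction n generalizing s with
  | zero =>
    exact ⟨fun _ => s, fun _ => none, ⟨hs, List.eq_nil_of_length_eq_zero hn,
        fun i hi => by omega⟩, rfl⟩
  | succ n ih =>
    obtain ⟨x, s₀, hs₀, hstep⟩ := exists_step_to hl hlr hs (List.ne_nil_of_length_eq_add_one hn)
    have h1 := hstep.length_word
    obtain ⟨cs, o, hrun, hc⟩ := ih hs₀ (by omega)
    have hrun' : Run r l w n cs (fun i => if i = n then x else o i) :=
      hrun.congr (fun _ _ => rfl) fun i hi => if_neg hi.ne
    refine ⟨_, _, hrun'.snoc (s' := s) ?_, if_pos rfl⟩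
    simpa [hc] using hstep

/-- The rectifications of a row can be performed along every chain of lower graphs. -/
theorem exists_run (hl : 1 ≤ l) (hlr : l ≤ r) (o : ℕ → Option (ℕ × ℕ)) {L : ℕ → Graph}
    {A : Finset ℕ} (hs : Config.Valid r l w ⟨L 0, A, []⟩)
    (hL : ∀ i < n, ∀ t, o i = some t → LowerCover r l (L (lowerWord o i).length)
      (L ((lowerWord o i).length + 1)) t.1 t.2) :
    ∃ cs, Run r l w n cs o ∧ cs 0 = ⟨L 0, A, []⟩ ∧ (cs n).lower = L (lowerWord o n).length := by
  induction n with
  | zero => exact ⟨fun _ => ⟨L 0, A, []⟩, ⟨hs, rfl, fun i hi => by omega⟩, rfl, rfl⟩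
  | succ n ih =>
    obtain ⟨cs, hrun, h0, hlow⟩ := ih fun i hi => hL i (by omega)
    have hv := hrun.valid hl hlr le_rfl
    obtain ⟨s', hs', hlow'⟩ : ∃ s', Step r l (o n) (cs n) s' ∧
        s'.lower = L (lowerWord o (n + 1)).length := by
      rcases ho : o n with _ | ⟨a, b⟩
      · obtain ⟨s', hs'⟩ := exists_step_insertion hlr hv
        exact ⟨s', hs', by rw [hs'.lower_eq, lowerWord_succ_none ho, hlow]⟩
      · have h1 := hL n n.lt_succ_self _ ho
        rw [← hlow] at h1
        obtain ⟨A', T', hs'⟩ := exists_step_rectification hlr hv h1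
        exact ⟨_, hs', by rw [lowerWord_succ_some ho, List.length_append, List.length_singleton]⟩
    exact ⟨_, hrun.snoc hs', by simpa using h0, by simpa using hlow'⟩

/-- The graphs that arise from an rc-graph by removing the crossings of a chain. -/
theorem exists_lowerChain {T : List (ℕ × ℕ)} {U : Graph} (hU : IsRCGraph U)
    (hrows : ∀ p ∈ U, l < p.1) (hperm : w * transProd T = graphPerm U) (hT : IsChain w T)
    (hr : ∀ t ∈ T, 1 ≤ t.1 ∧ t.1 ≤ r ∧ r < t.2) :
    ∃ L : ℕ → Graph, L T.length = U ∧ IsRCGraph (L 0) ∧ graphPerm (L 0) = w ∧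
      (∀ k ≤ T.length, ∀ p ∈ L k, l < p.1) ∧
      ∀ k t, T[k]? = some t → LowerCover r l (L k) (L (k + 1)) t.1 t.2 := by
  induction T using List.reverseRecOn generalizing U with
  | nil => exact ⟨fun _ => U, rfl, hU, by simpa [transProd] using hperm.symm, fun _ _ => hrows,
      fun k t h => by simp at h⟩
  | append_singleton T t ih =>
    obtain ⟨a, b⟩ := t
    have hab := hr (a, b) (by simp)
    simp only at hab
    have hperm' : w * transProd T = graphPerm U * Equiv.swap a b := by
      rw [← hperm, transProd_snoc, ← mul_assoc, mul_assoc, Equiv.swap_mul_self, mul_one]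
    have hw : InSInf (w * transProd T) := by
      rw [hperm']
      exact (inSInf_graphPerm hU.1).mul (inSInf_swap hab.1 (by omega))
    have h1 := hT.length
    have h2 := hT.of_append.length
    rw [transProd_snoc, ← mul_assoc, List.length_append, List.length_singleton] at h1
    have h3 := ((permLength_mul_swap_eq_succ hw hab.1 (show a < b by omega)).mp (by omega)).1
    have h4 : graphPerm U b < graphPerm U a := by
      rw [← hperm, transProd_snoc, ← mul_assoc, Equiv.Perm.mul_apply _ (Equiv.swap a b),
        Equiv.Perm.mul_apply _ (Equiv.swap a b), Equiv.swap_apply_left, Equiv.swap_apply_right]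
      exact h3
    obtain ⟨q, hq, -⟩ := existsUnique_crossAt hU (show a < b by omega) h4
    have hqU := hq.1
    rw [crossAt_iff_graphPerm_erase hU.1 hqU, ← hperm'] at hq
    have hU' : IsRCGraph (U.erase q) := hU.erase_of_permLength hqU (by
      rw [hq, ← hperm, transProd_snoc, ← mul_assoc, h1, h2, add_assoc])
    obtain ⟨L, hLT, hL0, hLw, hLrows, hLcov⟩ := ih hU'
      (fun p hp => hrows p (Finset.mem_of_mem_erase hp)) hq.symm hT.of_append
      fun t ht => hr t (List.mem_append_left _ ht)
    refine ⟨fun k => if k = T.length + 1 then U else L k, by simp, by simpa using hL0,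
      by simpa using hLw, fun k hk => ?_, fun k t ht => ?_⟩
    · beta_reduce
      split_ifs with h5
      · exact hrows
      · rw [List.length_append, List.length_singleton] at hk
        exact hLrows k (by omega)
    · beta_reduce
      rcases lt_or_ge k T.length with h5 | h5
      · rw [List.getElem?_append_left h5] at ht
        rw [if_neg (by omega), if_neg (by omega)]
        exact hLcov k t ht
      · have h6 := (List.getElem?_eq_some_iff.mp ht).1
        rw [List.length_append, List.length_singleton] at h6
        obtain rfl : k = T.length := by omega
        simp only [List.getElem?_concat_length, Option.some.injEq] at ht
        subst ht
        rw [if_neg (by omega), if_pos rfl, hLT]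
        exact ⟨hab.2.1, hab.2.2, hU', hU, hrows, ⟨q, Finset.notMem_erase _ _,
          (Finset.insert_erase hqU).symm⟩, by
            rw [hq, hperm', mul_assoc, Equiv.swap_mul_self, mul_one]⟩

/-- The kinds of the steps and the transpositions of the rectifications. -/
theorem exists_kinds (t : ℕ → Bool) (T : List (ℕ × ℕ)) :
    ∃ o : ℕ → Option (ℕ × ℕ), (∀ i, (o i).isSome = t i) ∧
      (∀ i x, (lowerWord o i).length < T.length → o i = some x →
        T[(lowerWord o i).length]? = some x) ∧
      ∀ i, (lowerWord o i).length ≤ T.length → lowerWord o i = T.take (lowerWord o i).length := by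
  let o : ℕ → Option (ℕ × ℕ) := fun i =>
    if t i then some (T.getD ((List.range i).countP fun k => t k) (0, 0)) else none
  have h1 : ∀ i, (o i).isSome = t i := fun i => by
    by_cases h : t i <;> simp [o, h]
  have h2 : ∀ i, (lowerWord o i).length = (List.range i).countP fun k => t k := fun i => by
    rw [lowerWord, List.length_filterMap_eq_countP]
    simp only [h1]
  have h3 : ∀ i x, (lowerWord o i).length < T.length → o i = some x →
      T[(lowerWord o i).length]? = some x := by
    intro i x hi hx
    have h4 : t i = true := by rw [← h1, hx]; rfl
    simp only [o, h4, if_true, Option.some.injEq] at hx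
    rw [← h2, List.getD_eq_getElem?_getD] at hx
    rw [← hx, List.getElem?_eq_getElem hi, Option.getD_some]
  refine ⟨o, h1, h3, fun i => ?_⟩
  induction i with
  | zero => simp [lowerWord]
  | succ i ih =>
    intro hi
    rcases ho : o i with _ | x
    · rw [lowerWord_succ_none ho] at hi ⊢
      exact ih hi
    · rw [lowerWord_succ_some ho, List.length_append, List.length_singleton] at hi ⊢
      rw [List.take_add_one, h3 i x (by omega) ho, ← ih (by omega)]
      rfl

end exist

/-! ### The algorithms along the steps of a row -/

theorem LowerCover.theUnique_erase {r l a b : ℕ} {L L' : Graph} (h : LowerCover r l L L' a b) :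
    ∃ q, theUnique (fun p => p ∈ L' ∧ graphPerm (L'.erase p) = graphPerm L) = some q ∧
      L'.erase q = L := by
  obtain ⟨q, -, hq, hq'⟩ := h.crossAt
  have hL : graphPerm L = graphPerm L' * Equiv.swap a b := by
    rw [h.perm, mul_assoc, Equiv.swap_mul_self, mul_one]
  refine ⟨q, theUnique_eq_some ⟨((hq' q).mpr rfl).1, by rw [hq]⟩ fun p hp => ?_, hq⟩
  rw [← hq', crossAt_iff_graphPerm_erase h.rc'.1 hp.1, hp.2, hL]

theorem rowsGE_graph {l : ℕ} {s : Config} (h : ∀ p ∈ s.lower, l < p.1) :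
    rowsGE (s.graph l) (l + 1) = s.lower := by
  ext p
  simp only [rowsGE, Config.graph, Finset.mem_filter, Finset.mem_union, mem_rowGraph]
  constructor
  · rintro ⟨h1 | h1, h2⟩
    · exact h1
    · omega
  · exact fun h1 => ⟨Or.inl h1, h p h1⟩

theorem rowOnly_graph {l : ℕ} {s : Config} (h : ∀ p ∈ s.lower, l < p.1) :
    rowOnly (s.graph l) l = rowGraph l s.cols := by
  ext p
  simp only [rowOnly, Config.graph, Finset.mem_filter, Finset.mem_union, mem_rowGraph]
  constructor
  · rintro ⟨h1 | h1, h2⟩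
    · have := h p h1
      omega
    · exact h1
  · exact fun h1 => ⟨Or.inr h1, h1.1⟩

section along

variable {r l n : ℕ} {w : Equiv.Perm ℕ} {cs : ℕ → Config} {o : ℕ → Option (ℕ × ℕ)}

/-- The graphs `S_j` of the package of the lower rows are the lower graphs of the configurations. -/
theorem Run.sGraph_eq (h : Run r l w n cs o) (sh : List ℕ) {i : ℕ} (hi : i ≤ n) :
    sGraph (graphPerm (cs 0).lower) (cs n).lower ⟨sh, lowerWord o n⟩ (lowerWord o i).length =
      some (cs i).lower := by
  suffices H : ∀ d n, Run r l w n cs o → ∀ i, i + d = n →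
      sGraph (graphPerm (cs 0).lower) (cs n).lower ⟨sh, lowerWord o n⟩ (lowerWord o i).length =
        some (cs i).lower from H (n - i) _ h i (by omega)
  intro d
  induction d with
  | zero =>
    rintro n - i rfl
    simp [sGraph, peel]
  | succ d ih =>
    intro n h i hn
    have h1 := ih n h (i + 1) (by omega)
    have h2 := h.step i (by omega)
    rcases ho : o i with _ | ⟨a, b⟩
    · rw [ho] at h2
      rw [lowerWord_succ_none ho, h2.lower_eq] at h1
      exact h1
    · rw [ho] at h2
      obtain ⟨q, hq, hq'⟩ := h2.lowerCover.theUnique_erase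
      have h3 := (lowerWord_prefix o (show i + 1 ≤ n by omega)).length_le
      have h4 := lowerWord_take o (show i ≤ n by omega)
      simp only [sGraph] at h1 ⊢
      rw [lowerWord_succ_some ho, List.length_append, List.length_singleton] at h1 h3
      rw [show (lowerWord o n).length - (lowerWord o i).length =
        (lowerWord o n).length - ((lowerWord o i).length + 1) + 1 by omega]
      simp only [peel, h1, Option.bind_eq_bind, Option.bind_some]
      rw [show (lowerWord o n).length - ((lowerWord o n).length -
          ((lowerWord o i).length + 1) + 1) =
        (lowerWord o i).length by omega]
      have h5 : graphPerm (cs 0).lower * Tableau.perm ⟨sh, lowerWord o n⟩ (lowerWord o i).length =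
          graphPerm (cs i).lower := by
        rw [h.lower_perm (show i ≤ n by omega)]
        conv_rhs => rw [← h4]
        rfl
      rw [h5, hq]
      simp [hq']

/-- The insertion algorithm performs the steps of a row. -/
theorem Run.rowState_eq (h : Run r l w n cs o) (hl : 1 ≤ l) (hlr : l ≤ r) {R Y : Graph} {sh : ℕ → ℕ}
    (hR : graphPerm (rowsGE R l) = w) (hR' : graphPerm (rowsGE R (l + 1)) = graphPerm (cs 0).lower)
    (hrow : rowOnly R l = rowGraph l (cs 0).cols) (hsh : graphShape r (rowsGE Y l) = shapeOf r sh)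
    (hn : n = offset sh r)
    (hword : ∀ i < n, ∃ k, (fullWord r (rowsGE Y l))[i]? = some k ∧ l ≤ k ∧ (k = l ↔ o i = none))
    (hstrict : StrictOn r sh n (evalAt w (cs n).word)) {i : ℕ} (hi : i ≤ n) :
    rowState r R Y l ((cs n).lower, lowerWord o n) i = some ((cs i).graph l, (cs i).word) := by
  have hcount : ∀ i ≤ n, (((fullWord r (rowsGE Y l)).take i).filter fun k => l < k).length =
      (lowerWord o i).length := by
    intro i hi
    induction i with
    | zero => simp [lowerWord]
    | succ i ih =>
      obtain ⟨k, hk, hlk, hk'⟩ := hword i (by omega)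
      rw [List.take_add_one, hk, List.filter_append, List.length_append, ih (by omega)]
      rcases ho : o i with _ | t
      · rw [lowerWord_succ_none ho, hk'.mpr ho]
        simp
      · have : l < k := lt_of_le_of_ne hlk fun e => by
          rw [hk'.mp e.symm] at ho
          cases ho
        rw [lowerWord_succ_some ho]
        simp [this]
  induction i with
  | zero =>
    have h1 := h.sGraph_eq (graphShape r (rowsGE Y (l + 1))) (Nat.zero_le n)
    have h2 : (lowerWord o 0).length = 0 := rfl
    rw [h2] at h1
    simp only [rowState, hR', h1, Option.bind_eq_bind, Option.bind_some, hrow, h.word_zero,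
      Option.pure_def]
    rfl
  | succ i ih =>
    obtain ⟨k, hk, hlk, hk'⟩ := hword i (by omega)
    have h1 := h.step i (by omega)
    have hv := h.valid hl hlr (show i ≤ n by omega)
    rcases ho : o i with _ | t
    · rw [ho] at h1
      simp only [rowState, ih (by omega), hk, Option.bind_eq_bind, Option.bind_some,
        if_pos (hk'.mpr ho)]
      exact h1.insertStep_eq hl hv
    · have hne : k ≠ l := fun e => by
        rw [hk'.mp e] at ho
        cases ho
      rw [ho] at h1
      have hc := hcount (i + 1) hi
      have h2 := h.sGraph_eq (graphShape r (rowsGE Y (l + 1))) hi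
      have h3 := h.sGraph_eq (graphShape r (rowsGE Y (l + 1))) (show i ≤ n by omega)
      have h4 := lowerWord_getElem? (show i < n by omega) ho
      rw [lowerWord_succ_some ho, List.length_append, List.length_singleton] at hc h2
      have hst : EvalStrict w ⟨shapeOf r sh, (cs (i + 1)).word⟩ := by
        rw [evalStrict_iff, h.length hi]
        refine hstrict.mono hi fun k hk => ?_
        rw [h.evalAt_eq hk hi, h.evalAt_eq (show k < n by omega) le_rfl]
      simp only [rowState, ih (by omega), hk, Option.bind_eq_bind, Option.bind_some, if_neg hne,
        hc, hR', h2, h3, h4, Nat.add_sub_cancel, hR, hsh]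
      exact h1.rectifyStep_eq hl hlr hv (by
        rw [h.length hi, ← hn]
        exact hi) hst

/-- The inverse algorithm undoes the steps of a row. -/
theorem Run.invRowState_eq (h : Run r l w n cs o) (hl : 1 ≤ l) (hlr : l ≤ r) {k : ℕ} (hk : k ≤ n) :
    invRowState r l ((cs n).graph l) (cs n).word k = some ⟨(cs (n - k)).graph l, (cs (n - k)).word,
      (List.range' (n - k) k).map fun i => (o i).isSome, (List.range' (n - k) k).filterMap o⟩ := by
  induction k with
  | zero => simp [invRowState]
  | succ k ih =>
    obtain ⟨i, hi⟩ : ∃ i, n - k = i + 1 := ⟨n - k - 1, by omega⟩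
    have hi' : n - (k + 1) = i := by omega
    have h1 := h.step i (by omega)
    have hv := h.valid hl hlr (show i ≤ n by omega)
    have hv' := h.valid hl hlr (show i + 1 ≤ n by omega)
    have h2 := h1.invStep_eq hl hlr hv
    rw [invRowState, ih (by omega), hi, hi', List.range'_succ]
    simp only [Option.bind_eq_bind, Option.bind_some, h2]
    rcases ho : o i with _ | ⟨a, b⟩
    · simp [ho]
    · rw [ho] at h1
      have hcov := h1.lowerCover
      have h3 : theUnique (fun t : ℕ × ℕ => t.1 ≤ r ∧ r < t.2 ∧
          graphPerm (rowsGE ((cs (i + 1)).graph l) (l + 1)) =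
            graphPerm (rowsGE ((cs i).graph l) (l + 1)) * Equiv.swap t.1 t.2) = some (a, b) := by
        rw [rowsGE_graph hv.rows, rowsGE_graph hv'.rows]
        refine theUnique_eq_some ⟨hcov.ha, hcov.hb, hcov.perm⟩ ?_
        rintro ⟨a', b'⟩ ⟨ha', hb', h4⟩
        rw [hcov.perm, mul_right_inj] at h4
        have ha := hcov.ha
        have hb := hcov.hb
        simp only at ha' hb' h4
        rcases (swap_eq_swap_iff (by omega)).mp h4 with h5 | h5
        · rw [Prod.mk.injEq] at h5 ⊢
          exact ⟨h5.1.symm, h5.2.symm⟩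
        · rw [Prod.mk.injEq] at h5
          omega
      simp [ho, h3]

end along

/-! ### Rc-graphs of shuffles -/

section shuffle

variable {r l : ℕ} {L : Graph} {A : Finset ℕ}

theorem IsShuffle.lt_small {u : Equiv.Perm ℕ} (h : IsShuffle r u) {c d : ℕ} (hc : 1 ≤ c)
    (hcd : c < d)
    (hd : d ≤ r) : u c < u d := by
  induction d, hcd using Nat.le_induction with
  | base => exact h c hc (by omega)
  | succ d hcd ih => exact (ih (by omega)).trans (h d (by omega) (by omega))

theorem IsShuffle.isSemiShuffle {u : Equiv.Perm ℕ} (h : IsShuffle r u) : IsSemiShuffle r u :=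
  fun i hi => h i (by omega) (by omega)

theorem one_le_strands {R : Graph} (hR : IsGraph R) {p : ℕ × ℕ} (hp : p ∈ R) :
    1 ≤ (strands R p.1 p.2).1 := by
  have hpos := hR p hp
  by_contra h0
  have h2 : (strands R p.1 p.2).1 = 0 := by omega
  simp only [strands] at h2
  rw [Equiv.symm_apply_eq, (inSInf_graphPerm (hR.mono (Finset.filter_subset _ _))).1] at h2
  omega

/-- Every crossing is one of a small strand with a large one. -/
theorem IsShuffle.strands_le_lt {R : Graph} (hR : IsRCGraph R)
    (h : IsShuffle r (graphPerm R)) {p : ℕ × ℕ}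
    (hp : p ∈ R) : (strands R p.1 p.2).1 ≤ r ∧ r < (strands R p.1 p.2).2 := by
  have hlt := (isRCGraph_iff hR.1).mp hR p hp
  have h1 := one_le_strands hR.1 hp
  by_contra hc
  refine (strands_crossing hR hlt).2 ?_ p hp rfl
  by_cases h3 : (strands R p.1 p.2).1 ≤ r
  · exact h.lt_small h1 hlt (by omega)
  · exact h.isSemiShuffle.lt (by omega) hlt

theorem IsShuffle.lower (hrows : ∀ p ∈ L, l < p.1) (hrc : IsRCGraph (L ∪ rowGraph l A))
    (hL : IsRCGraph L) (h : IsShuffle r (graphPerm (L ∪ rowGraph l A))) :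
    IsShuffle r (graphPerm L) := fun i hi hir =>
  graphPerm_lt_of_rowUnion hrows hrc hL (Nat.lt_succ_self i) (h i hi hir)

/-- The crossings of a small strand in row `l`. -/
theorem IsShuffle.row (hl : 1 ≤ l) (hrows : ∀ p ∈ L, l < p.1) (hA : 0 ∉ A)
    (hrc : IsRCGraph (L ∪ rowGraph l A)) (h : IsShuffle r (graphPerm (L ∪ rowGraph l A))) {s : ℕ}
    (hsr : s ≤ r) :
    graphPerm L s ≤ graphPerm (L ∪ rowGraph l A) s ∧
      (graphPerm L s < graphPerm (L ∪ rowGraph l A) s → l ≤ graphPerm L s) ∧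
      ∀ j, 1 ≤ j → ((j ∈ A ∧ carry (below L l) A j = s) ↔
        graphPerm L s < l + j ∧ l + j ≤ graphPerm (L ∪ rowGraph l A) s) := by
  have hL := ((isRCGraph_rowUnion hl (hrc.1.mono Finset.subset_union_left) hrows hA).mp hrc).1
  have hz := below_injective L l
  have hbelow : ∀ i, below L l i = s ↔ graphPerm L s = l + i := fun i => by
    rw [below, Equiv.symm_apply_eq, eq_comm]
  have hlarge : ∀ j ∈ A, r < below L l j := fun j hj => by
    have hj1 : 1 ≤ j := Nat.one_le_iff_ne_zero.mpr fun e => hA (e ▸ hj)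
    have h1 := h.strands_le_lt hrc (p := (l, j)) ((mem_rowUnion hrows).mpr hj)
    rw [strands_row hl hL.1 hrows hA hj1] at h1
    exact h1.2
  rcases lt_or_ge s l with hsl | hsl
  · have h1 := graphPerm_fix hL.1 hrows hsl.le
    have h2 : graphPerm (L ∪ rowGraph l A) s = s := by
      refine graphPerm_fix (l := l - 1) hrc.1 (fun p hp => ?_) (by omega)
      rcases Finset.mem_union.mp hp with hp | hp
      · have := hrows p hp
        omega
      · have := (mem_rowGraph.mp hp).1
        omega
    refine ⟨by omega, by omega, fun j hj => ⟨?_, by omega⟩⟩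
    rintro ⟨-, h3⟩
    obtain ⟨i, -, -, h4, -⟩ := exists_carry_eq (z := below L l) hA hj
    rw [h3] at h4
    have := (hbelow i).mp h4.symm
    omega
  · have hxl : l ≤ graphPerm L s := by
      by_contra hc
      have := (graphPerm L).injective (graphPerm_fix hL.1 hrows (not_le.mp hc).le)
      omega
    obtain ⟨P, hP⟩ := Nat.exists_eq_add_of_le hxl
    have hzP := (hbelow P).mpr hP
    have hPA : P ∉ A := fun hPA => by
      have := hlarge P hPA
      omega
    obtain ⟨J, hPJ, hJA, hrun⟩ := exists_next_notMem A P
    have hcJ : carry (below L l) A J = s := by rw [carry_eq_of_run hPJ hPA hrun, hzP]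
    have hy : graphPerm (L ∪ rowGraph l A) s = l + J - 1 := by
      rw [eq_comm, ← Equiv.symm_apply_eq, graphPerm_rowUnion_symm hl hL.1 hrows hA (by omega),
        exitStrand, if_neg hJA, hcJ]
    refine ⟨by omega, fun _ => hxl, fun j hj => ⟨?_, fun h3 => ?_⟩⟩
    · rintro ⟨hjA, h3⟩
      rw [← hzP, carry_eq_iff hz hA hj] at h3
      have : j < J := by
        by_contra hc
        rcases (not_lt.mp hc).eq_or_lt with e | e
        · exact hJA (e ▸ hjA)
        · exact hJA (h3.2.2 J hPJ e)
      omega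
    · refine ⟨hrun j (by omega) (by omega), ?_⟩
      rw [← hzP, carry_eq_iff hz hA hj]
      exact ⟨by omega, hPA, fun k hk1 hk2 => hrun k hk1 (by omega)⟩

/-- The columns of the crossings in row `l`. -/
theorem IsShuffle.mem_row (hl : 1 ≤ l) (hrows : ∀ p ∈ L, l < p.1) (hA : 0 ∉ A)
    (hrc : IsRCGraph (L ∪ rowGraph l A)) (h : IsShuffle r (graphPerm (L ∪ rowGraph l A))) {j : ℕ} :
    j ∈ A ↔ 1 ≤ j ∧ ∃ s, 1 ≤ s ∧ s ≤ r ∧ graphPerm L s < l + j ∧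
      l + j ≤ graphPerm (L ∪ rowGraph l A) s := by
  have hL := ((isRCGraph_rowUnion hl (hrc.1.mono Finset.subset_union_left) hrows hA).mp hrc).1
  constructor
  · intro hj
    have hj1 : 1 ≤ j := Nat.one_le_iff_ne_zero.mpr fun e => hA (e ▸ hj)
    have h1 := h.strands_le_lt hrc (p := (l, j)) ((mem_rowUnion hrows).mpr hj)
    rw [strands_row hl hL.1 hrows hA hj1] at h1
    have h2 := one_le_carry hl hL.1 hrows hA hj1
    exact ⟨hj1, _, h2, h1.1, ((h.row hl hrows hA hrc h1.1).2.2 j hj1).mp ⟨hj, rfl⟩⟩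
  · rintro ⟨hj1, s, hs, hsr, h1⟩
    exact (((h.row hl hrows hA hrc hsr).2.2 j hj1).mpr h1).1

/-- A small strand leaves row `l` before the column where the next one enters it. -/
theorem IsShuffle.row_lt (hl : 1 ≤ l) (hrows : ∀ p ∈ L, l < p.1) (hA : 0 ∉ A)
    (hrc : IsRCGraph (L ∪ rowGraph l A)) (h : IsShuffle r (graphPerm (L ∪ rowGraph l A))) {s : ℕ}
    (hs : 1 ≤ s) (hsr : s + 1 ≤ r) :
    graphPerm (L ∪ rowGraph l A) s < graphPerm L (s + 1) := by
  have hL := ((isRCGraph_rowUnion hl (hrc.1.mono Finset.subset_union_left) hrows hA).mp hrc).1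
  by_contra hc
  have h1 := (h.lower hrows hrc hL).lt_small hs (show s < s + 1 by omega) hsr
  obtain ⟨-, h2, h3⟩ := h.row hl hrows hA hrc (show s ≤ r by omega)
  have h4 := h2 (by omega)
  obtain ⟨j, hj⟩ := Nat.exists_eq_add_of_le (show l ≤ graphPerm L (s + 1) by omega)
  have hjA := ((h3 j (by omega)).mpr ⟨by omega, by omega⟩).1
  have h5 := h.strands_le_lt hrc (p := (l, j)) ((mem_rowUnion hrows).mpr hjA)
  rw [strands_row hl hL.1 hrows hA (by omega), below, ← hj, Equiv.symm_apply_apply] at h5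
  simp only at h5
  omega

theorem sort_add_replicate (M : Multiset ℕ) (m l : ℕ) (h : ∀ a ∈ M, l ≤ a) :
    (M + Multiset.replicate m l).sort (· ≥ ·) = M.sort (· ≥ ·) ++ List.replicate m l := by
  refine List.Perm.eq_of_pairwise' (r := fun a b : ℕ => a ≥ b) (Multiset.pairwise_sort _ _) ?_ ?_
  · rw [List.pairwise_append]
    refine ⟨Multiset.pairwise_sort _ _, List.pairwise_replicate.mpr (Or.inr le_rfl), ?_⟩
    intro a ha b hb
    rw [List.eq_of_mem_replicate hb]
    exact h a ((Multiset.mem_sort _).mp ha)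
  · rw [← Multiset.coe_eq_coe, Multiset.sort_eq, ← Multiset.coe_add, Multiset.sort_eq,
      Multiset.coe_replicate]

theorem IsShuffle.strandWord_rowUnion (hl : 1 ≤ l) (hrows : ∀ p ∈ L, l < p.1) (hA : 0 ∉ A)
    (hrc : IsRCGraph (L ∪ rowGraph l A)) (h : IsShuffle r (graphPerm (L ∪ rowGraph l A))) {s : ℕ}
    (hsr : s ≤ r) :
    strandWord (L ∪ rowGraph l A) s = strandWord L s ++
      List.replicate (graphPerm (L ∪ rowGraph l A) s - graphPerm L s) l := by
  have hL := ((isRCGraph_rowUnion hl (hrc.1.mono Finset.subset_union_left) hrows hA).mp hrc).1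
  obtain ⟨hxy, hxl, hrow⟩ := h.row hl hrows hA hrc hsr
  have hpos : ∀ j ∈ A, 1 ≤ j := fun j hj => Nat.one_le_iff_ne_zero.mpr fun e => hA (e ▸ hj)
  have e1 : (L ∪ rowGraph l A).filter (fun p => (strands (L ∪ rowGraph l A) p.1 p.2).1 = s ∨
      (strands (L ∪ rowGraph l A) p.1 p.2).2 = s) =
      L.filter (fun p => (strands L p.1 p.2).1 = s ∨ (strands L p.1 p.2).2 = s) ∪
        rowGraph l (A.filter fun j => carry (below L l) A j = s) := by
    rw [Finset.filter_union]
    congr 1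
    · refine Finset.filter_congr fun p hp => ?_
      rw [strands_lower (hrows p hp)]
    · ext ⟨i, j⟩
      simp only [Finset.mem_filter, mem_rowGraph]
      constructor
      · rintro ⟨⟨rfl, hj⟩, h1⟩
        have h2 := h.strands_le_lt hrc (p := (i, j)) ((mem_rowUnion hrows).mpr hj)
        rw [strands_row hl hL.1 hrows hA (hpos j hj)] at h1 h2
        simp only at h1 h2
        exact ⟨rfl, hj, h1.resolve_right (by omega)⟩
      · rintro ⟨rfl, hj, h1⟩
        rw [strands_row hl hL.1 hrows hA (hpos j hj)]
        exact ⟨⟨rfl, hj⟩, Or.inl h1⟩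
  have hcard : (rowGraph l (A.filter fun j => carry (below L l) A j = s)).card =
      graphPerm (L ∪ rowGraph l A) s - graphPerm L s := by
    rw [rowGraph, Finset.card_image_of_injective _ (Prod.mk_right_injective l), ← Nat.card_Ioc,
      ← Finset.card_image_of_injective _ (add_right_injective l)]
    congr 1
    ext k
    simp only [Finset.mem_image, Finset.mem_filter, Finset.mem_Ioc]
    constructor
    · rintro ⟨j, hj, rfl⟩
      exact (hrow j (hpos j hj.1)).mp hj
    · intro hk
      have := hxl (by omega)
      obtain ⟨j, rfl⟩ := Nat.exists_eq_add_of_le (show l ≤ k by omega)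
      exact ⟨j, (hrow j (by omega)).mpr hk, rfl⟩
  have hdisj : Disjoint (L.filter fun p => (strands L p.1 p.2).1 = s ∨ (strands L p.1 p.2).2 = s)
      (rowGraph l (A.filter fun j => carry (below L l) A j = s)) := by
    refine Finset.disjoint_left.mpr fun p h1 h2 => ?_
    have h3 := hrows p (Finset.mem_filter.mp h1).1
    have h4 := (mem_rowGraph.mp h2).1
    omega
  have e2 : (rowGraph l (A.filter fun j => carry (below L l) A j = s)).val.map Prod.fst =
      Multiset.replicate (graphPerm (L ∪ rowGraph l A) s - graphPerm L s) l := by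
    rw [Multiset.eq_replicate]
    refine ⟨by rw [Multiset.card_map]; exact hcard, fun i hi => ?_⟩
    obtain ⟨p, hp, rfl⟩ := Multiset.mem_map.mp hi
    exact (mem_rowGraph.mp hp).1
  rw [strandWord, e1, ← Finset.disjUnion_eq_union _ _ hdisj, Finset.disjUnion_val,
    Multiset.map_add, e2, sort_add_replicate]
  · rfl
  · intro i hi
    obtain ⟨p, hp, rfl⟩ := Multiset.mem_map.mp hi
    exact (hrows p (Finset.mem_filter.mp hp).1).le

/-! ### The words of the rc-graphs of shuffles -/

theorem rowsGE_one {R : Graph} (hR : IsGraph R) : rowsGE R 1 = R :=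
  Finset.filter_true_of_mem fun p hp => (hR p hp).1

theorem IsRCGraph.isRCGraph_rowsGE {R : Graph} (hR : IsRCGraph R) (hl : 1 ≤ l) :
    IsRCGraph (rowsGE R l) := by
  induction l, hl using Nat.le_induction with
  | base => rwa [rowsGE_one hR.1]
  | succ l hl ih =>
    rw [rowsGE_eq_union] at ih
    exact ((isRCGraph_rowUnion hl (rowsGE_isGraph hR.1 _) (rowsGE_succ_rows R l)
      (zero_notMem_rowCols hR.1 l)).mp ih).1

theorem IsShuffle.isShuffle_rowsGE {R : Graph} (hR : IsRCGraph R) (h : IsShuffle r (graphPerm R))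
    (hl : 1 ≤ l) :
    IsShuffle r (graphPerm (rowsGE R l)) := by
  induction l, hl using Nat.le_induction with
  | base => rwa [rowsGE_one hR.1]
  | succ l hl ih =>
    have h1 := hR.isRCGraph_rowsGE hl
    rw [rowsGE_eq_union] at ih h1
    exact ih.lower (rowsGE_succ_rows R l) h1 (hR.isRCGraph_rowsGE (by omega))

theorem IsShuffle.row_le {R : Graph} (hR : IsRCGraph R) (h : IsShuffle r (graphPerm R)) {p : ℕ × ℕ}
    (hp : p ∈ R) : p.1 ≤ r := by
  by_contra hc
  have hl := (hR.1 p hp).1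
  have h1 := hR.isRCGraph_rowsGE hl
  have h2 := h.isShuffle_rowsGE hR hl
  rw [rowsGE_eq_union] at h1 h2
  obtain ⟨-, s, hs, hsr, h3, h4⟩ := (h2.mem_row hl (rowsGE_succ_rows R p.1)
    (zero_notMem_rowCols hR.1 _) h1).mp (mem_rowCols.mpr hp)
  obtain ⟨-, h5, -⟩ := h2.row hl (rowsGE_succ_rows R p.1) (zero_notMem_rowCols hR.1 _) h1 hsr
  have h6 := h5 (by omega)
  have h7 := graphPerm_fix (rowsGE_isGraph hR.1 (p.1 + 1)) (rowsGE_succ_rows R p.1)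
    (m := s) (by omega)
  omega

theorem IsShuffle.rowsGE_eq_empty {R : Graph} (hR : IsRCGraph R) (h : IsShuffle r (graphPerm R)) :
    rowsGE R (r + 1) = ∅ :=
  Finset.filter_false_of_mem fun p hp => by
    have := h.row_le hR hp
    omega

theorem strandWord_empty (s : ℕ) : strandWord ∅ s = [] := by
  simp [strandWord]

theorem IsShuffle.strandWord_rowsGE {Y : Graph} (hY : IsRCGraph Y) (h : IsShuffle r (graphPerm Y))
    (hl : 1 ≤ l) {s : ℕ} (hsr : s ≤ r) :
    strandWord (rowsGE Y l) s =
      strandWord (rowsGE Y (l + 1)) s ++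
        List.replicate (graphPerm (rowsGE Y l) s -
          graphPerm (rowsGE Y (l + 1)) s) l := by
  have h1 := hY.isRCGraph_rowsGE hl
  have h2 := h.isShuffle_rowsGE hY hl
  rw [rowsGE_eq_union] at h1 h2 ⊢
  exact h2.strandWord_rowUnion hl (rowsGE_succ_rows Y l) (zero_notMem_rowCols hY.1 l) h1 hsr

/-- A small strand goes one column to the right for every letter of its word. -/
theorem IsShuffle.graphPerm_eq {Y : Graph} (hY : IsRCGraph Y) (h : IsShuffle r (graphPerm Y))
    (hl : 1 ≤ l) (hlr : l ≤ r + 1) {s : ℕ} (hsr : s ≤ r) :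
    graphPerm (rowsGE Y l) s =
      s + (strandWord (rowsGE Y l) s).length := by
  suffices H : ∀ d l, 1 ≤ l → l + d = r + 1 → graphPerm (rowsGE Y l) s =
      s + (strandWord (rowsGE Y l) s).length from
    H (r + 1 - l) l hl (by omega)
  intro d
  induction d with
  | zero =>
    rintro l - rfl
    rw [h.rowsGE_eq_empty hY, graphPerm_empty, strandWord_empty]
    rfl
  | succ d ih =>
    intro l hl hd
    have h1 := ih (l + 1) (by omega) (by omega)
    have h2 := hY.isRCGraph_rowsGE hl
    have h3 := h.isShuffle_rowsGE hY hl
    rw [rowsGE_eq_union] at h2 h3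
    have h4 := (h3.row hl (rowsGE_succ_rows Y l) (zero_notMem_rowCols hY.1 l) h2 hsr).1
    rw [← rowsGE_eq_union] at h4
    rw [h.strandWord_rowsGE hY hl hsr, List.length_append, List.length_replicate]
    omega

theorem le_of_mem_strandWord {Y : Graph} (hY : ∀ p ∈ Y, l ≤ p.1) {s k : ℕ}
    (hk : k ∈ strandWord Y s) : l ≤ k := by
  rw [strandWord, Multiset.mem_sort] at hk
  obtain ⟨p, hp, rfl⟩ := Multiset.mem_map.mp hk
  exact hY p (Finset.mem_filter.mp hp).1

theorem IsShuffle.strandWord_filter {Y : Graph} (hY : IsRCGraph Y) (h : IsShuffle r (graphPerm Y))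
    (hl : 1 ≤ l) {s : ℕ} (hsr : s ≤ r) :
    strandWord (rowsGE Y l) s =
      (strandWord Y s).filter fun k => l ≤ k := by
  induction l, hl using Nat.le_induction with
  | base =>
    rw [rowsGE_one hY.1, eq_comm, List.filter_eq_self]
    intro k hk
    simpa using le_of_mem_strandWord (fun p hp => (hY.1 p hp).1) hk
  | succ l hl ih =>
    have h1 := congrArg (List.filter fun k => decide (l + 1 ≤ k)) (h.strandWord_rowsGE hY hl hsr)
    have h2 : ((strandWord (rowsGE Y (l + 1)) s).filter fun k => decide (l + 1 ≤ k)) =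
        strandWord (rowsGE Y (l + 1)) s :=
      List.filter_eq_self.mpr fun k hk =>
        decide_eq_true (le_of_mem_strandWord (l := l + 1) (rowsGE_succ_rows Y l) hk)
    have h3 : ∀ m, ((List.replicate m l).filter fun k => decide (l + 1 ≤ k)) = [] := fun m =>
      List.filter_eq_nil_iff.mpr fun k hk => by
        rw [List.eq_of_mem_replicate hk]
        simp
    rw [ih, List.filter_filter, List.filter_append, h2, h3, List.append_nil] at h1
    rw [← h1]
    refine List.filter_congr fun k _ => ?_
    rw [← Bool.decide_and, decide_eq_decide]
    omega

/-- An rc-graph of a shuffle is determined by the words of its small strands. -/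
theorem IsShuffle.eq_of_strandWord {Y Y' : Graph} (hY : IsRCGraph Y) (h : IsShuffle r (graphPerm Y))
    (hY' : IsRCGraph Y') (h' : IsShuffle r (graphPerm Y'))
    (he : ∀ s, 1 ≤ s → s ≤ r → strandWord Y s = strandWord Y' s) : Y = Y' := by
  have key : ∀ {Y Y' : Graph}, IsRCGraph Y → IsShuffle r (graphPerm Y) → IsRCGraph Y' →
      IsShuffle r (graphPerm Y') →
      (∀ s, 1 ≤ s → s ≤ r → strandWord Y s = strandWord Y' s) → Y ⊆ Y' := by
    rintro Y Y' hY h hY' h' he ⟨l, j⟩ hp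
    have hlr : l ≤ r := h.row_le hY hp
    have hl : 1 ≤ l := (hY.1 _ hp).1
    have hx : ∀ l, 1 ≤ l → l ≤ r + 1 → ∀ s, 1 ≤ s → s ≤ r →
        graphPerm (rowsGE Y l) s = graphPerm (rowsGE Y' l) s := by
      intro l hl hlr s hs hsr
      rw [h.graphPerm_eq hY hl hlr hsr, h'.graphPerm_eq hY' hl hlr hsr,
        h.strandWord_filter hY hl hsr, h'.strandWord_filter hY' hl hsr, he s hs hsr]
    have h1 := hY.isRCGraph_rowsGE hl
    have h2 := h.isShuffle_rowsGE hY hl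
    have h1' := hY'.isRCGraph_rowsGE hl
    have h2' := h'.isShuffle_rowsGE hY' hl
    rw [rowsGE_eq_union] at h1 h2 h1' h2'
    have h3 := (h2.mem_row hl (rowsGE_succ_rows Y l) (zero_notMem_rowCols hY.1 l) h1).mp
      (mem_rowCols.mpr hp)
    rw [← mem_rowCols, h2'.mem_row hl (rowsGE_succ_rows Y' l) (zero_notMem_rowCols hY'.1 l) h1']
    rw [← rowsGE_eq_union] at h3 ⊢
    obtain ⟨hj, s, hs, hsr, h4⟩ := h3
    exact ⟨hj, s, hs, hsr, by rwa [← hx l hl (by omega) s hs hsr,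
      ← hx (l + 1) (by omega) (by omega) s hs hsr]⟩
  exact (key hY h hY' h' he).antisymm (key hY' h' hY h fun s hs hsr => (he s hs hsr).symm)

theorem IsShuffle.card_eq {Y : Graph} (hY : IsRCGraph Y) (h : IsShuffle r (graphPerm Y)) :
    Y.card = ∑ p ∈ Finset.range r, (strandWord Y (p + 1)).length := by
  rw [Finset.card_eq_sum_card_fiberwise (f := fun q => (strands Y q.1 q.2).1 - 1)
    (t := Finset.range r) fun q hq => ?_]
  · refine Finset.sum_congr rfl fun p hp => ?_
    rw [strandWord, Multiset.length_sort, Multiset.card_map]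
    refine congrArg Finset.card (Finset.filter_congr fun q hq => ?_)
    have h1 := h.strands_le_lt hY hq
    have h2 := one_le_strands hY.1 hq
    have h3 := Finset.mem_range.mp hp
    omega
  · have h1 := h.strands_le_lt hY hq
    have h2 := one_le_strands hY.1 hq
    simp only [Finset.coe_range, Set.mem_Iio]
    omega

end shuffle

/-! ### The rc-graphs of shuffles from their words -/

/-- The words of the parts in rows `≥ l` of the strands `1, …, r` of the rc-graphs of `r`-shuffles:
every row `l` adds some letters `l` to every word, and a word does not become longer than the word
of the next strand was before. -/
inductive WordFamily (r : ℕ) : ℕ → (ℕ → List ℕ) → Prop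
  | nil {W : ℕ → List ℕ} (hW : ∀ p < r, W p = []) : WordFamily r (r + 1) W
  | cons {l : ℕ} {W W' : ℕ → List ℕ} {m : ℕ → ℕ} (hl : 1 ≤ l) (hlr : l ≤ r)
      (h : WordFamily r (l + 1) W) (hW : ∀ p < r, W' p = W p ++ List.replicate (m p) l)
      (hb : ∀ p, p + 1 < r → (W' p).length ≤ (W (p + 1)).length) : WordFamily r l W'

section family

variable {r l : ℕ} {W : ℕ → List ℕ}

theorem WordFamily.le_of_mem (h : WordFamily r l W) {p k : ℕ} (hp : p < r) (hk : k ∈ W p) :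
    l ≤ k := by
  induction h with
  | nil hW =>
    rw [hW p hp] at hk
    cases hk
  | cons hl hlr h hW hb ih =>
    rw [hW p hp] at hk
    rcases List.mem_append.mp hk with h1 | h1
    · have := ih h1
      omega
    · exact (List.eq_of_mem_replicate h1).ge

theorem WordFamily.eq_nil (h : WordFamily r l W) {p : ℕ} (hp : p < r) (hpl : p + 1 < l) :
    W p = [] := by
  induction h generalizing p with
  | nil hW => exact hW p hp
  | cons hl hlr h hW hb ih =>
    have h1 := hb p (by omega)
    rw [ih (by omega) (by omega)] at h1
    exact List.eq_nil_of_length_eq_zero (by simpa using h1)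

theorem IsShuffle.wordFamily {Y : Graph} (hY : IsRCGraph Y) (h : IsShuffle r (graphPerm Y))
    (hl : 1 ≤ l) (hlr : l ≤ r + 1) :
    WordFamily r l fun p => strandWord (rowsGE Y l) (p + 1) := by
  suffices H : ∀ d l, 1 ≤ l → l + d = r + 1 →
      WordFamily r l fun p => strandWord (rowsGE Y l) (p + 1) from H (r + 1 - l) l hl (by omega)
  intro d
  induction d with
  | zero =>
    rintro l - rfl
    refine WordFamily.nil fun p _ => ?_
    rw [h.rowsGE_eq_empty hY, strandWord_empty]
  | succ d ih =>
    intro l hl hd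
    refine WordFamily.cons hl (by omega) (ih (l + 1) (by omega) (by omega))
      (fun p hp => h.strandWord_rowsGE hY hl (show p + 1 ≤ r from hp)) fun p hp => ?_
    have h1 := h.graphPerm_eq hY hl (by omega) (show p + 1 ≤ r by omega)
    have h2 := h.graphPerm_eq hY (l := l + 1) (by omega) (by omega) (show p + 1 + 1 ≤ r by omega)
    have h3 := hY.isRCGraph_rowsGE hl
    have h4 := h.isShuffle_rowsGE hY hl
    rw [rowsGE_eq_union] at h3 h4
    have h5 := h4.row_lt hl (rowsGE_succ_rows Y l) (zero_notMem_rowCols hY.1 l) h3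
      (show 1 ≤ p + 1 by omega) (by omega)
    rw [← rowsGE_eq_union] at h5
    omega

/-- Every such family consists of the words of an rc-graph. -/
theorem WordFamily.exists_graph (h : WordFamily r l W) : ∃ Y, IsRCGraph Y ∧ (∀ p ∈ Y, l ≤ p.1) ∧
    IsShuffle r (graphPerm Y) ∧ ∀ p < r, strandWord Y (p + 1) = W p ∧
      graphPerm Y (p + 1) = p + 1 + (W p).length := by
  induction h with
  | nil hW =>
    refine ⟨∅, (isRCGraph_iff fun p hp => by simp at hp).mpr fun p hp => by simp at hp,
      fun p hp => by simp at hp, fun i _ _ => by simp [graphPerm_empty], fun p hp => ?_⟩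
    rw [hW p hp, strandWord_empty, graphPerm_empty]
    exact ⟨rfl, rfl⟩
  | @cons l W W' m hl hlr h hW hb ih =>
    obtain ⟨L, hL, hrows, hsh, hx⟩ := ih
    have hlen : ∀ p < r, (W' p).length = (W p).length + m p := fun p hp => by
      rw [hW p hp, List.length_append, List.length_replicate]
    have hm0 : ∀ p, p + 1 < l → m p = 0 := fun p hp => by
      have h1 := hlen p (by omega)
      rw [(WordFamily.cons hl hlr h hW hb).eq_nil (by omega) hp] at h1
      simp only [List.length_nil] at h1
      omega
    have hxW : ∀ p < r, graphPerm L (p + 1) = p + 1 + (W p).length := fun p hp => (hx p hp).2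
    have hgap : ∀ p p', p < p' → p' < r → graphPerm L (p + 1) + m p < graphPerm L (p' + 1) := by
      intro p p' hp hp'
      have h1 := hb p (by omega)
      have h2 := hxW p (by omega)
      have h3 := hxW (p + 1) (by omega)
      have h4 := hlen p (by omega)
      have h5 : graphPerm L (p + 1 + 1) ≤ graphPerm L (p' + 1) := by
        rcases eq_or_lt_of_le (Nat.succ_le_of_lt hp) with e | h6
        · rw [← e]
        · exact (hsh.lt_small (by omega) (by omega) (by omega)).le
      omega
    let A : Finset ℕ := (Finset.range r).biUnion fun p =>
      Finset.Ioc (graphPerm L (p + 1) - l) (graphPerm L (p + 1) - l + m p)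
    have hA : ∀ j, j ∈ A ↔ ∃ p < r, l ≤ p + 1 ∧ graphPerm L (p + 1) < l + j ∧
        l + j ≤ graphPerm L (p + 1) + m p := by
      intro j
      simp only [A, Finset.mem_biUnion, Finset.mem_range, Finset.mem_Ioc]
      refine exists_congr fun p => and_congr_right fun hp => ?_
      have h1 := hxW p hp
      have h2 := hm0 p
      constructor
      · intro h3
        by_cases h4 : p + 1 < l
        · have := h2 h4
          omega
        · omega
      · intro h3
        omega
    have hA0 : 0 ∉ A := fun h0 => by
      obtain ⟨p, hp, h1, h2, -⟩ := (hA 0).mp h0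
      have := hxW p hp
      omega
    have hz := below_injective L l
    -- strand `p + 1` enters the row in column `x - l` and crosses in the next `m p` columns
    have hstart : ∀ p < r, l ≤ p + 1 → graphPerm L (p + 1) - l ∉ A ∧
        graphPerm L (p + 1) - l + m p + 1 ∉ A := by
      intro p hp hlp
      have h1 := hxW p hp
      have h2 : ∀ j, graphPerm L (p + 1) ≤ l + j → j ∈ A → graphPerm L (p + 1) < l + j ∧
          l + j ≤ graphPerm L (p + 1) + m p ∨ graphPerm L (p + 1) + m p + 1 < l + j := by
        intro j hj hjA
        obtain ⟨p', hp', h3, h4, h5⟩ := (hA j).mp hjA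
        rcases lt_trichotomy p' p with h6 | rfl | h6
        · have := hgap p' p h6 hp
          omega
        · exact Or.inl ⟨h4, h5⟩
        · have := hgap p p' h6 hp'
          omega
      constructor
      · intro h3
        have := h2 _ (by omega) h3
        omega
      · intro h3
        have := h2 _ (by omega) h3
        omega
    have hbelow : ∀ p < r, l ≤ p + 1 → RCInsertion.below L l (graphPerm L (p + 1) - l) = p + 1 := by
      intro p hp hlp
      have h1 := hxW p hp
      rw [RCInsertion.below, Equiv.symm_apply_eq]
      omega
    have hcarry : ∀ p < r, l ≤ p + 1 → ∀ j, graphPerm L (p + 1) < l + j →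
        l + j ≤ graphPerm L (p + 1) + m p + 1 → carry (RCInsertion.below L l) A j = p + 1 := by
      intro p hp hlp j hj hj'
      have h1 := hxW p hp
      rw [carry_eq_of_run (i := graphPerm L (p + 1) - l) (by omega)
          (hstart p hp hlp).1 fun k hk hk' =>
        (hA k).mpr ⟨p, hp, hlp, by omega, by omega⟩, hbelow p hp hlp]
    have hrc : IsRCGraph (L ∪ rowGraph l A) := by
      refine (isRCGraph_rowUnion hl hL.1 hrows hA0).mpr ⟨hL, fun j hj => ?_⟩
      obtain ⟨p, hp, h1, h2, h3⟩ := (hA j).mp hj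
      rw [hcarry p hp h1 j h2 (by omega)]
      -- the strand from below is large as no small strand enters the row in these columns
      by_contra hc
      have h4 : graphPerm L (RCInsertion.below L l j) = l + j := Equiv.apply_symm_apply _ _
      have h5 : RCInsertion.below L l j ≠ 0 := fun e => by
        rw [e, (inSInf_graphPerm hL.1).1] at h4
        omega
      obtain ⟨p', hp'⟩ := Nat.exists_eq_succ_of_ne_zero h5
      rw [Nat.succ_eq_add_one] at hp'
      rw [hp'] at h4 hc
      rcases lt_trichotomy p' p with h6 | rfl | h6
      · have := hgap p' p h6 hp
        omega
      · omega
      · omega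
    have hy : ∀ p < r, graphPerm (L ∪ rowGraph l A) (p + 1) = graphPerm L (p + 1) + m p := by
      intro p hp
      have h1 := hxW p hp
      rcases lt_or_ge (p + 1) l with h2 | h2
      · rw [hm0 p h2, graphPerm_fix hL.1 hrows h2.le]
        refine graphPerm_fix (l := l - 1) hrc.1 (fun p hp => ?_) (by omega)
        rcases Finset.mem_union.mp hp with hp | hp
        · have := hrows p hp
          omega
        · have := (mem_rowGraph.mp hp).1
          omega
      · have h3 := graphPerm_rowUnion_symm hl hL.1 hrows hA0
          (j := graphPerm L (p + 1) - l + m p + 1) (by omega)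
        rw [exitStrand, if_neg (hstart p hp h2).2,
          hcarry p hp h2 (graphPerm L (p + 1) - l + m p + 1) (by omega) (by omega),
          Equiv.symm_apply_eq] at h3
        rw [← h3]
        omega
    have hsh' : IsShuffle r (graphPerm (L ∪ rowGraph l A)) := by
      intro i hi hir
      rcases lt_or_ge i r with h1 | h1
      · obtain ⟨p, rfl⟩ : ∃ p, i = p + 1 := ⟨i - 1, by omega⟩
        rw [hy p (by omega), hy (p + 1) h1]
        have := hgap p (p + 1) (by omega) h1
        omega
      · -- large strands do not cross
        by_contra hc
        have h2 : graphPerm (L ∪ rowGraph l A) (i + 1) < graphPerm (L ∪ rowGraph l A) i :=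
          lt_of_le_of_ne (not_lt.mp hc) ((graphPerm _).injective.ne (by omega))
        obtain ⟨⟨k, j⟩, ⟨hk, hks⟩, -⟩ := (strands_crossing hrc (Nat.lt_succ_self i)).1 h2
        rcases Finset.mem_union.mp hk with h3 | h3
        · simp only at hks
          rw [strands_lower (hrows _ h3)] at hks
          exact (strands_crossing hL (Nat.lt_succ_self i)).2 (hsh i hi hir) _ h3 hks
        · obtain ⟨rfl, hj⟩ := mem_rowGraph.mp h3
          simp only at hks hj
          rw [strands_row hl hL.1 hrows hA0
            (Nat.one_le_iff_ne_zero.mpr fun e => hA0 (e ▸ hj))] at hks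
          obtain ⟨p, hp, h4, h5, h6⟩ := (hA j).mp hj
          rw [hcarry p hp h4 j h5 (by omega), Prod.mk.injEq] at hks
          omega
    refine ⟨_, hrc, fun p hp => ?_, hsh', fun p hp => ⟨?_, ?_⟩⟩
    · rcases Finset.mem_union.mp hp with h1 | h1
      · exact Nat.le_of_succ_le (hrows p h1)
      · exact (mem_rowGraph.mp h1).1.ge
    · rw [hsh'.strandWord_rowUnion hl hrows hA0 hrc (show p + 1 ≤ r from hp), (hx p hp).1, hy p hp,
        hW p hp, Nat.add_sub_cancel_left]
    · rw [hy p hp, hxW p hp, hlen p hp, add_assoc]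

/-- A shuffle is determined by its values at the small numbers. -/
theorem IsShuffle.ext {u v : Equiv.Perm ℕ} (hu : IsShuffle r u) (hv : IsShuffle r v)
    (h0 : u 0 = v 0) (h : ∀ p < r, u (p + 1) = v (p + 1)) : u = v := by
  have key : ∀ {u v : Equiv.Perm ℕ} {d : ℕ}, IsShuffle r v → r < d → (∀ c < d, u c = v c) →
      ¬ u d < v d := by
    intro u v d hv hd hc hlt
    obtain ⟨e, he⟩ := v.surjective (u d)
    rcases lt_trichotomy e d with h1 | rfl | h1
    · rw [← hc e h1] at he
      exact h1.ne (u.injective he)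
    · omega
    · have := hv.isSemiShuffle.lt hd h1
      omega
  ext d
  induction d using Nat.strong_induction_on with
  | _ d ih =>
    rcases Nat.eq_zero_or_pos d with rfl | h1
    · exact h0
    · rcases lt_or_ge r d with h2 | h2
      · have h3 := key hv h2 ih
        have h4 := key hu h2 fun c hc => (ih c hc).symm
        omega
      · obtain ⟨p, rfl⟩ : ∃ p, d = p + 1 := ⟨d - 1, by omega⟩
        exact h p h2

/-- The parts of the partition are the displacements of the small numbers. -/
theorem IsShuffle.shuffleShape_eq {v : Equiv.Perm ℕ} {m : ℕ → ℕ}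
    (hv : ∀ p < r, v (p + 1) = p + 1 + m p) : shuffleShape r v = shapeOf r m := by
  rw [shuffleShape, shapeOf, List.range'_eq_map_range, List.map_map]
  refine List.map_congr_left fun p hp => ?_
  have hp' := List.mem_range.mp hp
  have h1 := hv p hp'
  simp only [Function.comp, shufflePart]
  rw [if_pos (by omega), show r + 1 - (r + 1 - (1 + p)) = p + 1 by omega]
  omega

end family

/-! ### The words of all rows -/

/-- The word with the parts `W 0, …, W (r - 1)`. -/
def wordOf (r : ℕ) (W : ℕ → List ℕ) : List ℕ := (List.range r).flatMap W

theorem fullWord_eq (r : ℕ) (Y : Graph) :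
    fullWord r Y = wordOf r fun p => strandWord Y (p + 1) := by
  rw [fullWord, wordOf, List.range'_eq_map_range, List.flatMap_map]
  simp only [add_comm]

theorem graphShape_eq (r : ℕ) (Y : Graph) :
    graphShape r Y = shapeOf r fun p => (strandWord Y (p + 1)).length := by
  rw [graphShape, shapeOf, List.range'_eq_map_range, List.map_map]
  simp only [Function.comp_def, add_comm]

theorem wordOf_congr {r : ℕ} {W W' : ℕ → List ℕ} (h : ∀ p < r, W p = W' p) :
    wordOf r W = wordOf r W' :=
  List.flatMap_congr fun p hp => h p (List.mem_range.mp hp)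

theorem shapeOf_congr {r : ℕ} {m m' : ℕ → ℕ} (h : ∀ p < r, m p = m' p) :
    shapeOf r m = shapeOf r m' :=
  List.map_congr_left fun p hp => h p (List.mem_range.mp hp)

theorem offset_congr {r : ℕ} {m m' : ℕ → ℕ} (h : ∀ p < r, m p = m' p) : offset m r = offset m' r :=
  Finset.sum_congr rfl fun p hp => h p (Finset.mem_range.mp hp)

theorem wordOf_succ (r : ℕ) (W : ℕ → List ℕ) : wordOf (r + 1) W = wordOf r W ++ W r := by
  simp [wordOf, List.range_succ]

theorem wordOf_length (r : ℕ) (W : ℕ → List ℕ) :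
    (wordOf r W).length = offset (fun p => (W p).length) r := by
  induction r with
  | zero => rfl
  | succ r ih => rw [wordOf_succ, List.length_append, ih, offset_succ]

theorem wordOf_getElem? {r : ℕ} {W : ℕ → List ℕ} {p q : ℕ} (hp : p < r) (hq : q < (W p).length) :
    (wordOf r W)[offset (fun p => (W p).length) p + q]? = (W p)[q]? := by
  induction r with
  | zero => omega
  | succ r ih =>
    rw [wordOf_succ]
    rcases Nat.lt_succ_iff_lt_or_eq.mp hp with h1 | rfl
    · rw [List.getElem?_append_left, ih h1]
      rw [wordOf_length]
      exact box_lt (m := fun p => (W p).length) h1 hq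
    · rw [List.getElem?_append_right (by rw [wordOf_length]; omega), wordOf_length,
        Nat.add_sub_cancel_left]

/-- The parts of equal lengths of a word are determined. -/
theorem wordOf_inj {r : ℕ} {W W' : ℕ → List ℕ} (hlen : ∀ p < r, (W p).length = (W' p).length)
    (h : wordOf r W = wordOf r W') : ∀ p < r, W p = W' p := by
  induction r with
  | zero => exact fun p hp => by omega
  | succ r ih =>
    rw [wordOf_succ, wordOf_succ] at h
    obtain ⟨h1, h2⟩ := List.append_inj' h (hlen r r.lt_succ_self)
    intro p hp
    rcases Nat.lt_succ_iff_lt_or_eq.mp hp with h3 | rfl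
    · exact ih (fun p hp => hlen p (by omega)) h1 p h3
    · exact h2

theorem mergeWord_true (l : ℕ) (a ks : List ℕ) (fs : List Bool) :
    mergeWord l (List.replicate a.length true ++ fs) (a ++ ks) = a ++ mergeWord l fs ks := by
  induction a with
  | nil => rfl
  | cons k a ih =>
    rw [List.length_cons, List.replicate_succ, List.cons_append, List.cons_append, mergeWord, ih,
      List.cons_append]

theorem mergeWord_false (l m : ℕ) (ks : List ℕ) (fs : List Bool) :
    mergeWord l (List.replicate m false ++ fs) ks = List.replicate m l ++ mergeWord l fs ks := by
  induction m with
  | zero => rfl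
  | succ m ih =>
    rw [List.replicate_succ, List.cons_append, mergeWord, ih, List.replicate_succ, List.cons_append]

theorem mergeWord_flatMap {l : ℕ} {W W' : ℕ → List ℕ} {m : ℕ → ℕ} {ps : List ℕ}
    (hW : ∀ p ∈ ps, W' p = W p ++ List.replicate (m p) l) :
    mergeWord l (ps.flatMap fun p => List.replicate (W p).length true ++ List.replicate (m p) false)
      (ps.flatMap W) = ps.flatMap W' := by
  induction ps with
  | nil => rfl
  | cons p ps ih =>
    rw [List.flatMap_cons, List.flatMap_cons, List.flatMap_cons, List.append_assoc, mergeWord_true,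
      mergeWord_false, ih fun p hp => hW p (List.mem_cons_of_mem _ hp), hW p List.mem_cons_self,
      List.append_assoc]

theorem Subdiagram.flags {r : ℕ} {sh sh' : ℕ → ℕ} {o : ℕ → Option (ℕ × ℕ)}
    (h : Subdiagram r sh sh' o) {p : ℕ} (hp : p ≤ r) :
    ((List.range (offset sh' p)).map fun i => (o i).isSome) = (List.range p).flatMap fun p =>
      List.replicate (sh p) true ++ List.replicate (sh' p - sh p) false := by
  induction p with
  | zero => rfl
  | succ p ih =>
    have h1 := h.le p hp
    have h2 := h.isSome p hp
    rw [List.range_succ, List.flatMap_append, ← ih (by omega), offset_succ, List.range_add,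
      List.map_append, List.map_map]
    congr 1
    rw [List.flatMap_cons, List.flatMap_nil, List.append_nil]
    conv_lhs => rw [show sh' p = sh p + (sh' p - sh p) by omega, List.range_add, List.map_append,
      List.map_map]
    congr 1
    · rw [List.eq_replicate_iff]
      refine ⟨by simp, fun b hb => ?_⟩
      obtain ⟨q, hq, rfl⟩ := List.mem_map.mp hb
      have hq' := List.mem_range.mp hq
      exact (h2 q (by omega)).mpr hq'
    · rw [List.eq_replicate_iff]
      refine ⟨by simp, fun b hb => ?_⟩
      obtain ⟨q, hq, rfl⟩ := List.mem_map.mp hb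
      have hq' := List.mem_range.mp hq
      simp only [Function.comp]
      rw [Bool.eq_false_iff]
      intro h3
      have := (h2 (sh p + q) (by omega)).mp h3
      omega

/-- The word of a row tells which steps are rectifications. -/
theorem Subdiagram.exists_letter {r l : ℕ} {W W' : ℕ → List ℕ} {m : ℕ → ℕ}
    {o : ℕ → Option (ℕ × ℕ)}
    (h : Subdiagram r (fun p => (W p).length) (fun p => (W' p).length) o)
    (hW : ∀ p < r, W' p = W p ++ List.replicate (m p) l) (hlt : ∀ p < r, ∀ k ∈ W p, l < k) {i : ℕ}
    (hi : i < offset (fun p => (W' p).length) r) :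
    ∃ k, (wordOf r W')[i]? = some k ∧ l ≤ k ∧ (k = l ↔ o i = none) := by
  obtain ⟨p, q, hp, hq, rfl⟩ := exists_box _ hi
  have h1 := h.isSome p hp q hq
  rw [wordOf_getElem? hp hq]
  have h2 := hW p hp
  rcases lt_or_ge q (W p).length with h3 | h3
  · have h4 := hlt p hp _ (List.getElem_mem h3)
    refine ⟨(W p)[q], by rw [h2, List.getElem?_append_left h3, List.getElem?_eq_getElem h3],
        h4.le, ?_⟩
    constructor
    · intro h5
      omega
    · intro h5
      rw [h5] at h1
      simp only [Option.isSome_none, Bool.false_eq_true, false_iff] at h1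
      exact absurd h3 h1
  · refine ⟨l, ?_, le_rfl, ?_⟩
    · rw [h2] at hq ⊢
      rw [List.length_append, List.length_replicate] at hq
      rw [List.getElem?_append_right h3, List.getElem?_replicate_of_lt (by omega)]
    · simp only [true_iff]
      rcases h4 : o (offset (fun p => (W' p).length) p + q) with _ | t
      · rfl
      · rw [h4] at h1
        simp only [Option.isSome_some, true_iff] at h1
        omega

/-! ### The steps of all rows -/

/-- The steps of the rows `r, r - 1, …, l` lead from the graph `R` and the words `W` to the graph
`U` and the tableau with the word `T`, which is strict over `w = w(R)`. -/
inductive Rows (r : ℕ) :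
    ℕ → Equiv.Perm ℕ → (ℕ → List ℕ) → Graph → List (ℕ × ℕ) → Graph → Prop
  | nil {U : Graph} {W : ℕ → List ℕ} (hU : IsRCGraph U) (hrows : ∀ p ∈ U, r < p.1)
      (hW : ∀ p < r, W p = []) : Rows r (r + 1) (graphPerm U) W U [] U
  | cons {l n : ℕ} {w : Equiv.Perm ℕ} {W W' : ℕ → List ℕ} {m : ℕ → ℕ} {cs : ℕ → Config}
      {o : ℕ → Option (ℕ × ℕ)} {R : Graph} (hl : 1 ≤ l) (hlr : l ≤ r) (hrun : Run r l w n cs o)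
      (h : Rows r (l + 1) (graphPerm (cs 0).lower) W (cs n).lower (lowerWord o n) R)
      (hn : n = offset (fun p => (W' p).length) r)
      (hsub : Subdiagram r (fun p => (W p).length) (fun p => (W' p).length) o)
      (hW : ∀ p < r, W' p = W p ++ List.replicate (m p) l)
      (hb : ∀ p, p + 1 < r → (W' p).length ≤ (W (p + 1)).length)
      (hstrict : StrictOn r (fun p => (W' p).length) n (evalAt w (cs n).word)) :
      Rows r l w W' ((cs n).graph l) (cs n).word (R ∪ rowGraph l (cs 0).cols)

section rows

variable {r l : ℕ} {w : Equiv.Perm ℕ} {W : ℕ → List ℕ} {U R : Graph} {T : List (ℕ × ℕ)}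

theorem Rows.wordFamily (h : Rows r l w W U T R) : WordFamily r l W := by
  induction h with
  | nil hU hrows hW => exact WordFamily.nil hW
  | cons hl hlr hrun h hn hsub hW hb hstrict ih => exact WordFamily.cons hl hlr ih hW hb

theorem Rows.graph (h : Rows r l w W U T R) :
    IsRCGraph R ∧ (∀ p ∈ R, l ≤ p.1) ∧ graphPerm R = w := by
  induction h with
  | nil hU hrows hW => exact ⟨hU, hrows, rfl⟩
  | @cons l n w W W' m cs o R hl hlr hrun h hn hsub hW hb hstrict ih =>
    obtain ⟨hR, hrows, hp⟩ := ih
    have hv := hrun.valid_zero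
    have hbel : RCInsertion.below R l = RCInsertion.below (cs 0).lower l := by
      unfold RCInsertion.below
      rw [hp]
    refine ⟨(isRCGraph_rowUnion hl hR.1 hrows hv.zero).mpr ⟨hR, ?_⟩, fun p hp => ?_, ?_⟩
    · rw [hbel]
      exact hv.reduced
    · rcases Finset.mem_union.mp hp with h1 | h1
      · exact Nat.le_of_succ_le (hrows p h1)
      · exact (mem_rowGraph.mp h1).1.ge
    · rw [graphPerm_rowUnion hl hR.1 hrows hv.zero, hp,
        ← graphPerm_rowUnion hl hv.rc.1 hv.rows hv.zero]
      have h1 := hv.perm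
      rw [hrun.word_zero] at h1
      exact h1.symm.trans (mul_one w)

/-- The result of the steps is an `r`-Bruhat package with a strict tableau. -/
theorem Rows.package (h : Rows r l w W U T R) : IsRCGraph U ∧ (∀ p ∈ U, l ≤ p.1) ∧
    w * transProd T = graphPerm U ∧ IsChain w T ∧ (∀ t ∈ T, 1 ≤ t.1 ∧ t.1 ≤ r ∧ r < t.2) ∧
    T.length = offset (fun p => (W p).length) r ∧
    StrictOn r (fun p => (W p).length) T.length (evalAt w T) := by
  cases h with
  | nil hU hrows hW =>
    refine ⟨hU, hrows, mul_one _, ?_, by simp, ?_, ⟨by simp, by simp⟩⟩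
    · intro i hi
      obtain rfl : i = 0 := by simpa using hi
      simp [transProd]
    · rw [offset_congr (m' := fun _ => 0) fun p hp => by rw [hW p hp, List.length_nil]]
      simp [offset]
  | @cons _ n _ _ _ _ cs _ _ hl hlr hrun h hn hsub hW hb hstrict =>
    have hv := hrun.valid hl hlr le_rfl
    have h1 := hrun.length le_rfl
    refine ⟨hv.isRC hl, fun p hp => ?_, hv.perm, hv.chain, hv.range, h1.trans hn, ?_⟩
    · rcases Finset.mem_union.mp hp with h1 | h1
      · exact (hv.rows p h1).le
      · exact (mem_rowGraph.mp h1).1.ge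
    · rw [h1]
      exact hstrict

/-- The inverse algorithm undoes the steps. -/
theorem Rows.invRows_eq (h : Rows r l w W U T R) :
    invRows r (r + 1 - l) l U T = some (R, wordOf r W) := by
  induction h with
  | @nil U W hU hrows hW =>
    rw [Nat.sub_self, invRows, if_pos rfl, wordOf_congr hW]
    simp [wordOf]
  | @cons l n w W W' m cs o R hl hlr hrun h hn hsub hW hb hstrict ih =>
    have hv := hrun.valid hl hlr le_rfl
    have h1 := hrun.invRowState_eq hl hlr le_rfl
    have h2 := hrun.length le_rfl
    rw [Nat.sub_self, ← List.range_eq_range'] at h1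
    rw [show r + 1 - l = r + 1 - (l + 1) + 1 by omega, invRows, h2, h1]
    simp only [Option.bind_eq_bind, Option.bind_some, rowsGE_graph hv.rows]
    have h3 : (List.range n).filterMap o = lowerWord o n := rfl
    have h4 := hsub.flags le_rfl
    rw [← hn] at h4
    rw [h3, ih, Option.bind_some, h4, rowOnly_graph hrun.valid_zero.rows, Finset.union_comm]
    simp only [Option.pure_def, Option.some.injEq, Prod.mk.injEq, true_and, wordOf]
    rw [← mergeWord_flatMap (W := W) (m := m) fun p hp => hW p (List.mem_range.mp hp)]
    congr 1
    refine List.flatMap_congr fun p hp => ?_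
    rw [hW p (List.mem_range.mp hp), List.length_append, List.length_replicate,
      Nat.add_sub_cancel_left]

theorem rowsGE_rowsGE (G : Graph) (l : ℕ) : rowsGE (rowsGE G l) (l + 1) = rowsGE G (l + 1) := by
  ext p
  simp only [rowsGE, Finset.mem_filter]
  exact ⟨fun h => ⟨h.1.1, h.2⟩, fun h => ⟨⟨h.1, by omega⟩, h.2⟩⟩

theorem rowOnly_rowsGE (G : Graph) (l : ℕ) : rowOnly (rowsGE G l) l = rowOnly G l := by
  ext p
  simp only [rowsGE, rowOnly, Finset.mem_filter]
  exact ⟨fun h => ⟨h.1.1, h.2⟩, fun h => ⟨⟨h.1, h.2.ge⟩, h.2⟩⟩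

/-- The insertion algorithm performs the steps. -/
theorem Rows.afterRows_eq (h : Rows r l w W U T R) {R₀ Y : Graph} (hR : rowsGE R₀ l = R)
    (hY : IsRCGraph Y) (hsh : IsShuffle r (graphPerm Y))
    (hYW : ∀ p < r, strandWord (rowsGE Y l) (p + 1) = W p) :
    afterRows r R₀ Y (r + 1 - l) = some (U, T) := by
  induction h with
  | @nil U W hU hrows hW => rw [Nat.sub_self, afterRows, hR]
  | @cons l n w W W' m cs o R hl hlr hrun h hn hsub hW hb hstrict ih =>
    have hrows := h.graph.2.1
    have hperm := h.graph.2.2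
    have hw := (Rows.cons hl hlr hrun h hn hsub hW hb hstrict).graph.2.2
    have hlt : ∀ p < r, ∀ k ∈ W p, l < k := fun p hp k hk => h.wordFamily.le_of_mem hp hk
    have h1 : rowsGE R₀ (l + 1) = R := by
      rw [← rowsGE_rowsGE, hR]
      exact rowsGE_graph (s := ⟨R, (cs 0).cols, []⟩) hrows
    have h2 : rowOnly R₀ l = rowGraph l (cs 0).cols := by
      rw [← rowOnly_rowsGE, hR]
      exact rowOnly_graph (s := ⟨R, (cs 0).cols, []⟩) hrows
    have h3 : ∀ p < r, strandWord (rowsGE Y (l + 1)) (p + 1) = W p := by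
      intro p hp
      have h4 := hsh.strandWord_rowsGE hY hl (show p + 1 ≤ r from hp)
      rw [hYW p hp, hW p hp] at h4
      have h5 : ∀ (V : List ℕ) (k : ℕ), (∀ x ∈ V, l < x) →
          (V ++ List.replicate k l).filter (fun x => decide (l < x)) = V := fun V k hV => by
        rw [List.filter_append, List.filter_eq_self.mpr fun x hx => decide_eq_true (hV x hx),
          List.filter_eq_nil_iff.mpr fun x hx => by rw [List.eq_of_mem_replicate hx]; simp,
          List.append_nil]
      rw [← h5 (W p) (m p) (hlt p hp), h4, h5 _ _ fun x hx =>
        le_of_mem_strandWord (rowsGE_succ_rows Y l) hx]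
    have hfull : fullWord r (rowsGE Y l) = wordOf r W' := by
      rw [fullWord_eq, wordOf_congr hYW]
    have hcard : (rowsGE Y l).card = n := by
      rw [(hsh.isShuffle_rowsGE hY hl).card_eq (hY.isRCGraph_rowsGE hl), hn]
      exact offset_congr fun p hp => by rw [hYW p hp]
    have hshape : graphShape r (rowsGE Y l) = shapeOf r fun p => (W' p).length := by
      rw [graphShape_eq, shapeOf_congr fun p hp => by rw [hYW p hp]]
    rw [show r + 1 - l = r + 1 - (l + 1) + 1 by omega, afterRows, ih h1 h3, Option.bind_eq_bind,
      Option.bind_some, show r - (r + 1 - (l + 1)) = l by omega, hcard]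
    refine hrun.rowState_eq hl hlr (by rw [hR, hw]) (by rw [h1, hperm]) h2 hshape hn
        (fun i hi => ?_)
      hstrict le_rfl
    rw [hfull]
    exact hsub.exists_letter hW hlt (hn ▸ hi)

end rows

/-! ### Existence of the steps of all rows -/

section existence

variable {r l : ℕ} {w : Equiv.Perm ℕ} {W : ℕ → List ℕ} {U R : Graph} {T : List (ℕ × ℕ)}

/-- The number of a box determines its row and column. -/
theorem box_inj {m : ℕ → ℕ} {p q p' q' : ℕ} (hq : q < m p) (hq' : q' < m p')
    (h : offset m p + q = offset m p' + q') : p = p' ∧ q = q' := by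
  have key : ∀ {p q p' q' : ℕ}, q < m p → offset m p + q = offset m p' + q' → ¬ p < p' := by
    intro p q p' q' hq h hlt
    have := offset_mono m (Nat.succ_le_of_lt hlt)
    rw [Nat.succ_eq_add_one, offset_succ] at this
    omega
  obtain rfl : p = p' := le_antisymm (not_lt.mp (key hq' h.symm)) (not_lt.mp (key hq h))
  exact ⟨rfl, by omega⟩

/-- The lower rows of a semi-shuffle form a semi-shuffle. -/
theorem IsSemiShuffle.lower {L : Graph} {A : Finset ℕ}
    (h : IsSemiShuffle r (graphPerm (L ∪ rowGraph l A)))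
    (hrows : ∀ p ∈ L, l < p.1) (hrc : IsRCGraph (L ∪ rowGraph l A)) (hL : IsRCGraph L) :
    IsSemiShuffle r (graphPerm L) := fun i hi =>
  graphPerm_lt_of_rowUnion hrows hrc hL (Nat.lt_succ_self i) (h i hi)

theorem rowsGE_eq_self {R : Graph} (h : ∀ p ∈ R, l ≤ p.1) : rowsGE R l = R :=
  Finset.filter_true_of_mem h

/-- The steps can be performed from every rc-graph. -/
theorem WordFamily.exists_rows (h : WordFamily r l W) (hR : IsRCGraph R) (hrows : ∀ p ∈ R, l ≤ p.1)
    (hcase : IsSemiShuffle r (graphPerm R) ∨ ∀ p, p + 1 < r → (W p).length ≤ 1) :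
    ∃ U T, Rows r l (graphPerm R) W U T R := by
  induction h generalizing R with
  | nil hW => exact ⟨R, [], Rows.nil hR hrows hW⟩
  | @cons l W W' m hl hlr h hW hb ih =>
    have hA := zero_notMem_rowCols hR.1 l
    have hrows' := rowsGE_succ_rows R l
    have hRe : R = rowsGE R (l + 1) ∪ rowGraph l (rowCols R l) := by
      rw [← rowsGE_eq_union, rowsGE_eq_self hrows]
    have hR' := hRe ▸ hR
    have hred := (isRCGraph_rowUnion hl (rowsGE_isGraph hR.1 _) hrows' hA).mp hR'
    have hlen : ∀ p < r, (W' p).length = (W p).length + m p := fun p hp => by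
      rw [hW p hp, List.length_append, List.length_replicate]
    have hle : ∀ p < r, (W p).length ≤ (W' p).length := fun p hp => by
      have := hlen p hp
      omega
    have hmono : ∀ p, p + 1 < r → (W p).length ≤ (W (p + 1)).length := fun p hp =>
      (hle p (by omega)).trans (hb p hp)
    -- the rows below are treated first; their result is the lower package of row `l`
    obtain ⟨U, T, hrec⟩ := ih hred.1 hrows' (by
      rcases hcase with h1 | h1
      · exact Or.inl (IsSemiShuffle.lower (hRe ▸ h1) hrows' hR' hred.1)
      · exact Or.inr fun p hp => (hle p (by omega)).trans (h1 p hp))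
    obtain ⟨hU, hUrows, hUperm, hchain, hrange, hTlen, hTstrict⟩ := hrec.package
    obtain ⟨L, hLT, hL0, hLw, hLrows, hLcov⟩ := exists_lowerChain (l := l) (r := r) hU hUrows hUperm
      hchain hrange
    have hbel : RCInsertion.below (L 0) l = RCInsertion.below (rowsGE R (l + 1)) l := by
      unfold RCInsertion.below
      rw [hLw]
    -- the boxes of the lower diagram are filled by rectifications
    obtain ⟨o, ho, hoT, hoW⟩ := exists_kinds (fun i => decide (∃ p < r, ∃ q < (W p).length,
      i = offset (fun p => (W' p).length) p + q)) T
    have hsub : Subdiagram r (fun p => (W p).length) (fun p => (W' p).length) o := by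
      refine ⟨hle, fun p hp q hq => ?_⟩
      rw [ho, decide_eq_true_iff]
      constructor
      · rintro ⟨p', hp', q', hq', e⟩
        obtain ⟨rfl, rfl⟩ := box_inj (m := fun p => (W' p).length) hq
          (hq'.trans_le (hle p' hp')) e
        exact hq'
      · exact fun h1 => ⟨p, hp, q, h1, rfl⟩
    have hlow : ∀ i < offset (fun p => (W' p).length) r, (o i).isSome →
        (lowerWord o i).length < T.length := by
      intro i hi hoi
      obtain ⟨p, q, hp, hq, rfl⟩ := exists_box _ hi
      have h1 := (hsub.isSome p hp q hq).mp hoi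
      rw [hsub.length_add hp (hsub.length hp.le) (show q ≤ (W' p).length by omega), hTlen,
        min_eq_left h1.le]
      exact box_lt (m := fun p => (W p).length) hp h1
    have hoTn : lowerWord o (offset (fun p => (W' p).length) r) = T := by
      have h1 := hsub.length le_rfl
      rw [hoW _ (by rw [h1, hTlen]), h1, ← hTlen, List.take_length]
    have hvalid : Config.Valid r l (graphPerm R) ⟨L 0, rowCols R l, []⟩ := by
      refine ⟨hL0, hLrows 0 (Nat.zero_le _), hA, ?_, by simp, ?_, ?_⟩
      · simp only
        rw [hbel]
        exact hred.2
      · simp only [Config.graph]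
        rw [graphPerm_rowUnion hl hL0.1 (hLrows 0 (Nat.zero_le _)) hA, hLw,
          ← graphPerm_rowUnion hl hred.1.1 hrows' hA, ← hRe]
        exact mul_one _
      · intro i hi
        obtain rfl : i = 0 := by simpa using hi
        simp [transProd]
    obtain ⟨cs, hrun, hcs0, hcsn⟩ :=
      exists_run (n := offset (fun p => (W' p).length) r) hl hlr o hvalid
      fun i hi t hot => hLcov _ t (hoT i t (hlow i hi (by rw [hot]; rfl)) hot)
    rw [hoTn, hLT] at hcsn
    have hlow0 : graphPerm (cs 0).lower = graphPerm (rowsGE R (l + 1)) := by rw [hcs0, hLw]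
    have hF := (hrun.lower_strict_iff hsub rfl hmono).mp (by
      rw [hoTn, hlow0]
      exact hTstrict)
    have hE := (hrun.alternation hl hlr).strict_upper rfl hsub.isSome hsub.le hb (by
      rcases hcase with h1 | h1
      · exact Or.inl (hrun.largeMoves hl hlr (inSInf_graphPerm hR.1) h1)
      · exact Or.inr h1) hF
    have hmono' : ∀ p, p + 1 < r → (W' p).length ≤ (W' (p + 1)).length := fun p hp =>
      (hb p hp).trans (hle (p + 1) hp)
    rw [← hlow0, ← hcsn, ← hoTn] at hrec
    have hrow := Rows.cons hl hlr hrun hrec rfl hsub hW hb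
      ((strictOn_iff_boxStrict hmono' rfl).mpr hE)
    rw [hcs0] at hrow
    simp only at hrow
    rw [← hRe] at hrow
    exact ⟨_, _, hrow⟩

/-- Every package with a strict tableau is the result of the steps. -/
theorem exists_rows_to {sh : ℕ → ℕ} (hl : 1 ≤ l) (hlr : l ≤ r + 1) (hU : IsRCGraph U)
    (hrows : ∀ p ∈ U, l ≤ p.1) (hperm : w * transProd T = graphPerm U) (hchain : IsChain w T)
    (hrange : ∀ t ∈ T, 1 ≤ t.1 ∧ t.1 ≤ r ∧ r < t.2) (hlen : T.length = offset sh r)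
    (hmono : ∀ p, p + 1 < r → sh p ≤ sh (p + 1))
    (hcase : InSInf w ∧ IsSemiShuffle r w ∨ ∀ p, p + 1 < r → sh p ≤ 1)
    (hstrict : StrictOn r sh T.length (evalAt w T)) :
    ∃ W R, Rows r l w W U T R ∧ ∀ p < r, (W p).length = sh p := by
  obtain ⟨d, hd⟩ := Nat.exists_eq_add_of_le hlr
  induction d generalizing l w U T sh with
  | zero =>
    obtain rfl : l = r + 1 := by omega
    -- the rows below row `r` do not move the small strands
    have hT : T = [] := by
      obtain ⟨L, -, -, -, -, hcov⟩ := exists_lowerChain (l := r) hU hrows hperm hchain hrange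
      by_contra hne
      obtain ⟨t, T', rfl⟩ := List.exists_cons_of_ne_nil hne
      have h1 := hcov 0 t rfl
      obtain ⟨P, Q, hP, hPQ, h2, -⟩ := h1.columns
      rw [RCInsertion.below, Equiv.symm_apply_eq, graphPerm_fix h1.rc.1 h1.rows h1.ha] at h2
      have := h1.ha
      omega
    subst hT
    obtain rfl : w = graphPerm U := by simpa [transProd] using hperm
    refine ⟨fun _ => [], U, Rows.nil hU hrows fun _ _ => rfl, fun p hp => ?_⟩
    have h1 := offset_mono sh (Nat.succ_le_of_lt hp)
    rw [Nat.succ_eq_add_one, offset_succ, ← hlen] at h1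
    simp only [List.length_nil] at h1 ⊢
    omega
  | succ d ih =>
    have hlr' : l ≤ r := by omega
    have hA := zero_notMem_rowCols hU.1 l
    have hUe : U = rowsGE U (l + 1) ∪ rowGraph l (rowCols U l) := by
      rw [← rowsGE_eq_union, rowsGE_eq_self hrows]
    have hred := (isRCGraph_rowUnion hl (rowsGE_isGraph hU.1 _) (rowsGE_succ_rows U l) hA).mp
      (hUe ▸ hU)
    have hvalid : Config.Valid r l w ⟨rowsGE U (l + 1), rowCols U l, T⟩ :=
      ⟨hred.1, rowsGE_succ_rows U l, hA, hred.2, hrange, by rw [hperm, Config.graph, ← hUe], hchain⟩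
    -- row `l` is undone first; it determines the lower package and the subdiagram of the
    -- rectifications
    obtain ⟨cs, o, hrun, hcsn⟩ := hvalid.exists_run hl hlr' hlen
    have hword : (cs (offset sh r)).word = T := by rw [hcsn]
    have hE := (strictOn_iff_boxStrict hmono hlen).mp hstrict
    rw [← hword] at hE
    obtain ⟨sh₀, hle, hsome, hb, hF⟩ := (hrun.alternation hl hlr').strict_lower rfl hmono (by
      rcases hcase with ⟨h1, h2⟩ | h1
      · exact Or.inl (hrun.largeMoves hl hlr' h1 h2)
      · exact Or.inr h1) hE
    have hsub : Subdiagram r sh₀ sh o := ⟨hle, hsome⟩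
    have hmono₀ : ∀ p, p + 1 < r → sh₀ p ≤ sh₀ (p + 1) := fun p hp =>
      (hle p (by omega)).trans (hb p hp)
    have hv0 := hrun.valid_zero
    have hvn := hrun.valid hl hlr' le_rfl
    obtain ⟨W, R, hrec, hWlen⟩ := ih (l := l + 1) (by omega) (by omega) hvn.rc hvn.rows
      (hrun.lower_perm le_rfl).symm (hrun.lower_chain le_rfl) (fun t ht => hrun.lower_range ht)
      (hsub.length le_rfl) hmono₀ (by
        rcases hcase with ⟨h1, h2⟩ | h1
        · exact Or.inl ⟨inSInf_graphPerm hv0.rc.1, hv0.semi_lower hl h1 h2⟩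
        · exact Or.inr fun p hp => (hle p (by omega)).trans (h1 p hp))
      ((hrun.lower_strict_iff hsub rfl hmono₀).mpr hF) (by omega)
    have hlen' : ∀ p < r, (W p ++ List.replicate (sh p - sh₀ p) l).length = sh p := fun p hp => by
      rw [List.length_append, List.length_replicate, hWlen p hp]
      have := hle p hp
      omega
    have hoff : ∀ p ≤ r, offset (fun p => (W p ++ List.replicate (sh p - sh₀ p) l).length) p =
        offset sh p := fun p hp => offset_congr fun k hk => hlen' k (by omega)
    have hrow := Rows.cons (W' := fun p => W p ++ List.replicate (sh p - sh₀ p) l)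
      (m := fun p => sh p - sh₀ p) hl hlr' hrun hrec (hoff r le_rfl).symm
      ⟨fun p hp => by rw [hWlen p hp, hlen' p hp]; exact hle p hp, fun p hp q hq => by
        rw [hoff p hp.le, hWlen p hp]
        rw [hlen' p hp] at hq
        exact hsome p hp q hq⟩
      (fun p hp => rfl) (fun p hp => by rw [hlen' p (by omega), hWlen (p + 1) hp]; exact hb p hp)
      (by
        rw [strictOn_iff_boxStrict (fun p hp => by
          rw [hlen' p (by omega), hlen' (p + 1) hp]; exact hmono p hp) (hoff r le_rfl).symm]
        refine ⟨fun p hp q q' h1 h2 => ?_, fun p hp q h1 h2 => ?_⟩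
        · rw [hlen' p hp] at h2
          rw [hoff p hp.le]
          exact hE.row p hp q q' h1 h2
        · rw [hlen' p (by omega)] at h1
          rw [hlen' (p + 1) hp] at h2
          rw [hoff p (by omega), hoff (p + 1) hp.le]
          exact hE.col p hp q h1 h2)
    rw [hcsn] at hrow
    simp only [Config.graph] at hrow
    rw [← hUe] at hrow
    exact ⟨_, _, hrow, hlen'⟩

end existence

/-! ### The two algorithms -/

section algorithms

variable {r : ℕ} {w v : Equiv.Perm ℕ} {W : ℕ → List ℕ} {U R Y : Graph}

theorem IsShuffle.le_apply (h : IsShuffle r v) (h0 : v 0 = 0) {s : ℕ} (hs : s ≤ r) : s ≤ v s := by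
  induction s with
  | zero => exact Nat.zero_le _
  | succ s ih =>
    rcases Nat.eq_zero_or_pos s with rfl | h1
    · exact Nat.one_le_iff_ne_zero.mpr fun e => one_ne_zero (v.injective (e.trans h0.symm))
    · exact (ih (by omega)).trans_lt (h s h1 (by omega))

/-- The admissible pairs, with the shape of the tableau given by its row lengths `m 0, …, m (r - 1)`
from the bottom. -/
theorem mem_admissiblePairs_iff {m : ℕ → ℕ} (hm : ∀ p < r, v (p + 1) = p + 1 + m p)
    {T : Tableau (ℕ × ℕ)} : (U, T) ∈ admissiblePairs r w v ↔
      T.shape = shapeOf r m ∧ IsRCGraph U ∧ w * transProd T.word = graphPerm U ∧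
      IsChain w T.word ∧ (∀ t ∈ T.word, 1 ≤ t.1 ∧ t.1 ≤ r ∧ r < t.2) ∧
      T.word.length = offset m r ∧ StrictOn r m T.word.length (evalAt w T.word) := by
  obtain ⟨sh, T⟩ := T
  have hT : (⟨sh, T⟩ : Tableau (ℕ × ℕ)).perm T.length = transProd T := by
    rw [Tableau.perm, List.take_length]
    rfl
  simp only [admissiblePairs, Set.mem_ofPred_eq, IsTranspositionTableau, IsBruhatPackage,
    IsBruhatChain, IsShuffle.shuffleShape_eq hm, hT]
  constructor
  · rintro ⟨⟨rfl, h2, h3⟩, ⟨h4, h5, -, h6⟩, h7⟩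
    refine ⟨rfl, h4, h5, fun i hi => ?_, h3, h2.trans (shapeOf_sum r m), evalStrict_iff.mp h7⟩
    rcases Nat.eq_zero_or_pos i with rfl | h8
    · simp [transProd]
    · exact h6 i h8 hi
  · rintro ⟨rfl, h1, h2, h3, h4, h5, h6⟩
    exact ⟨⟨rfl, h5.trans (shapeOf_sum r m).symm, h4⟩, ⟨h1, h2, h4, fun i _ hi => h3 i hi⟩,
      evalStrict_iff.mpr h6⟩

theorem IsShuffle.apply_eq (hY : IsRCGraph Y) (h : IsShuffle r (graphPerm Y)) {p : ℕ} (hp : p < r) :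
    graphPerm Y (p + 1) = p + 1 + (strandWord Y (p + 1)).length := by
  have h1 := h.graphPerm_eq hY le_rfl (Nat.le_add_left 1 r) (show p + 1 ≤ r from hp)
  rwa [rowsGE_one hY.1] at h1

/-- An rc-graph of an `r`-shuffle is determined by its word. -/
theorem RC.eq_of_fullWord {Y' : Graph} (hv : IsShuffle r v) (hY : Y ∈ RC v) (hY' : Y' ∈ RC v)
    (h : fullWord r Y = fullWord r Y') : Y = Y' := by
  obtain ⟨hY, rfl⟩ := hY
  obtain ⟨hY', he⟩ := hY'
  rw [fullWord_eq, fullWord_eq] at h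
  have hv' : IsShuffle r (graphPerm Y') := he ▸ hv
  refine hv.eq_of_strandWord hY hY' hv' fun s hs hsr => ?_
  have h1 := wordOf_inj (fun p hp => ?_) h (s - 1) (by omega)
  · rwa [Nat.sub_add_cancel hs] at h1
  · have h1 := hv.apply_eq hY hp
    have h2 := hv'.apply_eq hY' hp
    rw [he] at h2
    omega

/-- The steps of all rows compute the insertion. -/
theorem Rows.insertion_eq {T : List (ℕ × ℕ)} (h : Rows r 1 w W U T R) (hR : IsRCGraph R)
    (hY : IsRCGraph Y) (hsh : IsShuffle r (graphPerm Y))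
    (hYW : ∀ p < r, strandWord Y (p + 1) = W p) :
    insertion r R Y = some (U, ⟨shapeOf r fun p => (W p).length, T⟩) := by
  have h1 := h.afterRows_eq (rowsGE_one hR.1) hY hsh fun p hp => by rw [rowsGE_one hY.1, hYW p hp]
  rw [Nat.add_sub_cancel] at h1
  rw [insertion, h1, graphShape_eq, shapeOf_congr fun p hp => by rw [hYW p hp]]
  rfl

/-- The steps of all rows start from every pair of rc-graphs. -/
theorem exists_rows_of_mem_RC (hv : IsShuffle r v)
    (hcase : IsSemiShuffle r w ∨ ∀ p, p + 1 < r → v (p + 1) ≤ p + 2) (hR : R ∈ RC w)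
    (hY : Y ∈ RC v) : ∃ U T, Rows r 1 w (fun p => strandWord Y (p + 1)) U T R := by
  obtain ⟨hR, rfl⟩ := hR
  obtain ⟨hY, rfl⟩ := hY
  have h1 := hv.wordFamily hY le_rfl (Nat.le_add_left 1 r)
  rw [rowsGE_one hY.1] at h1
  refine h1.exists_rows hR (fun p hp => (hR.1 p hp).1) (hcase.imp id fun h p hp => ?_)
  have h2 := h p hp
  rw [hv.apply_eq hY (by omega)] at h2
  omega

/-- The steps of all rows lead to every admissible pair. -/
theorem exists_rows_of_mem_admissiblePairs (hw : InSInf w) (h0 : v 0 = 0) (hv : IsShuffle r v)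
    (hcase : IsSemiShuffle r w ∨ ∀ p, p + 1 < r → v (p + 1) ≤ p + 2) {T : Tableau (ℕ × ℕ)}
    (h : (U, T) ∈ admissiblePairs r w v) :
    ∃ R Y W, Rows r 1 w W U T.word R ∧ R ∈ RC w ∧ Y ∈ RC v ∧
      (∀ p < r, strandWord Y (p + 1) = W p) ∧ T.shape = shapeOf r fun p => (W p).length := by
  have hm : ∀ p < r, v (p + 1) = p + 1 + (v (p + 1) - (p + 1)) := fun p hp => by
    have := hv.le_apply h0 (show p + 1 ≤ r from hp)
    omega
  obtain ⟨hsh, hU, hperm, hchain, hrange, hlen, hstrict⟩ := (mem_admissiblePairs_iff hm).mp h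
  obtain ⟨W, R, hrows, hW⟩ := exists_rows_to le_rfl (Nat.le_add_left 1 r) hU
    (fun p hp => (hU.1 p hp).1) hperm hchain hrange hlen
    (fun p hp => by
      have := hv (p + 1) (by omega) (by omega)
      omega)
    (hcase.imp (fun h => ⟨hw, h⟩) fun h p hp => by
      have := h p hp
      omega) hstrict
  obtain ⟨Y, hY, -, hYsh, hYW⟩ := hrows.wordFamily.exists_graph
  have hYv : graphPerm Y = v := by
    refine hYsh.ext hv ((inSInf_graphPerm hY.1).1.trans h0.symm) fun p hp => ?_
    rw [(hYW p hp).2, hW p hp, ← hm p hp]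
  exact ⟨R, Y, W, hrows, ⟨hrows.graph.1, hrows.graph.2.2⟩, ⟨hY, hYv⟩, fun p hp => (hYW p hp).1,
    hsh.trans (shapeOf_congr fun p hp => (hW p hp).symm)⟩

end algorithms

end RCInsertion

theorem theorem2p3 (r : ℕ) (hr : 1 ≤ r) (w v : Equiv.Perm ℕ) (hw : InSInf w) (hv : InSInf v)
    (hshuffle : IsShuffle r v)
    (hcase : IsSemiShuffle r w ∨ IsHook (shufflePart r v)) :
    (∀ (U : Graph) (T : Tableau (ℕ × ℕ)),
      IsTranspositionTableau r v T → IsBruhatPackage r w U T → EvalStrict w T →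
        ∃ R Y : Graph, inverseInsertion r v U T = some (R, Y) ∧ R ∈ RC w ∧ Y ∈ RC v ∧
          insertion r R Y = some (U, T)) ∧
    Set.BijOn (fun x : Graph × Graph => insertion r x.1 x.2) (RC w ×ˢ RC v)
      (some '' admissiblePairs r w v) := by
  have hcase' : IsSemiShuffle r w ∨ ∀ p, p + 1 < r → v (p + 1) ≤ p + 2 := by
    refine hcase.imp id fun h p hp => ?_
    -- the strand `p + 1 < r` corresponds to the row `r - p ≥ 2` of the diagram
    have h1 := h (r - p) (by omega)
    rw [shufflePart, if_pos (by omega), show r + 1 - (r - p) = p + 1 by omega] at h1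
    omega
  have key : ∀ (U : Graph) (T : Tableau (ℕ × ℕ)), (U, T) ∈ admissiblePairs r w v →
      ∃ R Y : Graph, inverseInsertion r v U T = some (R, Y) ∧ R ∈ RC w ∧ Y ∈ RC v ∧
        insertion r R Y = some (U, T) := by
    intro U T h
    obtain ⟨R, Y, W, hrows, hR, hY, hYW, hsh⟩ :=
      exists_rows_of_mem_admissiblePairs hw hv.1 hshuffle hcase' h
    have hword : fullWord r Y = wordOf r W := by
      rw [fullWord_eq, wordOf_congr hYW]
    refine ⟨R, Y, ?_, hR, hY, ?_⟩
    · have h1 := hrows.invRows_eq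
      rw [Nat.add_sub_cancel] at h1
      have h2 : theUnique (fun Y => Y ∈ RC v ∧ fullWord r Y = wordOf r W) = some Y :=
        theUnique_eq_some ⟨hY, hword⟩ fun Y' h' =>
          RC.eq_of_fullWord hshuffle h'.1 hY (h'.2.trans hword.symm)
      simp only [inverseInsertion, h1, h2, Option.bind_eq_bind, Option.bind_some, Option.pure_def]
    · rw [hrows.insertion_eq hR.1 hY.1 (hY.2 ▸ hshuffle) hYW, ← hsh]
  have hfwd : ∀ x ∈ RC w ×ˢ RC v, ∃ U T, Rows r 1 w (fun p => strandWord x.2 (p + 1)) U T x.1 ∧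
      insertion r x.1 x.2 =
        some (U, ⟨shapeOf r fun p => (strandWord x.2 (p + 1)).length, T⟩) := by
    rintro ⟨R, Y⟩ ⟨hR, hY⟩
    obtain ⟨U, T, hrows⟩ := exists_rows_of_mem_RC hshuffle hcase' hR hY
    exact ⟨U, T, hrows, hrows.insertion_eq hR.1 hY.1 (hY.2 ▸ hshuffle) fun _ _ => rfl⟩
  refine ⟨fun U T h1 h2 h3 => key U T ⟨h1, h2, h3⟩, ?_, ?_, ?_⟩
  · intro x hx
    obtain ⟨U, T, hrows, h1⟩ := hfwd x hx
    obtain ⟨hY, hYv⟩ := hx.2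
    obtain ⟨hU, -, hpack⟩ := hrows.package
    have hm : ∀ p < r, v (p + 1) = p + 1 + (strandWord x.2 (p + 1)).length := fun p hp => by
      rw [← hYv]
      exact IsShuffle.apply_eq hY (hYv ▸ hshuffle) hp
    exact ⟨_, (mem_admissiblePairs_iff hm).mpr ⟨rfl, hU, hpack⟩, h1.symm⟩
  · intro x hx x' hx' he
    obtain ⟨U, T, hrows, h1⟩ := hfwd x hx
    obtain ⟨U', T', hrows', h1'⟩ := hfwd x' hx'
    simp only [h1, h1', Option.some.injEq, Prod.mk.injEq, Tableau.mk.injEq] at he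
    obtain ⟨rfl, -, rfl⟩ := he
    -- the inverse algorithm recovers both pairs from the same data
    have h2 := hrows.invRows_eq.symm.trans hrows'.invRows_eq
    rw [← fullWord_eq, ← fullWord_eq] at h2
    simp only [Option.some.injEq, Prod.mk.injEq] at h2
    exact Prod.ext h2.1 (RC.eq_of_fullWord hshuffle hx.2 hx'.2 h2.2)
  · rintro _ ⟨⟨U, T⟩, h, rfl⟩
    obtain ⟨R, Y, -, hR, hY, h1⟩ := key U T h
    exact ⟨(R, Y), ⟨hR, hY⟩, h1⟩
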